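/- **Setting.** Let $k=\mathbb F_v$ be a finite field with $q$ elements, $A_v=k[[z]]$, $Q_v=k((z))$, let $Q_v^{\rm alg}$ be an algebraic closure of $Q_v$ and $\mathbb C_v$ its completion. We write $\zeta$ for the image of $z$ in $Q_v^{\rm alg}\subset\mathbb C_v$, and $v$ is the valuation on $\mathbb C_v$ with $v(\zeta)=1$. Let $L\subset Q_v^{\rm alg}$ be a finite separable extension of $Q_v$ with valuation ring $R$ and separable closure $L^{\rm sep}$. We have the ring $R[[z]]$ with its endomorphism $\hat\sigma(\sum b_iz^i)=\sum b_i^{q}z^i$, and we expand elements of $R[[z]]$ in powers of $z-\zeta$, that is, we use $R[[z]]\to L[[z-\zeta]]$, $z\mapsto\zeta+(z-\zeta)$. For $0\neq x\in\mathbb C_v((z-\zeta))$ let $v(x)$ be the valuation of the leading coefficient of $x$, that is, of the coefficient of the lowest power of $z-\zeta$ occurring in $x$. A *local $\hat\sigma$-shtuka* $\hat M$ over $R$ is a free $R[[z]]$-module $M$ of finite rank with an isomorphism $\tau\colon(\hat\sigma^*M)[\frac1{z-\zeta}]\to M[\frac1{z-\zeta}]$, where $\hat\sigma^*M=M\otimes_{R[[z]],\hat\sigma}R[[z]]$.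 Put $H^1_v(\hat M,A_v)=\{m\in M\otimes_{R[[z]]}L^{\rm sep}[[z]] : \tau(\hat\sigma^*m)=m\}$, $H^1_{\rm dR}(\hat M,R)=\hat\sigma^*M/(z-\zeta)\hat\sigma^*M$, and $H^1_{\rm dR}(\hat M,B)=\hat\sigma^*M\otimes_{R[[z]]}B$ for $B=L[[z-\zeta]]$ or $B=\mathbb C_v((z-\zeta))$. The elements of $H^1_v(\hat M,A_v)$ lie in $M\otimes_{R[[z]]}L^{\rm sep}\langle\frac z\zeta\rangle$, where $L^{\rm sep}\langle\frac z\zeta\rangle=\{\sum b_iz^i: b_i\in L^{\rm sep},\ |b_i|\,|\zeta|^i\to0\}$. Expanding them in powers of $z-\zeta$ and applying $\tau^{-1}$ gives a comparison isomorphism $h_{v,\rm dR}\colon H^1_v(\hat M,A_v)\otimes_{A_v}\mathbb C_v((z-\zeta))\to H^1_{\rm dR}(\hat M,\mathbb C_v((z-\zeta)))$. For $u\in H_{1,v}(\hat M,Q_v)=\mathrm{Hom}_{A_v}(H^1_v(\hat M,A_v),Q_v)$ and $\omega\in H^1_{\rm dR}(\hat M,L[[z-\zeta]])$ the *period* is $\int_u\omega=(u\otimes\mathrm{id})(h_{v,\rm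 dR}^{-1}(\omega))\in\mathbb C_v((z-\zeta))$. Let $E_v$ be a commutative semisimple separable finite-dimensional $Q_v$-algebra, $\mathcal O_{E_v}$ the integral closure of $A_v$ in $E_v$, and $H_{E_v}=\mathrm{Hom}_{Q_v}(E_v,Q_v^{\rm alg})$. Assume that $\psi(E_v)\subset L$ for all $\psi\in H_{E_v}$. Let $\hat M$ have *complex multiplication by $\mathcal O_{E_v}$*: an injective $A_v$-algebra homomorphism $\mathcal O_{E_v}\to\mathrm{End}_R(\hat M)$ is given, and $\dim_{Q_v}E_v=\mathrm{rk}\,\hat M$. Then * $H^1_{\rm dR}(\hat M,L[[z-\zeta]])=\bigoplus_{\psi\in H_{E_v}}H^\psi$, where $H^\psi$ is the part on which $[a]^*-\psi(a)$ is $(z-\zeta)$-adically topologically nilpotent for every $a\in\mathcal O_{E_v}$, and $H^\psi$ is free of rank one over $L[[z-\zeta]]$. The *local CM-type* of $\hat M$ is the family $\Phi=(d_\psi)_{\psi\in H_{E_v}}$ of integers with $\tau^{-1}(M\otimes_{R[[z]]}L[[z-\zeta]])=\bigoplus_\psi(z-\zeta)^{-d_\psi}H^\psi$. * Let $H^\psi(\hat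 M,R)$ be the rank-one free $R$-module of those $\omega\in H^1_{\rm dR}(\hat M,R)$ such that for every $a\in\mathcal O_{E_v}$ one has $([a]^*-\psi(a))^n\omega=0$ for all large $n$. Let $\omega_\psi^\circ$ be an $L[[z-\zeta]]$-generator of $H^\psi$ whose reduction modulo $z-\zeta$ is an $R$-generator of $H^\psi(\hat M,R)$. For a generator $\omega_\psi=x\,\omega_\psi^\circ$ of $H^\psi$, with $x\in L[[z-\zeta]]^\times$, put $v(\omega_\psi)=v(x\bmod z-\zeta)$. * If $u$ is a generator of the $E_v$-module $H_{1,v}(\hat M,Q_v)$ and $a\in E_v^\times$ is such that $a^{-1}u$ is an $\mathcal O_{E_v}$-generator of $\mathrm{Hom}_{A_v}(H^1_v(\hat M,A_v),A_v)$, put $v_\psi(u)=v(\psi(a))$. * For $g\in\mathrm{Gal}(Q_v^{\rm sep}/Q_v)$ put $a_{E_v,\psi,\Phi}(g)=d_{g\psi}$. For a finite Galois extension $N/Q_v$ in $Q_v^{\rm alg}$ with group $G_N$, ring of integers $\mathcal O_N$, uniformizer $\pi$, different $\mathfrak D$ and ramification index $e_N$ let $W_N^n=\{g\in G_N: v(g(x)-x^{q^n})>0\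 \forall x\in\mathcal O_N\}$, and for $g\in G_N$ let $\mu_N(g)=0$ if $g\notin W_N^0$, $\mu_N(g)=-v(g(\pi)-\pi)$ if $1\ne g\in W_N^0$, and $\mu_N(1)=v(\mathfrak D)$. For $a\colon\mathrm{Gal}(Q_v^{\rm sep}/Q_v)\to\mathbb Q$ constant modulo $\mathrm{Gal}(Q_v^{\rm sep}/N)$ put $$\mu_{{\rm Art},v}(a)=\sum_{g\in G_N}a(g)\mu_N(g),\qquad Z_v(a,s)=\frac1{e_N}\sum_{n\ge1}\ \sum_{g\in W_N^n}a(g)\,q^{-ns}\quad(s>0).$$ **Theorem.** Let $\hat M$ be a local $\hat\sigma$-shtuka over $R$ with complex multiplication by $\mathcal O_{E_v}$ and local CM-type $\Phi$ as above, let $u\in H_{1,v}(\hat M,Q_v)$ be an $E_v$-generator, let $\psi\in H_{E_v}$ and let $\omega_\psi$ be an $L[[z-\zeta]]$-generator of $H^\psi$. Then $\int_u\omega_\psi$ is a well-defined nonzero element of $\mathbb C_v((z-\zeta))$ (that is, the elements of $H^1_v(\hat M,A_v)$ do lie in $M\otimes_{R[[z]]}L^{\rm sep}\langle\frac z\zeta\rangle$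 and $h_{v,\rm dR}$ is an isomorphism), the valuations $v(\omega_\psi)$ and $v_\psi(u)$ exist, and for every finite Galois extension $N/Q_v$ modulo whose Galois group $a_{E_v,\psi,\Phi}$ is constant, with $Z_v$ and $\mu_{{\rm Art},v}$ computed from $N$, $$v\Bigl(\int_u\omega_\psi\Bigr)=Z_v(a_{E_v,\psi,\Phi},1)-\mu_{{\rm Art},v}(a_{E_v,\psi,\Phi})+v(\omega_\psi)+v_\psi(u).$$ -/

import Mathlib

set_option linter.unusedSectionVars false

open scoped NNReal LaurentSeries PowerSeries TensorProduct Topology WithZero nonZeroDivisors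
open Filter

noncomputable section

namespace LocSht

section Fields

variable (k : Type*) [Field k] [Fintype k]

/-- The `X`-adic valuation on `Q_v = k((X))`, for a finite field `k` with `q` elements, as a
real-valued valuation with `|X| = 1/q`. Here `A_v = k[[z]]` and `Q_v = k((z))`, and the variable
is written `X`. -/
instance rankOne : (Valued.v : Valuation k⸨X⸩ ℤᵐ⁰).RankOne where
  hom' := (WithZeroMulInt.toNNReal (e := (Fintype.card k : ℝ≥0)) (by
    exact_mod_cast Fintype.card_ne_zero)).comp MonoidWithZeroHom.ValueGroup₀.embedding
  strictMono' := (WithZeroMulInt.toNNReal_strictMono (by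
    exact_mod_cast Fintype.one_lt_card)).comp
      MonoidWithZeroHom.ValueGroup₀.embedding_strictMono
  exists_val_nontrivial := by
    refine ⟨HahnSeries.single 1 1, ?_, ?_⟩
    · rw [LaurentSeries.valuation_single_zpow]; simp
    · rw [LaurentSeries.valuation_single_zpow]
      intro h
      rw [← WithZero.exp_zero, WithZero.exp_inj] at h
      omega

instance : NontriviallyNormedField k⸨X⸩ := Valued.toNontriviallyNormedField k⸨X⸩ ℤᵐ⁰

instance : IsUltrametricDist k⸨X⸩ := inferInstance
instance : CompleteSpace k⸨X⸩ := LaurentSeries.instLaurentSeriesComplete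

/-- An algebraic closure of `Q_v`, with the unique extension of the absolute value. -/
abbrev Qalg : Type _ := AlgebraicClosure k⸨X⸩
instance : NontriviallyNormedField (Qalg k) := spectralNorm.nontriviallyNormedField k⸨X⸩ (Qalg k)
instance : NormedAlgebra k⸨X⸩ (Qalg k) := spectralNorm.normedAlgebra k⸨X⸩ (Qalg k)
instance : IsUltrametricDist (Qalg k) := IsUltrametricDist.of_normedAlgebra k⸨X⸩

/-- The completion `C_v` of the algebraic closure of `Q_v`. -/
abbrev Cv : Type _ := UniformSpace.Completion (Qalg k)
instance : NontriviallyNormedField (Cv k) where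
  toNormedField := inferInstance
  non_trivial := by
    choose x hx using NontriviallyNormedField.non_trivial (α := Qalg k)
    exact ⟨x, by simpa using hx⟩
instance : NormedAlgebra k⸨X⸩ (Cv k) := inferInstance
instance : IsUltrametricDist (Cv k) := IsUltrametricDist.of_normedAlgebra k⸨X⸩

variable {k} (L : IntermediateField k⸨X⸩ (Qalg k))

/-- The valuation ring `R` of `L`: the integral closure of `A_v` in `L`. -/
abbrev VR : Subalgebra k⟦X⟧ L := integralClosure k⟦X⟧ L

/-- The inclusion of the constants `k` into `R`. -/
instance : Algebra k (VR L) := ((algebraMap k⟦X⟧ (VR L)).comp PowerSeries.C).toAlgebra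
/-- The element `ζ` of `R`, the image of `z` under `A_v → R`. -/
def zeta : VR L := algebraMap k⟦X⟧ (VR L) PowerSeries.X

/-- The separable closure `L^sep` of `L`. -/
abbrev Lsep : IntermediateField L (Qalg k) := separableClosure L (Qalg k)

instance : Algebra k (Lsep L) := ((algebraMap (VR L) (Lsep L)).comp (algebraMap k (VR L))).toAlgebra

theorem norm_coe_le_one (f : k⟦X⟧) : ‖algebraMap k⟦X⟧ k⸨X⸩ f‖ ≤ 1 :=
  Valued.toNormedField.norm_le_one_iff.2 ((LaurentSeries.val_le_one_iff_eq_coe k _).2 ⟨f, rfl⟩)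

theorem norm_X_lt_one : ‖algebraMap k⟦X⟧ k⸨X⸩ PowerSeries.X‖ < 1 := by
  refine Valued.toNormedField.norm_lt_one_iff.2 ?_
  have := LaurentSeries.valuation_X_pow k 1
  rw [pow_one] at this
  change Valued.v ((PowerSeries.X : k⟦X⟧) : k⸨X⸩) < 1
  rw [this, ← WithZero.exp_zero, WithZero.exp_lt_exp]
  simp

theorem norm_algebraMap_L (x : k⸨X⸩) : ‖algebraMap k⸨X⸩ L x‖ = ‖x‖ :=
  norm_algebraMap' (Qalg k) x

theorem norm_le_one (x : VR L) : ‖(x : L)‖ ≤ 1 := by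
  let v : Valuation L ℝ≥0 := NormedField.valuation
  let φ : k⟦X⟧ →+* v.integer := ((algebraMap k⸨X⸩ L).comp (algebraMap k⟦X⟧ k⸨X⸩)).codRestrict
    v.integer (fun f => by
      change ‖algebraMap k⸨X⸩ L (algebraMap k⟦X⟧ k⸨X⸩ f)‖ ≤ 1
      rw [norm_algebraMap_L]; exact norm_coe_le_one f)
  have h := IsIntegral.map_of_comp_eq φ (RingHom.id L) (by ext f; rfl) x.2
  exact (Valuation.integer.integers v).mem_of_integral h

theorem norm_zeta_lt_one : ‖(zeta L : L)‖ < 1 := by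
  change ‖algebraMap k⸨X⸩ L (algebraMap k⟦X⟧ k⸨X⸩ PowerSeries.X)‖ < 1
  rw [norm_algebraMap_L]; exact norm_X_lt_one

theorem zeta_ne_zero : (zeta L : L) ≠ 0 := by
  change algebraMap k⸨X⸩ L (algebraMap k⟦X⟧ k⸨X⸩ PowerSeries.X) ≠ 0
  simp

end Fields

section Taylor

variable {F : Type*} [NormedField F] [IsUltrametricDist F]

/-- The series `∑ fₘ zᵐ` with `|fₘ| |c|ᵐ → 0`. -/
def tate (c : F) : Subring F⟦X⟧ where
  carrier := {f | PowerSeries.IsRestricted ‖c‖ f}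
  mul_mem' hf hg := PowerSeries.isRestricted.mul _ hf hg
  one_mem' := PowerSeries.isRestricted_one _
  add_mem' hf hg := PowerSeries.isRestricted.add _ hf hg
  zero_mem' := PowerSeries.isRestricted_zero _
  neg_mem' hf := PowerSeries.isRestricted.neg _ hf

/-- The contribution of the term `fₘ zᵐ` to the coefficient of `(z - c)ⁿ`. -/
def taylorTerm (c : F) (f : F⟦X⟧) (n m : ℕ) : F :=
  (m.choose n : F) * PowerSeries.coeff m f * c ^ (m - n)

theorem norm_natCast_le_one' (m : ℕ) : ‖(m : F)‖ ≤ 1 := IsUltrametricDist.norm_natCast_le_one F m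

theorem taylorTerm_summable [CompleteSpace F] (c : F) (f : F⟦X⟧) (hf : f ∈ tate c) (n : ℕ) :
    Summable (taylorTerm c f n) := by
  apply NonarchimedeanAddGroup.summable_of_tendsto_cofinite_zero
  rw [Nat.cofinite_eq_atTop]
  by_cases hc : c = 0
  · refine tendsto_const_nhds.congr' ?_
    filter_upwards [eventually_gt_atTop n] with m hm
    simp [taylorTerm, hc, Nat.sub_ne_zero_of_lt hm]
  have hf' : Tendsto (fun m => ‖PowerSeries.coeff m f‖ * ‖c‖ ^ m) atTop (𝓝 0) :=
    (PowerSeries.isRestricted_iff' _ _).1 hf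
  have h2 := hf'.mul_const ((‖c‖ ^ n)⁻¹)
  rw [zero_mul] at h2
  refine squeeze_zero_norm' ?_ h2
  filter_upwards [eventually_ge_atTop n] with m hm
  have hc' : ‖c‖ ≠ 0 := norm_ne_zero_iff.2 hc
  have e : ‖c‖ ^ m * (‖c‖ ^ n)⁻¹ = ‖c‖ ^ (m - n) := by
    rw [← div_eq_mul_inv, div_eq_iff (pow_ne_zero _ hc'), ← pow_add, Nat.sub_add_cancel hm]
  rw [taylorTerm, norm_mul, norm_mul, norm_pow, mul_assoc, mul_assoc, e]
  exact mul_le_of_le_one_left (by positivity) (norm_natCast_le_one' _)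

theorem taylorTerm_mul (c : F) (f g : F⟦X⟧) (n m : ℕ) :
    taylorTerm c (f * g) n m = ∑ p ∈ Finset.HasAntidiagonal.antidiagonal m,
      ∑ q ∈ Finset.HasAntidiagonal.antidiagonal n,
      taylorTerm c f q.1 p.1 * taylorTerm c g q.2 p.2 := by
  rw [taylorTerm, PowerSeries.coeff_mul, Finset.mul_sum, Finset.sum_mul]
  refine Finset.sum_congr rfl fun p hp => ?_
  rw [Finset.HasAntidiagonal.mem_antidiagonal] at hp
  rw [← hp, Nat.add_choose_eq, Nat.cast_sum, Finset.sum_mul, Finset.sum_mul]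
  refine Finset.sum_congr rfl fun q hq => ?_
  rw [Finset.HasAntidiagonal.mem_antidiagonal] at hq
  by_cases h1 : p.1 < q.1
  · simp [taylorTerm, Nat.choose_eq_zero_of_lt h1]
  by_cases h2 : p.2 < q.2
  · simp [taylorTerm, Nat.choose_eq_zero_of_lt h2]
  have e : p.1 + p.2 - n = (p.1 - q.1) + (p.2 - q.2) := by omega
  rw [e, taylorTerm, taylorTerm, pow_add]
  push_cast
  ring

variable [CompleteSpace F]

/-- The expansion in powers of `z - c`, as a ring homomorphism. -/
def taylor (c : F) : tate c →+* F⟦X⟧ where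
  toFun f := PowerSeries.mk fun n => ∑' m, taylorTerm c f.1 n m
  map_zero' := by ext n; simp [taylorTerm]
  map_one' := by
    ext n
    rw [PowerSeries.coeff_mk, tsum_eq_single 0]
    · rcases n with _ | n <;> simp [taylorTerm, PowerSeries.coeff_one]
    · intro m hm; simp [taylorTerm, PowerSeries.coeff_one, hm]
  map_add' f g := by
    ext n
    rw [map_add, PowerSeries.coeff_mk, PowerSeries.coeff_mk, PowerSeries.coeff_mk,
      ← (taylorTerm_summable c f.1 f.2 n).tsum_add (taylorTerm_summable c g.1 g.2 n)]
    refine tsum_congr fun m => ?_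
    simp [taylorTerm]; ring
  map_mul' f g := by
    ext n
    have hs := fun (h : tate c) i => taylorTerm_summable c h.1 h.2 i
    rw [PowerSeries.coeff_mul, PowerSeries.coeff_mk]
    simp only [PowerSeries.coeff_mk]
    have : NonarchimedeanRing F :=
      { is_nonarchimedean := NonarchimedeanAddGroup.is_nonarchimedean }
    have h1 : ∀ q : ℕ × ℕ, (∑' m, taylorTerm c f.1 q.1 m) * ∑' m, taylorTerm c g.1 q.2 m =
        ∑' p : ℕ × ℕ, taylorTerm c f.1 q.1 p.1 * taylorTerm c g.1 q.2 p.2 := fun q =>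
      tsum_mul_tsum_of_nonarchimedean (hs f q.1) (hs g q.2)
    have h2 : ∀ q : ℕ × ℕ, Summable
        (fun p : ℕ × ℕ => taylorTerm c f.1 q.1 p.1 * taylorTerm c g.1 q.2 p.2) := fun q =>
      Summable.mul_of_nonarchimedean (hs f q.1) (hs g q.2)
    simp only [h1]
    rw [← Summable.tsum_finsetSum (fun q _ => h2 q)]
    have h3 := summable_sum (s := Finset.HasAntidiagonal.antidiagonal n) (fun q _ => h2 q)
    rw [← Finset.HasAntidiagonal.sigmaAntidiagonalEquivProd.tsum_eq]
    have h4 := Finset.HasAntidiagonal.sigmaAntidiagonalEquivProd.summable_iff.2 h3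
    refine Eq.trans ?_ h4.tsum_sigma.symm
    refine tsum_congr fun m => ?_
    rw [tsum_fintype]
    change taylorTerm c (f.1 * g.1) n m = _
    rw [taylorTerm_mul]
    exact (Finset.sum_coe_sort _ (fun p : ℕ × ℕ => ∑ q ∈ Finset.HasAntidiagonal.antidiagonal n,
      taylorTerm c f.1 q.1 p.1 * taylorTerm c g.1 q.2 p.2)).symm

end Taylor

section TaylorMore

variable {F : Type*} [NormedField F] [IsUltrametricDist F]
variable {F' : Type*} [NormedField F'] [IsUltrametricDist F']

theorem map_mem_tate (φ : F →+* F') (hφ : ∀ x, ‖φ x‖ = ‖x‖) (c : F) (f : F⟦X⟧)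
    (hf : f ∈ tate c) : PowerSeries.map φ f ∈ tate (φ c) := by
  change PowerSeries.IsRestricted ‖φ c‖ _
  have hf' : PowerSeries.IsRestricted ‖c‖ f := hf
  rw [PowerSeries.isRestricted_iff'] at hf' ⊢
  simpa [hφ] using hf'

theorem mem_tate_of_norm_le_one (c : F) (hc : ‖c‖ < 1) (f : F⟦X⟧)
    (hf : ∀ n, ‖PowerSeries.coeff n f‖ ≤ 1) : f ∈ tate c := by
  change PowerSeries.IsRestricted ‖c‖ _
  rw [PowerSeries.isRestricted_iff']
  refine squeeze_zero (fun n => by positivity) (fun n => ?_)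
    (tendsto_pow_atTop_nhds_zero_of_lt_one (norm_nonneg c) hc)
  exact mul_le_of_le_one_left (by positivity) (hf n)

variable [CompleteSpace F] [CompleteSpace F']

theorem coeff_taylor (c : F) (f : tate c) (n : ℕ) :
    PowerSeries.coeff n (taylor c f) = ∑' m, taylorTerm c f.1 n m :=
  PowerSeries.coeff_mk n fun n => ∑' m, taylorTerm c f.1 n m

theorem taylor_map (φ : F →+* F') (hφ : ∀ x, ‖φ x‖ = ‖x‖) (c : F) (f : tate c) :
    taylor (φ c) ⟨PowerSeries.map φ f.1, map_mem_tate φ hφ c f.1 f.2⟩ =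
      PowerSeries.map φ (taylor c f) := by
  ext n
  have hcont : Continuous φ :=
    (AddMonoidHomClass.isometry_of_norm φ hφ).continuous
  rw [PowerSeries.coeff_map, coeff_taylor, coeff_taylor,
    (taylorTerm_summable c f.1 f.2 n).map_tsum φ hcont]
  refine tsum_congr fun m => ?_
  simp [taylorTerm]

theorem taylor_C (c a : F) (h : PowerSeries.C a ∈ tate c) :
    taylor c ⟨PowerSeries.C a, h⟩ = PowerSeries.C a := by
  ext n
  rw [coeff_taylor, tsum_eq_single 0]
  · rcases n with _ | n <;> simp [taylorTerm, PowerSeries.coeff_C]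
  · intro m hm; simp [taylorTerm, PowerSeries.coeff_C, hm]

theorem taylor_X (c : F) (h : PowerSeries.X ∈ tate c) :
    taylor c ⟨PowerSeries.X, h⟩ = PowerSeries.X + PowerSeries.C c := by
  ext n
  rw [coeff_taylor, tsum_eq_single 1]
  · rcases n with _ | _ | n <;> simp [taylorTerm, PowerSeries.coeff_X, Nat.choose_eq_zero_of_lt]
  · intro m hm; simp [taylorTerm, PowerSeries.coeff_X, hm]

end TaylorMore

section Rings

variable {k : Type*} [Field k] [Fintype k] (L : IntermediateField k⸨X⸩ (Qalg k))

/-- The inclusion of `L` into `C_v`. -/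
def LtoC : L →+* Cv k := algebraMap L (Cv k)

/-- The inclusion of `L^sep` into `C_v`. -/
def LsepToC : Lsep L →+* Cv k := algebraMap (Lsep L) (Cv k)

theorem norm_LtoC (x : L) : ‖LtoC L x‖ = ‖x‖ := by
  change ‖((x : Qalg k) : Cv k)‖ = _
  rw [UniformSpace.Completion.norm_coe]; rfl

theorem norm_LsepToC (x : Lsep L) : ‖LsepToC L x‖ = ‖x‖ := by
  change ‖((x : Qalg k) : Cv k)‖ = _
  rw [UniformSpace.Completion.norm_coe]; rfl

/-- The inclusion of `R` into `L`. -/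
def RtoL : VR L →+* L := algebraMap (VR L) L
/-- The inclusion of `R` into `L^sep`. -/
def RtoLsep : VR L →+* Lsep L := algebraMap (VR L) (Lsep L)

theorem LsepToC_RtoLsep (x : VR L) : LsepToC L (RtoLsep L x) = LtoC L (RtoL L x) := rfl

theorem norm_RtoLsep (x : VR L) : ‖RtoLsep L x‖ = ‖(x : L)‖ := rfl

/-- `R[[z]]`. -/
def RZ : Type _ := (VR L)⟦X⟧
instance : CommRing (RZ L) := inferInstanceAs (CommRing (VR L)⟦X⟧)

/-- `L^sep[[z]]`. -/
def LsepZ : Type _ := (Lsep L)⟦X⟧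
instance : CommRing (LsepZ L) := inferInstanceAs (CommRing (Lsep L)⟦X⟧)

/-- `L[[z - ζ]]`; the power series variable is `z - ζ`. -/
def BPlusL : Type _ := L⟦X⟧
instance : CommRing (BPlusL L) := inferInstanceAs (CommRing L⟦X⟧)

/-- `L((z - ζ))`. -/
def BL : Type _ := L⸨X⸩
instance : Field (BL L) := inferInstanceAs (Field L⸨X⸩)

/-- `C_v((z - ζ))`. -/
def BC : Type _ := (fun _ : IntermediateField k⸨X⸩ (Qalg k) => (Cv k)⸨X⸩) L
instance : Field (BC L) := inferInstanceAs (Field (Cv k)⸨X⸩)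

/-- `L^sep⟨z/ζ⟩`, the series `∑ bᵢ zⁱ` with `|bᵢ| |ζ|ⁱ → 0`. -/
def TateSep : Type _ := tate (RtoLsep L (zeta L))
instance : CommRing (TateSep L) := inferInstanceAs (CommRing (tate (RtoLsep L (zeta L))))

/-- `A_v = k[[z]] → R[[z]]`, coefficientwise. -/
instance : Algebra k⟦X⟧ (RZ L) :=
  (PowerSeries.map (algebraMap k (VR L)) : k⟦X⟧ →+* (VR L)⟦X⟧).toAlgebra

instance : Algebra (RZ L) (LsepZ L) :=
  (PowerSeries.map (RtoLsep L) : (VR L)⟦X⟧ →+* (Lsep L)⟦X⟧).toAlgebra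

instance : Algebra k⟦X⟧ (LsepZ L) :=
  ((algebraMap (RZ L) (LsepZ L)).comp (algebraMap k⟦X⟧ (RZ L))).toAlgebra

instance : IsScalarTower k⟦X⟧ (RZ L) (LsepZ L) := IsScalarTower.of_algebraMap_eq fun _ => rfl

/-- `z - ζ` in `R[[z]]`. -/
def zMinusZeta : RZ L := (PowerSeries.X - PowerSeries.C (zeta L) : (VR L)⟦X⟧)

/-- The multiplicative set of the powers of `z - ζ`. -/
def SS : Submonoid (RZ L) := Submonoid.powers (zMinusZeta L)

/-- The endomorphism `∑ bᵢ zⁱ ↦ ∑ bᵢ^q zⁱ` of `R[[z]]`. -/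
def sigma : RZ L →+* RZ L :=
  (PowerSeries.map (FiniteField.frobeniusAlgHom k (VR L)).toRingHom : (VR L)⟦X⟧ →+* (VR L)⟦X⟧)

/-- The endomorphism `∑ bᵢ zⁱ ↦ ∑ bᵢ^q zⁱ` of `L^sep[[z]]`. -/
def sigmaSep : LsepZ L →+* LsepZ L :=
  (PowerSeries.map (FiniteField.frobeniusAlgHom k (Lsep L)).toRingHom :
    (Lsep L)⟦X⟧ →+* (Lsep L)⟦X⟧)

theorem sigmaSep_algebraMap (x : RZ L) :
    sigmaSep L (algebraMap (RZ L) (LsepZ L) x) = algebraMap (RZ L) (LsepZ L) (sigma L x) := by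
  refine PowerSeries.ext (R := Lsep L) fun n => ?_
  change (RtoLsep L (PowerSeries.coeff n (R := VR L) x)) ^ Fintype.card k =
    RtoLsep L (PowerSeries.coeff n (R := VR L) x ^ Fintype.card k)
  rw [map_pow]

theorem sigmaSep_algebraMap_base (x : k⟦X⟧) :
    sigmaSep L (algebraMap k⟦X⟧ (LsepZ L) x) = algebraMap k⟦X⟧ (LsepZ L) x := by
  refine PowerSeries.ext (R := Lsep L) fun n => ?_
  change (algebraMap k (Lsep L) (PowerSeries.coeff n x)) ^ Fintype.card k =
    algebraMap k (Lsep L) (PowerSeries.coeff n x)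
  rw [← map_pow, FiniteField.pow_card]

theorem isUnit_zMinusZeta_LsepZ : IsUnit (algebraMap (RZ L) (LsepZ L) (zMinusZeta L)) := by
  change IsUnit (PowerSeries.map (RtoLsep L) (PowerSeries.X - PowerSeries.C (zeta L)))
  rw [PowerSeries.isUnit_iff_constantCoeff]
  simp only [map_sub, PowerSeries.map_X, PowerSeries.map_C, PowerSeries.constantCoeff_X,
    PowerSeries.constantCoeff_C, zero_sub, isUnit_iff_ne_zero]
  intro h
  rw [neg_eq_zero] at h
  apply zeta_ne_zero L
  rw [← norm_eq_zero, ← norm_RtoLsep, h, norm_zero]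

/-- The inclusion `L^sep⟨z/ζ⟩ ⊂ L^sep[[z]]`. -/
def tateToSeries : TateSep L →+* LsepZ L := (tate (RtoLsep L (zeta L))).subtype

theorem RZ_mem_tateSep (f : (VR L)⟦X⟧) : PowerSeries.map (RtoLsep L) f ∈ tate (RtoLsep L (zeta L)) :=
  mem_tate_of_norm_le_one _ ((norm_RtoLsep L _).trans_lt (norm_zeta_lt_one L)) _ fun n => by
    rw [PowerSeries.coeff_map, norm_RtoLsep]; exact norm_le_one L _

theorem RZ_mem_tateL (f : (VR L)⟦X⟧) : PowerSeries.map (RtoL L) f ∈ tate (RtoL L (zeta L)) :=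
  mem_tate_of_norm_le_one _ (norm_zeta_lt_one L) _ fun n => by
    rw [PowerSeries.coeff_map]; exact norm_le_one L _

instance : Algebra (RZ L) (TateSep L) :=
  ((PowerSeries.map (RtoLsep L) : (VR L)⟦X⟧ →+* (Lsep L)⟦X⟧).codRestrict
    (tate (RtoLsep L (zeta L))) (RZ_mem_tateSep L) : RZ L →+* TateSep L).toAlgebra

instance : Algebra k⟦X⟧ (TateSep L) :=
  ((algebraMap (RZ L) (TateSep L)).comp (algebraMap k⟦X⟧ (RZ L))).toAlgebra

instance : IsScalarTower k⟦X⟧ (RZ L) (TateSep L) := IsScalarTower.of_algebraMap_eq fun _ => rfl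

/-- The inclusion `L^sep⟨z/ζ⟩ ⊂ L^sep[[z]]` as a homomorphism of `R[[z]]`-algebras. -/
def tateIncl : TateSep L →ₐ[RZ L] LsepZ L := { tateToSeries L with commutes' := fun _ => rfl }

/-- The coefficientwise inclusion of `L^sep⟨z/ζ⟩` into `C_v⟨z/ζ⟩`. -/
def tateSepToTateC : TateSep L →+* tate (LsepToC L (RtoLsep L (zeta L))) :=
  ((PowerSeries.map (LsepToC L)).comp (tate (RtoLsep L (zeta L))).subtype).codRestrict _
    fun f => map_mem_tate (LsepToC L) (norm_LsepToC L) _ f.1 f.2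

/-- `C_v[[z - ζ]] ⊂ C_v((z - ζ))`. -/
def powerToBC : (Cv k)⟦X⟧ →+* BC L := HahnSeries.ofPowerSeries ℤ (Cv k)

theorem powerToBC_injective : Function.Injective (powerToBC L) :=
  HahnSeries.ofPowerSeries_injective

/-- The expansion of an element of `L^sep⟨z/ζ⟩` as a power series in `z - ζ` over `C_v`. -/
def tateEval : TateSep L →+* BC L :=
  (powerToBC L).comp ((taylor (LsepToC L (RtoLsep L (zeta L)))).comp (tateSepToTateC L))

section Finite

variable [FiniteDimensional k⸨X⸩ L]

instance : CompleteSpace L := FiniteDimensional.complete k⸨X⸩ L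

/-- The homomorphism `R[[z]] → L[[z - ζ]]`, `z ↦ ζ + (z - ζ)`. -/
def expandL : RZ L →+* BPlusL L :=
  (taylor (RtoL L (zeta L))).comp
    ((PowerSeries.map (RtoL L)).codRestrict (tate (RtoL L (zeta L))) (RZ_mem_tateL L))

instance : Algebra (RZ L) (BPlusL L) := (expandL L).toAlgebra

/-- `L[[z - ζ]] ⊂ L((z - ζ))`. -/
instance : Algebra (BPlusL L) (BL L) :=
  (HahnSeries.ofPowerSeries ℤ L : BPlusL L →+* BL L).toAlgebra

/-- `L[[z - ζ]] ⊂ C_v((z - ζ))`, coefficientwise. -/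
instance : Algebra (BPlusL L) (BC L) :=
  ((powerToBC L).comp (PowerSeries.map (LtoC L)) : BPlusL L →+* BC L).toAlgebra

instance : Algebra (RZ L) (BL L) :=
  ((algebraMap (BPlusL L) (BL L)).comp (algebraMap (RZ L) (BPlusL L))).toAlgebra

instance : Algebra (RZ L) (BC L) :=
  ((algebraMap (BPlusL L) (BC L)).comp (algebraMap (RZ L) (BPlusL L))).toAlgebra

instance : IsScalarTower (RZ L) (BPlusL L) (BL L) := IsScalarTower.of_algebraMap_eq fun _ => rfl
instance : IsScalarTower (RZ L) (BPlusL L) (BC L) := IsScalarTower.of_algebraMap_eq fun _ => rfl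

instance : Algebra k⟦X⟧ (BC L) :=
  ((algebraMap (RZ L) (BC L)).comp (algebraMap k⟦X⟧ (RZ L))).toAlgebra

instance : IsScalarTower k⟦X⟧ (RZ L) (BC L) := IsScalarTower.of_algebraMap_eq fun _ => rfl

/-- `z - ζ` as an element of `L[[z - ζ]]`. -/
def wPlus : BPlusL L := (PowerSeries.X : L⟦X⟧)

theorem algebraMap_zMinusZeta : algebraMap (RZ L) (BPlusL L) (zMinusZeta L) = wPlus L := by
  have h : ∀ f : (VR L)⟦X⟧, expandL L f = taylor (RtoL L (zeta L))
    ⟨PowerSeries.map (RtoL L) f, RZ_mem_tateL L f⟩ := fun _ => rfl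
  change expandL L (PowerSeries.X - PowerSeries.C (zeta L) : (VR L)⟦X⟧) = _
  have e := (expandL L).map_sub (PowerSeries.X : (VR L)⟦X⟧) (PowerSeries.C (zeta L) : (VR L)⟦X⟧)
  refine e.trans ?_
  rw [h, h]
  simp only [PowerSeries.map_X, PowerSeries.map_C, taylor_X, taylor_C]
  exact add_sub_cancel_right _ _

theorem isUnit_zMinusZeta_BL : IsUnit (algebraMap (RZ L) (BL L) (zMinusZeta L)) := by
  change IsUnit (algebraMap (BPlusL L) (BL L) (algebraMap (RZ L) (BPlusL L) (zMinusZeta L)))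
  rw [algebraMap_zMinusZeta, isUnit_iff_ne_zero]
  intro h
  have := (HahnSeries.ofPowerSeries_injective (Γ := ℤ) (R := L)) (h.trans (map_zero _).symm)
  exact PowerSeries.X_ne_zero this

theorem isUnit_zMinusZeta_BC : IsUnit (algebraMap (RZ L) (BC L) (zMinusZeta L)) := by
  change IsUnit (algebraMap (BPlusL L) (BC L) (algebraMap (RZ L) (BPlusL L) (zMinusZeta L)))
  rw [algebraMap_zMinusZeta, isUnit_iff_ne_zero]
  intro h
  have := (powerToBC_injective L) (h.trans (map_zero _).symm)
  have h2 : PowerSeries.map (LtoC L) (PowerSeries.X : L⟦X⟧) = 0 := this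
  rw [PowerSeries.map_X] at h2
  exact PowerSeries.X_ne_zero h2

theorem isUnit_X_BC : IsUnit (algebraMap k⟦X⟧ (BC L) PowerSeries.X) := by
  have e : (PowerSeries.map (algebraMap k (VR L)) PowerSeries.X : (VR L)⟦X⟧) = PowerSeries.X :=
    PowerSeries.map_X _
  change IsUnit (algebraMap (BPlusL L) (BC L) (expandL L (PowerSeries.map _ PowerSeries.X)))
  rw [e, isUnit_iff_ne_zero]
  intro h
  have := (powerToBC_injective L) (h.trans (map_zero _).symm)
  have h1 : expandL L (PowerSeries.X : (VR L)⟦X⟧) =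
      (PowerSeries.X + PowerSeries.C (RtoL L (zeta L)) : L⟦X⟧) := by
    have h : ∀ f : (VR L)⟦X⟧, expandL L f = taylor (RtoL L (zeta L))
      ⟨PowerSeries.map (RtoL L) f, RZ_mem_tateL L f⟩ := fun _ => rfl
    rw [h]
    simp only [PowerSeries.map_X, taylor_X]
    rfl
  have h2 : PowerSeries.map (LtoC L) (expandL L (PowerSeries.X : (VR L)⟦X⟧)) = 0 := this
  rw [h1, map_add, PowerSeries.map_X] at h2
  have h3 := congrArg (PowerSeries.coeff 1) h2
  simp at h3

/-- The homomorphism `Q_v → C_v((z - ζ))`, `z ↦ ζ + (z - ζ)`. -/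
def QvToBC : k⸨X⸩ →+* BC L :=
  IsLocalization.Away.lift (S := k⸨X⸩) (PowerSeries.X : k⟦X⟧) (g := algebraMap k⟦X⟧ (BC L))
    (isUnit_X_BC L)

theorem QvToBC_algebraMap (f : k⟦X⟧) :
    QvToBC L (algebraMap k⟦X⟧ k⸨X⸩ f) = algebraMap k⟦X⟧ (BC L) f :=
  IsLocalization.Away.lift_eq _ _ _

/-- `Q_v → C_v((z - ζ))` as an `A_v`-linear map. -/
def QvToBCLin : k⸨X⸩ →ₗ[k⟦X⟧] BC L where
  toFun := QvToBC L
  map_add' := map_add _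
  map_smul' a x := by
    rw [Algebra.smul_def, map_mul, QvToBC_algebraMap, RingHom.id_apply, Algebra.smul_def]

/-- The expansion in `z - ζ` as a homomorphism of `R[[z]]`-algebras
`L^sep⟨z/ζ⟩ → C_v((z - ζ))`. -/
def tateEvalAlg : TateSep L →ₐ[RZ L] BC L :=
  { tateEval L with
    commutes' := fun f => by
      change powerToBC L (taylor _ ⟨PowerSeries.map (LsepToC L) (PowerSeries.map (RtoLsep L) f), _⟩)
        = powerToBC L (PowerSeries.map (LtoC L) (taylor (RtoL L (zeta L))
          ⟨PowerSeries.map (RtoL L) f, RZ_mem_tateL L f⟩))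
      rw [← taylor_map (LtoC L) (norm_LtoC L)]
      rfl }

end Finite

end Rings

section Shtuka

variable {k : Type*} [Field k] [Fintype k] (L : IntermediateField k⸨X⸩ (Qalg k))

/-- `R[[z]]`, regarded as an `R[[z]]`-algebra by means of the endomorphism `sigma`. -/
def FrobTw : Type _ := RZ L
instance : CommRing (FrobTw L) := inferInstanceAs (CommRing (RZ L))
instance : Algebra (RZ L) (FrobTw L) := (sigma L : RZ L →+* FrobTw L).toAlgebra

/-- The identity `R[[z]] → R[[z]]`, with target the twisted algebra. -/
def toFrobTw : RZ L →+* FrobTw L := RingHom.id (RZ L)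

variable (M : Type*) [AddCommGroup M] [Module (RZ L) M]

/-- The Frobenius pullback `σ^*M = R[[z]] ⊗_{σ, R[[z]]} M`. -/
def FrobPull : Type _ := FrobTw L ⊗[RZ L] M
instance : AddCommGroup (FrobPull L M) := inferInstanceAs (AddCommGroup (FrobTw L ⊗[RZ L] M))

/-- `R[[z]]` acts on `σ^*M` through the factor `R[[z]]` of the tensor product. -/
instance : Module (RZ L) (FrobPull L M) := Module.compHom (FrobTw L ⊗[RZ L] M) (toFrobTw L)

variable {M}

/-- The semilinear map `M → σ^*M`, `m ↦ 1 ⊗ m`. -/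
def frobIncl : M →ₛₗ[sigma L] FrobPull L M where
  toFun m := (1 : FrobTw L) ⊗ₜ[RZ L] m
  map_add' x y := TensorProduct.tmul_add _ _ _
  map_smul' r m := by
    change (1 : FrobTw L) ⊗ₜ[RZ L] (r • m) =
      (toFrobTw L (sigma L r)) • ((1 : FrobTw L) ⊗ₜ[RZ L] m)
    rw [← TensorProduct.smul_tmul, TensorProduct.smul_tmul', Algebra.smul_def, smul_eq_mul]
    rfl

/-- The pullback `σ^*f` of an endomorphism `f`. -/
def frobMap (f : M →ₗ[RZ L] M) : FrobPull L M →ₗ[RZ L] FrobPull L M where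
  toFun := LinearMap.baseChange (FrobTw L) f
  map_add' x y := (LinearMap.baseChange (FrobTw L) f).map_add x y
  map_smul' r x := (LinearMap.baseChange (FrobTw L) f).map_smul (toFrobTw L r) x

variable (M)

/-- A local shtuka over `R` with underlying module `M`: the module `M` is free of finite rank over
`R[[z]]`, and `τ : σ^*M[1/(z - ζ)] → M[1/(z - ζ)]` is an isomorphism. -/
structure LocalShtuka where
  free : Module.Free (RZ L) M
  finite : Module.Finite (RZ L) M
  tau : LocalizedModule (SS L) (FrobPull L M) ≃ₗ[RZ L] LocalizedModule (SS L) M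

/-- The integral closure of `A_v` in `E`. -/
abbrev OE (k : Type*) [Field k] (E : Type*) [CommRing E] [Algebra k⟦X⟧ E] : Subalgebra k⟦X⟧ E :=
  integralClosure k⟦X⟧ E

variable {L M}

/-- Complex multiplication by `O_E` on a local shtuka: a faithful `A_v`-linear action of `O_E`
on `M` by endomorphisms that commute with `τ`, where `dim_{Q_v} E = rk M`. -/
structure CM (S : LocalShtuka L M) (E : Type*) [CommRing E] [Algebra k⸨X⸩ E] [Algebra k⟦X⟧ E] where
  act : OE k E →+* Module.End (RZ L) M
  act_injective : Function.Injective act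
  act_algebraMap : ∀ (a : k⟦X⟧) (m : M),
    act (algebraMap k⟦X⟧ (OE k E) a) m = algebraMap k⟦X⟧ (RZ L) a • m
  act_tau : ∀ (a : OE k E) (x : LocalizedModule (SS L) (FrobPull L M)),
    S.tau (LocalizedModule.map (SS L) (frobMap L (act a)) x) =
      LocalizedModule.map (SS L) (act a) (S.tau x)
  finrank_eq : Module.finrank (RZ L) M = Module.finrank k⸨X⸩ E

section BaseChange

variable (B : Type*) [CommRing B] [Algebra (RZ L) B]

theorem isUnit_end (hB : IsUnit (algebraMap (RZ L) B (zMinusZeta L)))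
    (N : Type*) [AddCommGroup N] [Module (RZ L) N] (s : SS L) :
    IsUnit (algebraMap (RZ L) (Module.End (RZ L) (B ⊗[RZ L] N)) s) := by
  have h : IsUnit (algebraMap (RZ L) B s) := by
    obtain ⟨_, n, rfl⟩ := s
    simpa using hB.pow n
  have h2 := h.map (Algebra.lsmul (RZ L) (RZ L) (B ⊗[RZ L] N))
  rwa [AlgHom.commutes] at h2

/-- The map `M[1/(z - ζ)] → B ⊗ M` for an `R[[z]]`-algebra `B` in which `z - ζ` is a unit. -/
def locToB (hB : IsUnit (algebraMap (RZ L) B (zMinusZeta L)))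
    (N : Type*) [AddCommGroup N] [Module (RZ L) N] :
    LocalizedModule (SS L) N →ₗ[RZ L] B ⊗[RZ L] N :=
  LocalizedModule.lift (SS L) (TensorProduct.mk (RZ L) B N 1) (isUnit_end B hB N)

/-- The base change `τ ⊗ B : B ⊗ σ^*M → B ⊗ M`. -/
def tauB (S : LocalShtuka L M) (hB : IsUnit (algebraMap (RZ L) B (zMinusZeta L))) :
    B ⊗[RZ L] FrobPull L M →ₗ[B] B ⊗[RZ L] M :=
  LinearMap.liftBaseChange B (locToB B hB M ∘ₗ S.tau.toLinearMap ∘ₗ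
    LocalizedModule.mkLinearMap (SS L) (FrobPull L M))

/-- The base change `τ⁻¹ ⊗ B : B ⊗ M → B ⊗ σ^*M`. -/
def tauInvB (S : LocalShtuka L M) (hB : IsUnit (algebraMap (RZ L) B (zMinusZeta L))) :
    B ⊗[RZ L] M →ₗ[B] B ⊗[RZ L] FrobPull L M :=
  LinearMap.liftBaseChange B (locToB B hB (FrobPull L M) ∘ₗ S.tau.symm.toLinearMap ∘ₗ
    LocalizedModule.mkLinearMap (SS L) M)

end BaseChange

variable (L M)

instance : SMulCommClass (RZ L) k⟦X⟧ (LsepZ L) :=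
  ⟨fun a b c => by simp only [Algebra.smul_def]; ring⟩
instance : SMulCommClass k⟦X⟧ (RZ L) (LsepZ L) := SMulCommClass.symm _ _ _
instance : SMulCommClass (RZ L) k⟦X⟧ (TateSep L) :=
  ⟨fun a b c => by simp only [Algebra.smul_def]; ring⟩
instance : SMulCommClass k⟦X⟧ (RZ L) (TateSep L) := SMulCommClass.symm _ _ _

instance : IsScalarTower k⟦X⟧ (LsepZ L) (LsepZ L ⊗[RZ L] M) := inferInstance

theorem algebraMap_smul_LsepZ (a : k⟦X⟧) (m : LsepZ L ⊗[RZ L] M) :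
    algebraMap k⟦X⟧ (LsepZ L) a • m = a • m := algebraMap_smul _ _ _

/-- The map `b ⊗ m ↦ σ(b) ⊗ (1 ⊗ m)`, from `L^sep[[z]] ⊗ M` to `L^sep[[z]] ⊗ σ^*M`. -/
def sigmaB : LsepZ L ⊗[RZ L] M →ₛₗ[sigma L] LsepZ L ⊗[RZ L] FrobPull L M :=
  TensorProduct.lift (LinearMap.mk₂'ₛₗ (sigma L) (sigma L)
    (fun (b : LsepZ L) (m : M) => sigmaSep L b ⊗ₜ[RZ L] frobIncl L m)
    (fun b b' m => by rw [map_add, TensorProduct.add_tmul])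
    (fun r b m => by
      rw [Algebra.smul_def, map_mul, sigmaSep_algebraMap, ← Algebra.smul_def,
        TensorProduct.smul_tmul'])
    (fun b m m' => by rw [map_add, TensorProduct.tmul_add])
    (fun r b m => by
      rw [LinearMap.map_smulₛₗ, TensorProduct.tmul_smul]))

theorem sigmaB_smul (a : LsepZ L) (m : LsepZ L ⊗[RZ L] M) :
    sigmaB L M (a • m) = sigmaSep L a • sigmaB L M m := by
  induction m with
  | zero => simp
  | add x y hx hy => rw [smul_add, map_add, map_add, smul_add, hx, hy]
  | tmul b m =>
    rw [TensorProduct.smul_tmul', smul_eq_mul]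
    change sigmaSep L (a * b) ⊗ₜ[RZ L] frobIncl L m =
      sigmaSep L a • (sigmaSep L b ⊗ₜ[RZ L] frobIncl L m)
    rw [map_mul, TensorProduct.smul_tmul', smul_eq_mul]

variable {L M}

/-- The `v`-adic realization `H^1_v(M, A_v)`: the `τ`-invariants of `L^sep[[z]] ⊗ M`. -/
def H1v (S : LocalShtuka L M) : Submodule k⟦X⟧ (LsepZ L ⊗[RZ L] M) where
  carrier := {m | tauB (LsepZ L) S (isUnit_zMinusZeta_LsepZ L) (sigmaB L M m) = m}
  add_mem' {x y} hx hy := by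
    change tauB _ _ _ _ = _ at hx hy ⊢
    rw [map_add, map_add, hx, hy]
  zero_mem' := by
    change tauB _ _ _ _ = _
    rw [map_zero, map_zero]
  smul_mem' a x hx := by
    change tauB _ _ _ _ = _ at hx ⊢
    rw [← algebraMap_smul_LsepZ, sigmaB_smul, sigmaSep_algebraMap_base, map_smul, hx]

/-- The inclusion `L^sep⟨z/ζ⟩ ⊗ M → L^sep[[z]] ⊗ M`. -/
def tateInclM : TateSep L ⊗[RZ L] M →ₗ[k⟦X⟧] LsepZ L ⊗[RZ L] M :=
  (LinearMap.rTensor M (tateIncl L).toLinearMap).restrictScalars k⟦X⟧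

/-- The elements of `L^sep⟨z/ζ⟩ ⊗ M` that are `τ`-invariant in `L^sep[[z]] ⊗ M`. -/
def H1vTate (S : LocalShtuka L M) : Submodule k⟦X⟧ (TateSep L ⊗[RZ L] M) :=
  (H1v S).comap tateInclM

/-- The map from the `τ`-invariants in `L^sep⟨z/ζ⟩ ⊗ M` to `H^1_v(M, A_v)`. -/
def tateToH1v (S : LocalShtuka L M) : H1vTate S →ₗ[k⟦X⟧] H1v S :=
  tateInclM.restrict fun _ hx => hx

section Action

variable {S : LocalShtuka L M} {E : Type*} [CommRing E] [Algebra k⸨X⸩ E] [Algebra k⟦X⟧ E]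

theorem locToB_map (B : Type*) [CommRing B] [Algebra (RZ L) B]
    (hB : IsUnit (algebraMap (RZ L) B (zMinusZeta L))) (f : M →ₗ[RZ L] M)
    (x : LocalizedModule (SS L) M) :
    locToB B hB M (LocalizedModule.map (SS L) f x) = f.lTensor B (locToB B hB M x) := by
  have h : locToB B hB M ∘ₗ (LocalizedModule.map (SS L) f).restrictScalars (RZ L) =
      f.lTensor B ∘ₗ locToB B hB M := by
    refine IsLocalizedModule.ext (SS L) (LocalizedModule.mkLinearMap (SS L) M)
      (isUnit_end B hB M) ?_
    ext m
    simp [locToB, LocalizedModule.lift_mk, LocalizedModule.map_mk]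
  exact LinearMap.congr_fun h x

theorem tauB_act (c : CM S E) (B : Type*) [CommRing B] [Algebra (RZ L) B]
    (hB : IsUnit (algebraMap (RZ L) B (zMinusZeta L))) (a : OE k E)
    (x : B ⊗[RZ L] FrobPull L M) :
    tauB B S hB ((frobMap L (c.act a)).lTensor B x) = (c.act a).lTensor B (tauB B S hB x) := by
  induction x with
  | zero => simp
  | add x y hx hy => simp only [map_add, hx, hy]
  | tmul b m =>
    have e : LocalizedModule.mkLinearMap (SS L) (FrobPull L M) (frobMap L (c.act a) m) =
        LocalizedModule.map (SS L) (frobMap L (c.act a))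
          (LocalizedModule.mkLinearMap (SS L) (FrobPull L M) m) := by
      simp [LocalizedModule.map_mk]
    rw [LinearMap.lTensor_tmul, tauB, LinearMap.liftBaseChange_tmul,
      LinearMap.liftBaseChange_tmul, LinearMap.comp_apply, LinearMap.comp_apply, e,
      LinearEquiv.coe_coe, c.act_tau, locToB_map, LinearMap.comp_apply, LinearMap.comp_apply]
    exact ((LinearMap.baseChange B (c.act a)).map_smul b _).symm

theorem sigmaB_act (f : M →ₗ[RZ L] M) (x : LsepZ L ⊗[RZ L] M) :
    sigmaB L M (f.lTensor (LsepZ L) x) = (frobMap L f).lTensor (LsepZ L) (sigmaB L M x) := by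
  induction x with
  | zero => simp
  | add x y hx hy => simp only [map_add, hx, hy]
  | tmul b m => rfl

/-- The action of `O_E` on `H^1_v(M, A_v)`. -/
def actH1v (c : CM S E) (a : OE k E) : H1v S →ₗ[k⟦X⟧] H1v S :=
  LinearMap.restrict
    ((LinearMap.baseChange (LsepZ L) (c.act a)).restrictScalars k⟦X⟧) (fun x hx => by
      change tauB _ _ _ (sigmaB L M ((c.act a).lTensor (LsepZ L) x)) =
        (c.act a).lTensor (LsepZ L) x
      have hx' : tauB _ S (isUnit_zMinusZeta_LsepZ L) (sigmaB L M x) = x := hx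
      rw [sigmaB_act, tauB_act c, hx'])

end Action

end Shtuka

section Periods

variable {k : Type*} [Field k] [Fintype k] {L : IntermediateField k⸨X⸩ (Qalg k)}
  [FiniteDimensional k⸨X⸩ L] {M : Type*} [AddCommGroup M] [Module (RZ L) M]

instance : SMulCommClass (RZ L) k⟦X⟧ (BC L) :=
  ⟨fun a b c => by simp only [Algebra.smul_def]; ring⟩
instance : SMulCommClass k⟦X⟧ (RZ L) (BC L) := SMulCommClass.symm _ _ _

/-- The expansion `L^sep⟨z/ζ⟩ ⊗ M → C_v((z - ζ)) ⊗ M`. -/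
def tateEvalM : TateSep L ⊗[RZ L] M →ₗ[k⟦X⟧] BC L ⊗[RZ L] M :=
  (LinearMap.rTensor M (tateEvalAlg L).toLinearMap).restrictScalars k⟦X⟧

open Classical in
/-- The map `H^1_v(M, A_v) → M ⊗ C_v((z - ζ))`: the `τ`-invariants lie in `M ⊗ L^sep⟨z/ζ⟩`, and
are expanded in powers of `z - ζ`. (The value is `0` if `tateToH1v` were not bijective.) -/
def hZero (S : LocalShtuka L M) : H1v S →ₗ[k⟦X⟧] BC L ⊗[RZ L] M :=
  if h : Function.Bijective (tateToH1v S) then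
    tateEvalM ∘ₗ (H1vTate S).subtype ∘ₗ (LinearEquiv.ofBijective (tateToH1v S) h).symm.toLinearMap
  else 0

/-- The comparison homomorphism
`h_{v,dR} : C_v((z - ζ)) ⊗_{A_v} H^1_v(M, A_v) → C_v((z - ζ)) ⊗ σ^*M`, obtained from
`τ⁻¹ ∘ hZero` by extension of scalars. -/
def hdR (S : LocalShtuka L M) : BC L ⊗[k⟦X⟧] H1v S →ₗ[BC L] BC L ⊗[RZ L] FrobPull L M :=
  LinearMap.liftBaseChange (BC L)
    ((tauInvB (BC L) S (isUnit_zMinusZeta_BC L)).restrictScalars k⟦X⟧ ∘ₗ hZero S)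

open Classical in
/-- The inverse of `h_{v,dR}`. (The value is `0` if `hdR` were not bijective.) -/
def hdRInv (S : LocalShtuka L M) : BC L ⊗[RZ L] FrobPull L M →ₗ[BC L] BC L ⊗[k⟦X⟧] H1v S :=
  if h : Function.Bijective (hdR S) then (LinearEquiv.ofBijective (hdR S) h).symm.toLinearMap
  else 0

variable (L M) in
/-- The de Rham realization `H^1_dR(M, L[[z - ζ]]) = L[[z - ζ]] ⊗ σ^*M`. -/
abbrev HdRPlus : Type _ := BPlusL L ⊗[RZ L] FrobPull L M

variable (L M) in
/-- The de Rham realization `H^1_dR(M, R) = σ^*M / (z - ζ) σ^*M`. -/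
abbrev HdRInt : Type _ :=
  FrobPull L M ⧸ (Ideal.span {zMinusZeta L} • (⊤ : Submodule (RZ L) (FrobPull L M)))

/-- The map `H^1_dR(M, L[[z - ζ]]) → H^1_dR(M, C_v((z - ζ)))`. -/
def dRToBC : HdRPlus L M →ₗ[RZ L] BC L ⊗[RZ L] FrobPull L M :=
  LinearMap.rTensor (FrobPull L M) (IsScalarTower.toAlgHom (RZ L) (BPlusL L) (BC L)).toLinearMap

/-- The period `∫_u ω = (u ⊗ id)(h_{v,dR}⁻¹(ω))` in `C_v((z - ζ))`, for
`u ∈ Hom_{A_v}(H^1_v(M, A_v), Q_v)`. -/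
def period (S : LocalShtuka L M) (u : H1v S →ₗ[k⟦X⟧] k⸨X⸩) (ω : HdRPlus L M) : BC L :=
  LinearMap.liftBaseChange (BC L) (QvToBCLin L ∘ₗ u) (hdRInv S (dRToBC ω))

/-- The valuation `v` on `C_v`, normalized by `v(ζ) = 1`. -/
def vC (x : Cv k) : ℝ :=
  Real.logb ‖algebraMap k⸨X⸩ (Cv k) (algebraMap k⟦X⟧ k⸨X⸩ PowerSeries.X)‖ ‖x‖

/-- The map `v` on the nonzero elements of `C_v((z - ζ))`: the valuation of the leading
coefficient of the expansion in powers of `z - ζ`. -/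
def vBC (x : BC L) : ℝ := vC (HahnSeries.leadingCoeff (R := Cv k) (Γ := ℤ) x)

variable {S : LocalShtuka L M} {E : Type*} [CommRing E] [Algebra k⸨X⸩ E] [Algebra k⟦X⟧ E]

section Realizations

variable [IsScalarTower k⟦X⟧ k⸨X⸩ E] (c : CM S E) {ψ : E →ₐ[k⸨X⸩] Qalg k} (hψ : ∀ e, ψ e ∈ L)

/-- `ψ` as a homomorphism to `L`. -/
def psiL : E →ₐ[k⸨X⸩] L := ψ.codRestrict L.toSubalgebra hψ

/-- The restriction `O_E → R` of `ψ`. -/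
def psiR (a : OE k E) : VR L :=
  ⟨psiL hψ a, a.2.map ((psiL hψ).restrictScalars k⟦X⟧)⟩

/-- The endomorphism `[a]^* - ψ(a)` of `H^1_dR(M, L[[z - ζ]])`. -/
def dRShift (a : OE k E) : Module.End (BPlusL L) (HdRPlus L M) :=
  LinearMap.baseChange (BPlusL L) (frobMap L (c.act a)) -
    algebraMap (BPlusL L) (Module.End (BPlusL L) (HdRPlus L M))
      (PowerSeries.C (psiL hψ a) : L⟦X⟧)

/-- The `ψ`-component `H^ψ(M, L[[y - ψ(y)]])` of `H^1_dR(M, L[[z - ζ]])`: the submodule on which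
`[a]^* - ψ(a)` is topologically nilpotent, for the `(z - ζ)`-adic topology, for every `a ∈ O_E`.
This is the factor that corresponds to `ψ` in the decomposition of `H^1_dR(M, L[[z - ζ]])` under
`E ⊗_{Q_v} L[[z - ζ]] = ∏_ψ L[[y_{i(ψ)} - ψ(y_{i(ψ)})]]`. -/
def HPsi : Submodule (BPlusL L) (HdRPlus L M) where
  carrier := {ω | ∀ (a : OE k E) (n : ℕ), ∀ᶠ m in atTop,
    (dRShift c hψ a ^ m) ω ∈ Ideal.span {wPlus L ^ n} • (⊤ : Submodule (BPlusL L) (HdRPlus L M))}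
  add_mem' {x y} hx hy a n := by
    filter_upwards [hx a n, hy a n] with m h1 h2
    rw [map_add]
    exact add_mem h1 h2
  zero_mem' a n := by simp
  smul_mem' r x hx a n := by
    filter_upwards [hx a n] with m h1
    rw [map_smul]
    exact Submodule.smul_mem _ _ h1

/-- The endomorphism `[a]^*` of `H^1_dR(M, R)`. -/
def actInt (a : OE k E) : Module.End (RZ L) (HdRInt L M) :=
  Submodule.mapQ _ _ (frobMap L (c.act a)) (by
    rw [← Submodule.map_le_iff_le_comap, Submodule.map_smul'']
    exact Submodule.smul_mono le_rfl le_top)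

/-- `H^ψ(M, R)`: the elements `ω` of `H^1_dR(M, R)` such that, for every `a ∈ O_E`,
`([a]^* - ψ(a))^n ω = 0` for all large `n`. -/
def HPsiInt : Submodule (RZ L) (HdRInt L M) :=
  ⨅ a : OE k E, (actInt c a).maxGenEigenspace (PowerSeries.C (psiR hψ a) : (VR L)⟦X⟧)

/-- `ω` is a generator `ω°` of the `ψ`-component whose reduction modulo `z - ζ` is (the image of)
a generator of the `R`-module `H^ψ(M, R)`. -/
def IsNormalized (ω : HdRPlus L M) : Prop :=
  Submodule.span (BPlusL L) {ω} = HPsi c hψ ∧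
  ∃ g : FrobPull L M,
    Submodule.span (RZ L) {(Submodule.Quotient.mk g : HdRInt L M)} = HPsiInt c hψ ∧
    ω - (1 : BPlusL L) ⊗ₜ[RZ L] g ∈
      Ideal.span {wPlus L} • (⊤ : Submodule (BPlusL L) (HdRPlus L M))

/-- `r` is the valuation `v(ω)` of the generator `ω` of the `ψ`-component. -/
def IsValOmega (ω : HdRPlus L M) (r : ℝ) : Prop :=
  ∃ (ω' : HdRPlus L M) (x : (BPlusL L)ˣ), IsNormalized c hψ ω' ∧ ω = (x : BPlusL L) • ω' ∧
    r = vC (LtoC L (PowerSeries.constantCoeff (R := L) (x : BPlusL L)))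

end Realizations

section Homology

variable (c : CM S E)

/-- `u' = e • u` for the `E`-module structure on `Hom_{A_v}(H^1_v(M, A_v), Q_v)` for which
`b ∈ O_E` acts by `u ↦ u ∘ [b]`. -/
def IsESmul (e : E) (u u' : H1v S →ₗ[k⟦X⟧] k⸨X⸩) : Prop :=
  ∀ (b : OE k E) (d : k⟦X⟧), (b : E) = algebraMap k⟦X⟧ E d * e → d • u' = u ∘ₗ actH1v c b

/-- `u` generates the `E`-module `Hom_{A_v}(H^1_v(M, A_v), Q_v)`. -/
def IsEGenerator (u : H1v S →ₗ[k⟦X⟧] k⸨X⸩) : Prop :=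
  ∀ u' : H1v S →ₗ[k⟦X⟧] k⸨X⸩, ∃ e : E, IsESmul c e u u'

/-- `u` lies in `Hom_{A_v}(H^1_v(M, A_v), A_v)`. -/
def IsIntegralFunctional (u : H1v S →ₗ[k⟦X⟧] k⸨X⸩) : Prop :=
  ∀ x, u x ∈ (algebraMap k⟦X⟧ k⸨X⸩).range

/-- `u` generates the `O_E`-module `Hom_{A_v}(H^1_v(M, A_v), A_v)`. -/
def IsOEGenerator (u : H1v S →ₗ[k⟦X⟧] k⸨X⸩) : Prop :=
  IsIntegralFunctional u ∧
    ∀ u' : H1v S →ₗ[k⟦X⟧] k⸨X⸩, IsIntegralFunctional u' → ∃ b : OE k E, u' = u ∘ₗ actH1v c b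

/-- `s` is the valuation `v_ψ(u)` of the `E`-generator `u`. -/
def IsValU (ψ : E →ₐ[k⸨X⸩] Qalg k) (u : H1v S →ₗ[k⟦X⟧] k⸨X⸩) (s : ℝ) : Prop :=
  ∃ (a : Eˣ) (u' : H1v S →ₗ[k⟦X⟧] k⸨X⸩), IsESmul c (a⁻¹ : Eˣ) u u' ∧ IsOEGenerator c u' ∧
    s = vC ((ψ a : Qalg k) : Cv k)

end Homology

section HodgePink

variable (L) in
/-- The inclusion `L[[z - ζ]] ⊗ N → L((z - ζ)) ⊗ N`. -/
def latIncl (N : Type*) [AddCommGroup N] [Module (RZ L) N] :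
    BPlusL L ⊗[RZ L] N →ₗ[BPlusL L] BL L ⊗[RZ L] N :=
  TensorProduct.AlgebraTensorModule.map (Algebra.linearMap (BPlusL L) (BL L)) LinearMap.id

/-- The Hodge-Pink lattice `τ⁻¹(L[[z - ζ]] ⊗ M)` in `L((z - ζ)) ⊗ σ^*M`. -/
def hodgePink (S : LocalShtuka L M) : Submodule (BPlusL L) (BL L ⊗[RZ L] FrobPull L M) :=
  (LinearMap.range (latIncl L M)).comap
    ((tauB (BL L) S (isUnit_zMinusZeta_BL L)).restrictScalars (BPlusL L))

variable (L M) in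
/-- Multiplication by `(z - ζ)^n` on `L((z - ζ)) ⊗ σ^*M`. -/
def wPow (n : ℤ) :
    BL L ⊗[RZ L] FrobPull L M →ₗ[BPlusL L] BL L ⊗[RZ L] FrobPull L M :=
  (algebraMap (BL L) (Module.End (BL L) (BL L ⊗[RZ L] FrobPull L M))
    (algebraMap (BPlusL L) (BL L) (wPlus L) ^ n)).restrictScalars (BPlusL L)

/-- `Φ = (d_φ)_φ` is the local CM-type of `M`: the Hodge-Pink lattice is the direct sum of the
lattices `(z - ζ)^{-d_φ} H^φ(M, L[[z - ζ]])`. -/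
def HasCMType [IsScalarTower k⟦X⟧ k⸨X⸩ E] (c : CM S E)
    (hL : ∀ (φ : E →ₐ[k⸨X⸩] Qalg k) (e : E), φ e ∈ L) (Φ : (E →ₐ[k⸨X⸩] Qalg k) → ℤ) : Prop :=
  hodgePink S = ⨆ φ : E →ₐ[k⸨X⸩] Qalg k,
    ((HPsi c (hL φ)).map (latIncl L (FrobPull L M))).map (wPow L M (-Φ φ))

end HodgePink

end Periods

section Artin

variable {k : Type*} [Field k] [Fintype k]

/-- `Gal(Q_v^sep/Q_v)`, as the group of `Q_v`-automorphisms of the algebraic closure. -/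
abbrev GQ (k : Type*) [Field k] : Type _ := Qalg k ≃ₐ[k⸨X⸩] Qalg k

/-- The function `a_{E,ψ,Φ} : g ↦ d_{gψ}`. -/
def aPsiPhi {E : Type*} [CommRing E] [Algebra k⸨X⸩ E] (ψ : E →ₐ[k⸨X⸩] Qalg k)
    (Φ : (E →ₐ[k⸨X⸩] Qalg k) → ℤ) (g : GQ k) : ℚ :=
  Φ ((g : Qalg k →ₐ[k⸨X⸩] Qalg k).comp ψ)

variable (N : FiniteGaloisIntermediateField k⸨X⸩ (Qalg k))

/-- The function `a` is constant modulo the absolute Galois group of `N`. -/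
def ConstMod (a : GQ k → ℚ) : Prop :=
  ∀ g h : GQ k, (∀ x ∈ N.toIntermediateField, g x = h x) → a g = a h

/-- `Gal(N/Q_v)`. -/
abbrev GN : Type _ := N.toIntermediateField ≃ₐ[k⸨X⸩] N.toIntermediateField

/-- The value on `Gal(N/Q_v)` of a function that is constant modulo the absolute Galois group
of `N`. -/
def onGN (a : GQ k → ℚ) (g : GN N) : ℚ := a (g.liftNormal (Qalg k))

/-- The valuation `v` on `N`, with `v(z) = 1`. -/
def vN (x : N.toIntermediateField) : ℝ := vC ((x : Qalg k) : Cv k)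

/-- The ring of integers of `N`. -/
abbrev ON : Type _ := VR N.toIntermediateField

/-- A uniformizer of `N`. -/
def unif : ON N := Classical.epsilon fun x : ON N => Irreducible x

/-- The ramification index of `N` over `Q_v`. -/
def ramIdx : ℕ := multiplicity (unif N) (algebraMap k⟦X⟧ (ON N) PowerSeries.X)

/-- The set of all `g ∈ Gal(N/Q_v)` with `g(x) ≡ x^{q^n}` modulo the maximal ideal, for all
integral `x`. For `n = 0` it is the inertia group. -/
def WN (n : ℕ) : Set (GN N) :=
  {g | ∀ x : ON N, ‖g (x : N.toIntermediateField) - (x : N.toIntermediateField) ^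
    Fintype.card k ^ n‖ < 1}

instance : IsDedekindDomain (ON N) :=
  integralClosure.isDedekindDomain k⟦X⟧ k⸨X⸩ N.toIntermediateField

instance : Module.IsTorsionFree k⟦X⟧ (ON N) := by
  have h : Function.Injective (algebraMap k⟦X⟧ (ON N)) := by
    intro x y hxy
    have h2 := congrArg (algebraMap (ON N) N.toIntermediateField) hxy
    exact FaithfulSMul.algebraMap_injective k⟦X⟧ k⸨X⸩
      ((algebraMap k⸨X⸩ N.toIntermediateField).injective h2)
  exact Module.isTorsionFree_iff_algebraMap_injective.2 h

/-- The valuation of the different of `N` over `Q_v`. -/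
def vDifferent : ℝ :=
  sInf {r | ∃ d ∈ differentIdeal k⟦X⟧ (ON N), d ≠ 0 ∧ r = vN N (d : N.toIntermediateField)}

open Classical in
/-- The function `μ_N` on `Gal(N/Q_v)`. -/
def muN (g : GN N) : ℝ :=
  if g ∉ WN N 0 then 0
  else if g (unif N : N.toIntermediateField) ≠ unif N then
    -vN N (g (unif N : N.toIntermediateField) - unif N)
  else vDifferent N

/-- `μ_{Art,v}(a) = ∑_{g ∈ Gal(N/Q_v)} a(g) μ_N(g)`, for `a` constant modulo the absolute Galois
group of `N`. -/
def muArt (a : GQ k → ℚ) : ℝ := ∑ g : GN N, (onGN N a g : ℝ) * muN N g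

open Classical in
/-- `Z_v(a, s) = 1/e_N · ∑_{n ≥ 1} ∑_{g ∈ W^n_N} a(g) q^{-ns}` for real `s > 0`, for `a` constant
modulo the absolute Galois group of `N`. -/
def Zv (a : GQ k → ℚ) (s : ℝ) : ℝ :=
  (ramIdx N : ℝ)⁻¹ * ∑' n : ℕ, ∑ g : GN N,
    if g ∈ WN N (n + 1) then (onGN N a g : ℝ) / (Fintype.card k : ℝ) ^ (((n + 1 : ℕ) : ℝ) * s)
    else 0

end Artin

end LocSht

end

open LocSht

/-!
# The valuation of a period of a local shtuka with complex multiplication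

Write `O = O_E`, and fix an element `y` of `O` that is a uniformizer in every factor of `E`. By means
of an embedding `φ : E → Q_v^alg`, the elements of `O` are expanded into power series in `y` with
Teichmüller coefficients in `R`. The finitely many expansions that occur, as homomorphisms
`O → R[[Y]]`, are the *branches*; Frobenius permutes them, and `R[[z]] ⊗ O` is the product of copies
of `R[[Y]]` over the branches (`omega`). Because `O` acts faithfully and `M` has rank `dim E`, the module `M` is
free of rank one over `R[[z]] ⊗ O` (`exists_cyclic`), and so is `σ^*M`. Hence `τ` is multiplication
by an element `t / (z - ζ)^n` with `t` dividing a power of `z - ζ` (`Triv`, `nonempty_triv`).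

The element `z - ζ` is, up to a unit, the product of prime elements `p_φ` (`phiPrime`), one for each
embedding: `p_φ` is `Y - φ(y)` on the branch of `φ` and `1` elsewhere. So `t` is a unit times
`∏ p_φ^(a φ)`, and the CM-type is `d_φ = a φ - n` (`eq_of_hasCMType`). Lang's theorem gives
eigenvectors `σ(λ_φ) = p_φ λ_φ` with integral coefficients over `L^sep`. They are invertible over
`L^sep⟨z/ζ⟩`, because their product is up to a unit the solution of `σ(ℓ) = (z - ζ) ℓ`, a Carlitz
period. Then `x = ∏ λ_φ^(-d_φ)`, up to a unit, generates `H^1_v(M, A_v)` over `O` (`Solution`,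
`nonempty_solution`), which proves the statements about `H^1_v` and the comparison isomorphism.

The period of a generator of `H^ψ` is the product of the `ψ`-components of `t / (z - ζ)^n`, of the
generator and of the functional, divided by that of `x` (`Solution.leadNorm_period`).
* The component of `t` contributes `∑ (d_φ - d_ψ) v(ψ(y) - φ(y))`, over the `φ` on the branch of `ψ`;
  this is `-μ_Art` (`sum_lv_normAt`, `muArt_eq`).
* The generator and the functional contribute `v(ω) + v_ψ(u)`: the valuation of
  `∏_{φ ≠ ψ} p_φ` at `ψ`, that is, of the different of the factor of `ψ`, occurs in both and cancels
  (`Triv.norm_resPlus_of_isValOmega`, `leadNorm_compAt_of_isESmul`).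
* The component of `λ_φ` has the absolute value of its constant term on the branch of `ψ`
  (`Solution.leadNorm_evAt_lam`). The eigenvector equation relates the `q`-th power of this constant
  term to the constant term on the next branch, with a factor `φ(y)` if that is the branch of `φ`.
  The solution of the recursion is a geometric series over the `n` for which `φ` is congruent to
  `Frob^n ∘ ψ`, which is the series of `Z(a, 1)` (`Solution.hasSum_frobSum`, `Zv_eq`).

Thus `Solution.vBC_period` expresses the valuation by sums over the embeddings of `E`. These are
invariant under extension of the algebra (`conjSum_comp`, `frobSum_comp`), so that they may be
compared with sums over the Galois group of `N` on a compositum of `L` and `N` (`sums_eq`).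
-/

open LocSht

namespace LocSht

noncomputable section

/-! ### Shortcut instances

These are found by instance search anyway, at a much higher cost. -/

namespace Shortcuts

section Homs

variable {A B : Type*} [NonAssocSemiring A] [NonAssocSemiring B]

scoped instance : AddMonoidHomClass (A →+* B) A B := RingHomClass.toAddMonoidHomClass
scoped instance : AddHomClass (A →+* B) A B := AddMonoidHomClass.toAddHomClass
scoped instance : ZeroHomClass (A →+* B) A B := AddMonoidHomClass.toZeroHomClass
scoped instance : MonoidHomClass (A →+* B) A B := RingHomClass.toMonoidHomClass
scoped instance : MulHomClass (A →+* B) A B := MonoidHomClass.toMulHomClass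

end Homs

section Rings

variable {k : Type*} [Field k] [Fintype k] {L : IntermediateField k⸨X⸩ (Qalg k)}

scoped instance {E : Type*} [CommRing E] [Algebra k⸨X⸩ E] : Module k⸨X⸩ E := Algebra.toModule
scoped instance : Module k⸨X⸩ L := L.module'
scoped instance : SMul k⟦X⟧ k⸨X⸩ := Algebra.toSMul
scoped instance : CommRing (VR L) := (VR L).toCommRing
scoped instance : CommSemiring (VR L) := CommRing.toCommSemiring
scoped instance : Semiring (VR L) := CommSemiring.toSemiring
scoped instance : NonAssocSemiring (VR L) := Semiring.toNonAssocSemiring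
scoped instance : NonUnitalNonAssocSemiring (VR L) := NonAssocSemiring.toNonUnitalNonAssocSemiring
scoped instance : Mul (VR L) := NonUnitalNonAssocSemiring.toMul
scoped instance : MonoidWithZero (VR L) := Semiring.toMonoidWithZero
scoped instance : CommMonoidWithZero (VR L) := CommSemiring.toCommMonoidWithZero
scoped instance : Monoid (VR L) := MonoidWithZero.toMonoid
scoped instance : CommMonoid (VR L) := CommSemiring.toCommMonoid
scoped instance : NoZeroDivisors (VR L) := inferInstance
scoped instance {D : Type*} [CommRing D] [Algebra (VR L) D] : SMul (VR L) D := Algebra.toSMul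

variable {E : Type*} [CommRing E] [Algebra k⟦X⟧ E]

scoped instance : CommRing (OE k E) := (OE k E).toCommRing
scoped instance : CommSemiring (OE k E) := CommRing.toCommSemiring
scoped instance : Semiring (OE k E) := CommSemiring.toSemiring
scoped instance : NonAssocSemiring (OE k E) := Semiring.toNonAssocSemiring
scoped instance : NonUnitalNonAssocSemiring (OE k E) := NonAssocSemiring.toNonUnitalNonAssocSemiring

variable {B : Type*} [CommRing B] [Algebra k⟦X⟧ B]

scoped instance : CommRing (B ⊗[k⟦X⟧] OE k E) := Algebra.TensorProduct.instCommRing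
scoped instance : CommSemiring (B ⊗[k⟦X⟧] OE k E) := CommRing.toCommSemiring
scoped instance : Semiring (B ⊗[k⟦X⟧] OE k E) := CommSemiring.toSemiring
scoped instance : NonAssocSemiring (B ⊗[k⟦X⟧] OE k E) := Semiring.toNonAssocSemiring
scoped instance : NonUnitalNonAssocSemiring (B ⊗[k⟦X⟧] OE k E) := NonAssocSemiring.toNonUnitalNonAssocSemiring
scoped instance : Mul (B ⊗[k⟦X⟧] OE k E) := NonUnitalNonAssocSemiring.toMul
scoped instance : MonoidWithZero (B ⊗[k⟦X⟧] OE k E) := Semiring.toMonoidWithZero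
scoped instance : Monoid (B ⊗[k⟦X⟧] OE k E) := MonoidWithZero.toMonoid
scoped instance : CommMonoid (B ⊗[k⟦X⟧] OE k E) := CommSemiring.toCommMonoid

end Rings

end Shortcuts

open scoped Shortcuts

/-! ### Finite extensions of `k((X))` inside the algebraic closure -/

section LocalFields

variable {k : Type*} [Field k] [Fintype k]

theorem properSpace_laurentSeries : ProperSpace k⸨X⸩ := by
  let φ : k⟦X⟧ →+* (Valued.v : Valuation k⸨X⸩ ℤᵐ⁰).integer :=
    (algebraMap k⟦X⟧ k⸨X⸩).codRestrict _ fun f =>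
      (LaurentSeries.val_le_one_iff_eq_coe k _).2 ⟨f, rfl⟩
  have hφ : Function.Bijective φ := by
    refine ⟨fun f g h => FaithfulSMul.algebraMap_injective k⟦X⟧ k⸨X⸩ (congrArg Subtype.val h),
      fun x => ?_⟩
    obtain ⟨f, hf⟩ := (LaurentSeries.val_le_one_iff_eq_coe k _).1 x.2
    exact ⟨f, Subtype.ext hf⟩
  let e := RingEquiv.ofBijective φ hφ
  refine Valued.integer.properSpace_iff_completeSpace_and_isDiscreteValuationRing_integer_and_finite_residueField.2 ⟨inferInstance, ?_, ?_⟩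
  · exact IsDiscreteValuationRing.RingEquivClass.isDiscreteValuationRing (A := k⟦X⟧) e
  · have : Finite (IsLocalRing.ResidueField k⟦X⟧) :=
      Finite.of_equiv k (PowerSeries.residueFieldOfPowerSeries (k := k)).symm.toEquiv
    exact Finite.of_equiv _ (IsLocalRing.ResidueField.mapEquiv e).toEquiv

theorem norm_map_algHom {F : IntermediateField k⸨X⸩ (Qalg k)} (g : F →ₐ[k⸨X⸩] Qalg k) (x : F) :
    ‖g x‖ = ‖x‖ := by
  change spectralNorm k⸨X⸩ (Qalg k) (g x) = spectralNorm k⸨X⸩ (Qalg k) (x : Qalg k)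
  rw [spectralNorm, spectralNorm, minpoly.algHom_eq g g.injective,
    minpoly.algHom_eq F.val F.val.injective x |>.symm]
  rfl

theorem isIntegral_Qalg_iff (x : Qalg k) : IsIntegral k⟦X⟧ x ↔ ‖x‖ ≤ 1 := by
  constructor
  · intro h
    let v : Valuation (Qalg k) ℝ≥0 := NormedField.valuation
    let φ : k⟦X⟧ →+* v.integer := ((algebraMap k⸨X⸩ (Qalg k)).comp
      (algebraMap k⟦X⟧ k⸨X⸩)).codRestrict v.integer (fun f => by
        change ‖algebraMap k⸨X⸩ (Qalg k) (algebraMap k⟦X⟧ k⸨X⸩ f)‖ ≤ 1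
        rw [norm_algebraMap']; exact norm_coe_le_one f)
    have h := IsIntegral.map_of_comp_eq φ (RingHom.id (Qalg k)) (by ext f; rfl) h
    exact (Valuation.integer.integers v).mem_of_integral h
  · intro h
    have hx : IsIntegral k⸨X⸩ x := Algebra.IsIntegral.isIntegral x
    have h1 : spectralValue (minpoly k⸨X⸩ x) ≤ 1 := h
    rw [spectralValue_le_one_iff (minpoly.monic hx)] at h1
    have h2 : minpoly k⸨X⸩ x ∈ Polynomial.lifts (algebraMap k⟦X⟧ k⸨X⸩) := by
      rw [Polynomial.lifts_iff_coeff_lifts]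
      intro n
      have := Valued.toNormedField.norm_le_one_iff.1 (h1 n)
      obtain ⟨f, hf⟩ := (LaurentSeries.val_le_one_iff_eq_coe k _).1 this
      exact ⟨f, hf⟩
    obtain ⟨p, hp, -, hm⟩ := Polynomial.lifts_and_degree_eq_and_monic h2 (minpoly.monic hx)
    refine ⟨p, hm, ?_⟩
    rw [← Polynomial.aeval_def, ← Polynomial.aeval_map_algebraMap k⸨X⸩, hp, minpoly.aeval]

theorem isIntegral_iff_norm_le_one {F : IntermediateField k⸨X⸩ (Qalg k)} (x : F) :
    IsIntegral k⟦X⟧ x ↔ ‖x‖ ≤ 1 := by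
  have : IsScalarTower k⟦X⟧ F (Qalg k) := IsScalarTower.of_algebraMap_eq fun _ => rfl
  rw [← isIntegral_algebraMap_iff (A := F) (B := Qalg k) (algebraMap F (Qalg k)).injective,
    isIntegral_Qalg_iff]
  rfl

theorem norm_sub_le_max {F : Type*} [NormedField F] [IsUltrametricDist F] (x y : F) :
    ‖x - y‖ ≤ max ‖x‖ ‖y‖ := by
  rw [sub_eq_add_neg, ← norm_neg y]; exact IsUltrametricDist.norm_add_le_max x (-y)

theorem pow_card_eq (a : k) : a ^ Fintype.card k = a := FiniteField.pow_card a

/-- In an algebra over a field with `q` elements, `x ↦ x^(q^n)` is additive. -/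
theorem sub_pow_card_pow {A : Type*} [CommRing A] [Algebra k A] (x y : A) (n : ℕ) :
    (x - y) ^ Fintype.card k ^ n = x ^ Fintype.card k ^ n - y ^ Fintype.card k ^ n := by
  have h : ∀ z : A, z ^ Fintype.card k ^ n = (FiniteField.frobeniusAlgHom k A ^ n) z := by
    intro z
    induction n with
    | zero => simp
    | succ n ih => rw [pow_succ, pow_mul, ih, pow_succ']; rfl
  rw [h, h, h, map_sub]

theorem add_pow_card_pow {A : Type*} [CommRing A] [Algebra k A] (x y : A) (n : ℕ) :
    (x + y) ^ Fintype.card k ^ n = x ^ Fintype.card k ^ n + y ^ Fintype.card k ^ n := by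
  have := sub_pow_card_pow (k := k) (x + y) y n
  rw [add_sub_cancel_right] at this
  rw [this]; ring

section

variable {F : IntermediateField k⸨X⸩ (Qalg k)}

theorem norm_sub_pow_lt_one_iff (x y : Qalg k) (n : ℕ) :
    ‖x ^ Fintype.card k ^ n - y ^ Fintype.card k ^ n‖ < 1 ↔ ‖x - y‖ < 1 := by
  rw [← sub_pow_card_pow, norm_pow]
  exact pow_lt_one_iff_of_nonneg (norm_nonneg _) (pow_ne_zero _ Fintype.card_ne_zero)

variable [FiniteDimensional k⸨X⸩ F]

theorem properSpace_of_finiteDimensional (F : IntermediateField k⸨X⸩ (Qalg k))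
    [FiniteDimensional k⸨X⸩ F] : ProperSpace F :=
  have := properSpace_laurentSeries (k := k)
  FiniteDimensional.proper k⸨X⸩ F

/-- A finite extension of `k((X))` has a uniformizer. -/
theorem exists_uniformizer (F : IntermediateField k⸨X⸩ (Qalg k)) [FiniteDimensional k⸨X⸩ F] :
    ∃ π : F, π ≠ 0 ∧ ‖π‖ < 1 ∧ ∀ x : F, ‖x‖ < 1 → ‖x / π‖ ≤ 1 := by
  have := properSpace_of_finiteDimensional F
  have hc : IsCompact (Metric.ball (0 : F) 1) := by
    refine (isCompact_closedBall (0 : F) 1).of_isClosed_subset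
      (IsUltrametricDist.isClosed_ball _ _) Metric.ball_subset_closedBall
  obtain ⟨π, hπ, hmax⟩ := hc.exists_isMaxOn ⟨0, by simp⟩ (continuous_norm.continuousOn)
  have h0 : π ≠ 0 := by
    rintro rfl
    have := hmax (a := (zeta F : F)) (by simpa using norm_zeta_lt_one F)
    simp only [norm_zero, Set.mem_ofPred_eq] at this
    exact zeta_ne_zero F (norm_le_zero_iff.1 this)
  refine ⟨π, h0, by simpa using hπ, fun x hx => ?_⟩
  rw [norm_div, div_le_one (norm_pos_iff.2 h0)]
  exact hmax (a := x) (by simpa using hx)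

/-- The residue field of a finite extension of `k((X))` is finite: there is `f > 0` such that
`x^(q^f)` is congruent to `x` for all integral `x`. -/
theorem exists_residueDegree (F : IntermediateField k⸨X⸩ (Qalg k)) [FiniteDimensional k⸨X⸩ F] :
    ∃ f : ℕ, 0 < f ∧ ∀ x : Qalg k, x ∈ F → ‖x‖ ≤ 1 → ‖x ^ Fintype.card k ^ f - x‖ < 1 := by
  have := properSpace_of_finiteDimensional F
  obtain ⟨t, -, htf, hcov⟩ := Metric.finite_approx_of_totallyBounded
    (isCompact_closedBall (0 : F) 1).totallyBounded 1 one_pos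
  have key : ∀ x : Qalg k, x ∈ F → ‖x‖ ≤ 1 → ∃ d : ℕ, 0 < d ∧ d ≤ htf.toFinset.card ∧
      ‖x ^ Fintype.card k ^ d - x‖ < 1 := by
    intro x hxF hx
    have hc : ∀ i : ℕ, ∃ c ∈ htf.toFinset, ‖x ^ Fintype.card k ^ i - (c : F)‖ < 1 := by
      intro i
      have h1 : (⟨x, hxF⟩ : F) ^ Fintype.card k ^ i ∈ Metric.closedBall (0 : F) 1 := by
        rw [mem_closedBall_zero_iff, norm_pow]
        exact pow_le_one₀ (norm_nonneg _) hx
      have h2 := hcov h1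
      simp only [Set.mem_iUnion, Metric.mem_ball, dist_eq_norm] at h2
      obtain ⟨c, hc, h3⟩ := h2
      exact ⟨c, by simpa using hc, h3⟩
    choose c hcm hcn using hc
    -- Two of the powers `x^(q^i)` lie in the same residue class.
    obtain ⟨i, hi, j, hj, hij, he⟩ := Finset.exists_ne_map_eq_of_card_lt_of_maps_to
      (s := Finset.range (htf.toFinset.card + 1)) (t := htf.toFinset) (by simp)
      (f := c) (fun i _ => hcm i)
    wlog hlt : i < j generalizing i j
    · exact this j hj i hi hij.symm he.symm (by omega)
    refine ⟨j - i, by omega, by have := Finset.mem_range.1 hj; omega, ?_⟩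
    rw [← norm_sub_pow_lt_one_iff _ _ i, ← pow_mul, ← pow_add, Nat.sub_add_cancel hlt.le]
    have e : x ^ Fintype.card k ^ j - x ^ Fintype.card k ^ i =
        (x ^ Fintype.card k ^ j - (c j : F)) - (x ^ Fintype.card k ^ i - (c i : F)) := by
      rw [he]; ring
    rw [e]
    exact (norm_sub_le_max _ _).trans_lt (max_lt (hcn j) (hcn i))
  refine ⟨(htf.toFinset.card).factorial, Nat.factorial_pos _, fun x hxF hx => ?_⟩
  obtain ⟨d, hd0, hd, hdx⟩ := key x hxF hx
  have : ∀ m : ℕ, ‖x ^ Fintype.card k ^ (d * m) - x‖ < 1 := by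
    intro m
    induction m with
    | zero => simp
    | succ m ih =>
      have e : x ^ Fintype.card k ^ (d * (m + 1)) - x =
          ((x ^ Fintype.card k ^ d) ^ Fintype.card k ^ (d * m) - x ^ Fintype.card k ^ (d * m)) +
            (x ^ Fintype.card k ^ (d * m) - x) := by
        rw [← pow_mul, ← pow_add]; ring_nf
      rw [e]
      refine (IsUltrametricDist.norm_add_le_max _ _).trans_lt (max_lt ?_ ih)
      exact (norm_sub_pow_lt_one_iff _ _ _).2 hdx
  obtain ⟨m, hm⟩ := Nat.dvd_factorial hd0 hd
  rw [hm]
  exact this m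

/-- Every residue class is represented by a root of unity or zero (a Teichmüller
representative). -/
theorem exists_teichmuller (F : IntermediateField k⸨X⸩ (Qalg k)) [FiniteDimensional k⸨X⸩ F]
    {f : ℕ} (hf0 : 0 < f)
    (hf : ∀ x : Qalg k, x ∈ F → ‖x‖ ≤ 1 → ‖x ^ Fintype.card k ^ f - x‖ < 1)
    (x : F) (hx : ‖x‖ ≤ 1) : ∃ l : F, l ^ Fintype.card k ^ f = l ∧ ‖x - l‖ < 1 := by
  have := properSpace_of_finiteDimensional F
  obtain ⟨Q, hQ⟩ : ∃ Q, Q = Fintype.card k ^ f := ⟨_, rfl⟩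
  rw [← hQ] at hf ⊢
  have hQ2 : 2 ≤ Q := by
    calc 2 ≤ Fintype.card k := Fintype.one_lt_card
      _ ≤ Q := hQ ▸ Nat.le_self_pow hf0.ne' _
  set δ := x ^ Q - x with hδ
  have hδ1 : ‖δ‖ < 1 := hf x x.2 hx
  -- The representative is the limit of `x^(Q^n)`; consecutive terms differ by `δ^(Q^n)`.
  let u : ℕ → F := fun n => x ^ Q ^ n
  have hu : ∀ n, u (n + 1) - u n = δ ^ Q ^ n := by
    intro n
    have h1 := sub_pow_card_pow (k := k) (x ^ Q : Qalg k) x (f * n)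
    rw [pow_mul (Fintype.card k) f n, ← hQ] at h1
    apply Subtype.ext
    simp only [u, hδ, SubmonoidClass.coe_pow, AddSubgroupClass.coe_sub]
    rw [h1, ← pow_mul, ← pow_succ']
  have hsum : ∀ n, ‖u (n + 1) - u n‖ ≤ ‖δ‖ ^ n := by
    intro n
    rw [hu, norm_pow]
    exact pow_le_pow_of_le_one (norm_nonneg _) hδ1.le (Nat.lt_pow_self (by omega)).le
  have hcauchy : CauchySeq u := by
    refine cauchySeq_of_le_geometric ‖δ‖ 1 hδ1 fun n => ?_
    rw [dist_comm, dist_eq_norm, one_mul]; exact hsum n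
  obtain ⟨l, hl⟩ := cauchySeq_tendsto_of_complete hcauchy
  have hdiff : ∀ n, ‖u n - x‖ ≤ ‖δ‖ := by
    intro n
    induction n with
    | zero => simp [u]
    | succ n ih =>
      have e : u (n + 1) - x = (u (n + 1) - u n) + (u n - x) := by ring
      rw [e]
      refine (IsUltrametricDist.norm_add_le_max _ _).trans (max_le ?_ ih)
      rw [hu, norm_pow]
      exact pow_le_of_le_one (norm_nonneg _) hδ1.le (pow_pos (by omega) _).ne'
  refine ⟨l, ?_, ?_⟩
  · refine tendsto_nhds_unique (hl.pow Q) ?_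
    have := (tendsto_add_atTop_iff_nat 1).2 hl
    refine this.congr fun n => ?_
    simp only [u]; rw [← pow_mul, ← pow_succ]
  · rw [norm_sub_rev]
    refine lt_of_le_of_lt ?_ hδ1
    exact le_of_tendsto ((hl.sub_const x).norm) (Eventually.of_forall hdiff)

end

end LocalFields

/-! ### Étale algebras over `k((X))` and uniformizing elements of their maximal orders -/

section Etale

variable {k : Type*} [Field k] [Fintype k]
variable {E : Type*} [CommRing E] [Algebra k⸨X⸩ E]

section

variable (E)
variable [Module.Finite k⸨X⸩ E] [IsSemisimpleRing E]

/-- A commutative semisimple finite algebra over `k((X))` is a product of finite extensions of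
`k((X))` inside the algebraic closure, and each embedding factors through one factor. -/
theorem exists_prod_fields : ∃ (F : MaximalSpectrum E → IntermediateField k⸨X⸩ (Qalg k))
    (Ψ : E ≃ₐ[k⸨X⸩] (∀ m, F m)), (∀ m, FiniteDimensional k⸨X⸩ (F m)) ∧
      ∀ φ : E →ₐ[k⸨X⸩] Qalg k, ∃ m, ∃ g : F m →ₐ[k⸨X⸩] Qalg k, ∀ a, φ a = g (Ψ a m) := by
  have hart : IsArtinianRing E := IsArtinianRing.of_finite k⸨X⸩ E
  have hred : IsReduced E := inferInstance
  have hfield : ∀ m : MaximalSpectrum E, m.asIdeal.IsMaximal := fun m => m.isMaximal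
  let : ∀ m : MaximalSpectrum E, Field (E ⧸ m.asIdeal) := fun m => Ideal.Quotient.field _
  have hfin : ∀ m : MaximalSpectrum E, FiniteDimensional k⸨X⸩ (E ⧸ m.asIdeal) := fun m =>
    inferInstance
  let j : ∀ m : MaximalSpectrum E, (E ⧸ m.asIdeal) →ₐ[k⸨X⸩] Qalg k := fun m =>
    IsAlgClosed.lift
  let F : MaximalSpectrum E → IntermediateField k⸨X⸩ (Qalg k) := fun m => (j m).fieldRange
  let e : ∀ m, (E ⧸ m.asIdeal) ≃ₐ[k⸨X⸩] F m := fun m =>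
    AlgEquiv.ofInjectiveField (j m)
  let Ψ : E ≃ₐ[k⸨X⸩] (∀ m, F m) :=
    ((IsArtinianRing.equivPi E).restrictScalars k⸨X⸩).trans (AlgEquiv.piCongrRight e)
  refine ⟨F, Ψ, fun m => ?_, fun φ => ?_⟩
  · exact LinearEquiv.finiteDimensional (e m).toLinearEquiv
  · have hp : (RingHom.ker φ).IsPrime := RingHom.ker_isPrime φ.toRingHom
    have hm : (RingHom.ker φ).IsMaximal := IsArtinianRing.isMaximal_of_isPrime _
    let m : MaximalSpectrum E := ⟨RingHom.ker φ, hm⟩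
    let φ' : (E ⧸ m.asIdeal) →ₐ[k⸨X⸩] Qalg k := Ideal.Quotient.liftₐ _ φ fun a ha => ha
    refine ⟨m, φ'.comp (e m).symm, fun a => ?_⟩
    have : Ψ a m = e m (Ideal.Quotient.mk _ a) := rfl
    rw [this]
    simp only [AlgHom.comp_apply, AlgEquiv.coe_toAlgHom, AlgEquiv.symm_apply_apply]
    rfl

theorem exists_algHom_ne {a : E} (ha : a ≠ 0) : ∃ φ : E →ₐ[k⸨X⸩] Qalg k, φ a ≠ 0 := by
  obtain ⟨F, Ψ, -, -⟩ := exists_prod_fields (k := k) E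
  have : Ψ a ≠ 0 := by simpa using ha
  obtain ⟨m, hm⟩ := Function.ne_iff.1 this
  refine ⟨((F m).val.comp (Pi.evalAlgHom k⸨X⸩ (fun m => F m) m)).comp (Ψ : E →ₐ[k⸨X⸩] ∀ m, F m),
    fun h => hm ?_⟩
  exact Subtype.ext h

theorem card_algHom_eq_finrank [Algebra.IsSeparable k⸨X⸩ E] :
    Nat.card (E →ₐ[k⸨X⸩] Qalg k) = Module.finrank k⸨X⸩ E := by
  refine (card_algHom_le_finrank _ _ _).antisymm ?_
  have hart : IsArtinianRing E := IsArtinianRing.of_finite k⸨X⸩ E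
  obtain ⟨F, Ψ, hF, -⟩ := exists_prod_fields (k := k) E
  have : Fintype (MaximalSpectrum E) := Fintype.ofFinite _
  have hsep : ∀ m, Algebra.IsSeparable k⸨X⸩ (F m) := fun m => ⟨fun x => by
    classical
    have h := Algebra.IsSeparable.isSeparable k⸨X⸩ (Ψ.symm (Pi.single m x))
    refine Polynomial.Separable.of_dvd h (minpoly.dvd _ _ ?_)
    have h2 := congrArg (fun z => Ψ z m) (minpoly.aeval k⸨X⸩ (Ψ.symm (Pi.single m x)))
    have h3 := Polynomial.aeval_algHom_apply ((Pi.evalAlgHom k⸨X⸩ (fun m => F m) m).comp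
      (Ψ : E →ₐ[k⸨X⸩] ∀ m, F m)) (Ψ.symm (Pi.single m x)) (minpoly k⸨X⸩ (Ψ.symm (Pi.single m x)))
    simp only [minpoly.aeval, map_zero] at h3
    simpa using h3⟩
  have h1 : Module.finrank k⸨X⸩ E = ∑ m, Nat.card (F m →ₐ[k⸨X⸩] Qalg k) := by
    rw [Ψ.toLinearEquiv.finrank_eq, Module.finrank_pi_fintype]
    refine Finset.sum_congr rfl fun m _ => ?_
    rw [← AlgHom.card k⸨X⸩ (F m) (Qalg k), Nat.card_eq_fintype_card]
  rw [h1, ← Nat.card_sigma]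
  refine Nat.card_le_card_of_injective (fun p : Σ m, (F m →ₐ[k⸨X⸩] Qalg k) =>
    (p.2.comp (Pi.evalAlgHom k⸨X⸩ (fun m => F m) p.1)).comp (Ψ : E →ₐ[k⸨X⸩] ∀ m, F m)) ?_
  rintro ⟨m, g⟩ ⟨m', g'⟩ h
  have h2 : ∀ z : ∀ m, F m, g (z m) = g' (z m') := fun z => by
    simpa using AlgHom.congr_fun h (Ψ.symm z)
  classical
  obtain rfl : m = m' := by
    by_contra hne
    have := h2 (Pi.single m 1)
    rw [Pi.single_eq_same, Pi.single_eq_of_ne (Ne.symm hne)] at this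
    simp at this
  congr 1
  ext x
  simpa using h2 (Pi.single m x)

variable [Algebra k⟦X⟧ E] [IsScalarTower k⟦X⟧ k⸨X⸩ E]

theorem isIntegral_iff_forall_norm_le_one {E : Type*} [CommRing E] [Algebra k⸨X⸩ E]
    [Module.Finite k⸨X⸩ E] [IsSemisimpleRing E] [Algebra k⟦X⟧ E] [IsScalarTower k⟦X⟧ k⸨X⸩ E]
    (a : E) :
    IsIntegral k⟦X⟧ a ↔ ∀ φ : E →ₐ[k⸨X⸩] Qalg k, ‖φ a‖ ≤ 1 := by
  constructor
  · intro h φ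
    rw [← isIntegral_Qalg_iff]
    exact h.map (φ.restrictScalars k⟦X⟧)
  · intro h
    have hfin : Fintype (E →ₐ[k⸨X⸩] Qalg k) := Fintype.ofFinite _
    choose p hpm hp using fun φ => (isIntegral_Qalg_iff _).2 (h φ)
    refine ⟨∏ φ, p φ, Polynomial.monic_prod_of_monic _ _ fun φ _ => hpm φ, ?_⟩
    by_contra hne
    obtain ⟨φ, hφ⟩ := exists_algHom_ne (k := k) E hne
    apply hφ
    rw [← Polynomial.aeval_def]
    have h1 := Polynomial.aeval_algHom_apply (φ.restrictScalars k⟦X⟧) a (∏ φ, p φ)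
    change _ = φ _ at h1
    rw [← h1, map_prod]
    exact Finset.prod_eq_zero (Finset.mem_univ φ) (by rw [Polynomial.aeval_def]; exact hp φ)

/-- An element `y` of the maximal order of `E` which is a uniformizer in every factor of `E`,
such that every integral element is congruent modulo `y` to a Teichmüller representative. -/
def IsUniformizing {E : Type*} [CommRing E] [Algebra k⸨X⸩ E] [Algebra k⟦X⟧ E]
    (y : OE k E) : Prop :=
  (∀ φ : E →ₐ[k⸨X⸩] Qalg k, φ y ≠ 0 ∧ ‖φ y‖ < 1) ∧
    ∀ a : OE k E, ∃ l a' : OE k E, (∃ n, 0 < n ∧ l ^ Fintype.card k ^ n = l) ∧ a = l + y * a'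

theorem pow_pow_eq_of_dvd {A : Type*} [Monoid A] {q : ℕ} {x : A} {d : ℕ} (h : x ^ q ^ d = x)
    {n : ℕ} (hn : d ∣ n) : x ^ q ^ n = x := by
  obtain ⟨m, rfl⟩ := hn
  induction m with
  | zero => simp
  | succ m ih => rw [mul_add, pow_add, pow_mul, ih, mul_one, h]

theorem exists_isUniformizing : ∃ y : OE k E, IsUniformizing y := by
  have hart : IsArtinianRing E := IsArtinianRing.of_finite k⸨X⸩ E
  obtain ⟨F, Ψ, hF, hφ⟩ := exists_prod_fields (k := k) E
  have : Fintype (MaximalSpectrum E) := Fintype.ofFinite _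
  choose π hπ0 hπ1 hπ using fun m => exists_uniformizer (F m)
  choose f hf0 hf using fun m => exists_residueDegree (F m)
  have hnorm : ∀ (φ : E →ₐ[k⸨X⸩] Qalg k), ∃ m, ∀ a, ‖φ a‖ = ‖Ψ a m‖ := fun φ => by
    obtain ⟨m, g, hg⟩ := hφ φ
    exact ⟨m, fun a => by rw [hg, norm_map_algHom]⟩
  have hint : ∀ a : E, (∀ m, ‖Ψ a m‖ ≤ 1) → IsIntegral k⟦X⟧ a := fun a ha => by
    rw [isIntegral_iff_forall_norm_le_one]
    intro φ
    obtain ⟨m, hm⟩ := hnorm φ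
    rw [hm]; exact ha m
  have hint' : ∀ a : OE k E, ∀ m, ‖Ψ a m‖ ≤ 1 := fun a m =>
    (isIntegral_iff_forall_norm_le_one (a : E)).1 a.2 (((F m).val.comp
      (Pi.evalAlgHom k⸨X⸩ (fun m => F m) m)).comp (Ψ : E →ₐ[k⸨X⸩] ∀ m, F m))
  refine ⟨⟨Ψ.symm π, hint _ fun m => by simpa using (hπ1 m).le⟩, fun φ => ?_, fun a => ?_⟩
  · obtain ⟨m, hm⟩ := hnorm φ
    constructor
    · rw [← norm_ne_zero_iff, hm, norm_ne_zero_iff]; simpa using hπ0 m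
    · rw [hm]; simpa using hπ1 m
  · choose l hl1 hl2 using fun m => exists_teichmuller (F m) (hf0 m) (hf m) (Ψ a m) (hint' a m)
    have hl3 : ∀ m, ‖l m‖ ≤ 1 := fun m => by
      have e : l m = Ψ a m - (Ψ a m - l m) := by ring
      rw [e]
      exact (norm_sub_le_max _ _).trans (max_le (hint' a m) (hl2 m).le)
    refine ⟨⟨Ψ.symm l, hint _ fun m => by simpa using hl3 m⟩,
      ⟨Ψ.symm fun m => (Ψ a m - l m) / π m, hint _ fun m => by simpa using hπ m _ (hl2 m)⟩,
      ⟨∏ m, f m, Finset.prod_pos fun m _ => hf0 m, ?_⟩, ?_⟩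
    · apply Subtype.ext
      apply Ψ.injective
      funext m
      change Ψ ((Ψ.symm l) ^ Fintype.card k ^ ∏ m, f m) m = Ψ (Ψ.symm l) m
      rw [map_pow, AlgEquiv.apply_symm_apply, Pi.pow_apply,
        pow_pow_eq_of_dvd (hl1 m) (Finset.dvd_prod_of_mem f (Finset.mem_univ m))]
    · apply Subtype.ext
      apply Ψ.injective
      ext m
      simp only [Subalgebra.coe_add, Subalgebra.coe_mul, map_add, map_mul,
        AlgEquiv.apply_symm_apply, Pi.add_apply, Pi.mul_apply]
      rw [mul_div_cancel₀ _ (hπ0 m)]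
      simp

end

end Etale

/-! ### The valuation ring of `L`, its Teichmüller elements and evaluation of power series -/

section ValuationRing

variable {k : Type*} [Field k] [Fintype k] (L : IntermediateField k⸨X⸩ (Qalg k))

theorem mem_VR_iff (x : L) : x ∈ VR L ↔ ‖x‖ ≤ 1 := isIntegral_iff_norm_le_one x

variable {L}

theorem isUnit_VR_iff (x : VR L) : IsUnit x ↔ ‖(x : L)‖ = 1 := by
  constructor
  · rintro ⟨u, rfl⟩
    have h1 := norm_le_one L (u : VR L)
    have h2 := norm_le_one L ((u⁻¹ : (VR L)ˣ) : VR L)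
    have h3 : ‖((u : VR L) : L)‖ * ‖(((u⁻¹ : (VR L)ˣ) : VR L) : L)‖ = 1 := by
      rw [← norm_mul, ← Subalgebra.coe_mul, Units.mul_inv, Subalgebra.coe_one, norm_one]
    nlinarith [norm_nonneg ((u : VR L) : L), norm_nonneg (((u⁻¹ : (VR L)ˣ) : VR L) : L)]
  · intro h
    have h0 : (x : L) ≠ 0 := by rintro h0; simp [h0] at h
    refine IsUnit.of_mul_eq_one ⟨(x : L)⁻¹, (mem_VR_iff L _).2 (by rw [norm_inv, h, inv_one])⟩ ?_
    exact Subtype.ext (mul_inv_cancel₀ h0)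

theorem not_isUnit_VR_iff (x : VR L) : ¬ IsUnit x ↔ ‖(x : L)‖ < 1 := by
  rw [isUnit_VR_iff, ← ne_eq, lt_iff_le_and_ne]
  exact ⟨fun h => ⟨norm_le_one L x, h⟩, fun h => h.2⟩

instance isLocalRing_VR : IsLocalRing (VR L) := by
  refine IsLocalRing.of_nonunits_add fun a b ha hb => ?_
  rw [mem_nonunits_iff, not_isUnit_VR_iff] at *
  exact (IsUltrametricDist.norm_add_le_max _ _).trans_lt (max_lt ha hb)

theorem mem_maximalIdeal_VR_iff (x : VR L) :
    x ∈ IsLocalRing.maximalIdeal (VR L) ↔ ‖(x : L)‖ < 1 := by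
  rw [IsLocalRing.mem_maximalIdeal, mem_nonunits_iff, not_isUnit_VR_iff]

instance isLocalRing_RZ : IsLocalRing (RZ L) := inferInstanceAs (IsLocalRing (VR L)⟦X⟧)

section Residue

variable (L) [FiniteDimensional k⸨X⸩ L]

/-- An exponent `f > 0` such that `x^(q^f) ≡ x` for all integral `x` in `L`. -/
def fL : ℕ := (exists_residueDegree L).choose

theorem fL_pos : 0 < fL L := (exists_residueDegree L).choose_spec.1

theorem norm_pow_fL_sub_lt_one (x : VR L) :
    ‖((x ^ Fintype.card k ^ fL L - x : VR L) : L)‖ < 1 :=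
  (exists_residueDegree L).choose_spec.2 x (x : L).2 (norm_le_one L x)

theorem eq_zero_of_pow_eq {x : VR L} {n : ℕ} (hn : 0 < n) (h : x ^ Fintype.card k ^ n = x)
    (hx : ‖(x : L)‖ < 1) : x = 0 := by
  by_contra h0
  have h1 : ‖(x : L)‖ ^ (Fintype.card k ^ n - 1 + 1) = ‖(x : L)‖ := by
    have hq : Fintype.card k ^ n - 1 + 1 = Fintype.card k ^ n :=
      Nat.sub_add_cancel (Nat.one_le_pow _ _ Fintype.card_pos)
    rw [hq, ← norm_pow, ← Subalgebra.coe_pow, h]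
  have hpos : 0 < ‖(x : L)‖ := norm_pos_iff.2 fun h => h0 (Subtype.ext h)
  rw [pow_succ] at h1
  have h2 := mul_right_cancel₀ hpos.ne' (h1.trans (one_mul _).symm)
  have h3 : Fintype.card k ^ n - 1 ≠ 0 := by
    have := Nat.one_lt_pow hn.ne' (Fintype.one_lt_card (α := k)); omega
  exact (pow_lt_one₀ (norm_nonneg _) hx h3).ne h2

theorem pow_fL_eq {x : VR L} {n : ℕ} (hn : 0 < n) (h : x ^ Fintype.card k ^ n = x) :
    x ^ Fintype.card k ^ fL L = x := by
  rw [← sub_eq_zero]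
  refine eq_zero_of_pow_eq L hn ?_ (norm_pow_fL_sub_lt_one L x)
  rw [sub_pow_card_pow, h, ← pow_mul, mul_comm, pow_mul, h]

/-- The field of Teichmüller elements of `R`, isomorphic to the residue field. -/
def teich : Subring (VR L) where
  carrier := {x | x ^ Fintype.card k ^ fL L = x}
  mul_mem' {a b} ha hb := by
    change _ = _ at *; rw [mul_pow, ha, hb]
  one_mem' := one_pow _
  add_mem' {a b} ha hb := by
    change _ = _ at *; rw [add_pow_card_pow, ha, hb]
  zero_mem' := zero_pow (pow_ne_zero _ Fintype.card_ne_zero)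
  neg_mem' {a} ha := by
    change _ = _ at *
    have := sub_pow_card_pow (k := k) 0 a (fL L)
    rwa [zero_sub, zero_pow (pow_ne_zero _ Fintype.card_ne_zero), ha, zero_sub] at this

variable {L}

theorem isUnit_of_mem_teich {x : VR L} (hx : x ∈ teich L) (h0 : x ≠ 0) : IsUnit x := by
  by_contra h
  rw [not_isUnit_VR_iff] at h
  exact h0 (eq_zero_of_pow_eq L (fL_pos L) hx h)

theorem mem_teich_of_pow_eq {x : VR L} {n : ℕ} (hn : 0 < n) (h : x ^ Fintype.card k ^ n = x) :
    x ∈ teich L := pow_fL_eq L hn h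

end Residue

section Eval

variable [FiniteDimensional k⸨X⸩ L]

theorem map_mem_tate_of_norm_lt_one {c : VR L} (hc : ‖(c : L)‖ < 1) (f : (VR L)⟦X⟧) :
    PowerSeries.map (RtoL L) f ∈ tate (RtoL L c) :=
  mem_tate_of_norm_le_one _ hc _ fun n => by
    rw [PowerSeries.coeff_map]; exact norm_le_one L _

theorem norm_constantCoeff_taylor_le {F : Type*} [NormedField F] [IsUltrametricDist F]
    [CompleteSpace F] (c : F) (f : tate c) {b : ℝ}
    (hb : ∀ n, ‖PowerSeries.coeff n f.1‖ * ‖c‖ ^ n ≤ b) :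
    ‖PowerSeries.constantCoeff (taylor c f)‖ ≤ b := by
  have hb0 : 0 ≤ b := le_trans (by positivity) (hb 0)
  rw [← PowerSeries.coeff_zero_eq_constantCoeff_apply, coeff_taylor]
  refine IsUltrametricDist.norm_tsum_le_of_forall_le_of_nonneg hb0 fun m => ?_
  simpa [taylorTerm] using hb m

/-- Evaluation of power series over `R` at an element of the maximal ideal. -/
def evR (c : VR L) (hc : ‖(c : L)‖ < 1) : (VR L)⟦X⟧ →+* VR L :=
  (((PowerSeries.constantCoeff (R := L)).comp (taylor (RtoL L c))).comp
    ((PowerSeries.map (RtoL L)).codRestrict (tate (RtoL L c))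
      (map_mem_tate_of_norm_lt_one hc))).codRestrict (VR L) fun f => by
    rw [mem_VR_iff]
    refine norm_constantCoeff_taylor_le _ _ fun n => ?_
    have h1 : ‖PowerSeries.coeff n (PowerSeries.map (RtoL L) f)‖ ≤ 1 := by
      rw [PowerSeries.coeff_map]; exact norm_le_one L _
    exact mul_le_one₀ h1 (by positivity) (pow_le_one₀ (norm_nonneg _) hc.le)

variable {c : VR L} (hc : ‖(c : L)‖ < 1)

@[simp]
theorem evR_C (a : VR L) : evR c hc (PowerSeries.C a) = a := by
  apply Subtype.ext
  change PowerSeries.constantCoeff (taylor (RtoL L c) ⟨PowerSeries.map (RtoL L) _, _⟩) = _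
  simp only [PowerSeries.map_C, taylor_C, PowerSeries.constantCoeff_C]
  rfl

@[simp]
theorem evR_X : evR c hc PowerSeries.X = c := by
  apply Subtype.ext
  change PowerSeries.constantCoeff (taylor (RtoL L c) ⟨PowerSeries.map (RtoL L) _, _⟩) = _
  simp only [PowerSeries.map_X, taylor_X, PowerSeries.constantCoeff_C, map_add,
    PowerSeries.constantCoeff_X, zero_add]
  rfl

theorem eq_of_forall_norm_sub_le {F : Type*} [NormedField F] {x y c : F} (hc : ‖c‖ < 1)
    (h : ∀ n : ℕ, ‖x - y‖ ≤ ‖c‖ ^ n) : x = y := by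
  rw [← sub_eq_zero, ← norm_le_zero_iff]
  exact ge_of_tendsto' (tendsto_pow_atTop_nhds_zero_of_lt_one (norm_nonneg _) hc) h

end Eval

end ValuationRing

section Division

variable {D : Type*} [CommRing D]

/-- If `ev` is an evaluation of power series at `c`, then `T - c` divides every power series that
is mapped to zero. -/
theorem X_sub_C_dvd_of_eval_eq_zero {c : D} (ev : D⟦X⟧ →+* D)
    (hC : ∀ a, ev (PowerSeries.C a) = a) (hX : ev PowerSeries.X = c) {g : D⟦X⟧} (hg : ev g = 0) :
    PowerSeries.X - PowerSeries.C c ∣ g := by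
  let sh : ℕ → D⟦X⟧ := fun n => PowerSeries.mk fun m => PowerSeries.coeff (m + n) g
  have hsh : ∀ n, ev (sh n) = PowerSeries.coeff n g + c * ev (sh (n + 1)) := by
    intro n
    have : sh n = PowerSeries.C (PowerSeries.coeff n g) + PowerSeries.X * sh (n + 1) := by
      ext m
      rcases m with _ | m
      · simp [sh]
      · simp only [sh, PowerSeries.coeff_mk, map_add, PowerSeries.coeff_succ_X_mul,
          PowerSeries.coeff_C, Nat.succ_ne_zero, if_false, zero_add]
        rw [add_right_comm, add_assoc]
    rw [this, map_add, map_mul, hC, hX]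
  have h0 : ev (sh 0) = 0 := hg ▸ congrArg ev (by ext m; simp [sh])
  refine ⟨PowerSeries.mk fun n => ev (sh (n + 1)), ?_⟩
  ext n
  rw [sub_mul, map_sub, PowerSeries.coeff_C_mul, PowerSeries.coeff_mk]
  rcases n with _ | n
  · have := hsh 0
    rw [h0] at this
    rw [PowerSeries.coeff_zero_X_mul, zero_sub]
    linear_combination -this
  · rw [PowerSeries.coeff_succ_X_mul, PowerSeries.coeff_mk]
    linear_combination hsh (n + 1) * (-1)

theorem prime_X_sub_C [IsDomain D] {c : D} (ev : D⟦X⟧ →+* D)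
    (hC : ∀ a, ev (PowerSeries.C a) = a) (hX : ev PowerSeries.X = c) :
    Prime (PowerSeries.X - PowerSeries.C c) := by
  have h0 : ev (PowerSeries.X - PowerSeries.C c) = 0 := by rw [map_sub, hC, hX, sub_self]
  refine ⟨fun h => ?_, fun h => ?_, fun a b h => ?_⟩
  · have := congrArg (PowerSeries.coeff 1) h
    simp at this
  · have := h.map ev
    rw [h0] at this
    exact not_isUnit_zero this
  · obtain ⟨r, hr⟩ := h
    have : ev a * ev b = 0 := by rw [← map_mul, hr, map_mul, h0, zero_mul]
    exact (mul_eq_zero.1 this).imp (X_sub_C_dvd_of_eval_eq_zero ev hC hX)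
      (X_sub_C_dvd_of_eval_eq_zero ev hC hX)

end Division

/-! ### Expansion of integral elements of `E` in powers of a uniformizing element -/

section Frobenius

variable {k : Type*} [Field k] [Fintype k]

theorem pow_card_eq_of_pow_card_pow_eq {f : ℕ} (hf : 0 < f) {c : k⸨X⸩}
    (hc : c ^ Fintype.card k ^ f = c) : c ^ Fintype.card k = c := by
  have h1q : 1 < Fintype.card k ^ f := Nat.one_lt_pow hf.ne' Fintype.one_lt_card
  obtain ⟨m, hm⟩ : ∃ m, Fintype.card k ^ f = m + 2 := ⟨Fintype.card k ^ f - 2, by omega⟩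
  have hcn : ‖c‖ ≤ 1 := by
    by_contra h
    push Not at h
    have := congrArg norm hc
    rw [norm_pow, hm, pow_succ] at this
    have h2 : 1 < ‖c‖ ^ (m + 1) := one_lt_pow₀ h (Nat.succ_ne_zero m)
    nlinarith
  obtain ⟨g, rfl⟩ := (LaurentSeries.val_le_one_iff_eq_coe k _).1
    (Valued.toNormedField.norm_le_one_iff.1 hcn)
  have hg : g ^ Fintype.card k ^ f = g := by
    apply FaithfulSMul.algebraMap_injective k⟦X⟧ k⸨X⸩
    rw [map_pow]; exact hc
  have h0 : g - PowerSeries.C (PowerSeries.constantCoeff g) = 0 := by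
    by_contra hne
    have h1 : (g - PowerSeries.C (PowerSeries.constantCoeff g)) ^ Fintype.card k ^ f =
        g - PowerSeries.C (PowerSeries.constantCoeff g) := by
      rw [sub_pow_card_pow, hg, ← map_pow, ← map_pow, hg]
    rw [hm, pow_succ] at h1
    have h2 := mul_right_cancel₀ hne (h1.trans (one_mul _).symm)
    have h3 := congrArg PowerSeries.constantCoeff h2
    simp at h3
  rw [sub_eq_zero] at h0
  have h4 : g ^ Fintype.card k = g := by
    rw [h0, ← map_pow, FiniteField.pow_card]
  have h5 := congrArg (algebraMap k⟦X⟧ k⸨X⸩) h4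
  rw [map_pow] at h5
  exact h5

theorem frobeniusAlgHom_pow_apply {A : Type*} [CommRing A] [Algebra k A] (n : ℕ) (z : A) :
    (FiniteField.frobeniusAlgHom k A ^ n) z = z ^ Fintype.card k ^ n := by
  induction n with
  | zero => simp
  | succ n ih => rw [pow_succ' (Fintype.card k), mul_comm, pow_mul, ← ih, pow_succ']; rfl

/-- The Frobenius of a finite subfield of `Q_v^alg` is induced by an automorphism over
`k((X))`. -/
theorem exists_frobenius_of_pow_eq {f : ℕ} (hf : 0 < f) {θ : Qalg k}
    (hθ : θ ^ Fintype.card k ^ f = θ) : ∃ g : GQ k, g θ = θ ^ Fintype.card k := by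
  set p := minpoly k⸨X⸩ θ with hp
  have hint : IsIntegral k⸨X⸩ θ := Algebra.IsIntegral.isIntegral θ
  set Fr : Qalg k →+* Qalg k := (FiniteField.frobeniusAlgHom k (Qalg k) ^ f).toRingHom with hFr
  have hFrz : ∀ z, Fr z = z ^ Fintype.card k ^ f := fun z => frobeniusAlgHom_pow_apply f z
  set P := p.map (algebraMap k⸨X⸩ (Qalg k)) with hP
  have hPm : P.Monic := (minpoly.monic hint).map _
  have hPe : P = (P.roots.map fun a => Polynomial.X - Polynomial.C a).prod :=
    (IsAlgClosed.splits P).eq_prod_roots_of_monic hPm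
  have hroots : ∀ r ∈ P.roots, Fr r = r := by
    intro r hr
    have hr' : Polynomial.aeval r p = 0 := by
      have := Polynomial.isRoot_of_mem_roots hr
      rwa [Polynomial.IsRoot, hP, Polynomial.eval_map_algebraMap] at this
    have hd : p ∣ Polynomial.X ^ Fintype.card k ^ f - Polynomial.X :=
      minpoly.dvd _ _ (by simp [hθ])
    have := Polynomial.aeval_eq_zero_of_dvd_aeval_eq_zero hd hr'
    rw [hFrz]
    simpa [sub_eq_zero] using this
  have hPF : P.map Fr = P := by
    conv_lhs => rw [hPe]
    conv_rhs => rw [hPe]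
    rw [Polynomial.map_multiset_prod, Multiset.map_map]
    congr 1
    refine Multiset.map_congr rfl fun r hr => ?_
    simp [hroots r hr]
  have hcoef : ∀ n, p.coeff n ^ Fintype.card k = p.coeff n := by
    intro n
    refine pow_card_eq_of_pow_card_pow_eq hf ?_
    apply (algebraMap k⸨X⸩ (Qalg k)).injective
    have := congrArg (fun t => Polynomial.coeff t n) hPF
    simp only [Polynomial.coeff_map, hP, hFrz] at this
    rw [map_pow]; exact this
  have hroot : Polynomial.aeval (θ ^ Fintype.card k) p = 0 := by
    have h1 : (Polynomial.aeval θ p) ^ Fintype.card k = 0 := by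
      rw [hp, minpoly.aeval, zero_pow Fintype.card_ne_zero]
    have h2 : ∀ z : Qalg k, z ^ Fintype.card k = FiniteField.frobeniusAlgHom k (Qalg k) z :=
      fun _ => rfl
    rw [← h1, h2 (Polynomial.aeval θ p), Polynomial.aeval_eq_sum_range,
      Polynomial.aeval_eq_sum_range, map_sum]
    refine Finset.sum_congr rfl fun i _ => ?_
    rw [Algebra.smul_def, Algebra.smul_def, map_mul, map_pow, ← h2, ← h2, ← map_pow, hcoef]
  have hmin : minpoly k⸨X⸩ (θ ^ Fintype.card k) = p :=
    (minpoly.eq_of_irreducible_of_monic (minpoly.irreducible hint) hroot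
      (minpoly.monic hint)).symm
  obtain ⟨g, hg⟩ := (Normal.minpoly_eq_iff_mem_orbit (Qalg k)).1 hmin
  exact ⟨g, hg⟩

variable (L : IntermediateField k⸨X⸩ (Qalg k)) [FiniteDimensional k⸨X⸩ L]

instance finite_teich : Finite (teich L) := by
  have hq : 1 < Fintype.card k ^ fL L := Nat.one_lt_pow (fL_pos L).ne' Fintype.one_lt_card
  have hP : (Polynomial.X ^ Fintype.card k ^ fL L - Polynomial.X : Polynomial (Qalg k)) ≠ 0 :=
    FiniteField.X_pow_card_sub_X_ne_zero (Qalg k) hq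
  have hfin := Polynomial.finite_setOfPred_isRoot hP
  refine @Finite.of_injective _ _ hfin.to_subtype
    (fun x : teich L => ⟨(((x : VR L) : L) : Qalg k), ?_⟩) ?_
  · have h1 : (x : VR L) ^ Fintype.card k ^ fL L = x := x.2
    have h2 := congrArg (fun x : VR L => ((x : L) : Qalg k)) h1
    change Polynomial.IsRoot _ _
    rw [Polynomial.IsRoot, Polynomial.eval_sub, Polynomial.eval_pow, Polynomial.eval_X, sub_eq_zero]
    exact h2
  · intro x x' h
    exact Subtype.ext (Subtype.ext (Subtype.ext (by simpa using h)))

theorem exists_frobenius : ∃ g : GQ k, ∀ x ∈ teich L,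
    g ((x : L) : Qalg k) = ((x : L) : Qalg k) ^ Fintype.card k := by
  have := finite_teich L
  obtain ⟨θ, hθ⟩ := IsCyclic.exists_generator (α := (teich L)ˣ)
  obtain ⟨g, hg⟩ := exists_frobenius_of_pow_eq (fL_pos L)
    (θ := (((θ : teich L) : VR L) : L)) (by
      have h1 : ((θ : teich L) : VR L) ^ Fintype.card k ^ fL L = ((θ : teich L) : VR L) :=
        (θ : teich L).2
      exact congrArg (fun x : VR L => ((x : L) : Qalg k)) h1)
  refine ⟨g, fun x hx => ?_⟩
  by_cases h0 : x = 0
  · simp [h0]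
  obtain ⟨b, hb⟩ := (isUnit_of_mem_teich hx h0).exists_right_inv
  have hxu : IsUnit (⟨x, hx⟩ : teich L) := by
    refine IsUnit.of_mul_eq_one ⟨b, ?_⟩ (Subtype.ext hb)
    refine (isUnit_of_mem_teich hx h0).mul_left_cancel ?_
    have ha : x ^ Fintype.card k ^ fL L = x := hx
    rw [hb]
    nth_rw 1 [← ha]
    rw [← mul_pow, hb, one_pow]
  obtain ⟨u, hu⟩ := hxu
  obtain ⟨n, hn⟩ := (mem_powers_iff_mem_zpowers.2 (hθ u))
  have e : ((x : L) : Qalg k) = ((((θ : teich L) : VR L) : L) : Qalg k) ^ n := by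
    have h1 : x = ((θ : teich L) : VR L) ^ n := by
      have h2 : ((u : teich L) : VR L) = x := congrArg Subtype.val hu
      rw [← h2, ← hn]; rfl
    rw [h1]; rfl
  rw [e, map_pow, hg, ← pow_mul, ← pow_mul, mul_comm]

end Frobenius

section SeriesTools

theorem sum_coeff_add_X_pow_mul {D : Type*} [CommRing D] (g : D⟦X⟧) (n : ℕ) :
    g = (∑ i ∈ Finset.range n, PowerSeries.C (PowerSeries.coeff i g) * PowerSeries.X ^ i) +
      PowerSeries.X ^ n * PowerSeries.mk fun m => PowerSeries.coeff (m + n) g := by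
  ext m
  simp only [map_add, map_sum, PowerSeries.coeff_C_mul, PowerSeries.coeff_X_pow,
    PowerSeries.coeff_X_pow_mul', PowerSeries.coeff_mk, mul_ite, mul_one, mul_zero]
  by_cases h : n ≤ m
  · rw [if_pos h, Nat.sub_add_cancel h, Finset.sum_eq_zero, zero_add]
    intro i hi
    rw [if_neg]
    have := Finset.mem_range.1 hi
    omega
  · rw [if_neg h, add_zero, Finset.sum_ite_eq, if_pos (Finset.mem_range.2 (not_le.1 h))]

variable {k : Type*} [Field k] [Fintype k] {L : IntermediateField k⸨X⸩ (Qalg k)}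
  [FiniteDimensional k⸨X⸩ L] {c : VR L} (hc : ‖(c : L)‖ < 1)

theorem exists_evR_eq (g : (VR L)⟦X⟧) (n : ℕ) : ∃ r : VR L, evR c hc g =
    (∑ i ∈ Finset.range n, PowerSeries.coeff i g * c ^ i) + c ^ n * r := by
  refine ⟨evR c hc (PowerSeries.mk fun m => PowerSeries.coeff (m + n) g), ?_⟩
  conv_lhs => rw [sum_coeff_add_X_pow_mul g n]
  simp only [map_add, map_sum, map_mul, map_pow, evR_C, evR_X]

theorem norm_coe_mul_pow_le (x r : VR L) (n : ℕ) :
    ‖((x ^ n * r : VR L) : L)‖ ≤ ‖(x : L)‖ ^ n := by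
  rw [Subalgebra.coe_mul, Subalgebra.coe_pow, norm_mul, norm_pow]
  exact mul_le_of_le_one_right (by positivity) (norm_le_one L r)

/-- The value of an evaluation is determined by its congruences. -/
theorem evR_eq_of_forall (g : (VR L)⟦X⟧) (x : VR L)
    (h : ∀ n, ∃ r : VR L, x = (∑ i ∈ Finset.range n, PowerSeries.coeff i g * c ^ i) + c ^ n * r) :
    evR c hc g = x := by
  apply Subtype.ext
  refine eq_of_forall_norm_sub_le hc fun n => ?_
  obtain ⟨r, hr⟩ := h n
  obtain ⟨r', hr'⟩ := exists_evR_eq hc g n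
  have e : ((evR c hc g : VR L) : L) - (x : L) = ((c ^ n * (r' - r) : VR L) : L) := by
    rw [← Subalgebra.coe_sub, hr', hr]; congr 1; ring
  rw [e]
  exact norm_coe_mul_pow_le _ _ _

variable (L) in
/-- The power series all of whose coefficients are Teichmüller elements. -/
def IsTeichSeries (g : (VR L)⟦X⟧) : Prop := ∀ n, PowerSeries.coeff n g ∈ teich L

theorem IsTeichSeries.eq_X_pow_mul {g : (VR L)⟦X⟧} (hg : IsTeichSeries L g) (h0 : g ≠ 0) :
    ∃ (n : ℕ) (u : (VR L)⟦X⟧), IsUnit u ∧ g = PowerSeries.X ^ n * u := by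
  classical
  have hex : ∃ n, PowerSeries.coeff n g ≠ 0 := by
    by_contra h
    push Not at h
    exact h0 (PowerSeries.ext fun n => by simpa using h n)
  let n := Nat.find hex
  refine ⟨n, PowerSeries.mk fun m => PowerSeries.coeff (m + n) g, ?_, ?_⟩
  · rw [PowerSeries.isUnit_iff_constantCoeff, ← PowerSeries.coeff_zero_eq_constantCoeff_apply,
      PowerSeries.coeff_mk, zero_add]
    exact isUnit_of_mem_teich (hg n) (Nat.find_spec hex)
  · conv_lhs => rw [sum_coeff_add_X_pow_mul g n]
    rw [Finset.sum_eq_zero, zero_add]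
    intro i hi
    have := Nat.find_min hex (Finset.mem_range.1 hi)
    rw [not_not.1 this, map_zero, zero_mul]

theorem IsTeichSeries.sub {g h : (VR L)⟦X⟧} (hg : IsTeichSeries L g) (hh : IsTeichSeries L h) :
    IsTeichSeries L (g - h) := fun n => by
  rw [map_sub]; exact sub_mem (hg n) (hh n)

theorem IsTeichSeries.add {g h : (VR L)⟦X⟧} (hg : IsTeichSeries L g) (hh : IsTeichSeries L h) :
    IsTeichSeries L (g + h) := fun n => by
  rw [map_add]; exact add_mem (hg n) (hh n)

theorem IsTeichSeries.mul {g h : (VR L)⟦X⟧} (hg : IsTeichSeries L g) (hh : IsTeichSeries L h) :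
    IsTeichSeries L (g * h) := fun n => by
  rw [PowerSeries.coeff_mul]
  exact sum_mem fun p _ => mul_mem (hg _) (hh _)

theorem IsTeichSeries.evR_injective {g h : (VR L)⟦X⟧} (hg : IsTeichSeries L g)
    (hh : IsTeichSeries L h) (h0 : c ≠ 0) (e : evR c hc g = evR c hc h) : g = h := by
  by_contra hne
  obtain ⟨n, u, hu, hgu⟩ := (hg.sub hh).eq_X_pow_mul (sub_ne_zero.2 hne)
  have h1 := congrArg (evR c hc) hgu
  rw [map_sub, e, sub_self, map_mul, map_pow, evR_X] at h1
  rcases mul_eq_zero.1 h1.symm with h2 | h2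
  · exact h0 (pow_eq_zero_iff (n := n) (fun hn => by subst hn; simp at h2) |>.1 h2)
  · exact (hu.map (evR c hc)).ne_zero h2

end SeriesTools

theorem exists_smul_mem_OE {k : Type*} [Field k] [Fintype k] {E : Type*} [CommRing E]
    [Algebra k⸨X⸩ E] [Algebra k⟦X⟧ E] [IsScalarTower k⟦X⟧ k⸨X⸩ E] [Module.Finite k⸨X⸩ E] (e : E) :
    ∃ b : nonZeroDivisors k⟦X⟧, b.1 • e ∈ OE k E :=
  IsIntegral.exists_multiple_integral_of_isLocalization (Rₘ := k⸨X⸩) (nonZeroDivisors k⟦X⟧) e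
    (Algebra.IsIntegral.isIntegral e)

section Expansion

variable {k : Type*} [Field k] [Fintype k] {L : IntermediateField k⸨X⸩ (Qalg k)}
  [FiniteDimensional k⸨X⸩ L]
variable {E : Type*} [CommRing E] [Algebra k⸨X⸩ E] [Algebra k⟦X⟧ E] [IsScalarTower k⟦X⟧ k⸨X⸩ E]
variable {y : OE k E} (hy : IsUniformizing y) (hL : ∀ (φ : E →ₐ[k⸨X⸩] Qalg k) (e : E), φ e ∈ L)

/-- The restriction of an embedding `E → Q_v^alg` to a ring homomorphism `O_E → R`. -/
def embR (hL : ∀ (φ : E →ₐ[k⸨X⸩] Qalg k) (e : E), φ e ∈ L) (φ : E →ₐ[k⸨X⸩] Qalg k) :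
    OE k E →+* VR L where
  toFun a := psiR (hL φ) a
  map_one' := Subtype.ext (Subtype.ext (map_one φ))
  map_zero' := Subtype.ext (Subtype.ext (map_zero φ))
  map_add' a b := Subtype.ext (Subtype.ext (map_add φ (a : E) b))
  map_mul' a b := Subtype.ext (Subtype.ext (map_mul φ (a : E) b))

theorem coe_embR (φ : E →ₐ[k⸨X⸩] Qalg k) (a : OE k E) :
    (((embR hL φ a : VR L) : L) : Qalg k) = φ a := rfl

include hy in
theorem norm_embR_lt_one (φ : E →ₐ[k⸨X⸩] Qalg k) : ‖((embR hL φ y : VR L) : L)‖ < 1 :=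
  (hy.1 φ).2

include hy in
theorem embR_ne_zero (φ : E →ₐ[k⸨X⸩] Qalg k) : embR hL φ y ≠ 0 := fun h =>
  (hy.1 φ).1 (congrArg (fun x : VR L => ((x : L) : Qalg k)) h)

theorem embR_mem_teich (φ : E →ₐ[k⸨X⸩] Qalg k) {l : OE k E} {n : ℕ} (hn : 0 < n)
    (h : l ^ Fintype.card k ^ n = l) : embR hL φ l ∈ teich L :=
  mem_teich_of_pow_eq hn (by rw [← map_pow, h])

/-- Evaluation of power series at `φ(y)`. -/
def evPhi (φ : E →ₐ[k⸨X⸩] Qalg k) : (VR L)⟦X⟧ →+* VR L :=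
  evR (embR hL φ y) (norm_embR_lt_one hy hL φ)

theorem exists_digits (hy : IsUniformizing y) (a : OE k E) : ∃ l r : ℕ → OE k E,
    (∀ i, ∃ n, 0 < n ∧ l i ^ Fintype.card k ^ n = l i) ∧
      ∀ n, a = (∑ i ∈ Finset.range n, l i * y ^ i) + y ^ n * r n := by
  choose l r hl hr using hy.2
  let s : ℕ → OE k E := fun n => r^[n] a
  refine ⟨fun i => l (s i), s, fun i => hl _, fun n => ?_⟩
  induction n with
  | zero => simp [s]
  | succ n ih =>
    rw [Finset.sum_range_succ]
    have h1 : s n = l (s n) + y * s (n + 1) := by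
      have := hr (s n)
      rw [show s (n + 1) = r (s n) from Function.iterate_succ_apply' r n a]
      exact this
    conv_lhs => rw [ih, h1]
    ring

theorem exists_expansion (φ : E →ₐ[k⸨X⸩] Qalg k) (a : OE k E) :
    ∃ g, IsTeichSeries L g ∧ evPhi hy hL φ g = embR hL φ a := by
  obtain ⟨l, r, hl, hr⟩ := exists_digits hy a
  refine ⟨PowerSeries.mk fun n => embR hL φ (l n), fun n => ?_, ?_⟩
  · obtain ⟨m, hm, h⟩ := hl n
    rw [PowerSeries.coeff_mk]
    exact embR_mem_teich hL φ hm h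
  · refine evR_eq_of_forall _ _ _ fun n => ⟨embR hL φ (r n), ?_⟩
    have := congrArg (embR hL φ) (hr n)
    simpa only [map_add, map_sum, map_mul, map_pow, PowerSeries.coeff_mk] using this

/-- The expansion of the elements of `O_E` in powers of `y`, with Teichmüller coefficients,
by means of the embedding `φ`. -/
def iota (φ : E →ₐ[k⸨X⸩] Qalg k) : OE k E →+* (VR L)⟦X⟧ :=
  have hinj : ∀ {g h}, IsTeichSeries L g → IsTeichSeries L h →
      evPhi hy hL φ g = evPhi hy hL φ h → g = h := fun hg hh e =>
    hg.evR_injective _ hh (embR_ne_zero hy hL φ) e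
  have hs := fun a => (exists_expansion hy hL φ a).choose_spec
  { toFun := fun a => (exists_expansion hy hL φ a).choose
    map_one' := hinj (hs 1).1 (fun n => by
        rw [PowerSeries.coeff_one]; split_ifs
        · exact one_mem _
        · exact zero_mem _) (by rw [(hs 1).2, map_one, map_one])
    map_zero' := hinj (hs 0).1 (fun n => by rw [map_zero]; exact zero_mem _)
      (by rw [(hs 0).2, map_zero, map_zero])
    map_add' := fun a b => hinj (hs _).1 ((hs a).1.add (hs b).1)
      (by rw [(hs _).2, map_add, map_add, (hs a).2, (hs b).2])
    map_mul' := fun a b => hinj (hs _).1 ((hs a).1.mul (hs b).1)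
      (by rw [(hs _).2, map_mul, map_mul, (hs a).2, (hs b).2]) }

theorem isTeichSeries_iota (φ : E →ₐ[k⸨X⸩] Qalg k) (a : OE k E) :
    IsTeichSeries L (iota hy hL φ a) := (exists_expansion hy hL φ a).choose_spec.1

@[simp]
theorem evPhi_iota (φ : E →ₐ[k⸨X⸩] Qalg k) (a : OE k E) :
    evPhi hy hL φ (iota hy hL φ a) = embR hL φ a := (exists_expansion hy hL φ a).choose_spec.2

@[simp]
theorem evPhi_X (φ : E →ₐ[k⸨X⸩] Qalg k) : evPhi hy hL φ PowerSeries.X = embR hL φ y := evR_X _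

@[simp]
theorem evPhi_C (φ : E →ₐ[k⸨X⸩] Qalg k) (a : VR L) :
    evPhi hy hL φ (PowerSeries.C a) = a := evR_C _ _

theorem iota_eq_of_evPhi_eq (φ : E →ₐ[k⸨X⸩] Qalg k) {a : OE k E} {g : (VR L)⟦X⟧}
    (hg : IsTeichSeries L g) (h : evPhi hy hL φ g = embR hL φ a) : iota hy hL φ a = g :=
  (isTeichSeries_iota hy hL φ a).evR_injective _ hg (embR_ne_zero hy hL φ)
    ((evPhi_iota hy hL φ a).trans h.symm)

theorem isTeichSeries_X : IsTeichSeries L PowerSeries.X := fun n => by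
  rw [PowerSeries.coeff_X]; split_ifs
  · exact one_mem _
  · exact zero_mem _

theorem isTeichSeries_C {a : VR L} (ha : a ∈ teich L) : IsTeichSeries L (PowerSeries.C a) :=
  fun n => by
    rw [PowerSeries.coeff_C]; split_ifs
    · exact ha
    · exact zero_mem _

@[simp]
theorem iota_y (φ : E →ₐ[k⸨X⸩] Qalg k) : iota hy hL φ y = PowerSeries.X :=
  iota_eq_of_evPhi_eq hy hL φ isTeichSeries_X (evPhi_X hy hL φ)

theorem iota_teich (φ : E →ₐ[k⸨X⸩] Qalg k) {l : OE k E} {n : ℕ} (hn : 0 < n)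
    (h : l ^ Fintype.card k ^ n = l) : iota hy hL φ l = PowerSeries.C (embR hL φ l) :=
  iota_eq_of_evPhi_eq hy hL φ (isTeichSeries_C (embR_mem_teich hL φ hn h)) (evPhi_C hy hL φ _)

include hy in
/-- A ring homomorphism to power series that maps `y` to the variable is determined by the images
of the Teichmüller elements. -/
theorem ringHom_ext_of_teich {D : Type*} [CommRing D] {J J' : OE k E →+* D⟦X⟧}
    (hJ : J y = PowerSeries.X) (hJ' : J' y = PowerSeries.X)
    (h : ∀ (l : OE k E) (n : ℕ), 0 < n → l ^ Fintype.card k ^ n = l → J l = J' l) : J = J' := by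
  refine RingHom.ext fun a => ?_
  obtain ⟨l, r, hl, hr⟩ := exists_digits hy a
  have hn : ∀ n, ∃ R, J a - J' a = PowerSeries.X ^ n * R := fun n => by
    refine ⟨J (r n) - J' (r n), ?_⟩
    have h1 := congrArg J (hr n)
    have h2 := congrArg J' (hr n)
    simp only [map_add, map_sum, map_mul, map_pow, hJ, hJ'] at h1 h2
    have h3 : ∀ i, J (l i) = J' (l i) := fun i => by
      obtain ⟨m, hm, e⟩ := hl i
      exact h _ m hm e
    simp only [h3] at h1
    linear_combination h1 - h2
  rw [← sub_eq_zero]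
  ext m
  obtain ⟨R, hR⟩ := hn (m + 1)
  rw [hR, PowerSeries.coeff_X_pow_mul', if_neg (by omega), map_zero]

/-- Embeddings with the same expansions are determined by the image of `y`. -/
theorem eq_of_iota_eq {φ φ' : E →ₐ[k⸨X⸩] Qalg k} (h : iota hy hL φ = iota hy hL φ')
    [Module.Finite k⸨X⸩ E] (h1 : φ y = φ' y) : φ = φ' := by
  have h2 : embR hL φ y = embR hL φ' y := Subtype.ext (Subtype.ext h1)
  have h3 : ∀ a : OE k E, φ a = φ' a := fun a => by
    have e1 := evPhi_iota hy hL φ a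
    have e2 := evPhi_iota hy hL φ' a
    have e3 : embR hL φ a = embR hL φ' a := by
      rw [← e1, ← e2, h]
      simp only [evPhi, h2]
    exact congrArg (fun x : VR L => ((x : L) : Qalg k)) e3
  ext e
  obtain ⟨b, hbe⟩ := exists_smul_mem_OE (k := k) e
  have h4 := h3 ⟨b.1 • e, hbe⟩
  change φ (b.1 • e) = φ' (b.1 • e) at h4
  rw [← algebraMap_smul k⸨X⸩, map_smul, map_smul] at h4
  refine smul_right_injective _ ?_ h4
  exact fun h => nonZeroDivisors.ne_zero b.2
    (FaithfulSMul.algebraMap_injective k⟦X⟧ k⸨X⸩ (h.trans (map_zero _).symm))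

end Expansion

/-! ### Branches: the expansions of `O_E` and their permutation by Frobenius -/

section FrobS

variable {k : Type*} [Field k] [Fintype k] (D : Type*) [CommRing D] [Algebra k D]

/-- The endomorphism `∑ bᵢ Yⁱ ↦ ∑ bᵢ^q Yⁱ` of `D[[Y]]`. -/
def frobS : D⟦X⟧ →+* D⟦X⟧ := PowerSeries.map (FiniteField.frobeniusAlgHom k D).toRingHom

variable {D}

@[simp]
theorem coeff_frobS (g : D⟦X⟧) (n : ℕ) :
    PowerSeries.coeff n (frobS (k := k) D g) = PowerSeries.coeff n g ^ Fintype.card k := by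
  rw [frobS, PowerSeries.coeff_map]; rfl

@[simp]
theorem frobS_C (a : D) : frobS (k := k) D (PowerSeries.C a) = PowerSeries.C (a ^ Fintype.card k) := by
  rw [frobS, PowerSeries.map_C]; rfl

@[simp]
theorem frobS_X : frobS (k := k) D PowerSeries.X = PowerSeries.X := PowerSeries.map_X _

theorem frobS_map {D' : Type*} [CommRing D'] [Algebra k D'] (h : D →+* D') (g : D⟦X⟧) :
    frobS (k := k) D' (PowerSeries.map h g) = PowerSeries.map h (frobS (k := k) D g) := by
  ext n
  simp

end FrobS

section Branch

variable {k : Type*} [Field k] [Fintype k] {L : IntermediateField k⸨X⸩ (Qalg k)}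
  [FiniteDimensional k⸨X⸩ L]
variable {E : Type*} [CommRing E] [Algebra k⸨X⸩ E] [Algebra k⟦X⟧ E] [IsScalarTower k⟦X⟧ k⸨X⸩ E]
variable {y : OE k E} (hy : IsUniformizing y) (hL : ∀ (φ : E →ₐ[k⸨X⸩] Qalg k) (e : E), φ e ∈ L)

/-- Composition with a lift of Frobenius raises the coefficients of the expansion to the
`q`-th power. -/
theorem exists_iota_eq_frobS_comp (φ : E →ₐ[k⸨X⸩] Qalg k) :
    ∃ φ', iota hy hL φ' = (frobS (k := k) (VR L)).comp (iota hy hL φ) := by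
  obtain ⟨g, hg⟩ := exists_frobenius L
  refine ⟨(g : Qalg k →ₐ[k⸨X⸩] Qalg k).comp φ, ?_⟩
  refine ringHom_ext_of_teich hy (iota_y hy hL _) (by simp) fun l n hn e => ?_
  rw [RingHom.comp_apply, iota_teich hy hL _ hn e, iota_teich hy hL _ hn e, frobS_C]
  congr 1
  exact Subtype.ext (Subtype.ext (hg _ (embR_mem_teich hL φ hn e)))

/-- The set of branches: the finite set of the expansions `O_E → R[[Y]]`. The spectrum of
`R[[z]] ⊗ O_E` is the disjoint union of copies of the spectrum of `R[[Y]]` indexed by it. -/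
def Branch : Type _ := Set.range (iota hy hL)

/-- The branch of an embedding. -/
def branchOf (φ : E →ₐ[k⸨X⸩] Qalg k) : Branch hy hL := ⟨iota hy hL φ, φ, rfl⟩

variable {hy hL}

/-- The expansion of `O_E` on a branch. -/
def Branch.hom (χ : Branch hy hL) : OE k E →+* (VR L)⟦X⟧ := χ.1

@[ext]
theorem Branch.ext {χ χ' : Branch hy hL} (h : χ.hom = χ'.hom) : χ = χ' := Subtype.ext h

@[simp]
theorem branchOf_hom (φ : E →ₐ[k⸨X⸩] Qalg k) : (branchOf hy hL φ).hom = iota hy hL φ := rfl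

theorem Branch.exists_eq (χ : Branch hy hL) : ∃ φ, branchOf hy hL φ = χ := by
  obtain ⟨_, φ, rfl⟩ := χ
  exact ⟨φ, rfl⟩

@[simp]
theorem Branch.hom_y (χ : Branch hy hL) : χ.hom y = PowerSeries.X := by
  obtain ⟨φ, rfl⟩ := χ.exists_eq
  exact iota_y hy hL φ

theorem Branch.hom_teich (χ : Branch hy hL) {l : OE k E} {n : ℕ} (hn : 0 < n)
    (h : l ^ Fintype.card k ^ n = l) : ∃ a ∈ teich L, χ.hom l = PowerSeries.C a := by
  obtain ⟨φ, rfl⟩ := χ.exists_eq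
  exact ⟨_, embR_mem_teich hL φ hn h, iota_teich hy hL φ hn h⟩

theorem Branch.isTeichSeries (χ : Branch hy hL) (a : OE k E) : IsTeichSeries L (χ.hom a) := by
  obtain ⟨φ, rfl⟩ := χ.exists_eq
  exact isTeichSeries_iota hy hL φ a

/-- Distinct branches are separated by Teichmüller elements. -/
theorem Branch.exists_separating {χ χ' : Branch hy hL} (h : χ ≠ χ') :
    ∃ (l : OE k E) (a a' : VR L), χ.hom l = PowerSeries.C a ∧ χ'.hom l = PowerSeries.C a' ∧
      IsUnit (a - a') := by
  by_contra hne
  apply h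
  refine Branch.ext (ringHom_ext_of_teich hy χ.hom_y χ'.hom_y fun l n hn e => ?_)
  obtain ⟨a, ha, ha2⟩ := χ.hom_teich hn e
  obtain ⟨a', ha', ha2'⟩ := χ'.hom_teich hn e
  by_contra hne2
  refine hne ⟨l, a, a', ha2, ha2', isUnit_of_mem_teich (sub_mem ha ha') fun h0 => hne2 ?_⟩
  rw [ha2, ha2', sub_eq_zero.1 h0]

instance [Module.Finite k⸨X⸩ E] : Finite (Branch hy hL) :=
  inferInstanceAs (Finite (Set.range (iota hy hL)))

instance [Module.Finite k⸨X⸩ E] : Fintype (Branch hy hL) := Fintype.ofFinite _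

instance : DecidableEq (Branch hy hL) := Classical.decEq _

theorem frobS_injective : Function.Injective (frobS (k := k) (VR L)) := fun g h e => by
  refine PowerSeries.ext fun n => ?_
  have := congrArg (PowerSeries.coeff n) e
  rw [coeff_frobS, coeff_frobS, ← sub_eq_zero] at this
  have h2 := sub_pow_card_pow (k := k) (PowerSeries.coeff n g) (PowerSeries.coeff n h) 1
  rw [pow_one, this] at h2
  exact sub_eq_zero.1 (eq_zero_of_pow_eq_zero h2)

/-- The permutation of the branches by Frobenius. -/
def frobPerm [Module.Finite k⸨X⸩ E] : Equiv.Perm (Branch hy hL) :=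
  Equiv.ofBijective (fun χ => (⟨(frobS (k := k) (VR L)).comp χ.hom, by
      obtain ⟨φ, rfl⟩ := χ.exists_eq
      exact exists_iota_eq_frobS_comp hy hL φ⟩ : Branch hy hL))
    (Finite.injective_iff_bijective.1 fun χ χ' h => by
      refine Branch.ext (RingHom.ext fun a => frobS_injective (k := k) ?_)
      exact RingHom.congr_fun (congrArg Branch.hom h) a)

theorem frobPerm_hom [Module.Finite k⸨X⸩ E] (χ : Branch hy hL) (a : OE k E) :
    (frobPerm χ).hom a = frobS (k := k) (VR L) (χ.hom a) := rfl

/-- The expansion of `z` on a branch. -/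
def Branch.z (χ : Branch hy hL) : (VR L)⟦X⟧ := χ.hom (algebraMap k⟦X⟧ (OE k E) PowerSeries.X)

theorem embR_algebraMap (φ : E →ₐ[k⸨X⸩] Qalg k) (f : k⟦X⟧) :
    embR hL φ (algebraMap k⟦X⟧ (OE k E) f) = algebraMap k⟦X⟧ (VR L) f := by
  refine Subtype.ext (Subtype.ext ?_)
  rw [coe_embR]
  change φ (algebraMap k⟦X⟧ E f) = algebraMap k⸨X⸩ (Qalg k) (algebraMap k⟦X⟧ k⸨X⸩ f)
  rw [IsScalarTower.algebraMap_apply k⟦X⟧ k⸨X⸩ E, AlgHom.commutes]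

theorem evPhi_z (φ : E →ₐ[k⸨X⸩] Qalg k) : evPhi hy hL φ (branchOf hy hL φ).z = zeta L := by
  rw [Branch.z, branchOf_hom, evPhi_iota, embR_algebraMap]; rfl

theorem norm_embR_y_lt_one (φ : E →ₐ[k⸨X⸩] Qalg k) (hy : IsUniformizing y) :
    ‖((embR hL φ y : VR L) : L)‖ < 1 := (hy.1 φ).2

theorem Branch.exists_z_eq (χ : Branch hy hL) :
    ∃ (e : ℕ) (u : (VR L)⟦X⟧), IsUnit u ∧ χ.z = PowerSeries.X ^ e * u := by
  refine (χ.isTeichSeries _).eq_X_pow_mul fun h => ?_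
  obtain ⟨φ, rfl⟩ := χ.exists_eq
  have h1 := evPhi_z (hy := hy) (hL := hL) φ
  rw [Branch.z, h, map_zero] at h1
  exact zeta_ne_zero L (by rw [← h1]; rfl)

/-- The ramification index of a branch: the order of the expansion of `z`. -/
def Branch.e (χ : Branch hy hL) : ℕ := χ.exists_z_eq.choose

/-- The unit factor in the expansion of `z`. -/
def Branch.unit (χ : Branch hy hL) : (VR L)⟦X⟧ := χ.exists_z_eq.choose_spec.choose

theorem Branch.isUnit_unit (χ : Branch hy hL) : IsUnit χ.unit :=
  χ.exists_z_eq.choose_spec.choose_spec.1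

theorem Branch.z_eq (χ : Branch hy hL) : χ.z = PowerSeries.X ^ χ.e * χ.unit :=
  χ.exists_z_eq.choose_spec.choose_spec.2

theorem norm_zeta_eq (φ : E →ₐ[k⸨X⸩] Qalg k) :
    ‖(zeta L : L)‖ = ‖((embR hL φ y : VR L) : L)‖ ^ (branchOf hy hL φ).e := by
  rw [← evPhi_z (hy := hy) (hL := hL) φ, Branch.z_eq, map_mul, map_pow, evPhi_X,
    Subalgebra.coe_mul, norm_mul, Subalgebra.coe_pow, norm_pow,
    (isUnit_VR_iff _).1 ((branchOf hy hL φ).isUnit_unit.map (evPhi hy hL φ)), mul_one]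

theorem Branch.e_pos (χ : Branch hy hL) : 0 < χ.e := by
  obtain ⟨φ, rfl⟩ := χ.exists_eq
  by_contra h
  have h1 := norm_zeta_eq (hy := hy) (hL := hL) φ
  rw [Nat.eq_zero_of_not_pos h, pow_zero] at h1
  exact (norm_zeta_lt_one L).ne h1

theorem Branch.constantCoeff_z (χ : Branch hy hL) : PowerSeries.constantCoeff χ.z = 0 := by
  rw [χ.z_eq, map_mul, map_pow, PowerSeries.constantCoeff_X, zero_pow χ.e_pos.ne', zero_mul]

/-- The embeddings that belong to a branch. -/
def Branch.embeddings [Module.Finite k⸨X⸩ E] (χ : Branch hy hL) : Finset (E →ₐ[k⸨X⸩] Qalg k) :=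
  (Set.toFinite {φ | branchOf hy hL φ = χ}).toFinset

@[simp]
theorem Branch.mem_embeddings [Module.Finite k⸨X⸩ E] {χ : Branch hy hL}
    {φ : E →ₐ[k⸨X⸩] Qalg k} : φ ∈ χ.embeddings ↔ branchOf hy hL φ = χ := by
  simp [Branch.embeddings]

theorem embR_y_injOn {φ φ' : E →ₐ[k⸨X⸩] Qalg k} [Module.Finite k⸨X⸩ E]
    (h : branchOf hy hL φ = branchOf hy hL φ') (h1 : embR hL φ y = embR hL φ' y) : φ = φ' :=
  eq_of_iota_eq hy hL (congrArg Branch.hom h)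
    (congrArg (fun x : VR L => ((x : L) : Qalg k)) h1)

theorem prime_X_sub_C_embR (φ : E →ₐ[k⸨X⸩] Qalg k) (hy : IsUniformizing y) :
    Prime (PowerSeries.X - PowerSeries.C (embR hL φ y)) :=
  prime_X_sub_C (evPhi hy hL φ) (evPhi_C hy hL φ) (evPhi_X hy hL φ)

/-- If the values of a series `g` at distinct elements of the maximal ideal vanish, then the
product of the corresponding linear factors divides `g`. -/
theorem prod_X_sub_C_dvd {ι : Type*} (s : Finset ι) (c : ι → VR L) (hc : ∀ i, ‖(c i : L)‖ < 1)
    (hinj : Set.InjOn c s) {g : (VR L)⟦X⟧} (hg : ∀ i ∈ s, evR (c i) (hc i) g = 0) :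
    ∏ i ∈ s, (PowerSeries.X - PowerSeries.C (c i)) ∣ g := by
  classical
  induction s using Finset.induction_on generalizing g with
  | empty => simp
  | insert i s his ih =>
    have h0 : PowerSeries.X - PowerSeries.C (c i) ∣ g :=
      X_sub_C_dvd_of_eval_eq_zero (evR (c i) (hc i)) (evR_C _) (evR_X _)
        (hg i (Finset.mem_insert_self i s))
    obtain ⟨h, rfl⟩ := h0
    rw [Finset.prod_insert his]
    refine mul_dvd_mul_left _ (ih (hinj.mono (by simp)) fun j hj => ?_)
    have h1 := hg j (Finset.mem_insert_of_mem hj)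
    rw [map_mul, map_sub, evR_X, evR_C] at h1
    refine (mul_eq_zero.1 h1).resolve_left fun h2 => his ?_
    rw [← hinj (Finset.mem_insert_of_mem hj) (Finset.mem_insert_self i s) (sub_eq_zero.1 h2)]
    exact hj

/-- A product of `n` linear factors `Y - c`, `|c| < 1`, that divides a series `Y^e u - c₀` with
a unit `u` has at most `e` factors, and for `n = e` the quotient is a unit. -/
theorem card_le_of_prod_X_sub_C_dvd {ι : Type*} (s : Finset ι) (c : ι → VR L)
    (hc : ∀ i, ‖(c i : L)‖ < 1) {u : (VR L)⟦X⟧} (hu : IsUnit u) {e : ℕ} {c₀ : VR L}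
    (hc₀ : ‖(c₀ : L)‖ < 1) {h : (VR L)⟦X⟧}
    (hd : PowerSeries.X ^ e * u - PowerSeries.C c₀ =
      (∏ i ∈ s, (PowerSeries.X - PowerSeries.C (c i))) * h) :
    s.card ≤ e ∧ (s.card = e → IsUnit h) := by
  have h0 : ∀ x : VR L, ‖(x : L)‖ < 1 → IsLocalRing.residue (VR L) x = 0 := fun x hx => by
    rwa [IsLocalRing.residue_eq_zero_iff, mem_maximalIdeal_VR_iff]
  have h1 := congrArg (PowerSeries.map (IsLocalRing.residue (VR L))) hd
  simp only [map_sub, map_mul, map_pow, map_prod, PowerSeries.map_X, PowerSeries.map_C, h0 _ hc₀,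
    h0 _ (hc _), map_zero, sub_zero, Finset.prod_const] at h1
  have hu' := hu.map (PowerSeries.map (IsLocalRing.residue (VR L)))
  set u' := PowerSeries.map (IsLocalRing.residue (VR L)) u
  set h' := PowerSeries.map (IsLocalRing.residue (VR L)) h with hh'
  have hlt : s.card ≤ e := by
    by_contra hlt
    obtain ⟨m, hm⟩ : ∃ m, s.card = e + (m + 1) := ⟨s.card - e - 1, by omega⟩
    rw [hm, pow_add, mul_assoc] at h1
    have h2 := mul_left_cancel₀ (pow_ne_zero e PowerSeries.X_ne_zero) h1
    rw [h2, PowerSeries.isUnit_iff_constantCoeff] at hu'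
    simp at hu'
  refine ⟨hlt, fun he => ?_⟩
  rw [he] at h1
  have h2 := mul_left_cancel₀ (pow_ne_zero e PowerSeries.X_ne_zero) h1
  rw [h2, PowerSeries.isUnit_iff_constantCoeff] at hu'
  rw [PowerSeries.isUnit_iff_constantCoeff]
  rw [hh', ← PowerSeries.coeff_zero_eq_constantCoeff_apply, PowerSeries.coeff_map,
    PowerSeries.coeff_zero_eq_constantCoeff_apply] at hu'
  exact (isUnit_map_iff (IsLocalRing.residue (VR L)) _).1 hu'

theorem Branch.prod_dvd [Module.Finite k⸨X⸩ E] (χ : Branch hy hL) :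
    ∏ φ ∈ χ.embeddings, (PowerSeries.X - PowerSeries.C (embR hL φ y)) ∣
      χ.z - PowerSeries.C (zeta L) := by
  refine prod_X_sub_C_dvd _ _ (fun φ => norm_embR_y_lt_one φ hy) ?_ fun φ hφ => ?_
  · intro φ hφ φ' hφ' h
    rw [Finset.mem_coe, mem_embeddings] at hφ hφ'
    exact embR_y_injOn (hφ.trans hφ'.symm) h
  · rw [mem_embeddings] at hφ
    have h := evPhi_z (hy := hy) (hL := hL) φ
    rw [hφ] at h
    change evPhi hy hL φ _ = 0
    rw [map_sub, h, evPhi_C, sub_self]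

theorem Branch.card_embeddings_le [Module.Finite k⸨X⸩ E] (χ : Branch hy hL) :
    χ.embeddings.card ≤ χ.e := by
  obtain ⟨h, hh⟩ := χ.prod_dvd
  rw [χ.z_eq] at hh
  exact (card_le_of_prod_X_sub_C_dvd _ _ (fun φ => norm_embR_y_lt_one φ hy) χ.isUnit_unit
    (norm_zeta_lt_one L) hh).1

theorem Branch.sum_card_embeddings [Module.Finite k⸨X⸩ E] :
    ∑ χ : Branch hy hL, χ.embeddings.card = Nat.card (E →ₐ[k⸨X⸩] Qalg k) := by
  have := Fintype.ofFinite (E →ₐ[k⸨X⸩] Qalg k)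
  rw [Nat.card_eq_fintype_card, ← Finset.card_univ,
    Finset.card_eq_sum_card_fiberwise (f := branchOf hy hL) (t := Finset.univ)
      (fun _ _ => Finset.mem_univ _)]
  refine Finset.sum_congr rfl fun χ _ => ?_
  congr 1
  ext φ
  simp

end Branch

/-! ### The decomposition of `D[[z]] ⊗ O_E` into power series rings -/

section SubstBasis

variable {D : Type*} [CommRing D] (sub : D⟦X⟧ →+* D⟦X⟧) {e : ℕ} {u : D⟦X⟧}

/-- The combination `∑ gₛ(Z) Yˢ`, where `sub` is the substitution of `Z`. -/
def substSum (e : ℕ) (g : Fin e → D⟦X⟧) : D⟦X⟧ := ∑ s, sub (g s) * PowerSeries.X ^ (s : ℕ)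

variable {sub}

theorem eq_zero_of_forall_X_pow_dvd {f : D⟦X⟧} (h : ∀ n : ℕ, PowerSeries.X ^ n ∣ f) : f = 0 := by
  ext n
  exact PowerSeries.X_pow_dvd_iff.1 (h (n + 1)) n (Nat.lt_succ_self n)

theorem coeff_sum_C_mul_X_pow (c : Fin e → D) (s : Fin e) :
    PowerSeries.coeff (s : ℕ) (∑ s, PowerSeries.C (c s) * PowerSeries.X ^ (s : ℕ) : D⟦X⟧) = c s := by
  rw [map_sum, Finset.sum_eq_single s]
  · simp
  · intro s' _ h
    rw [PowerSeries.coeff_C_mul, PowerSeries.coeff_X_pow, if_neg, mul_zero]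
    exact fun h' => h (Fin.ext h'.symm)
  · simp

theorem series_eq_C_add_X_mul (g : D⟦X⟧) :
    g = PowerSeries.C (PowerSeries.coeff 0 g) +
      PowerSeries.X * PowerSeries.mk fun m => PowerSeries.coeff (m + 1) g := by
  conv_lhs => rw [sum_coeff_add_X_pow_mul g 1]
  simp

theorem substSum_eq (hC : ∀ a, sub (PowerSeries.C a) = PowerSeries.C a)
    (hX : sub PowerSeries.X = PowerSeries.X ^ e * u) (g : Fin e → D⟦X⟧) :
    substSum sub e g =
      ∑ s, PowerSeries.C (PowerSeries.coeff 0 (g s)) * PowerSeries.X ^ (s : ℕ) +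
        PowerSeries.X ^ e * (u * substSum sub e fun s =>
          PowerSeries.mk fun m => PowerSeries.coeff (m + 1) (g s)) := by
  rw [substSum, substSum, Finset.mul_sum, Finset.mul_sum, ← Finset.sum_add_distrib]
  refine Finset.sum_congr rfl fun s _ => ?_
  conv_lhs => rw [series_eq_C_add_X_mul (g s), map_add, map_mul, hC, hX]
  ring

/-- If `Z = Y^e u` with a unit `u`, then the powers `Yˢ`, `s < e`, form a basis of `D[[Y]]`
over `D[[Z]]`. -/
theorem substSum_bijective (hC : ∀ a, sub (PowerSeries.C a) = PowerSeries.C a)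
    (hX : sub PowerSeries.X = PowerSeries.X ^ e * u) (hu : IsUnit u) (he : 0 < e) :
    Function.Bijective (substSum sub e) := by
  obtain ⟨v, hv⟩ := hu.exists_right_inv
  have hlow : ∀ (c : Fin e → D) (h : D⟦X⟧) (s : Fin e), PowerSeries.coeff (s : ℕ)
      (∑ s, PowerSeries.C (c s) * PowerSeries.X ^ (s : ℕ) + PowerSeries.X ^ e * h) = c s :=
    fun c h s => by
      rw [map_add, coeff_sum_C_mul_X_pow, PowerSeries.coeff_X_pow_mul', if_neg (by omega), add_zero]
  have hX0 : ∀ h : D⟦X⟧, PowerSeries.X ^ e * h = 0 → h = 0 := fun h h0 => by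
    ext n
    have := congrArg (PowerSeries.coeff (n + e)) h0
    simpa [PowerSeries.coeff_X_pow_mul] using this
  constructor
  · have key : ∀ (n : ℕ) (g : Fin e → D⟦X⟧), substSum sub e g = 0 →
        ∀ s, PowerSeries.coeff n (g s) = 0 := by
      intro n
      have h0 : ∀ g : Fin e → D⟦X⟧, substSum sub e g = 0 →
          ∀ s, PowerSeries.coeff 0 (g s) = 0 := fun g hg s => by
        have h1 := hlow (fun s => PowerSeries.coeff 0 (g s)) (u * substSum sub e fun s =>
          PowerSeries.mk fun m => PowerSeries.coeff (m + 1) (g s)) s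
        rw [← substSum_eq hC hX g, hg, map_zero] at h1
        exact h1.symm
      induction n with
      | zero => exact h0
      | succ n ih =>
        intro g hg s
        have h1 := substSum_eq hC hX g
        rw [hg, Finset.sum_eq_zero (fun s _ => by rw [h0 g hg s, map_zero, zero_mul]),
          zero_add] at h1
        have h2 := ih _ ((hu.mul_right_eq_zero).1 (hX0 _ h1.symm)) s
        simpa using h2
    intro g g' h
    have hsub : substSum sub e (g - g') = 0 := by
      have : substSum sub e (g - g') = substSum sub e g - substSum sub e g' := by
        simp [substSum, sub_mul]
      rw [this, sub_eq_zero]; exact h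
    funext s
    ext n
    have := key n _ hsub s
    rwa [Pi.sub_apply, map_sub, sub_eq_zero] at this
  · intro f
    let step : D⟦X⟧ → D⟦X⟧ := fun h => v *
      PowerSeries.mk fun m => PowerSeries.coeff (m + e) h
    have hstep : ∀ h : D⟦X⟧, h = ∑ s : Fin e, PowerSeries.C (PowerSeries.coeff (s : ℕ) h) *
        PowerSeries.X ^ (s : ℕ) + PowerSeries.X ^ e * (u * step h) := fun h => by
      conv_lhs => rw [sum_coeff_add_X_pow_mul h e]
      rw [Finset.sum_range fun i => PowerSeries.C (PowerSeries.coeff i h) * PowerSeries.X ^ i]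
      simp only [step, ← mul_assoc u v, hv, one_mul]
    let fs : ℕ → D⟦X⟧ := fun n => step^[n] f
    have hfs : ∀ n, fs (n + 1) = step (fs n) := fun n => Function.iterate_succ_apply' step n f
    let G : ℕ → Fin e → D⟦X⟧ := fun n s => PowerSeries.mk fun m => PowerSeries.coeff (s : ℕ) (fs (m + n))
    have hG : ∀ n, substSum sub e (G n) - fs n =
        PowerSeries.X ^ e * (u * (substSum sub e (G (n + 1)) - fs (n + 1))) := fun n => by
      conv_lhs => rw [substSum_eq hC hX, hstep (fs n)]
      have e1 : (fun s => PowerSeries.mk fun m => PowerSeries.coeff (m + 1) (G n s)) = G (n + 1) := by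
        funext s
        ext m
        simp only [G, PowerSeries.coeff_mk]
        rw [add_right_comm, add_assoc]
      rw [e1, hfs]
      simp only [G, PowerSeries.coeff_mk, zero_add]
      ring
    have hdvd : ∀ m n, (PowerSeries.X : D⟦X⟧) ^ m ∣ substSum sub e (G n) - fs n := by
      intro m
      induction m with
      | zero => simp
      | succ m ih =>
        intro n
        rw [hG n, pow_succ']
        exact mul_dvd_mul (dvd_pow_self _ he.ne') (Dvd.dvd.mul_left (ih _) _)
    exact ⟨G 0, sub_eq_zero.1 (eq_zero_of_forall_X_pow_dvd fun m => hdvd m 0)⟩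

theorem substSum_smul (b : D⟦X⟧) (g : Fin e → D⟦X⟧) :
    substSum sub e (fun s => b * g s) = sub b * substSum sub e g := by
  simp only [substSum, map_mul, Finset.mul_sum, mul_assoc]

theorem substSum_add (g h : Fin e → D⟦X⟧) :
    substSum sub e (fun s => g s + h s) = substSum sub e g + substSum sub e h := by
  simp only [substSum, map_add, add_mul, Finset.sum_add_distrib]

end SubstBasis

section Integers

variable {k : Type*} [Field k] [Fintype k] {L : IntermediateField k⸨X⸩ (Qalg k)}
  [FiniteDimensional k⸨X⸩ L] [Algebra.IsSeparable k⸨X⸩ L]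
variable {E : Type*} [CommRing E] [Algebra k⸨X⸩ E] [Algebra k⟦X⟧ E] [IsScalarTower k⟦X⟧ k⸨X⸩ E]
  [Module.Finite k⸨X⸩ E] [IsSemisimpleRing E]
variable (hL : ∀ (φ : E →ₐ[k⸨X⸩] Qalg k) (e : E), φ e ∈ L)

instance isTorsionFree_OE : Module.IsTorsionFree k⟦X⟧ (OE k E) := by
  refine ⟨fun a ha x y h => Subtype.ext ?_⟩
  have h1 : a • (x : E) = a • (y : E) := congrArg Subtype.val h
  rw [← algebraMap_smul k⸨X⸩ a, ← algebraMap_smul k⸨X⸩ a (y : E)] at h1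
  refine smul_right_injective E (fun h0 => ?_) h1
  exact ha.ne_zero (FaithfulSMul.algebraMap_injective k⟦X⟧ k⸨X⸩ (h0.trans (map_zero _).symm))

include hL in
theorem finite_OE : Module.Finite k⟦X⟧ (OE k E) := by
  have : IsNoetherian k⟦X⟧ (VR L) := IsIntegralClosure.isNoetherian k⟦X⟧ k⸨X⸩ L (VR L)
  let f : OE k E →ₗ[k⟦X⟧] ((E →ₐ[k⸨X⸩] Qalg k) → VR L) :=
    { toFun := fun a φ => embR hL φ a
      map_add' := fun a b => by funext φ; exact map_add _ _ _
      map_smul' := fun a b => by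
        funext φ
        simp only [Algebra.smul_def, map_mul, embR_algebraMap, RingHom.id_apply, Pi.mul_apply]
        rfl }
  refine Module.Finite.of_injective f fun a b h => ?_
  by_contra hne
  obtain ⟨φ, hφ⟩ := exists_algHom_ne (k := k) E (a := (a : E) - b)
    (sub_ne_zero.2 fun h => hne (Subtype.ext h))
  rw [map_sub, sub_ne_zero] at hφ
  exact hφ (congrArg (fun x : VR L => ((x : L) : Qalg k)) (congrFun h φ))

include hL in
theorem free_OE : Module.Free k⟦X⟧ (OE k E) :=
  have := finite_OE hL
  inferInstance

include hL in
/-- A basis of `O_E` over `A_v`, which is also a basis of `E` over `Q_v`. -/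
theorem exists_basis_OE : ∃ (b : Module.Basis (Fin (Module.finrank k⸨X⸩ E)) k⟦X⟧ (OE k E))
    (b' : Module.Basis (Fin (Module.finrank k⸨X⸩ E)) k⸨X⸩ E), ∀ i, b' i = (b i : E) := by
  have := finite_OE hL
  have := free_OE hL
  let b := Module.finBasis k⟦X⟧ (OE k E)
  have hli : LinearIndependent k⸨X⸩ (fun i => (b i : E)) := by
    rw [← LinearIndependent.iff_fractionRing k⟦X⟧ k⸨X⸩]
    exact b.linearIndependent.map' (OE k E).val.toLinearMap
      (LinearMap.ker_eq_bot.2 Subtype.val_injective)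
  have hsp : ⊤ ≤ Submodule.span k⸨X⸩ (Set.range fun i => (b i : E)) := by
    intro e _
    obtain ⟨a, ha⟩ := exists_smul_mem_OE (k := k) e
    obtain ⟨c, h1⟩ : ∃ c : Fin (Module.finrank k⟦X⟧ (OE k E)) → k⟦X⟧,
        ∑ i, c i • (b i : E) = a.1 • e := by
      have h1 := congrArg Subtype.val (b.sum_repr ⟨a.1 • e, ha⟩)
      simp only [AddSubmonoidClass.coe_finsetSum, SetLike.val_smul] at h1
      exact ⟨_, h1⟩
    have ha0 : algebraMap k⟦X⟧ k⸨X⸩ a ≠ 0 := fun h => nonZeroDivisors.ne_zero a.2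
      (FaithfulSMul.algebraMap_injective k⟦X⟧ k⸨X⸩ (h.trans (map_zero _).symm))
    rw [← algebraMap_smul k⸨X⸩ a.1 e] at h1
    have h2 : e = (algebraMap k⟦X⟧ k⸨X⸩ a)⁻¹ • (algebraMap k⟦X⟧ k⸨X⸩ a) • e := by
      rw [smul_smul, inv_mul_cancel₀ ha0, one_smul]
    rw [h2, ← h1]
    refine Submodule.smul_mem _ _ (Submodule.sum_mem _ fun i _ => ?_)
    rw [← algebraMap_smul k⸨X⸩ (_ : k⟦X⟧) (b i : E)]
    exact Submodule.smul_mem _ _ (Submodule.subset_span ⟨i, rfl⟩)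
  let b' := Module.Basis.mk hli hsp
  have hr : Module.finrank k⟦X⟧ (OE k E) = Module.finrank k⸨X⸩ E := by
    rw [Module.finrank_eq_card_basis b']; simp
  exact ⟨b.reindex (finCongr hr), b'.reindex (finCongr hr), fun i => by simp [b']⟩

end Integers

section Omega

variable {k : Type*} [Field k] [Fintype k] {L : IntermediateField k⸨X⸩ (Qalg k)}
  [FiniteDimensional k⸨X⸩ L]
variable {E : Type*} [CommRing E] [Algebra k⸨X⸩ E] [Algebra k⟦X⟧ E] [IsScalarTower k⟦X⟧ k⸨X⸩ E]
  [Module.Finite k⸨X⸩ E]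
variable {y : OE k E} {hy : IsUniformizing y} {hL : ∀ (φ : E →ₐ[k⸨X⸩] Qalg k) (e : E), φ e ∈ L}

theorem series_ringHom_ext {A D : Type*} [CommRing A] [CommRing D] {f g : A⟦X⟧ →+* D⟦X⟧}
    (hC : ∀ a, f (PowerSeries.C a) = g (PowerSeries.C a)) (hX : f PowerSeries.X = g PowerSeries.X)
    (h : PowerSeries.X ∣ f PowerSeries.X) : f = g := by
  refine RingHom.ext fun s => sub_eq_zero.1 (eq_zero_of_forall_X_pow_dvd fun n => ?_)
  rw [sum_coeff_add_X_pow_mul s n]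
  simp only [map_add, map_sum, map_mul, map_pow, hC, ← hX, add_sub_add_left_eq_sub, ← mul_sub]
  exact Dvd.dvd.mul_right (pow_dvd_pow_of_dvd h n) _

variable (χ : Branch hy hL)

theorem Branch.hom_algebraMap_C (c : k) :
    χ.hom (algebraMap k⟦X⟧ (OE k E) (PowerSeries.C c)) = PowerSeries.C (algebraMap k (VR L) c) := by
  obtain ⟨φ, rfl⟩ := χ.exists_eq
  refine iota_eq_of_evPhi_eq hy hL φ (isTeichSeries_C ?_) ?_
  · refine mem_teich_of_pow_eq one_pos ?_
    rw [pow_one, ← map_pow, pow_card_eq]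
  · rw [evPhi_C, embR_algebraMap]; rfl

section

variable (D : Type*) [CommRing D] [Algebra (VR L) D]

theorem Branch.hasSubst_z : PowerSeries.HasSubst (PowerSeries.map (algebraMap (VR L) D) χ.z) :=
  PowerSeries.HasSubst.of_constantCoeff_zero' (by
    rw [← PowerSeries.coeff_zero_eq_constantCoeff_apply, PowerSeries.coeff_map,
      PowerSeries.coeff_zero_eq_constantCoeff_apply, χ.constantCoeff_z, map_zero])

/-- Substitution of the expansion of `z` on a branch, as an endomorphism of `D[[Y]]`. -/
def Branch.sub : D⟦X⟧ →+* D⟦X⟧ := (PowerSeries.substAlgHom (R := D) (χ.hasSubst_z D)).toRingHom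

theorem Branch.sub_C (d : D) : χ.sub D (PowerSeries.C d) = PowerSeries.C d :=
  (PowerSeries.substAlgHom (R := D) (χ.hasSubst_z D)).commutes d

theorem Branch.sub_X : χ.sub D PowerSeries.X = PowerSeries.map (algebraMap (VR L) D) χ.z :=
  PowerSeries.substAlgHom_X _

theorem Branch.sub_X_eq : χ.sub D PowerSeries.X =
    PowerSeries.X ^ χ.e * PowerSeries.map (algebraMap (VR L) D) χ.unit := by
  rw [χ.sub_X, χ.z_eq, map_mul, map_pow, PowerSeries.map_X]

theorem Branch.sub_map_algebraMap [Algebra k D] [IsScalarTower k (VR L) D] (f : k⟦X⟧) :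
    χ.sub D (PowerSeries.map (algebraMap k D) f) =
      PowerSeries.map (algebraMap (VR L) D) (χ.hom (algebraMap k⟦X⟧ (OE k E) f)) := by
  have h : (χ.sub D).comp (PowerSeries.map (algebraMap k D)) =
      ((PowerSeries.map (algebraMap (VR L) D)).comp χ.hom).comp (algebraMap k⟦X⟧ (OE k E)) := by
    refine series_ringHom_ext (fun c => ?_) ?_ ?_
    · simp only [RingHom.comp_apply, PowerSeries.map_C, χ.sub_C, χ.hom_algebraMap_C,
        IsScalarTower.algebraMap_apply k (VR L) D]
    · simp only [RingHom.comp_apply, PowerSeries.map_X, χ.sub_X]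
      rfl
    · rw [RingHom.comp_apply, PowerSeries.map_X, χ.sub_X_eq]
      exact Dvd.dvd.mul_right (dvd_pow_self _ χ.e_pos.ne') _
  exact RingHom.congr_fun h f

theorem Branch.map_sub {D' : Type*} [CommRing D'] [Algebra (VR L) D'] (h : D →ₐ[VR L] D')
    (g : D⟦X⟧) : PowerSeries.map h.toRingHom (χ.sub D g) =
      χ.sub D' (PowerSeries.map h.toRingHom g) := by
  have e : (PowerSeries.map h.toRingHom).comp (χ.sub D) =
      (χ.sub D').comp (PowerSeries.map h.toRingHom) := by
    have e0 : PowerSeries.map h.toRingHom (PowerSeries.map (algebraMap (VR L) D) χ.z) =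
        PowerSeries.map (algebraMap (VR L) D') χ.z := by ext n; simp
    refine series_ringHom_ext (fun a => ?_) ?_ ?_
    · simp only [RingHom.comp_apply, sub_C, PowerSeries.map_C]
    · simp only [RingHom.comp_apply, sub_X, PowerSeries.map_X, e0]
    · rw [RingHom.comp_apply, sub_X_eq, map_mul, map_pow, PowerSeries.map_X]
      exact Dvd.dvd.mul_right (dvd_pow_self _ χ.e_pos.ne') _
  exact RingHom.congr_fun e g

theorem Branch.frobS_sub [Algebra k D] (g : D⟦X⟧) :
    frobS (k := k) D (χ.sub D g) = (frobPerm χ).sub D (frobS (k := k) D g) := by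
  have e : (frobS (k := k) D).comp (χ.sub D) =
      ((frobPerm χ).sub D).comp (frobS (k := k) D) := by
    have e0 : frobS (k := k) D (PowerSeries.map (algebraMap (VR L) D) χ.z) =
        PowerSeries.map (algebraMap (VR L) D) (frobPerm χ).z := frobS_map _ _
    refine series_ringHom_ext (fun a => ?_) ?_ ?_
    · simp only [RingHom.comp_apply, sub_C, frobS_C]
    · simp only [RingHom.comp_apply, sub_X, frobS_X, e0]
    · rw [RingHom.comp_apply, sub_X_eq, map_mul, map_pow, frobS_X]
      exact Dvd.dvd.mul_right (dvd_pow_self _ χ.e_pos.ne') _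
  exact RingHom.congr_fun e g

end

/-- A presentation of the `A_v`-algebra `B` as a power series ring `D[[z]]`. -/
structure SeriesPres (k : Type*) [Field k] (B D : Type*) [CommRing B] [CommRing D]
    [Algebra k⟦X⟧ B] [Algebra k D] where
  equiv : B ≃+* D⟦X⟧
  equiv_algebraMap : ∀ f, equiv (algebraMap k⟦X⟧ B f) = PowerSeries.map (algebraMap k D) f

variable {B D : Type*} [CommRing B] [CommRing D] [Algebra k⟦X⟧ B] [Algebra k D] [Algebra (VR L) D]
  [IsScalarTower k (VR L) D] (p : SeriesPres k B D)

/-- The component `B ⊗ O_E → D[[Y]]` at a branch, for `B = D[[z]]`: substitution of the expansion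
of `z` on `B`, and the expansion of the elements of `O_E`. -/
def omegaAt : B ⊗[k⟦X⟧] OE k E →+* D⟦X⟧ :=
  letI : Algebra k⟦X⟧ D⟦X⟧ :=
    (((PowerSeries.map (algebraMap (VR L) D)).comp χ.hom).comp
      (algebraMap k⟦X⟧ (OE k E))).toAlgebra
  (Algebra.TensorProduct.lift (S := k⟦X⟧)
    ({ (χ.sub D).comp p.equiv.toRingHom with
        commutes' := fun f => by
          change χ.sub D (p.equiv (algebraMap k⟦X⟧ B f)) = _
          rw [p.equiv_algebraMap, χ.sub_map_algebraMap]; rfl } : B →ₐ[k⟦X⟧] D⟦X⟧)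
    ({ (PowerSeries.map (algebraMap (VR L) D)).comp χ.hom with
        commutes' := fun f => rfl } : OE k E →ₐ[k⟦X⟧] D⟦X⟧)
    (fun _ _ => Commute.all _ _)).toRingHom

@[simp]
theorem omegaAt_tmul (b : B) (a : OE k E) : omegaAt χ p (b ⊗ₜ a) =
    χ.sub D (p.equiv b) * PowerSeries.map (algebraMap (VR L) D) (χ.hom a) := by
  rfl

theorem omegaAt_smul (b : B) (x : B ⊗[k⟦X⟧] OE k E) :
    omegaAt χ p (b • x) = χ.sub D (p.equiv b) * omegaAt χ p x := by
  induction x with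
  | zero => simp
  | add x x' hx hx' => rw [smul_add, map_add, map_add, mul_add, hx, hx']
  | tmul b' a => rw [TensorProduct.smul_tmul', smul_eq_mul, omegaAt_tmul, omegaAt_tmul, map_mul,
      map_mul, mul_assoc]

variable (hy hL) in
/-- The homomorphism `B ⊗ O_E → ∏ D[[Y]]`, for `B = D[[z]]`, to the product over the branches. -/
def omegaHom : B ⊗[k⟦X⟧] OE k E →+* (Branch hy hL → D⟦X⟧) := RingHom.pi fun χ => omegaAt χ p

theorem omegaHom_apply (x : B ⊗[k⟦X⟧] OE k E) : omegaHom hy hL p x χ = omegaAt χ p x := rfl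

/-- The elements `Y` and the constants are in the image of `B ⊗ O_E`, and Lagrange interpolation
at Teichmüller elements yields the idempotents that belong to the branches. -/
theorem exists_omegaHom_eq_single [DecidableEq (Branch hy hL)] : ∃ x : B ⊗[k⟦X⟧] OE k E,
    omegaHom hy hL p x = Pi.single χ 1 := by
  have h : ∀ χ' : Branch hy hL, ∃ x : B ⊗[k⟦X⟧] OE k E, χ' ≠ χ →
      (omegaAt χ p x = 1 ∧ omegaAt χ' p x = 0) := fun χ' => by
    by_cases hne : χ' = χ
    · exact ⟨0, fun h => absurd hne h⟩
    obtain ⟨l, a, a', ha, ha', hu⟩ := Branch.exists_separating (Ne.symm hne)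
    obtain ⟨v, hv⟩ := hu.exists_right_inv
    let i := algebraMap (VR L) D
    refine ⟨(1 ⊗ₜ l - p.equiv.symm (PowerSeries.C (i a')) ⊗ₜ 1) *
      p.equiv.symm (PowerSeries.C (i v)) ⊗ₜ 1, fun _ => ⟨?_, ?_⟩⟩
    · rw [map_mul, map_sub]
      simp only [omegaAt_tmul, map_one, one_mul, mul_one, RingEquiv.apply_symm_apply,
        Branch.sub_C, ha, PowerSeries.map_C]
      rw [← map_sub, ← map_mul, ← map_sub, ← map_mul, hv, map_one, map_one]
    · rw [map_mul, map_sub]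
      simp only [omegaAt_tmul, map_one, one_mul, mul_one, RingEquiv.apply_symm_apply,
        Branch.sub_C, ha', PowerSeries.map_C]
      rw [sub_self, zero_mul]
  choose x hx using h
  refine ⟨∏ χ' ∈ Finset.univ.erase χ, x χ', ?_⟩
  funext χ'
  rw [omegaHom_apply, map_prod]
  by_cases hne : χ' = χ
  · subst hne
    rw [Pi.single_eq_same]
    exact Finset.prod_eq_one fun χ'' h => (hx χ'' (Finset.ne_of_mem_erase h)).1
  · rw [Pi.single_eq_of_ne hne]
    exact Finset.prod_eq_zero (Finset.mem_erase.2 ⟨hne, Finset.mem_univ _⟩) (hx χ' hne).2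

theorem omegaHom_surjective : Function.Surjective (omegaHom hy hL p) := by
  classical
  intro f
  have hb : ∀ χ : Branch hy hL, Function.Bijective (substSum (χ.sub D) χ.e) := fun χ =>
    substSum_bijective (χ.sub_C D) (χ.sub_X_eq D) (χ.isUnit_unit.map _) χ.e_pos
  choose ε hε using fun χ : Branch hy hL => exists_omegaHom_eq_single χ p
  choose g hg using fun χ => (hb χ).2 (f χ)
  refine ⟨∑ χ : Branch hy hL, ε χ * ∑ s, p.equiv.symm (g χ s) ⊗ₜ (y ^ (s : ℕ)), ?_⟩
  funext χ
  rw [map_sum, Finset.sum_apply, Finset.sum_eq_single χ]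
  · rw [map_mul, hε, Pi.mul_apply, Pi.single_eq_same, one_mul, ← hg χ, omegaHom_apply, map_sum]
    refine Finset.sum_congr rfl fun s _ => ?_
    have h := omegaAt_tmul χ p (p.equiv.symm (g χ s)) (y ^ (s : ℕ))
    rwa [RingEquiv.apply_symm_apply, map_pow, χ.hom_y, map_pow, PowerSeries.map_X] at h
  · intro χ' _ hne
    rw [map_mul, hε, Pi.mul_apply, Pi.single_eq_of_ne (Ne.symm hne), zero_mul]
  · simp

variable [IsSemisimpleRing E] [Algebra.IsSeparable k⸨X⸩ E] [Algebra.IsSeparable k⸨X⸩ L]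

/-- The coordinates of the components of an element of `B ⊗ O_E` with respect to the powers
of `Y`. -/
theorem exists_coordinates : ∃ G : B ⊗[k⟦X⟧] OE k E →ₗ[B] ((Σ χ : Branch hy hL, Fin χ.e) → B),
    Function.Surjective G ∧ ∀ x, omegaHom hy hL p x = 0 → G x = 0 := by
  have hb : ∀ χ : Branch hy hL, Function.Bijective (substSum (χ.sub D) χ.e) := fun χ =>
    substSum_bijective (χ.sub_C D) (χ.sub_X_eq D) (χ.isUnit_unit.map _) χ.e_pos
  let c : ∀ χ : Branch hy hL, D⟦X⟧ → Fin χ.e → D⟦X⟧ := fun χ => (Equiv.ofBijective _ (hb χ)).symm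
  have hc : ∀ χ f, substSum (χ.sub D) χ.e (c χ f) = f := fun χ =>
    (Equiv.ofBijective _ (hb χ)).apply_symm_apply
  have hc' : ∀ (χ : Branch hy hL) g, c χ (substSum (χ.sub D) χ.e g) = g := fun χ =>
    (Equiv.ofBijective _ (hb χ)).symm_apply_apply
  refine ⟨{ toFun := fun x s => p.equiv.symm (c s.1 (omegaAt s.1 p x) s.2)
            map_add' := fun x x' => ?_
            map_smul' := fun b x => ?_ }, fun f => ?_, fun x hx => ?_⟩
  · funext ⟨χ, s⟩
    have h : c χ (omegaAt χ p (x + x')) =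
        fun s => c χ (omegaAt χ p x) s + c χ (omegaAt χ p x') s := by
      apply (hb χ).1
      rw [hc, substSum_add]
      rw [hc, hc, map_add]
    change p.equiv.symm (c χ (omegaAt χ p (x + x')) s) = _
    rw [h]
    exact map_add p.equiv.symm _ _
  · funext ⟨χ, s⟩
    have h : c χ (omegaAt χ p (b • x)) = fun s => p.equiv b * c χ (omegaAt χ p x) s := by
      apply (hb χ).1
      rw [hc, substSum_smul]
      rw [hc, omegaAt_smul]
    change p.equiv.symm (c χ (omegaAt χ p (b • x)) s) = _
    rw [h]
    exact (map_mul p.equiv.symm _ _).trans (by rw [RingEquiv.symm_apply_apply]; rfl)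
  · obtain ⟨x, hx⟩ := omegaHom_surjective (hy := hy) (hL := hL) p
      fun χ => substSum (χ.sub D) χ.e fun s => p.equiv (f ⟨χ, s⟩)
    refine ⟨x, ?_⟩
    funext ⟨χ, s⟩
    have h := congrFun hx χ
    rw [omegaHom_apply] at h
    simp only [LinearMap.coe_mk, AddHom.coe_mk, h, hc', RingEquiv.symm_apply_apply]
  · funext ⟨χ, s⟩
    have h0 : omegaAt χ p x = 0 := congrFun hx χ
    have h1 : c χ 0 = fun _ => 0 := by
      apply (hb χ).1
      rw [hc]; simp [substSum]
    simp only [LinearMap.coe_mk, AddHom.coe_mk, h0, h1, map_zero, Pi.zero_apply]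

include hL in
theorem finrank_le_sum_e : Module.finrank k⸨X⸩ E ≤ ∑ χ : Branch hy hL, χ.e := by
  rw [← card_algHom_eq_finrank, ← Branch.sum_card_embeddings (hy := hy) (hL := hL)]
  exact Finset.sum_le_sum fun χ _ => χ.card_embeddings_le

theorem sum_e_eq_finrank [Nontrivial B] (p : SeriesPres k B D) :
    ∑ χ : Branch hy hL, χ.e = Module.finrank k⸨X⸩ E := by
  refine le_antisymm ?_ finrank_le_sum_e
  obtain ⟨b, -, -⟩ := exists_basis_OE (k := k) hL
  obtain ⟨G, hG, -⟩ := exists_coordinates (hy := hy) (hL := hL) p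
  have h1 := card_le_of_surjective B (G ∘ₗ ((b.baseChange B).equivFun.symm).toLinearMap)
    (hG.comp (b.baseChange B).equivFun.symm.surjective)
  simpa using h1

theorem omegaHom_bijective [Nontrivial B] : Function.Bijective (omegaHom hy hL p) := by
  refine ⟨?_, omegaHom_surjective p⟩
  obtain ⟨b, -, -⟩ := exists_basis_OE (k := k) hL
  obtain ⟨G, hG, hG0⟩ := exists_coordinates (hy := hy) (hL := hL) p
  have hcard : Fintype.card (Σ χ : Branch hy hL, Fin χ.e) = Module.finrank k⸨X⸩ E := by
    rw [← sum_e_eq_finrank (hy := hy) (hL := hL) p]; simp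
  let eq := Fintype.equivFinOfCardEq hcard
  let H : B ⊗[k⟦X⟧] OE k E →ₗ[B] B ⊗[k⟦X⟧] OE k E :=
    (b.baseChange B).equivFun.symm.toLinearMap ∘ₗ
      (LinearEquiv.funCongrLeft B B eq.symm).toLinearMap ∘ₗ G
  have hH : Function.Surjective H :=
    (b.baseChange B).equivFun.symm.surjective.comp
      ((LinearEquiv.funCongrLeft B B eq.symm).surjective.comp hG)
  have : Module.Finite B (B ⊗[k⟦X⟧] OE k E) := Module.Finite.of_basis (b.baseChange B)
  have hGinj : Function.Injective G := by
    have h1 := OrzechProperty.injective_of_surjective_endomorphism H hH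
    exact Function.Injective.of_comp (f := (b.baseChange B).equivFun.symm ∘
      (LinearEquiv.funCongrLeft B B eq.symm)) h1
  rw [injective_iff_map_eq_zero]
  exact fun x hx => hGinj ((hG0 x hx).trans (map_zero G).symm)

variable (hy hL) in
/-- The isomorphism `B ⊗ O_E ≅ ∏ D[[Y]]`, for `B = D[[z]]`, with the product over the branches. -/
def omega [Nontrivial B] : B ⊗[k⟦X⟧] OE k E ≃+* (Branch hy hL → D⟦X⟧) :=
  RingEquiv.ofBijective (omegaHom hy hL p) (omegaHom_bijective p)

theorem omega_apply [Nontrivial B] (x : B ⊗[k⟦X⟧] OE k E) :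
    omega hy hL p x χ = omegaAt χ p x := rfl

theorem omegaAt_map {B' D' : Type*} [CommRing B'] [CommRing D'] [Algebra k⟦X⟧ B'] [Algebra k D']
    [Algebra (VR L) D'] [IsScalarTower k (VR L) D'] (p' : SeriesPres k B' D')
    (f : B →ₐ[k⟦X⟧] B') (h : D →ₐ[VR L] D')
    (hf : ∀ b, p'.equiv (f b) = PowerSeries.map h.toRingHom (p.equiv b)) (x : B ⊗[k⟦X⟧] OE k E) :
    omegaAt χ p' (Algebra.TensorProduct.map f (AlgHom.id k⟦X⟧ (OE k E)) x) =
      PowerSeries.map h.toRingHom (omegaAt χ p x) := by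
  induction x with
  | zero => simp
  | add x x' hx hx' => rw [map_add, map_add, map_add, map_add, hx, hx']
  | tmul b a =>
    rw [Algebra.TensorProduct.map_tmul, omegaAt_tmul, omegaAt_tmul, map_mul, hf, χ.map_sub]
    congr 1
    ext n
    simp

theorem omegaAt_frob (f : B →ₐ[k⟦X⟧] B)
    (hf : ∀ b, p.equiv (f b) = frobS (k := k) D (p.equiv b)) (x : B ⊗[k⟦X⟧] OE k E) :
    omegaAt (frobPerm χ) p (Algebra.TensorProduct.map f (AlgHom.id k⟦X⟧ (OE k E)) x) =
      frobS (k := k) D (omegaAt χ p x) := by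
  induction x with
  | zero => simp
  | add x x' hx hx' => rw [map_add, map_add, map_add, map_add, hx, hx']
  | tmul b a =>
    rw [Algebra.TensorProduct.map_tmul, omegaAt_tmul, omegaAt_tmul, map_mul, hf, χ.frobS_sub,
      frobS_map]
    rfl

variable (L) in
/-- `R[[z]]` as a power series ring over `R`. -/
def presRZ : SeriesPres k (RZ L) (VR L) where
  equiv := RingEquiv.refl _
  equiv_algebraMap _ := rfl

instance : Nontrivial (RZ L) := inferInstanceAs (Nontrivial (VR L)⟦X⟧)
instance : IsDomain (RZ L) := inferInstanceAs (IsDomain (VR L)⟦X⟧)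

theorem Branch.card_embeddings : χ.embeddings.card = χ.e := by
  refine ((Finset.sum_eq_sum_iff_of_le (s := Finset.univ) (f := fun χ : Branch hy hL =>
    χ.embeddings.card) (g := fun χ => χ.e) fun χ _ => χ.card_embeddings_le).1 ?_) χ
    (Finset.mem_univ _)
  rw [sum_e_eq_finrank (presRZ L), ← card_algHom_eq_finrank, Branch.sum_card_embeddings]

theorem Branch.exists_z_sub_eq : ∃ w, IsUnit w ∧ χ.z - PowerSeries.C (zeta L) =
    (∏ φ ∈ χ.embeddings, (PowerSeries.X - PowerSeries.C (embR hL φ y))) * w := by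
  obtain ⟨w, hw⟩ := χ.prod_dvd
  refine ⟨w, ?_, hw⟩
  rw [χ.z_eq] at hw
  exact (card_le_of_prod_X_sub_C_dvd _ _ (fun φ => norm_embR_y_lt_one φ hy) χ.isUnit_unit
    (norm_zeta_lt_one L) hw).2 χ.card_embeddings

theorem exists_algebraMap_eq_of_pow_eq {D : Type*} [CommRing D] [IsDomain D] [Algebra k D] {c : D}
    (h : c ^ Fintype.card k = c) : ∃ a : k, algebraMap k D a = c := by
  have h1 : (∏ a : k, (Polynomial.X - Polynomial.C a)) =
      Polynomial.X ^ Fintype.card k - Polynomial.X :=  by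
    have hq : 1 < Fintype.card k := Fintype.one_lt_card
    have h := Polynomial.prod_multiset_X_sub_C_of_monic_of_roots_card_eq
      (p := (Polynomial.X ^ Fintype.card k - Polynomial.X : Polynomial k))
      (Polynomial.monic_X_pow_sub (by rw [Polynomial.degree_X]; exact_mod_cast hq)) (by
        rw [FiniteField.roots_X_pow_card_sub_X, FiniteField.X_pow_card_sub_X_natDegree_eq k hq]
        rfl)
    rw [FiniteField.roots_X_pow_card_sub_X] at h
    exact h
  have h2 := congrArg (Polynomial.aeval c) h1
  rw [map_prod] at h2
  simp only [map_sub, Polynomial.aeval_X, Polynomial.aeval_C, map_pow, h, sub_self] at h2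
  obtain ⟨a, -, ha⟩ := Finset.prod_eq_zero_iff.1 h2
  exact ⟨a, (sub_eq_zero.1 ha).symm⟩

include p hL in
/-- The invariants of Frobenius in `B ⊗ O_E` are the elements of `O_E`. -/
theorem exists_one_tmul_eq_of_frob_eq [IsDomain D] (f : B →ₐ[k⟦X⟧] B)
    (hf : ∀ b, p.equiv (f b) = frobS (k := k) D (p.equiv b)) (x : B ⊗[k⟦X⟧] OE k E)
    (hx : Algebra.TensorProduct.map f (AlgHom.id k⟦X⟧ (OE k E)) x = x) :
    ∃ a : OE k E, x = 1 ⊗ₜ a := by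
  obtain ⟨b, -, -⟩ := exists_basis_OE (k := k) hL
  let bB := b.baseChange B
  have hsum : ∑ i, bB.repr x i ⊗ₜ[k⟦X⟧] b i = x := by
    have := bB.sum_repr x
    simpa [bB, TensorProduct.smul_tmul'] using this
  have hfix : ∀ i, f (bB.repr x i) = bB.repr x i := fun i => by
    have h1 : ∑ i, f (bB.repr x i) • bB i = x := by
      conv_rhs => rw [← hx, ← hsum, map_sum]
      refine Finset.sum_congr rfl fun i _ => ?_
      simp [bB, TensorProduct.smul_tmul']
    have h2 := congrArg (fun v => bB.repr v i) h1
    simpa [Finsupp.single_apply] using h2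
  have hA : ∀ i, ∃ c : k⟦X⟧, algebraMap k⟦X⟧ B c = bB.repr x i := fun i => by
    have h1 : ∀ n, PowerSeries.coeff n (p.equiv (bB.repr x i)) ^ Fintype.card k =
        PowerSeries.coeff n (p.equiv (bB.repr x i)) := fun n => by
      rw [← coeff_frobS, ← hf, hfix]
    choose c hc using fun n => exists_algebraMap_eq_of_pow_eq (h1 n)
    refine ⟨PowerSeries.mk c, p.equiv.injective ?_⟩
    rw [p.equiv_algebraMap]
    ext n
    rw [PowerSeries.coeff_map, PowerSeries.coeff_mk, hc]
  choose c hc using hA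
  refine ⟨∑ i, c i • b i, ?_⟩
  conv_lhs => rw [← hsum]
  rw [TensorProduct.tmul_sum]
  refine Finset.sum_congr rfl fun i _ => ?_
  rw [← TensorProduct.smul_tmul, ← hc, Algebra.smul_def, mul_one]

end Omega

/-! ### Local shtukas with complex multiplication are cyclic over `R[[z]] ⊗ O_E` -/

section LocalRing

variable {A : Type*} [CommRing A] [IsLocalRing A] {N : Type*} [AddCommGroup N] [Module A N]
  {ι : Type*} [Fintype ι] [DecidableEq ι]

/-- A family of `r` elements of a free module of rank `r` over a local ring is a basis if it is
linearly independent modulo the maximal ideal. -/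
theorem span_eq_top_of_linearIndependent_mod (β : Module.Basis ι A N) (v : ι → N)
    (h : ∀ c : ι → A, ∑ i, c i • v i ∈ IsLocalRing.maximalIdeal A • (⊤ : Submodule A N) →
      ∀ i, c i ∈ IsLocalRing.maximalIdeal A) :
    Submodule.span A (Set.range v) = ⊤ := by
  refine ((β.is_basis_iff_det).2 ?_).2
  rw [Module.Basis.det_apply]
  rw [← isUnit_map_iff (IsLocalRing.residue A), RingHom.map_det, ← Matrix.isUnit_iff_isUnit_det,
    ← Matrix.mulVec_injective_iff_isUnit]
  intro c c' hcc
  have hsurj : Function.Surjective (IsLocalRing.residue A) := IsLocalRing.residue_surjective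
  choose d hd using fun i => hsurj (c i - c' i)
  have h1 : ∀ i, d i ∈ IsLocalRing.maximalIdeal A := by
    apply h
    rw [← β.sum_repr (∑ i, d i • v i)]
    refine Submodule.sum_mem _ fun j _ => Submodule.smul_mem_smul ?_ trivial
    rw [← IsLocalRing.residue_eq_zero_iff, map_sum, Finsupp.finsetSum_apply, map_sum]
    have h2 := congrFun (sub_eq_zero.2 hcc) j
    rw [Pi.zero_apply, ← Matrix.mulVec_sub] at h2
    rw [← h2]
    refine Finset.sum_congr rfl fun i _ => ?_
    simp [Module.Basis.toMatrix_apply, hd, mul_comm]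
  funext i
  have := (IsLocalRing.residue_eq_zero_iff _).2 (h1 i)
  rw [hd] at this
  exact sub_eq_zero.1 this

end LocalRing

section Action

variable {k : Type*} [Field k] [Fintype k] {L : IntermediateField k⸨X⸩ (Qalg k)}
variable {E : Type*} [CommRing E] [Algebra k⸨X⸩ E] [Algebra k⟦X⟧ E]
variable {N : Type*} [AddCommGroup N] [Module (RZ L) N] (ρ : OE k E →+* Module.End (RZ L) N)

/-- The action `ρ` of `O_E` on an `R[[z]]`-module extends the action of `A_v`. -/
def IsCompatible : Prop :=
  ∀ (a : k⟦X⟧) (n : N), ρ (algebraMap k⟦X⟧ (OE k E) a) n = algebraMap k⟦X⟧ (RZ L) a • n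

variable {ρ} (hρ : IsCompatible ρ)

/-- The action of `R[[z]] ⊗ O_E` on a module with an action of `O_E`. -/
def extAct : RZ L ⊗[k⟦X⟧] OE k E →+* Module.End (RZ L) N :=
  letI : Algebra k⟦X⟧ (Module.End (RZ L) N) :=
    RingHom.toAlgebra' ((algebraMap (RZ L) (Module.End (RZ L) N)).comp (algebraMap k⟦X⟧ (RZ L)))
      fun c x => Algebra.commutes (algebraMap k⟦X⟧ (RZ L) c) x
  (Algebra.TensorProduct.lift (S := k⟦X⟧)
    ({ algebraMap (RZ L) (Module.End (RZ L) N) with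
        commutes' := fun _ => rfl } : RZ L →ₐ[k⟦X⟧] Module.End (RZ L) N)
    ({ ρ with
        commutes' := fun f => LinearMap.ext (hρ f) } : OE k E →ₐ[k⟦X⟧] Module.End (RZ L) N)
    (fun _ _ => Algebra.commutes _ _)).toRingHom

@[simp]
theorem extAct_tmul (g : RZ L) (a : OE k E) (n : N) :
    extAct hρ (g ⊗ₜ a) n = g • ρ a n := rfl

theorem extAct_smul (g : RZ L) (x : RZ L ⊗[k⟦X⟧] OE k E) (n : N) :
    extAct hρ (g • x) n = g • extAct hρ x n := by
  induction x with
  | zero => simp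
  | add x x' hx hx' => rw [smul_add, map_add, map_add, LinearMap.add_apply, LinearMap.add_apply,
      smul_add, hx, hx']
  | tmul b a => rw [TensorProduct.smul_tmul', extAct_tmul, extAct_tmul, smul_eq_mul, mul_smul]

/-- The map `R[[z]] ⊗ O_E → N`, `x ↦ x • n`. -/
def orbitMap (n : N) : RZ L ⊗[k⟦X⟧] OE k E →ₗ[RZ L] N where
  toFun x := extAct hρ x n
  map_add' x x' := by rw [map_add, LinearMap.add_apply]
  map_smul' g x := extAct_smul hρ g x n

/-- The constant power series in `R[[z]]`. -/
def constRZ : VR L →+* RZ L := (PowerSeries.C : VR L →+* (VR L)⟦X⟧)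

variable (L) in
/-- The variable `z` of `R[[z]]`. -/
def zRZ : RZ L := (PowerSeries.X : (VR L)⟦X⟧)

variable [FiniteDimensional k⸨X⸩ L]

variable (L) in
theorem exists_uniformizer_VR : ∃ π : VR L, ‖(π : L)‖ < 1 ∧ π ≠ 0 ∧
    ∀ x : VR L, ‖(x : L)‖ < 1 → π ∣ x := by
  obtain ⟨π, h0, h1, h2⟩ := exists_uniformizer L
  refine ⟨⟨π, (mem_VR_iff L _).2 h1.le⟩, h1, fun h => h0 (congrArg Subtype.val h), fun x hx => ?_⟩
  exact ⟨⟨x / π, (mem_VR_iff L _).2 (h2 _ hx)⟩, Subtype.ext (mul_div_cancel₀ _ h0).symm⟩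

theorem exists_eq_of_mem_maximalIdeal_RZ {π : VR L}
    (hπ : ∀ x : VR L, ‖(x : L)‖ < 1 → π ∣ x) {f : RZ L} (hf : f ∈ IsLocalRing.maximalIdeal (RZ L)) :
    ∃ a b : RZ L, f = constRZ π * a + zRZ L * b := by
  have key : ∀ f : (VR L)⟦X⟧, ¬ IsUnit f → ∃ a b : (VR L)⟦X⟧,
      f = PowerSeries.C π * a + PowerSeries.X * b := fun f hf => by
    rw [PowerSeries.isUnit_iff_constantCoeff, not_isUnit_VR_iff] at hf
    obtain ⟨c, hc⟩ := hπ _ hf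
    have h2 := series_eq_C_add_X_mul (D := VR L) f
    rw [PowerSeries.coeff_zero_eq_constantCoeff_apply, hc, map_mul] at h2
    exact ⟨_, _, h2⟩
  exact key f hf

theorem zRZ_mem_maximalIdeal : zRZ L ∈ IsLocalRing.maximalIdeal (RZ L) := by
  change ¬ IsUnit (PowerSeries.X : (VR L)⟦X⟧)
  rw [PowerSeries.isUnit_iff_constantCoeff]
  simp

theorem constRZ_mem_maximalIdeal {π : VR L} (hπ : ‖(π : L)‖ < 1) :
    constRZ π ∈ IsLocalRing.maximalIdeal (RZ L) := by
  change ¬ IsUnit (PowerSeries.C π : (VR L)⟦X⟧)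
  rw [PowerSeries.isUnit_iff_constantCoeff, PowerSeries.constantCoeff_C]
  exact (not_isUnit_VR_iff _).2 hπ

theorem exists_eq_of_mem_maximalIdeal_smul {π : VR L}
    (hπ : ∀ x : VR L, ‖(x : L)‖ < 1 → π ∣ x) {n : N}
    (hn : n ∈ IsLocalRing.maximalIdeal (RZ L) • (⊤ : Submodule (RZ L) N)) :
    ∃ n₁ n₂ : N, n = constRZ π • n₁ + zRZ L • n₂ := by
  induction hn using Submodule.smul_induction_on' with
  | smul f hf n _ =>
    obtain ⟨a, b, rfl⟩ := exists_eq_of_mem_maximalIdeal_RZ hπ hf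
    exact ⟨a • n, b • n, by rw [add_smul, mul_smul, mul_smul]⟩
  | add n _ n' _ h h' =>
    obtain ⟨a, b, rfl⟩ := h
    obtain ⟨a', b', rfl⟩ := h'
    exact ⟨a + a', b + b', by rw [smul_add, smul_add]; abel⟩

theorem exists_smul_eq_of_z_smul_eq [Module.Free (RZ L) N] [Module.Finite (RZ L) N]
    {π : VR L} (hπ : π ≠ 0) {w n : N}
    (h : zRZ L • w = constRZ π • n) : ∃ n', w = constRZ π • n' := by
  have key : ∀ f g : (VR L)⟦X⟧, PowerSeries.X * f = PowerSeries.C π * g →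
      ∃ c, f = PowerSeries.C π * c := fun f g hfg => by
    have h3 := congrArg PowerSeries.constantCoeff hfg
    rw [map_mul, map_mul, PowerSeries.constantCoeff_X, zero_mul, PowerSeries.constantCoeff_C] at h3
    obtain ⟨c, rfl⟩ := PowerSeries.X_dvd_iff.2 ((mul_eq_zero.1 h3.symm).resolve_left hπ)
    refine ⟨c, mul_left_cancel₀ (PowerSeries.X_ne_zero (R := VR L)) ?_⟩
    rw [hfg]; ring
  let b := Module.Free.chooseBasis (RZ L) N
  have h1 : ∀ i, ∃ c : RZ L, b.repr w i = constRZ π * c := fun i => by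
    have h2 := congrArg (fun x => b.repr x i) h
    simp only [map_smul, Finsupp.smul_apply, smul_eq_mul] at h2
    exact key _ _ h2
  choose c hc using h1
  refine ⟨∑ i, c i • b i, ?_⟩
  rw [← b.sum_repr w, Finset.smul_sum]
  exact Finset.sum_congr rfl fun i _ => by rw [hc, mul_smul]

end Action

section Cyclic

variable {k : Type*} [Field k] [Fintype k] {L : IntermediateField k⸨X⸩ (Qalg k)}
  [FiniteDimensional k⸨X⸩ L] [Algebra.IsSeparable k⸨X⸩ L]
variable {E : Type*} [CommRing E] [Algebra k⸨X⸩ E] [Algebra k⟦X⟧ E] [IsScalarTower k⟦X⟧ k⸨X⸩ E]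
  [Module.Finite k⸨X⸩ E] [IsSemisimpleRing E] [Algebra.IsSeparable k⸨X⸩ E]
variable {y : OE k E} {hy : IsUniformizing y} {hL : ∀ (φ : E →ₐ[k⸨X⸩] Qalg k) (e : E), φ e ∈ L}
variable {N : Type*} [AddCommGroup N] [Module (RZ L) N] {ρ : OE k E →+* Module.End (RZ L) N}
  (hρ : IsCompatible ρ)

/-- The action of `∏ R[[Y]] ≅ R[[z]] ⊗ O_E` on a module with an action of `O_E`. -/
def branchAct : (Branch hy hL → (VR L)⟦X⟧) →+* Module.End (RZ L) N :=
  (extAct hρ).comp (omega hy hL (presRZ L)).symm.toRingHom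

theorem extAct_eq_branchAct (x : RZ L ⊗[k⟦X⟧] OE k E) :
    extAct hρ x = branchAct hρ (omega hy hL (presRZ L) x) := by
  change _ = extAct hρ ((omega hy hL (presRZ L)).symm _)
  rw [RingEquiv.symm_apply_apply]

theorem branchAct_z (n : N) :
    branchAct (hy := hy) (hL := hL) hρ (fun χ => χ.z) n = zRZ L • n := by
  have h : (fun χ : Branch hy hL => χ.z) = omega hy hL (presRZ L) (zRZ L ⊗ₜ 1) := by
    funext χ
    rw [omega_apply, omegaAt_tmul, map_one, map_one, mul_one]
    change _ = χ.sub (VR L) PowerSeries.X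
    rw [χ.sub_X]
    ext n
    simp
  rw [h, ← extAct_eq_branchAct, extAct_tmul, map_one]
  rfl

theorem branchAct_mul_apply (f g : Branch hy hL → (VR L)⟦X⟧) (n : N) :
    branchAct hρ (f * g) n = branchAct hρ f (branchAct hρ g n) := by
  rw [map_mul]; rfl

theorem branchAct_comm (f g : Branch hy hL → (VR L)⟦X⟧) (n : N) :
    branchAct hρ f (branchAct hρ g n) = branchAct hρ g (branchAct hρ f n) := by
  rw [← branchAct_mul_apply, mul_comm, branchAct_mul_apply]

variable [Module.Free (RZ L) N] [Module.Finite (RZ L) N]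

/-- Every branch with a nonzero component contributes an element that is nonzero modulo the
maximal ideal of `R[[Y]]`. -/
theorem exists_generator_of_branch {π : VR L} (hπ1 : ‖(π : L)‖ < 1) (χ : Branch hy hL)
    (hχ : branchAct (N := N) hρ (Pi.single χ 1) ≠ 0) :
    ∃ m : N, branchAct hρ (Pi.single χ 1) m = m ∧
      ¬ ∃ n₁ n₂ : N, m = constRZ π • n₁ + branchAct hρ (Pi.single χ PowerSeries.X) n₂ := by
  by_contra hcon
  push Not at hcon
  set δ := branchAct (N := N) hρ (Pi.single χ 1) with hδ
  set Y := branchAct (N := N) hρ (Pi.single χ PowerSeries.X) with hY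
  have hδδ : ∀ n, δ (δ n) = δ n := fun n => by
    rw [hδ, ← branchAct_mul_apply, ← Pi.single_mul, one_mul]
  have hδY : ∀ n, δ (Y n) = Y (δ n) := fun n => branchAct_comm hρ _ _ n
  -- If every element of the component were of the form `π n₁ + Y n₂`, the component would be equal to
  -- its product with the maximal ideal, because `Y^e` is divisible by `z`, and vanish by Nakayama.
  let Q := LinearMap.range δ
  have hQ : Q ≤ IsLocalRing.maximalIdeal (RZ L) • Q := by
    have hstep : ∀ (j : ℕ), ∀ m ∈ Q, ∃ a ∈ IsLocalRing.maximalIdeal (RZ L) • Q, ∃ n ∈ Q,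
        m = a + (Y ^ j) n := by
      intro j
      induction j with
      | zero => exact fun m hm => ⟨0, zero_mem _, m, hm, by simp⟩
      | succ j ih =>
        intro m hm
        obtain ⟨a, ha, n, hn, rfl⟩ := ih m hm
        obtain ⟨n₀, hn₀⟩ := hn
        obtain ⟨n₁, n₂, h⟩ := hcon n (by rw [← hn₀, hδδ])
        have hn' : n = constRZ π • δ n₁ + Y (δ n₂) := by
          rw [← hδY, ← map_smul, ← map_add, ← h, ← hn₀, hδδ]
        have hYj : ∀ x, (Y ^ j) (δ x) = δ ((Y ^ j) x) := fun x => by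
          have hc : Commute (Y ^ j) δ := Commute.pow_left (LinearMap.ext fun n => (hδY n).symm) j
          exact LinearMap.congr_fun hc.eq x
        refine ⟨a + constRZ π • (Y ^ j) (δ n₁), add_mem ha (Submodule.smul_mem_smul
          (constRZ_mem_maximalIdeal hπ1) ⟨_, (hYj n₁).symm⟩), δ n₂, ⟨n₂, rfl⟩, ?_⟩
        rw [hn', map_add, map_smul, pow_succ, add_assoc]
        rfl
    intro m hm
    obtain ⟨a, ha, n, hn, rfl⟩ := hstep χ.e m hm
    refine add_mem ha ?_
    obtain ⟨v, hv⟩ := χ.isUnit_unit.exists_right_inv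
    have h1 : (Y ^ χ.e) n = zRZ L • branchAct hρ (Pi.single χ v) n := by
      rw [← branchAct_z (hy := hy) (hL := hL) hρ, ← branchAct_mul_apply, hY, ← map_pow]
      congr 2
      funext χ'
      by_cases hne : χ' = χ
      · subst hne
        simp only [Pi.pow_apply, Pi.single_eq_same, Pi.mul_apply]
        rw [χ'.z_eq, mul_assoc, hv, mul_one]
      · simp [Pi.single_eq_of_ne hne, χ.e_pos.ne']
    rw [h1]
    obtain ⟨n₀, rfl⟩ := hn
    refine Submodule.smul_mem_smul zRZ_mem_maximalIdeal ⟨branchAct hρ (Pi.single χ v) n₀, ?_⟩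
    exact branchAct_comm hρ _ _ _
  have hbot := Submodule.eq_bot_of_le_smul_of_le_jacobson_bot _ Q
    (by
      change (LinearMap.range δ).FG
      rw [LinearMap.range_eq_map]; exact Module.Finite.fg_top.map δ) hQ
    (IsLocalRing.maximalIdeal_le_jacobson _)
  exact hχ (LinearMap.range_eq_bot.1 hbot)

/-- The elements `Yˢ m`, `s < e`, for `m` as in `exists_generator_of_branch`, are linearly
independent modulo the maximal ideal of `R[[z]]`. -/
theorem mem_maximalIdeal_of_sum_mem {π : VR L} (hπ0 : π ≠ 0)
    (hπ : ∀ x : VR L, ‖(x : L)‖ < 1 → π ∣ x) (χ : Branch hy hL) {m : N}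
    (hm : branchAct hρ (Pi.single χ 1) m = m)
    (hm' : ¬ ∃ n₁ n₂ : N, m = constRZ π • n₁ + branchAct hρ (Pi.single χ PowerSeries.X) n₂)
    (c : Fin χ.e → RZ L)
    (hc : ∑ s, c s • branchAct hρ (Pi.single χ (PowerSeries.X ^ (s : ℕ))) m ∈
      IsLocalRing.maximalIdeal (RZ L) • (⊤ : Submodule (RZ L) N)) (s : Fin χ.e) :
    c s ∈ IsLocalRing.maximalIdeal (RZ L) := by
  set I := IsLocalRing.maximalIdeal (RZ L) with hI
  obtain ⟨v, hv⟩ := χ.isUnit_unit.exists_right_inv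
  have hXe : ∀ n : N, branchAct hρ (Pi.single χ (PowerSeries.X ^ χ.e)) n =
      zRZ L • branchAct hρ (Pi.single χ v) n := fun n => by
    rw [← branchAct_z (hy := hy) (hL := hL) hρ, ← branchAct_mul_apply]
    congr 2
    funext χ'
    by_cases hne : χ' = χ
    · subst hne
      simp only [Pi.single_eq_same, Pi.mul_apply]
      rw [χ'.z_eq, mul_assoc, hv, mul_one]
    · simp [Pi.single_eq_of_ne hne]
  have hmulX : ∀ (i j : ℕ) (n : N), branchAct hρ (Pi.single χ (PowerSeries.X ^ i))
      (branchAct hρ (Pi.single χ (PowerSeries.X ^ j)) n) =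
        branchAct hρ (Pi.single χ (PowerSeries.X ^ (i + j))) n := fun i j n => by
    rw [← branchAct_mul_apply, ← Pi.single_mul, pow_add]
  -- The element `Y^(e-1) m` is not in the maximal ideal.
  have hlast : branchAct hρ (Pi.single χ (PowerSeries.X ^ (χ.e - 1))) m ∉
      I • (⊤ : Submodule (RZ L) N) := by
    intro h
    obtain ⟨n₁, n₂, h1⟩ := exists_eq_of_mem_maximalIdeal_smul hπ h
    have h2 := congrArg (branchAct hρ (Pi.single χ 1)) h1
    rw [branchAct_comm, hm, map_add, map_smul, map_smul] at h2
    set w := m - branchAct hρ (Pi.single χ (PowerSeries.X * χ.unit)) n₂ with hw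
    have h3 : branchAct hρ (Pi.single χ (PowerSeries.X ^ (χ.e - 1))) w =
        constRZ π • branchAct hρ (Pi.single χ 1) n₁ := by
      rw [hw, map_sub, h2, ← branchAct_z (hy := hy) (hL := hL) hρ, ← branchAct_mul_apply,
        ← branchAct_mul_apply, ← Pi.single_mul]
      have e1 : (fun χ => χ.z) * Pi.single χ 1 =
          (Pi.single χ (PowerSeries.X ^ (χ.e - 1) * (PowerSeries.X * χ.unit)) :
            Branch hy hL → (VR L)⟦X⟧) := by
        funext χ'
        by_cases hne : χ' = χ
        · subst hne
          simp only [Pi.single_eq_same, Pi.mul_apply]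
          rw [χ'.z_eq, mul_one, ← mul_assoc, ← pow_succ, Nat.sub_add_cancel χ'.e_pos]
        · simp [Pi.single_eq_of_ne hne]
      rw [e1, add_sub_cancel_right]
    have hδw : branchAct hρ (Pi.single χ 1) w = w := by
      rw [hw, map_sub, hm, ← branchAct_mul_apply, ← Pi.single_mul, one_mul]
    have h4 : zRZ L • w = constRZ π • branchAct hρ (Pi.single χ (χ.unit * PowerSeries.X))
        (branchAct hρ (Pi.single χ 1) n₁) := by
      rw [← map_smul, ← h3, ← branchAct_mul_apply, ← Pi.single_mul, mul_assoc, ← pow_succ',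
        Nat.sub_add_cancel χ.e_pos, mul_comm, Pi.single_mul, branchAct_mul_apply, branchAct_comm,
        branchAct_comm]
      nth_rw 1 [← hδw]
      rw [← branchAct_z (hy := hy) (hL := hL) hρ, ← branchAct_mul_apply, ← branchAct_mul_apply]
      congr 2
      funext χ'
      by_cases hne : χ' = χ
      · subst hne
        simp only [Pi.single_eq_same, Pi.mul_apply]
        rw [χ'.z_eq, mul_one, mul_comm]
      · simp [Pi.single_eq_of_ne hne]
    obtain ⟨n', hn'⟩ := exists_smul_eq_of_z_smul_eq hπ0 h4
    refine hm' ⟨n', branchAct hρ (Pi.single χ χ.unit) n₂, ?_⟩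
    rw [← hn', hw, ← branchAct_mul_apply, ← Pi.single_mul, sub_add_cancel]
  -- If `c s` is the first unit coefficient, multiplication by `Y^(e-1-s)` turns the sum into
  -- `c s • Y^(e-1) m`, up to elements of the maximal ideal.
  obtain ⟨s, hs⟩ := s
  induction s using Nat.strong_induction_on with
  | _ s ih =>
  by_contra hns
  have hu : IsUnit (c ⟨s, hs⟩) := by
    by_contra h; exact hns h
  apply hlast
  rw [← Submodule.smul_mem_iff_of_isUnit _ hu]
  have h1 : branchAct hρ (Pi.single χ (PowerSeries.X ^ (χ.e - 1 - s)))
      (∑ s, c s • branchAct hρ (Pi.single χ (PowerSeries.X ^ (s : ℕ))) m) ∈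
      I • (⊤ : Submodule (RZ L) N) := by
    have := Submodule.mem_map_of_mem (f := branchAct hρ (Pi.single χ (PowerSeries.X ^ (χ.e - 1 - s))))
      hc
    rw [Submodule.map_smul''] at this
    exact Submodule.smul_mono le_rfl le_top this
  rw [map_sum, ← Finset.add_sum_erase _ _ (Finset.mem_univ (⟨s, hs⟩ : Fin χ.e))] at h1
  rw [map_smul, hmulX, Nat.sub_add_cancel (by omega : s ≤ χ.e - 1)] at h1
  refine (Submodule.add_mem_iff_left _ (Submodule.sum_mem _ fun t ht => ?_)).1 h1
  rw [map_smul, hmulX]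
  have hne : t ≠ ⟨s, hs⟩ := Finset.ne_of_mem_erase ht
  rcases lt_or_ge (t : ℕ) s with hlt | hge
  · exact Submodule.smul_mem_smul (ih t hlt t.2) trivial
  · have hgt : s < t := lt_of_le_of_ne hge fun h => hne (Fin.ext h.symm)
    refine Submodule.smul_mem _ _ ?_
    have e1 : χ.e - 1 - s + t = χ.e + (t - s - 1) := by omega
    rw [e1, ← hmulX, hXe]
    exact Submodule.smul_mem_smul zRZ_mem_maximalIdeal trivial

/-- If all branches have a nonzero component, and the rank of the module is the degree of `E`,
then the module is free of rank one over `R[[z]] ⊗ O_E`. -/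
theorem exists_orbitMap_bijective (hrank : Module.finrank (RZ L) N = Module.finrank k⸨X⸩ E)
    (hne : ∀ χ : Branch hy hL, branchAct (N := N) hρ (Pi.single χ 1) ≠ 0) :
    ∃ n : N, Function.Bijective (orbitMap hρ n) := by
  obtain ⟨π, hπ1, hπ0, hπ⟩ := exists_uniformizer_VR L
  choose m hm hm' using fun χ => exists_generator_of_branch hρ hπ1 χ (hne χ)
  have hcard : Fintype.card (Σ χ : Branch hy hL, Fin χ.e) = Module.finrank (RZ L) N := by
    rw [hrank, ← sum_e_eq_finrank (hy := hy) (hL := hL) (presRZ L)]; simp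
  let β := (Module.finBasis (RZ L) N).reindex (Fintype.equivFinOfCardEq hcard).symm
  let v : (Σ χ : Branch hy hL, Fin χ.e) → N := fun i =>
    branchAct hρ (Pi.single i.1 (PowerSeries.X ^ (i.2 : ℕ))) (m i.1)
  have hv : Submodule.span (RZ L) (Set.range v) = ⊤ := by
    refine span_eq_top_of_linearIndependent_mod β v fun c hc i => ?_
    refine mem_maximalIdeal_of_sum_mem hρ hπ0 hπ i.1 (hm i.1) (hm' i.1) (fun s => c ⟨i.1, s⟩) ?_ i.2
    have h1 := Submodule.mem_map_of_mem (f := branchAct hρ (Pi.single i.1 1)) hc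
    rw [Submodule.map_smul''] at h1
    have h2 := Submodule.smul_mono (le_refl (IsLocalRing.maximalIdeal (RZ L))) le_top h1
    rw [map_sum, Fintype.sum_sigma, Finset.sum_eq_single i.1] at h2
    · convert h2 using 2 with s
      rw [map_smul, ← branchAct_mul_apply, ← Pi.single_mul, one_mul]
    · intro χ _ hne
      refine Finset.sum_eq_zero fun s _ => ?_
      rw [map_smul, ← branchAct_mul_apply]
      have e0 : (Pi.single i.1 1 * Pi.single χ (PowerSeries.X ^ (s : ℕ)) :
          Branch hy hL → (VR L)⟦X⟧) = 0 := by
        funext χ'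
        by_cases h : χ' = χ
        · subst h; simp [Pi.single_eq_of_ne hne]
        · simp [Pi.single_eq_of_ne h]
      rw [e0, map_zero, LinearMap.zero_apply, smul_zero]
    · simp
  refine ⟨∑ χ, m χ, ?_⟩
  have hsurj : Function.Surjective (orbitMap hρ (∑ χ, m χ)) := by
    rw [← LinearMap.range_eq_top, eq_top_iff, ← hv, Submodule.span_le]
    rintro _ ⟨i, rfl⟩
    refine ⟨(omega hy hL (presRZ L)).symm (Pi.single i.1 (PowerSeries.X ^ (i.2 : ℕ))), ?_⟩
    change branchAct hρ _ _ = _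
    rw [map_sum, Finset.sum_eq_single i.1]
    · intro χ _ hne
      rw [← hm χ, ← branchAct_mul_apply]
      have e0 : (Pi.single i.1 (PowerSeries.X ^ (i.2 : ℕ)) * Pi.single χ 1 :
          Branch hy hL → (VR L)⟦X⟧) = 0 := by
        funext χ'
        by_cases h : χ' = χ
        · subst h; simp [Pi.single_eq_of_ne hne]
        · simp [Pi.single_eq_of_ne h]
      rw [e0, map_zero, LinearMap.zero_apply]
    · simp
  refine ⟨?_, hsurj⟩
  obtain ⟨b, -, -⟩ := exists_basis_OE (k := k) hL
  let b' := b.baseChange (RZ L)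
  let eq : RZ L ⊗[k⟦X⟧] OE k E ≃ₗ[RZ L] N :=
    b'.equiv (Module.finBasis (RZ L) N) (finCongr hrank.symm)
  have : Module.Finite (RZ L) (RZ L ⊗[k⟦X⟧] OE k E) := Module.Finite.of_basis b'
  have h1 := OrzechProperty.injective_of_surjective_endomorphism
    (eq.symm.toLinearMap ∘ₗ orbitMap hρ (∑ χ, m χ)) (eq.symm.surjective.comp hsurj)
  exact Function.Injective.of_comp (f := eq.symm) h1

end Cyclic

section FrobAct

variable {k : Type*} [Field k] [Fintype k] {L : IntermediateField k⸨X⸩ (Qalg k)}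
variable {E : Type*} [CommRing E] [Algebra k⸨X⸩ E] [Algebra k⟦X⟧ E]
variable {M : Type*} [AddCommGroup M] [Module (RZ L) M]

theorem sigma_algebraMap (f : k⟦X⟧) :
    sigma L (algebraMap k⟦X⟧ (RZ L) f) = algebraMap k⟦X⟧ (RZ L) f := by
  change frobS (k := k) (VR L) (PowerSeries.map (algebraMap k (VR L)) f) =
    PowerSeries.map (algebraMap k (VR L)) f
  ext n
  rw [coeff_frobS, PowerSeries.coeff_map, ← map_pow, pow_card_eq]

variable (L) in
/-- The endomorphism `sigma` of `R[[z]]` as a homomorphism of `A_v`-algebras. -/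
def sigmaAlg : RZ L →ₐ[k⟦X⟧] RZ L := { sigma L with commutes' := sigma_algebraMap }

theorem frobPull_induction {p : FrobPull L M → Prop} (h : ∀ (g : RZ L) (m : M), p (g • frobIncl L m))
    (hadd : ∀ x y, p x → p y → p (x + y)) (x : FrobPull L M) : p x := by
  refine TensorProduct.induction_on (motive := fun x : FrobTw L ⊗[RZ L] M => p x) x ?_ ?_ hadd
  · have := h 0 0
    rwa [zero_smul] at this
  · intro g m
    have h1 : (g : FrobTw L) ⊗ₜ[RZ L] m = (show RZ L from g) • frobIncl L m := by
      change _ = (toFrobTw L g) • ((1 : FrobTw L) ⊗ₜ[RZ L] m)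
      rw [TensorProduct.smul_tmul', smul_eq_mul, mul_one]; rfl
    rw [h1]; exact h _ m

theorem frobMap_frobIncl (f : M →ₗ[RZ L] M) (m : M) :
    frobMap L f (frobIncl L m) = frobIncl L (f m) := rfl

variable {S : LocalShtuka L M} (c : CM S E)

/-- The action of `O_E` on `σ^*M`. -/
def frobAct : OE k E →+* Module.End (RZ L) (FrobPull L M) where
  toFun a := frobMap L (c.act a)
  map_one' := by
    refine LinearMap.ext fun x => ?_
    induction x using frobPull_induction with
    | h g m => rw [map_smul, frobMap_frobIncl, map_one]; rfl
    | hadd x y hx hy => rw [map_add, map_add, hx, hy]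
  map_mul' a b := by
    refine LinearMap.ext fun x => ?_
    induction x using frobPull_induction with
    | h g m =>
      rw [map_smul, map_smul, frobMap_frobIncl, map_mul]; rfl
    | hadd x y hx hy => rw [map_add, map_add, hx, hy]
  map_zero' := by
    refine LinearMap.ext fun x => ?_
    induction x using frobPull_induction with
    | h g m =>
      rw [map_smul, frobMap_frobIncl, map_zero, LinearMap.zero_apply, map_zero, smul_zero]; rfl
    | hadd x y hx hy => rw [map_add, map_add, hx, hy]
  map_add' a b := by
    refine LinearMap.ext fun x => ?_
    induction x using frobPull_induction with
    | h g m =>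
      rw [map_smul, frobMap_frobIncl, map_add, LinearMap.add_apply, LinearMap.add_apply, map_add,
        map_smul, map_smul, frobMap_frobIncl, frobMap_frobIncl, smul_add]
    | hadd x y hx hy =>
      rw [LinearMap.map_add, hx, hy]
      exact (map_add (frobMap L (c.act a) + frobMap L (c.act b)) x y).symm

theorem orbitMap_apply {N : Type*} [AddCommGroup N] [Module (RZ L) N]
    {ρ : OE k E →+* Module.End (RZ L) N} (hρ : IsCompatible ρ) (n : N)
    (x : RZ L ⊗[k⟦X⟧] OE k E) : orbitMap hρ n x = extAct hρ x n := rfl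

theorem isCompatible_act : IsCompatible c.act := c.act_algebraMap

theorem isCompatible_frobAct : IsCompatible (frobAct c) := fun a x => by
  change frobMap L (c.act (algebraMap k⟦X⟧ (OE k E) a)) x = _
  induction x using frobPull_induction with
  | h g m =>
    rw [map_smul, frobMap_frobIncl, c.act_algebraMap, LinearMap.map_smulₛₗ, sigma_algebraMap,
      smul_comm]
  | hadd x y hx hy => rw [map_add, smul_add, hx, hy]

theorem extAct_frobAct_frobIncl (x : RZ L ⊗[k⟦X⟧] OE k E) (m : M) :
    extAct (isCompatible_frobAct c)
      (Algebra.TensorProduct.map (sigmaAlg L) (AlgHom.id k⟦X⟧ (OE k E)) x) (frobIncl L m) =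
      frobIncl L (extAct (isCompatible_act c) x m) := by
  induction x with
  | zero => simp
  | add x y hx hy => simp only [map_add, LinearMap.add_apply, hx, hy]
  | tmul g a =>
    rw [Algebra.TensorProduct.map_tmul, extAct_tmul, extAct_tmul, LinearMap.map_smulₛₗ]
    rfl

theorem tau_extAct (x : RZ L ⊗[k⟦X⟧] OE k E) (n : LocalizedModule (SS L) (FrobPull L M)) :
    S.tau (LocalizedModule.map (SS L) (extAct (isCompatible_frobAct c) x) n) =
      LocalizedModule.map (SS L) (extAct (isCompatible_act c) x) (S.tau n) := by
  induction x with
  | zero => simp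
  | add x y hx hy => simp only [map_add, LinearMap.add_apply, hx, hy]
  | tmul g a =>
    have h1 : extAct (isCompatible_frobAct c) (g ⊗ₜ a) = g • frobMap L (c.act a) := rfl
    have h2 : extAct (isCompatible_act c) (g ⊗ₜ a) = g • c.act a := rfl
    rw [h1, h2, map_smul, map_smul, LinearMap.smul_apply, LinearMap.smul_apply, map_smul, c.act_tau]

variable (L) in
theorem zMinusZeta_ne_zero : zMinusZeta L ≠ 0 := fun h => by
  have h1 := congrArg (PowerSeries.coeff (R := VR L) 1) h
  have h2 : PowerSeries.coeff 1 (PowerSeries.X - PowerSeries.C (zeta L) : (VR L)⟦X⟧) = 0 := h1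
  simp at h2

end FrobAct

section Nonzero

variable {k : Type*} [Field k] [Fintype k] {L : IntermediateField k⸨X⸩ (Qalg k)}
  [FiniteDimensional k⸨X⸩ L] [Algebra.IsSeparable k⸨X⸩ L]
variable {E : Type*} [CommRing E] [Algebra k⸨X⸩ E] [Algebra k⟦X⟧ E] [IsScalarTower k⟦X⟧ k⸨X⸩ E]
  [Module.Finite k⸨X⸩ E] [IsSemisimpleRing E] [Algebra.IsSeparable k⸨X⸩ E]
variable {y : OE k E} (hy : IsUniformizing y) (hL : ∀ (φ : E →ₐ[k⸨X⸩] Qalg k) (e : E), φ e ∈ L)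
variable {M : Type*} [AddCommGroup M] [Module (RZ L) M] {S : LocalShtuka L M} (c : CM S E)

/-- Frobenius maps the idempotent of a branch to the idempotent of the next branch, so `τ` relates
the components of `M` at the branches. -/
theorem branchAct_frobPerm_eq_zero {χ : Branch hy hL}
    (h : branchAct (N := M) (isCompatible_act c) (Pi.single χ 1) = 0) :
    branchAct (N := M) (isCompatible_act c) (Pi.single (frobPerm χ) 1) = 0 := by
  set ε := (omega hy hL (presRZ L)).symm (Pi.single χ 1) with hε
  have h1 : Algebra.TensorProduct.map (sigmaAlg L) (AlgHom.id k⟦X⟧ (OE k E)) ε =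
      (omega hy hL (presRZ L)).symm (Pi.single (frobPerm χ) 1) := by
    apply (omega hy hL (presRZ L)).injective
    rw [RingEquiv.apply_symm_apply]
    funext χ'
    obtain ⟨χ', rfl⟩ := frobPerm.surjective χ'
    rw [omega_apply, omegaAt_frob χ' (presRZ L) (sigmaAlg L) (fun _ => rfl), ← omega_apply, hε,
      RingEquiv.apply_symm_apply]
    by_cases hne : χ' = χ
    · subst hne; simp
    · rw [Pi.single_eq_of_ne hne, Pi.single_eq_of_ne (fun h => hne (frobPerm.injective h)), map_zero]
  have h2 : extAct (isCompatible_frobAct c) ((omega hy hL (presRZ L)).symm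
      (Pi.single (frobPerm χ) 1)) = 0 := by
    rw [← h1]
    refine LinearMap.ext fun x => ?_
    induction x using frobPull_induction with
    | h g m =>
      rw [map_smul, extAct_frobAct_frobIncl]
      have h3 : extAct (isCompatible_act c) ε m = 0 := LinearMap.congr_fun h m
      rw [h3, map_zero, smul_zero]; rfl
    | hadd x y hx hy => rw [map_add, map_add, hx, hy]
  refine LinearMap.ext fun m => ?_
  have := S.free
  obtain ⟨n, hn⟩ := S.tau.surjective (LocalizedModule.mkLinearMap (SS L) M m)
  have h3 := tau_extAct c ((omega hy hL (presRZ L)).symm (Pi.single (frobPerm χ) 1)) n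
  rw [h2, map_zero, LinearMap.zero_apply, map_zero, hn] at h3
  have h4 : LocalizedModule.mkLinearMap (SS L) M
      (branchAct (isCompatible_act c) (Pi.single (frobPerm χ) 1) m) = 0 := by
    rw [h3]
    simp [LocalizedModule.map_mk, branchAct]
  rw [← map_zero (LocalizedModule.mkLinearMap (SS L) M), IsLocalizedModule.eq_iff_exists (SS L)] at h4
  obtain ⟨⟨_, n, rfl⟩, hs⟩ := h4
  rw [smul_zero] at hs
  have h5 : zMinusZeta L ^ n • branchAct (isCompatible_act c) (Pi.single (frobPerm χ) 1) m = 0 := hs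
  exact (smul_eq_zero.1 h5).resolve_left (pow_ne_zero _ (zMinusZeta_ne_zero L))

/-- The components of `M` at the branches are nonzero, because `O_E` acts faithfully. -/
theorem branchAct_single_ne_zero (χ₀ : Branch hy hL) :
    branchAct (N := M) (isCompatible_act c) (Pi.single χ₀ 1) ≠ 0 := by
  classical
  intro h0
  -- The set `U` of the branches without component is invariant under Frobenius, so its indicator
  -- function is an element `1 ⊗ a`, and `a` acts as zero on `M`.
  let U : Finset (Branch hy hL) := Finset.univ.filter fun χ =>
    branchAct (N := M) (isCompatible_act c) (Pi.single χ 1) = 0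
  have hU : ∀ χ, χ ∈ U ↔ branchAct (N := M) (isCompatible_act c) (Pi.single χ 1) = 0 := fun χ => by
    simp [U]
  have hs : ∀ χ, frobPerm χ ∈ U ↔ χ ∈ U := by
    have h1 : U.map frobPerm.toEmbedding = U := by
      refine Finset.eq_of_subset_of_card_le (fun χ hχ => ?_) (by rw [Finset.card_map])
      obtain ⟨χ', h, rfl⟩ := Finset.mem_map.1 hχ
      exact (hU _).2 (branchAct_frobPerm_eq_zero hy hL c ((hU _).1 h))
    intro χ
    conv_lhs => rw [← h1]
    simp
  let f : Branch hy hL → (VR L)⟦X⟧ := fun χ => if χ ∈ U then 1 else 0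
  have hf : f = ∑ χ ∈ U, Pi.single χ 1 := by
    funext χ
    simp [f, Finset.sum_apply, Pi.single_apply]
  set x := (omega hy hL (presRZ L)).symm f with hx
  have h1 : Algebra.TensorProduct.map (sigmaAlg L) (AlgHom.id k⟦X⟧ (OE k E)) x = x := by
    apply (omega hy hL (presRZ L)).injective
    funext χ'
    obtain ⟨χ', rfl⟩ := frobPerm.surjective χ'
    rw [omega_apply, omegaAt_frob χ' (presRZ L) (sigmaAlg L) (fun _ => rfl), ← omega_apply, hx,
      RingEquiv.apply_symm_apply]
    simp only [f, hs]
    split_ifs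
    · rw [map_one]
    · rw [map_zero]
  obtain ⟨a, ha⟩ := exists_one_tmul_eq_of_frob_eq (hL := hL) (presRZ L) (sigmaAlg L) (fun _ => rfl) x h1
  have h2 : branchAct (N := M) (isCompatible_act c) f = 0 := by
    rw [hf, map_sum]
    exact Finset.sum_eq_zero fun χ hχ => (hU χ).1 hχ
  have h3 : c.act a = 0 := by
    refine LinearMap.ext fun m => ?_
    have h4 : extAct (isCompatible_act c) x m = 0 := LinearMap.congr_fun h2 m
    rw [ha, extAct_tmul, one_smul] at h4
    exact h4
  have h4 : a = 0 := c.act_injective (h3.trans (map_zero _).symm)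
  rw [h4, TensorProduct.tmul_zero] at ha
  have h5 : f = 0 := by
    rw [← (omega hy hL (presRZ L)).apply_symm_apply f, ← hx, ha, map_zero]
  have h6 := congrFun h5 χ₀
  simp only [f, (hU χ₀).2 h0, if_true, Pi.zero_apply] at h6
  exact one_ne_zero h6

include hy hL in
/-- A local shtuka with complex multiplication by `O_E` is free of rank one over
`R[[z]] ⊗ O_E`. -/
theorem exists_cyclic : ∃ m : M, Function.Bijective (orbitMap (isCompatible_act c) m) := by
  have := S.free
  have := S.finite
  exact exists_orbitMap_bijective (hy := hy) (hL := hL) (isCompatible_act c) c.finrank_eq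
    (branchAct_single_ne_zero hy hL c)

/-- A basis of `M` induces a basis of `σ^*M`. -/
def frobBasis {ι : Type*} (b : Module.Basis ι (RZ L) M) : Module.Basis ι (RZ L) (FrobPull L M) :=
  b.baseChange (FrobTw L)

theorem frobBasis_apply {ι : Type*} (b : Module.Basis ι (RZ L) M) (i : ι) :
    frobBasis b i = frobIncl L (b i) := Module.Basis.baseChange_apply _ _ _

theorem orbitMap_bijective_of_basis {N : Type*} [AddCommGroup N] [Module (RZ L) N]
    {ρ : OE k E →+* Module.End (RZ L) N} (hρ : IsCompatible ρ) {n : N} {ι : Type*}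
    (b : Module.Basis ι k⟦X⟧ (OE k E)) (b' : Module.Basis ι (RZ L) N) (h : ∀ i, b' i = ρ (b i) n) :
    Function.Bijective (orbitMap hρ n) := by
  have e : orbitMap hρ n = ((b.baseChange (RZ L)).equiv b' (Equiv.refl ι)).toLinearMap := by
    refine (b.baseChange (RZ L)).ext fun i => ?_
    rw [LinearEquiv.coe_coe, Module.Basis.equiv_apply, Equiv.refl_apply, h,
      Module.Basis.baseChange_apply]
    rw [orbitMap_apply, extAct_tmul, one_smul]
  rw [e]
  exact LinearEquiv.bijective _

include hL in
theorem orbitMap_frobIncl_bijective {m : M}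
    (hm : Function.Bijective (orbitMap (isCompatible_act c) m)) :
    Function.Bijective (orbitMap (isCompatible_frobAct c) (frobIncl L m)) := by
  obtain ⟨b, -, -⟩ := exists_basis_OE (k := k) hL
  refine orbitMap_bijective_of_basis (isCompatible_frobAct c) b
    (frobBasis ((b.baseChange (RZ L)).map (LinearEquiv.ofBijective _ hm))) fun i => ?_
  rw [frobBasis_apply, Module.Basis.map_apply, Module.Basis.baseChange_apply]
  rw [LinearEquiv.ofBijective_apply, orbitMap_apply, extAct_tmul, one_smul]
  rfl

end Nonzero

/-! ### Trivializations: `M` and `σ^*M` as copies of `R[[z]] ⊗ O_E` -/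

section Theta

variable {k : Type*} [Field k] [Fintype k] {L : IntermediateField k⸨X⸩ (Qalg k)}
variable {E : Type*} [CommRing E] [Algebra k⸨X⸩ E] [Algebra k⟦X⟧ E]
variable {N : Type*} [AddCommGroup N] [Module (RZ L) N] {ρ : OE k E →+* Module.End (RZ L) N}
  (hρ : IsCompatible ρ) {n : N} (hn : Function.Bijective (orbitMap hρ n))
variable (B : Type*) [CommRing B] [Algebra (RZ L) B] [Algebra k⟦X⟧ B] [IsScalarTower k⟦X⟧ (RZ L) B]

/-- The isomorphism `B ⊗ O_E ≅ B ⊗ N` defined by a generator of `N`. -/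
def theta : B ⊗[k⟦X⟧] OE k E ≃ₗ[B] B ⊗[RZ L] N :=
  (TensorProduct.AlgebraTensorModule.cancelBaseChange k⟦X⟧ (RZ L) B B (OE k E)).symm ≪≫ₗ
    TensorProduct.AlgebraTensorModule.congr (LinearEquiv.refl B B) (LinearEquiv.ofBijective _ hn)

theorem theta_tmul (b : B) (a : OE k E) : theta hρ hn B (b ⊗ₜ a) = b ⊗ₜ ρ a n := by
  rw [theta, LinearEquiv.trans_apply,
    TensorProduct.AlgebraTensorModule.cancelBaseChange_symm_tmul,
    TensorProduct.AlgebraTensorModule.congr_tmul, LinearEquiv.refl_apply,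
    LinearEquiv.ofBijective_apply, orbitMap_apply, extAct_tmul, one_smul]

variable (k E L) in
/-- The homomorphism `R[[z]] ⊗ O_E → B ⊗ O_E`. -/
def baseMap : RZ L ⊗[k⟦X⟧] OE k E →ₐ[k⟦X⟧] B ⊗[k⟦X⟧] OE k E :=
  Algebra.TensorProduct.map (IsScalarTower.toAlgHom k⟦X⟧ (RZ L) B) (AlgHom.id k⟦X⟧ (OE k E))

theorem baseMap_tmul (g : RZ L) (a : OE k E) :
    baseMap k L E B (g ⊗ₜ a) = algebraMap (RZ L) B g ⊗ₜ a := rfl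

theorem theta_baseMap (x : RZ L ⊗[k⟦X⟧] OE k E) :
    theta hρ hn B (baseMap k L E B x) = 1 ⊗ₜ extAct hρ x n := by
  induction x with
  | zero => simp
  | add x y hx hy => rw [map_add, map_add, hx, hy, map_add, LinearMap.add_apply,
      TensorProduct.tmul_add]
  | tmul g a => rw [baseMap_tmul, theta_tmul, extAct_tmul, TensorProduct.tmul_smul,
      TensorProduct.smul_tmul', Algebra.smul_def, mul_one]

theorem theta_one_tmul_mul (a : OE k E) (x : B ⊗[k⟦X⟧] OE k E) :
    theta hρ hn B ((1 ⊗ₜ a) * x) = (ρ a).lTensor B (theta hρ hn B x) := by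
  induction x with
  | zero => simp
  | add x y hx hy => rw [mul_add, map_add, map_add, map_add, hx, hy]
  | tmul b a' =>
    rw [Algebra.TensorProduct.tmul_mul_tmul, one_mul, theta_tmul, theta_tmul, LinearMap.lTensor_tmul,
      map_mul]
    rfl

variable {B} in
theorem theta_map {B' : Type*} [CommRing B'] [Algebra (RZ L) B'] [Algebra k⟦X⟧ B']
    [IsScalarTower k⟦X⟧ (RZ L) B'] (f : B →ₐ[RZ L] B') (x : B ⊗[k⟦X⟧] OE k E) :
    theta hρ hn B' (Algebra.TensorProduct.map (f.restrictScalars k⟦X⟧)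
      (AlgHom.id k⟦X⟧ (OE k E)) x) = LinearMap.rTensor N f.toLinearMap (theta hρ hn B x) := by
  induction x with
  | zero => simp
  | add x y hx hy => rw [map_add, map_add, hx, hy, map_add, map_add]
  | tmul b a => rw [Algebra.TensorProduct.map_tmul, theta_tmul, theta_tmul]; rfl

end Theta

section Trivialization

variable {k : Type*} [Field k] [Fintype k] {L : IntermediateField k⸨X⸩ (Qalg k)}
variable {E : Type*} [CommRing E] [Algebra k⸨X⸩ E] [Algebra k⟦X⟧ E]
variable {M : Type*} [AddCommGroup M] [Module (RZ L) M] {S : LocalShtuka L M}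

/-- A generator `m` of `M` over `R[[z]] ⊗ O_E`, together with elements `t`, `t'` and exponents
`n`, `n'` such that `τ` and `τ⁻¹` correspond to multiplication by `t / (z - ζ)^n` and
`t' / (z - ζ)^n'`. -/
structure Triv (c : CM S E) where
  gen : M
  bij : Function.Bijective (orbitMap (isCompatible_act c) gen)
  bijF : Function.Bijective (orbitMap (isCompatible_frobAct c) (frobIncl L gen))
  n : ℕ
  t : RZ L ⊗[k⟦X⟧] OE k E
  tau_eq : ∀ x, zMinusZeta L ^ n • S.tau (LocalizedModule.mkLinearMap (SS L) (FrobPull L M)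
    (extAct (isCompatible_frobAct c) x (frobIncl L gen))) =
      LocalizedModule.mkLinearMap (SS L) M (extAct (isCompatible_act c) (t * x) gen)
  n' : ℕ
  t' : RZ L ⊗[k⟦X⟧] OE k E
  tau_symm_eq : ∀ x, zMinusZeta L ^ n' • S.tau.symm (LocalizedModule.mkLinearMap (SS L) M
    (extAct (isCompatible_act c) x gen)) =
      LocalizedModule.mkLinearMap (SS L) (FrobPull L M)
        (extAct (isCompatible_frobAct c) (t' * x) (frobIncl L gen))

theorem localizedModule_map_mkLinearMap {N : Type*} [AddCommGroup N] [Module (RZ L) N]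
    (f : N →ₗ[RZ L] N) (n : N) : LocalizedModule.map (SS L) f
      (LocalizedModule.mkLinearMap (SS L) N n) = LocalizedModule.mkLinearMap (SS L) N (f n) := by
  simp [LocalizedModule.map_mk]

theorem localizedModule_map_smul {N : Type*} [AddCommGroup N] [Module (RZ L) N]
    (f : N →ₗ[RZ L] N) (g : RZ L) (x : LocalizedModule (SS L) N) :
    LocalizedModule.map (SS L) f (g • x) = g • LocalizedModule.map (SS L) f x :=
  ((LocalizedModule.map (SS L) f).restrictScalars (RZ L)).map_smul g x

theorem exists_pow_smul_eq {N : Type*} [AddCommGroup N] [Module (RZ L) N]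
    (x : LocalizedModule (SS L) N) :
    ∃ (j : ℕ) (n : N), zMinusZeta L ^ j • x = LocalizedModule.mkLinearMap (SS L) N n := by
  obtain ⟨⟨n, ⟨_, j, rfl⟩⟩, h⟩ := IsLocalizedModule.surj (SS L) (LocalizedModule.mkLinearMap (SS L) N) x
  exact ⟨j, n, h⟩

theorem nonempty_triv (c : CM S E) {m : M}
    (hm : Function.Bijective (orbitMap (isCompatible_act c) m))
    (hm' : Function.Bijective (orbitMap (isCompatible_frobAct c) (frobIncl L m))) :
    Nonempty (Triv c) := by
  obtain ⟨n, m₁, h₁⟩ := exists_pow_smul_eq (S.tau (LocalizedModule.mkLinearMap (SS L) _ (frobIncl L m)))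
  obtain ⟨t, rfl⟩ := hm.2 m₁
  obtain ⟨n', m₂, h₂⟩ := exists_pow_smul_eq (S.tau.symm (LocalizedModule.mkLinearMap (SS L) _ m))
  obtain ⟨t', rfl⟩ := hm'.2 m₂
  refine ⟨⟨m, hm, hm', n, t, fun x => ?_, n', t', fun x => ?_⟩⟩
  · rw [← localizedModule_map_mkLinearMap, tau_extAct,
      ← localizedModule_map_smul, h₁,
      localizedModule_map_mkLinearMap, orbitMap_apply, mul_comm, map_mul]
    rfl
  · apply S.tau.injective
    rw [map_smul, LinearEquiv.apply_symm_apply, mul_comm, map_mul, Module.End.mul_apply,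
      ← orbitMap_apply _ _ t', ← localizedModule_map_mkLinearMap _ (orbitMap (L := L) (E := E) _ _ _), tau_extAct, ← h₂,
      map_smul, LinearEquiv.apply_symm_apply, localizedModule_map_smul,
      localizedModule_map_mkLinearMap]

variable {c : CM S E} (D : Triv c)

theorem Triv.t_mul_t' : D.t * D.t' = (zMinusZeta L ^ (D.n + D.n')) ⊗ₜ 1 := by
  apply D.bij.1
  rw [orbitMap_apply, orbitMap_apply, extAct_tmul, map_one, Module.End.one_apply]
  have h1 := D.tau_symm_eq 1
  rw [mul_one, map_one, Module.End.one_apply] at h1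
  have h2 := congrArg S.tau h1
  rw [map_smul, LinearEquiv.apply_symm_apply] at h2
  have h3 := congrArg (fun x => zMinusZeta L ^ D.n • x) h2
  simp only [D.tau_eq, smul_smul, ← pow_add] at h3
  rw [← map_smul] at h3
  have h4 := (IsLocalizedModule.eq_iff_exists (SS L) (LocalizedModule.mkLinearMap (SS L) M)).1 h3
  obtain ⟨⟨_, j, rfl⟩, hs⟩ := h4
  have := S.free
  have h5 : zMinusZeta L ^ j • (zMinusZeta L ^ (D.n + D.n') • D.gen) =
    zMinusZeta L ^ j • extAct (isCompatible_act c) (D.t * D.t') D.gen := hs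
  exact (smul_right_injective M (pow_ne_zero j (zMinusZeta_ne_zero L)) h5).symm

variable (B : Type*) [CommRing B] [Algebra (RZ L) B] [Algebra k⟦X⟧ B] [IsScalarTower k⟦X⟧ (RZ L) B]
  (hB : IsUnit (algebraMap (RZ L) B (zMinusZeta L)))

/-- The isomorphism `B ⊗ O_E ≅ B ⊗ M`. -/
def Triv.theta : B ⊗[k⟦X⟧] OE k E ≃ₗ[B] B ⊗[RZ L] M :=
  LocSht.theta (isCompatible_act c) D.bij B

/-- The isomorphism `B ⊗ O_E ≅ B ⊗ σ^*M`. -/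
def Triv.thetaF : B ⊗[k⟦X⟧] OE k E ≃ₗ[B] B ⊗[RZ L] FrobPull L M :=
  LocSht.theta (isCompatible_frobAct c) D.bijF B

theorem locToB_mkLinearMap {N : Type*} [AddCommGroup N] [Module (RZ L) N] (n : N) :
    locToB B hB N (LocalizedModule.mkLinearMap (SS L) N n) = 1 ⊗ₜ n := by
  simp [locToB, LocalizedModule.lift_mk]

theorem exists_smul_eq_baseMap (b : B) (a : OE k E) :
    b ⊗ₜ[k⟦X⟧] a = b • baseMap k L E B (1 ⊗ₜ a) := by
  rw [baseMap_tmul, map_one, TensorProduct.smul_tmul', smul_eq_mul, mul_one]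

theorem Triv.tauB_thetaF (x : B ⊗[k⟦X⟧] OE k E) :
    algebraMap (RZ L) B (zMinusZeta L) ^ D.n • tauB B S hB (D.thetaF B x) =
      D.theta B (baseMap k L E B D.t * x) := by
  induction x with
  | zero => simp
  | add x y hx hy => rw [mul_add, map_add, map_add, smul_add, hx, hy, map_add]
  | tmul b a =>
    have h : algebraMap (RZ L) B (zMinusZeta L) ^ D.n •
        tauB B S hB (D.thetaF B (baseMap k L E B (1 ⊗ₜ a))) =
        D.theta B (baseMap k L E B (D.t * (1 ⊗ₜ a))) := by
      rw [thetaF, theta_baseMap, theta, theta_baseMap, tauB, LinearMap.liftBaseChange_tmul,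
        one_smul, LinearMap.comp_apply, LinearMap.comp_apply, LinearEquiv.coe_coe, ← map_pow,
        algebraMap_smul, ← map_smul, D.tau_eq, locToB_mkLinearMap]
    rw [exists_smul_eq_baseMap (L := L) B b a, map_smul, map_smul, smul_comm, h, mul_smul_comm, map_smul,
      map_mul]

theorem Triv.tauInvB_theta (x : B ⊗[k⟦X⟧] OE k E) :
    algebraMap (RZ L) B (zMinusZeta L) ^ D.n' • tauInvB B S hB (D.theta B x) =
      D.thetaF B (baseMap k L E B D.t' * x) := by
  induction x with
  | zero => simp
  | add x y hx hy => rw [mul_add, map_add, map_add, smul_add, hx, hy, map_add]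
  | tmul b a =>
    have h : algebraMap (RZ L) B (zMinusZeta L) ^ D.n' •
        tauInvB B S hB (D.theta B (baseMap k L E B (1 ⊗ₜ a))) =
        D.thetaF B (baseMap k L E B (D.t' * (1 ⊗ₜ a))) := by
      rw [thetaF, theta_baseMap, theta, theta_baseMap, tauInvB, LinearMap.liftBaseChange_tmul,
        one_smul, LinearMap.comp_apply, LinearMap.comp_apply, LinearEquiv.coe_coe, ← map_pow,
        algebraMap_smul, ← map_smul, D.tau_symm_eq, locToB_mkLinearMap]
    rw [exists_smul_eq_baseMap (L := L) B b a, map_smul, map_smul, smul_comm, h, mul_smul_comm, map_smul,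
      map_mul]

end Trivialization

section Sep

variable {k : Type*} [Field k] [Fintype k] {L : IntermediateField k⸨X⸩ (Qalg k)}
variable {E : Type*} [CommRing E] [Algebra k⸨X⸩ E] [Algebra k⟦X⟧ E]
variable {M : Type*} [AddCommGroup M] [Module (RZ L) M] {S : LocalShtuka L M} {c : CM S E}
  (D : Triv c)

variable (L) in
/-- The endomorphism `sigmaSep` of `L^sep[[z]]` as a homomorphism of `A_v`-algebras. -/
def sigmaSepAlg : LsepZ L →ₐ[k⟦X⟧] LsepZ L :=
  { sigmaSep L with commutes' := sigmaSep_algebraMap_base L }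

theorem Triv.sigmaB_theta (x : LsepZ L ⊗[k⟦X⟧] OE k E) :
    sigmaB L M (D.theta (LsepZ L) x) = D.thetaF (LsepZ L)
      (Algebra.TensorProduct.map (sigmaSepAlg L) (AlgHom.id k⟦X⟧ (OE k E)) x) := by
  induction x with
  | zero => simp
  | add x y hx hy => rw [map_add, map_add, map_add, map_add, hx, hy]
  | tmul b a =>
    rw [Algebra.TensorProduct.map_tmul, thetaF, theta, theta_tmul, theta_tmul]
    rfl

theorem Triv.mem_H1v_iff (x : LsepZ L ⊗[k⟦X⟧] OE k E) :
    D.theta (LsepZ L) x ∈ H1v S ↔ baseMap k L E (LsepZ L) D.t *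
      Algebra.TensorProduct.map (sigmaSepAlg L) (AlgHom.id k⟦X⟧ (OE k E)) x =
        algebraMap (RZ L) (LsepZ L) (zMinusZeta L) ^ D.n • x := by
  have h := D.tauB_thetaF (LsepZ L) (isUnit_zMinusZeta_LsepZ L)
    (Algebra.TensorProduct.map (sigmaSepAlg L) (AlgHom.id k⟦X⟧ (OE k E)) x)
  rw [← D.sigmaB_theta] at h
  rw [← (D.theta (LsepZ L)).injective.eq_iff, ← h, map_smul,
    (isUnit_zMinusZeta_LsepZ L).pow D.n |>.smul_left_cancel]
  rfl

end Sep

/-! ### Frobenius equations over a separably closed field -/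

section Lang

/-- A family of maps along a permutation of a finite set has an invariant section as soon as the
return map of each point has a fixed point. -/
theorem exists_equivariant_section {X W : Type*} [Finite X] (s : Equiv.Perm X) (G : X → W → W)
    (F : X × W → X × W) (hF : ∀ χ w, F (χ, w) = (s χ, G χ w))
    (h : ∀ χ, ∃ w, F^[Function.minimalPeriod s χ] (χ, w) = (χ, w)) :
    ∃ x : X → W, ∀ χ, x (s χ) = G χ (x χ) := by
  choose w hw using h
  have hfst : ∀ (n : ℕ) (p : X × W), (F^[n] p).1 = s^[n] p.1 := fun n => by
    induction n with
    | zero => intro p; rfl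
    | succ n ih => intro p; rw [Function.iterate_succ_apply, Function.iterate_succ_apply, ih, hF]
  let rep : X → X := fun χ => (Quotient.mk (Equiv.Perm.SameCycle.setoid s) χ).out
  have hrep : ∀ χ, ∃ n : ℕ, s^[n] (rep χ) = χ := fun χ => by
    have h1 : Equiv.Perm.SameCycle s (rep χ) χ := Quotient.mk_out (s := Equiv.Perm.SameCycle.setoid s) χ
    obtain ⟨n, -, hn⟩ := h1.exists_pow_eq'
    exact ⟨n, by rw [Equiv.Perm.iterate_eq_pow, hn]⟩
  have hrep_s : ∀ χ, rep (s χ) = rep χ := fun χ => by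
    refine congrArg Quotient.out (Quotient.sound (s := Equiv.Perm.SameCycle.setoid s) ?_)
    exact (Equiv.Perm.sameCycle_apply_left).2 (Equiv.Perm.SameCycle.refl _ _)
  choose n hn using hrep
  have hwell : ∀ (r : X) (a b : ℕ), s^[a] r = s^[b] r → F^[a] (r, w r) = F^[b] (r, w r) := by
    intro r a b hab
    have hp : 0 < Function.minimalPeriod s r :=
      Function.minimalPeriod_pos_of_mem_periodicPts
        (Function.Injective.mem_periodicPts s.injective r)
    have h1 : Function.IsPeriodicPt F (Function.minimalPeriod s r) (r, w r) := hw r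
    rw [← h1.iterate_mod_apply a, ← h1.iterate_mod_apply b]
    rw [← Function.iterate_mod_minimalPeriod_eq (n := a),
      ← Function.iterate_mod_minimalPeriod_eq (n := b)] at hab
    rw [(Function.iterate_eq_iterate_iff_of_lt_minimalPeriod (Nat.mod_lt _ hp)
      (Nat.mod_lt _ hp)).1 hab]
  refine ⟨fun χ => (F^[n χ] (rep χ, w (rep χ))).2, fun χ => ?_⟩
  have h1 : F^[n χ] (rep χ, w (rep χ)) = (χ, (F^[n χ] (rep χ, w (rep χ))).2) :=
    Prod.ext ((hfst _ _).trans (hn χ)) rfl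
  have h2 : F^[n (s χ)] (rep χ, w (rep χ)) = F^[n χ + 1] (rep χ, w (rep χ)) := by
    refine hwell _ _ _ ?_
    have h3 := hn (s χ)
    rw [hrep_s] at h3
    rw [Function.iterate_succ_apply', hn χ, h3]
  simp only [hrep_s]
  rw [h2, Function.iterate_succ_apply', h1, hF]

/-- The sequence of coefficients that is defined by the recursion `w_(n+1) = r(∑ c_(n+1-j) w_j^Q)`. -/
def langSeq {F : Type*} [Field F] (c : ℕ → F) (r : F → F) (w : F) (Q : ℕ) : ℕ → F
  | 0 => w
  | n + 1 => r (∑ j : Fin (n + 1), c (n + 1 - j) * langSeq c r w Q j ^ Q)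
  decreasing_by exact j.2

variable {k : Type*} [Field k] [Fintype k] {F : Type*} [Field F] [Algebra k F]

theorem coeff_frobS_iterate {D : Type*} [CommRing D] [Algebra k D] (g : D⟦X⟧) (p n : ℕ) :
    PowerSeries.coeff n ((frobS (k := k) D)^[p] g) = PowerSeries.coeff n g ^ Fintype.card k ^ p := by
  induction p generalizing g with
  | zero => simp
  | succ p ih => rw [Function.iterate_succ_apply, ih, coeff_frobS, ← pow_mul, pow_succ']

/-- Lang's theorem for power series: over a separably closed field the equation `c σ^p(w) = w` has
a solution among the units, for each unit `c`. -/
theorem exists_unit_mul_frobS_eq [IsSepClosed F] (c : F⟦X⟧ˣ) {p : ℕ} (hp : 0 < p) :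
    ∃ w : F⟦X⟧ˣ, (c : F⟦X⟧) * (frobS (k := k) F)^[p] w = w := by
  set Q := Fintype.card k ^ p with hQ
  have hQ2 : 2 ≤ Q := le_trans Fintype.one_lt_card (Nat.le_self_pow hp.ne' _)
  have hQ0 : (Q : F) = 0 := by
    have h : ((Q : k) : k) = 0 := by
      rw [hQ, Nat.cast_pow, FiniteField.cast_card_eq_zero, zero_pow hp.ne']
    rw [← map_natCast (algebraMap k F), h, map_zero]
  set c0 := PowerSeries.coeff 0 (c : F⟦X⟧) with hc0
  have hc0' : c0 ≠ 0 := by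
    rw [hc0, PowerSeries.coeff_zero_eq_constantCoeff_apply]
    exact (c.isUnit.map (PowerSeries.constantCoeff (R := F))).ne_zero
  have : NeZero ((Q - 1 : ℕ) : F) := ⟨by rw [Nat.cast_sub (by omega), hQ0]; simp⟩
  obtain ⟨w0, hw0⟩ := IsSepClosed.exists_pow_nat_eq c0⁻¹ (Q - 1)
  have hw0' : w0 ≠ 0 := by
    rintro rfl
    rw [zero_pow (by omega)] at hw0
    exact inv_ne_zero hc0' hw0.symm
  have hr : ∀ b, ∃ a, c0 * a ^ Q + b = a := fun b => by
    obtain ⟨a, ha⟩ := IsSepClosed.exists_root_C_mul_X_pow_add_C_mul_X_add_C c0 (-1) b hQ0 hQ2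
      (neg_ne_zero.2 one_ne_zero)
    exact ⟨a, by linear_combination ha⟩
  choose r hr using hr
  let f := langSeq (fun n => PowerSeries.coeff n (c : F⟦X⟧)) r w0 Q
  have hf0 : f 0 = w0 := by simp only [f, langSeq]
  have hunit : IsUnit (PowerSeries.mk f) := by
    rw [PowerSeries.isUnit_iff_constantCoeff, ← PowerSeries.coeff_zero_eq_constantCoeff_apply,
      PowerSeries.coeff_mk, hf0]
    exact hw0'.isUnit
  refine ⟨hunit.unit, PowerSeries.ext fun n => ?_⟩
  rw [IsUnit.unit_spec, mul_comm, PowerSeries.coeff_mul]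
  simp only [coeff_frobS_iterate, PowerSeries.coeff_mk, ← hQ]
  rw [Finset.Nat.sum_antidiagonal_eq_sum_range_succ
    (fun i j => f i ^ Q * PowerSeries.coeff j (c : F⟦X⟧)), Finset.sum_range_succ, Nat.sub_self, ← hc0]
  rcases n with _ | n
  · rw [Finset.range_zero, Finset.sum_empty, zero_add, hf0]
    have h1 : w0 ^ Q = w0 ^ (Q - 1) * w0 := by rw [← pow_succ, Nat.sub_add_cancel (by omega)]
    rw [h1, hw0]
    field_simp
  · have h1 : f (n + 1) = r (∑ j : Fin (n + 1),
        PowerSeries.coeff (n + 1 - j) (c : F⟦X⟧) * f j ^ Q) := by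
      simp only [f]; rw [langSeq]
    rw [Finset.sum_range]
    conv_rhs => rw [h1, ← hr, ← h1]
    rw [add_comm, mul_comm c0]
    simp only [mul_comm]

/-- Lang's theorem for a product of power series rings that are permuted by Frobenius. -/
theorem exists_units_frobS_eq_mul [IsSepClosed F] {X : Type*} [Finite X] (s : Equiv.Perm X)
    (T : X → F⟦X⟧ˣ) :
    ∃ x : X → F⟦X⟧ˣ, ∀ χ, frobS (k := k) F (x χ) = T (s χ) * x (s χ) := by
  let σ : F⟦X⟧ˣ →* F⟦X⟧ˣ := Units.map (frobS (k := k) F).toMonoidHom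
  obtain ⟨x, hx⟩ := exists_equivariant_section s (fun χ w => (T (s χ))⁻¹ * σ w)
    (fun p => (s p.1, (T (s p.1))⁻¹ * σ p.2)) (fun _ _ => rfl) (fun χ => by
      have h1 : ∀ n, ∃ c : F⟦X⟧ˣ, ∀ w, (fun p : X × F⟦X⟧ˣ => (s p.1, (T (s p.1))⁻¹ * σ p.2))^[n]
          (χ, w) = (s^[n] χ, c * σ^[n] w) := fun n => by
        induction n with
        | zero => exact ⟨1, fun w => by simp⟩
        | succ n ih =>
          obtain ⟨c, hc⟩ := ih
          refine ⟨(T (s (s^[n] χ)))⁻¹ * σ c, fun w => ?_⟩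
          rw [Function.iterate_succ_apply', hc, Function.iterate_succ_apply',
            Function.iterate_succ_apply', map_mul, mul_assoc]
      obtain ⟨c, hc⟩ := h1 (Function.minimalPeriod s χ)
      obtain ⟨w, hw⟩ := exists_unit_mul_frobS_eq (k := k) c
        (Function.minimalPeriod_pos_of_mem_periodicPts
          (Function.Injective.mem_periodicPts s.injective χ))
      refine ⟨w, ?_⟩
      rw [hc, Function.iterate_minimalPeriod]
      congr 1
      refine Units.ext ?_
      rw [Units.val_mul, ← hw]
      congr 1
      have h2 : ∀ (n : ℕ) (w : F⟦X⟧ˣ), ((σ^[n] w : F⟦X⟧ˣ) : F⟦X⟧) = (frobS (k := k) F)^[n] w := by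
        intro n
        induction n with
        | zero => intro w; rfl
        | succ n ih => intro w; rw [Function.iterate_succ_apply, Function.iterate_succ_apply, ih]; rfl
      rw [h2])
  refine ⟨x, fun χ => ?_⟩
  rw [hx, ← Units.val_mul, mul_inv_cancel_left]
  rfl

end Lang

/-! ### Power series with integral coefficients over the separable closure -/

section IntegralSeries

variable {k : Type*} [Field k] [Fintype k] (L : IntermediateField k⸨X⸩ (Qalg k))

instance : IsScalarTower k (VR L) (Lsep L) := IsScalarTower.of_algebraMap_eq fun _ => rfl

instance : IsSepClosed (Lsep L) := (separableClosure.isSepClosure L (Qalg k)).sep_closed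

/-- The valuation ring of the separable closure of `L`. -/
def osSubring : Subring (Lsep L) where
  carrier := {x | ‖x‖ ≤ 1}
  mul_mem' {x y} hx hy := by
    change ‖x * y‖ ≤ 1
    rw [norm_mul]; exact mul_le_one₀ hx (norm_nonneg _) hy
  one_mem' := norm_one.le
  add_mem' {x y} hx hy := (IsUltrametricDist.norm_add_le_max x y).trans (max_le hx hy)
  zero_mem' := by change ‖(0 : Lsep L)‖ ≤ 1; rw [norm_zero]; exact zero_le_one
  neg_mem' {x} hx := by change ‖-x‖ ≤ 1; rw [norm_neg]; exact hx

/-- The valuation ring of the separable closure of `L`, as a type. -/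
def OS : Type _ := osSubring L
instance : CommRing (OS L) := inferInstanceAs (CommRing (osSubring L))
instance : IsDomain (OS L) := inferInstanceAs (IsDomain (osSubring L))

/-- The inclusion of the valuation ring into the separable closure. -/
def osV : OS L →+* Lsep L := (osSubring L).subtype

instance : Algebra (VR L) (OS L) :=
  ((RtoLsep L).codRestrict (osSubring L) (fun x => norm_le_one L x) : VR L →+* OS L).toAlgebra

instance : Algebra k (OS L) :=
  ((algebraMap (VR L) (OS L)).comp (algebraMap k (VR L))).toAlgebra

instance : IsScalarTower k (VR L) (OS L) := IsScalarTower.of_algebraMap_eq fun _ => rfl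

/-- The inclusion of the valuation ring into the separable closure, as a homomorphism of algebras
over the valuation ring of `L`. -/
def osVal : OS L →ₐ[VR L] Lsep L := { osV L with commutes' := fun _ => rfl }

variable {L} in
theorem osV_injective : Function.Injective (osV L) := Subtype.val_injective

variable {L} in
theorem norm_osV_le_one (x : OS L) : ‖osV L x‖ ≤ 1 := x.2

variable {L} in
theorem exists_osV_eq {x : Lsep L} (hx : ‖x‖ ≤ 1) : ∃ a : OS L, osV L a = x := ⟨⟨x, hx⟩, rfl⟩

theorem osV_algebraMap (a : VR L) : osV L (algebraMap (VR L) (OS L) a) = RtoLsep L a := rfl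

variable {L} in
theorem algebraMap_OS_ne_zero {a : VR L} (h : a ≠ 0) : algebraMap (VR L) (OS L) a ≠ 0 := fun h1 =>
  h (Subtype.ext (norm_eq_zero.1 (by
    rw [← norm_RtoLsep, ← osV_algebraMap, h1, map_zero, norm_zero])))

variable {L} in
theorem isUnit_OS_iff {x : OS L} : IsUnit x ↔ ‖osV L x‖ = 1 := by
  constructor
  · intro hx
    obtain ⟨b, hb⟩ := isUnit_iff_exists_inv.1 hx
    refine le_antisymm (norm_osV_le_one x) ?_
    have h3 := congrArg norm (congrArg (osV L) hb)
    rw [map_mul, map_one, norm_mul, norm_one] at h3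
    rw [← h3]
    exact mul_le_of_le_one_right (norm_nonneg _) (norm_osV_le_one b)
  · intro h
    have h0 : osV L x ≠ 0 := fun h0 => by rw [h0, norm_zero] at h; exact zero_ne_one h
    obtain ⟨b, hb⟩ := exists_osV_eq (L := L) (x := (osV L x)⁻¹) (by rw [norm_inv, h, inv_one])
    refine IsUnit.of_mul_eq_one b (osV_injective ?_)
    rw [map_mul, hb, map_one, mul_inv_cancel₀ h0]

/-- The ring of power series in `z` with integral coefficients over the separable closure. -/
def OSZ : Type _ := (OS L)⟦X⟧
instance : CommRing (OSZ L) := inferInstanceAs (CommRing (OS L)⟦X⟧)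
instance : Nontrivial (OSZ L) := inferInstanceAs (Nontrivial (OS L)⟦X⟧)
instance : Algebra (RZ L) (OSZ L) :=
  (PowerSeries.map (algebraMap (VR L) (OS L)) : (VR L)⟦X⟧ →+* (OS L)⟦X⟧).toAlgebra
instance : Algebra k⟦X⟧ (OSZ L) :=
  ((algebraMap (RZ L) (OSZ L)).comp (algebraMap k⟦X⟧ (RZ L))).toAlgebra
instance : IsScalarTower k⟦X⟧ (RZ L) (OSZ L) := IsScalarTower.of_algebraMap_eq fun _ => rfl
instance : Nontrivial (LsepZ L) := inferInstanceAs (Nontrivial (Lsep L)⟦X⟧)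

/-- The presentation of `OSZ L` as a power series ring. -/
def presOS : SeriesPres k (OSZ L) (OS L) where
  equiv := RingEquiv.refl _
  equiv_algebraMap _ := PowerSeries.ext fun _ => rfl

/-- The presentation of `L^sep[[z]]` as a power series ring. -/
def presSep : SeriesPres k (LsepZ L) (Lsep L) where
  equiv := RingEquiv.refl _
  equiv_algebraMap _ := PowerSeries.ext fun _ => rfl

/-- The inclusion of the power series with integral coefficients into `L^sep⟨z/ζ⟩`. -/
def osToTate : OSZ L →ₐ[RZ L] TateSep L :=
  { (PowerSeries.map (osV L) : (OS L)⟦X⟧ →+* (Lsep L)⟦X⟧).codRestrict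
      (tate (RtoLsep L (zeta L))) (fun f => mem_tate_of_norm_le_one _
        ((norm_RtoLsep L _).trans_lt (norm_zeta_lt_one L)) _ fun n => by
          rw [PowerSeries.coeff_map]; exact norm_osV_le_one _) with
    commutes' := fun f => Subtype.ext (PowerSeries.ext fun n => rfl) }

/-- The inclusion of the power series with integral coefficients into `L^sep[[z]]`. -/
def osToSep : OSZ L →ₐ[RZ L] LsepZ L := (tateIncl L).comp (osToTate L)

theorem presSep_osToSep (f : OSZ L) : (presSep L).equiv (osToSep L f) =
    PowerSeries.map (osVal L).toRingHom ((presOS L).equiv f) := rfl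

/-- The Frobenius endomorphism of the ring of power series with integral coefficients. -/
def sigmaOS : OSZ L →ₐ[k⟦X⟧] OSZ L :=
  { (frobS (k := k) (OS L) : (OS L)⟦X⟧ →+* (OS L)⟦X⟧) with
    commutes' := fun f => PowerSeries.ext fun n => by
      change PowerSeries.coeff n (frobS (k := k) (OS L) (PowerSeries.map (algebraMap (VR L) (OS L))
        (PowerSeries.map (algebraMap k (VR L)) f))) = PowerSeries.coeff n
          (PowerSeries.map (algebraMap (VR L) (OS L)) (PowerSeries.map (algebraMap k (VR L)) f))
      rw [coeff_frobS, PowerSeries.coeff_map, PowerSeries.coeff_map, ← map_pow, ← map_pow,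
        pow_card_eq] }

theorem sigmaOS_apply (f : OSZ L) : (presOS L).equiv (sigmaOS L f) =
    frobS (k := k) (OS L) ((presOS L).equiv f) := rfl

theorem sigmaSepAlg_apply (f : LsepZ L) : (presSep L).equiv (sigmaSepAlg L f) =
    frobS (k := k) (Lsep L) ((presSep L).equiv f) := rfl

variable {L}

theorem norm_coeff_mul_le {a b : ℕ → Lsep L} {n : ℕ} (ha : ∀ i, ‖a i‖ ≤ 1)
    (hb : ∀ i < n, ‖b i‖ ≤ 1) : ‖PowerSeries.coeff n (PowerSeries.mk a * PowerSeries.mk b)‖ ≤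
      max 1 (‖a 0‖ * ‖b n‖) := by
  rw [PowerSeries.coeff_mul]
  refine IsUltrametricDist.norm_sum_le_of_forall_le_of_nonneg (le_max_of_le_left zero_le_one)
    fun p hp => ?_
  rw [Finset.HasAntidiagonal.mem_antidiagonal] at hp
  rw [PowerSeries.coeff_mk, PowerSeries.coeff_mk, norm_mul]
  rcases Nat.eq_zero_or_pos p.1 with h | h
  · rw [h, zero_add] at hp
    rw [h, hp]; exact le_max_right _ _
  · exact le_max_of_le_left (mul_le_one₀ (ha _) (norm_nonneg _) (hb _ (by omega)))

/-- Solutions of Frobenius equations with integral coefficients have integral coefficients. -/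
theorem norm_coeff_le_one_of_frobS_eq {X : Type*} [Finite X] (s : Equiv.Perm X)
    (T x : X → (Lsep L)⟦X⟧) (hT : ∀ χ n, ‖PowerSeries.coeff n (T χ)‖ ≤ 1)
    (hx : ∀ χ, frobS (k := k) (Lsep L) (x χ) = T (s χ) * x (s χ)) (n : ℕ) (χ : X) :
    ‖PowerSeries.coeff n (x χ)‖ ≤ 1 := by
  induction n using Nat.strong_induction_on generalizing χ with
  | _ n ih =>
  have : Nonempty X := ⟨χ⟩
  obtain ⟨χ0, h0⟩ := Finite.exists_max fun χ => ‖PowerSeries.coeff n (x χ)‖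
  refine (h0 χ).trans ?_
  by_contra! hlt
  have h1 := congrArg (fun g => ‖PowerSeries.coeff n g‖) (hx χ0)
  simp only [coeff_frobS, norm_pow] at h1
  have h2 := norm_coeff_mul_le (n := n) (a := fun i => PowerSeries.coeff i (T (s χ0)))
    (b := fun i => PowerSeries.coeff i (x (s χ0))) (hT _) (fun i hi => ih i hi _)
  have e : ∀ g : (Lsep L)⟦X⟧, PowerSeries.mk (fun i => PowerSeries.coeff i g) = g := fun g =>
    PowerSeries.ext fun n => by rw [PowerSeries.coeff_mk]
  rw [e, e, ← h1] at h2
  have h3 : max 1 (‖PowerSeries.coeff 0 (T (s χ0))‖ * ‖PowerSeries.coeff n (x (s χ0))‖) ≤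
      ‖PowerSeries.coeff n (x χ0)‖ :=
    max_le hlt.le ((mul_le_of_le_one_left (norm_nonneg _) (hT _ _)).trans (h0 _))
  have h4 := h2.trans h3
  have h5 : ‖PowerSeries.coeff n (x χ0)‖ < ‖PowerSeries.coeff n (x χ0)‖ ^ Fintype.card k := by
    conv_lhs => rw [← pow_one ‖PowerSeries.coeff n (x χ0)‖]
    exact pow_lt_pow_right₀ hlt Fintype.one_lt_card
  exact absurd h4 (not_le.2 h5)

/-- The Frobenius equation `σ(x) = T x` with integral coefficients has a solution with integral
coefficients and nonzero constant terms. -/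
theorem exists_OS_frobS_eq {X : Type*} [Finite X] (s : Equiv.Perm X)
    (T : X → (OS L)⟦X⟧) (hT : ∀ χ, PowerSeries.coeff 0 (T χ) ≠ 0) :
    ∃ x : X → (OS L)⟦X⟧, (∀ χ, frobS (k := k) (OS L) (x χ) = T (s χ) * x (s χ)) ∧
      ∀ χ, PowerSeries.coeff 0 (x χ) ≠ 0 := by
  have hinj : Function.Injective (PowerSeries.map (osV L)) := fun f g h =>
    PowerSeries.ext fun n => osV_injective (by
      have := congrArg (PowerSeries.coeff n) h
      rwa [PowerSeries.coeff_map, PowerSeries.coeff_map] at this)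
  have hu : ∀ χ, IsUnit (PowerSeries.map (osV L) (T χ)) := fun χ => by
    rw [PowerSeries.isUnit_iff_constantCoeff, ← PowerSeries.coeff_zero_eq_constantCoeff_apply,
      PowerSeries.coeff_map, isUnit_iff_ne_zero, Ne, map_eq_zero_iff _ osV_injective]
    exact hT χ
  obtain ⟨x, hx⟩ := exists_units_frobS_eq_mul (k := k) s fun χ => (hu χ).unit
  have hint := norm_coeff_le_one_of_frobS_eq s (fun χ => PowerSeries.map (osV L) (T χ))
    (fun χ => (x χ : (Lsep L)⟦X⟧))
    (fun χ n => by rw [PowerSeries.coeff_map]; exact norm_osV_le_one _) hx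
  choose a ha using fun χ n => exists_osV_eq (hint n χ)
  have hmap : ∀ χ, PowerSeries.map (osV L) (PowerSeries.mk (a χ)) = x χ := fun χ =>
    PowerSeries.ext fun n => by rw [PowerSeries.coeff_map, PowerSeries.coeff_mk, ha]
  refine ⟨fun χ => PowerSeries.mk (a χ), fun χ => hinj ?_, fun χ h => ?_⟩
  · rw [← frobS_map, hmap, map_mul, hmap, hx]; rfl
  · have h1 : PowerSeries.coeff 0 (x χ : (Lsep L)⟦X⟧) = 0 := by
      rw [PowerSeries.coeff_mk] at h
      rw [← ha, h, map_zero]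
    rw [PowerSeries.coeff_zero_eq_constantCoeff_apply] at h1
    exact ((x χ).isUnit.map (PowerSeries.constantCoeff (R := Lsep L))).ne_zero h1

end IntegralSeries

/-! ### The Carlitz eigenvector and the prime elements of the embeddings -/

section Carlitz

/-- If the constant coefficient of a series dominates on a disc that is larger than the disc of
radius `|c|`, then the inverse series converges on the latter. -/
theorem inv_mem_tate {F : Type*} [NormedField F] [IsUltrametricDist F] {c : F} {f : F⟦X⟧} {r : ℝ}
    (hr : ‖c‖ < r) (h0 : PowerSeries.coeff 0 f ≠ 0)
    (hf : ∀ i, ‖PowerSeries.coeff i f‖ * r ^ i ≤ ‖PowerSeries.coeff 0 f‖) : f⁻¹ ∈ tate c := by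
  have hr0 : 0 < r := (norm_nonneg c).trans_lt hr
  have hn0 : 0 < ‖PowerSeries.coeff 0 f‖ := norm_pos_iff.2 h0
  have hb : ∀ n, ‖PowerSeries.coeff n f⁻¹‖ * r ^ n ≤ ‖PowerSeries.coeff 0 f‖⁻¹ := fun n => by
    induction n using Nat.strong_induction_on with
    | _ n ih =>
    rw [PowerSeries.coeff_inv, ← PowerSeries.coeff_zero_eq_constantCoeff_apply]
    split_ifs with hn
    · rw [hn, pow_zero, mul_one, norm_inv]
    · rw [norm_mul, norm_neg, norm_inv, mul_assoc]
      refine mul_le_of_le_one_right (by positivity) ?_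
      rw [← le_div_iff₀ (pow_pos hr0 n)]
      refine IsUltrametricDist.norm_sum_le_of_forall_le_of_nonneg (by positivity) fun p hp => ?_
      rw [Finset.HasAntidiagonal.mem_antidiagonal] at hp
      split_ifs with hlt
      · rw [norm_mul, le_div_iff₀ (pow_pos hr0 n), ← hp, pow_add, mul_mul_mul_comm]
        calc _ ≤ ‖PowerSeries.coeff 0 f‖ * ‖PowerSeries.coeff 0 f‖⁻¹ :=
              mul_le_mul (hf _) (ih _ hlt) (by positivity) hn0.le
          _ = 1 := mul_inv_cancel₀ hn0.ne'
      · rw [norm_zero]; positivity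
  change PowerSeries.IsRestricted ‖c‖ _
  rw [PowerSeries.isRestricted_iff']
  have h1 : Tendsto (fun n => ‖PowerSeries.coeff 0 f‖⁻¹ * (‖c‖ / r) ^ n) atTop (𝓝 0) := by
    have := (tendsto_pow_atTop_nhds_zero_of_lt_one (r := ‖c‖ / r) (by positivity)
      ((div_lt_one hr0).2 hr)).const_mul ‖PowerSeries.coeff 0 f‖⁻¹
    rwa [mul_zero] at this
  refine squeeze_zero (fun n => by positivity) (fun n => ?_) h1
  rw [div_pow, mul_div_assoc', le_div_iff₀ (pow_pos hr0 n)]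
  calc _ = ‖PowerSeries.coeff n f⁻¹‖ * r ^ n * ‖c‖ ^ n := by ring
    _ ≤ _ := mul_le_mul_of_nonneg_right (hb n) (by positivity)

/-- The coefficients of a solution of `σ(ℓ) = (z - c) ℓ` with integral coefficients are dominated
by the constant coefficient on a disc that is larger than the disc of radius `|c|`. -/
theorem norm_carlitz_coeff_le {F : Type*} [NormedField F] [IsUltrametricDist F] {c : F} {a : ℕ → F}
    {q : ℕ} (hc0 : c ≠ 0) (hc : ‖c‖ < 1) (ha1 : ∀ n, ‖a n‖ ≤ 1) (ha0 : a 0 ≠ 0)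
    (e0 : a 0 ^ (q + 2) = -c * a 0) (e1 : a 1 ^ (q + 2) = a 0 - c * a 1) :
    ∃ r, ‖c‖ < r ∧ ∀ i, ‖a i‖ * r ^ i ≤ ‖a 0‖ := by
  have hc' : 0 < ‖c‖ := norm_pos_iff.2 hc0
  have hn0 : 0 < ‖a 0‖ := norm_pos_iff.2 ha0
  have n0 : ‖a 0‖ ^ (q + 1) = ‖c‖ := by
    have h := congrArg norm e0
    rw [norm_pow, norm_mul, norm_neg, pow_succ] at h
    exact mul_right_cancel₀ hn0.ne' h
  have h0z : ‖c‖ ≤ ‖a 0‖ := by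
    rw [← n0, pow_succ]; exact mul_le_of_le_one_left hn0.le (pow_le_one₀ hn0.le (ha1 0))
  have hr2 : Real.sqrt ‖c‖ ^ 2 = ‖c‖ := Real.sq_sqrt hc'.le
  have hr0 : 0 < Real.sqrt ‖c‖ := Real.sqrt_pos.2 hc'
  have hr1 : Real.sqrt ‖c‖ < 1 := by rw [Real.sqrt_lt' one_pos, one_pow]; exact hc
  refine ⟨Real.sqrt ‖c‖, ?_, fun i => ?_⟩
  · conv_lhs => rw [← hr2, pow_two]
    exact mul_lt_of_lt_one_left hr0 hr1
  rcases i with _ | _ | i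
  · rw [pow_zero, mul_one]
  · rw [zero_add, pow_one]
    have h1 : ‖a 1‖ ^ (q + 2) ≤ max ‖a 0‖ (‖c‖ * ‖a 1‖) := by
      rw [← norm_pow, e1, ← norm_mul]; exact norm_sub_le_max _ _
    rcases le_max_iff.1 h1 with h | h
    · refine le_of_pow_le_pow_left₀ (n := q + 2) (by omega) hn0.le ?_
      rw [mul_pow, pow_succ ‖a 0‖, n0, mul_comm ‖c‖]
      refine mul_le_mul h ?_ (by positivity) hn0.le
      conv_rhs => rw [← hr2]
      exact pow_le_pow_of_le_one hr0.le hr1.le (by omega)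
    · have h2 : ‖a 1‖ ≤ ‖a 0‖ := by
        rcases (norm_nonneg (a 1)).eq_or_lt with h3 | h3
        · rw [← h3]; exact hn0.le
        · refine le_of_pow_le_pow_left₀ (n := q + 1) (by omega) hn0.le ?_
          rw [n0]
          rw [pow_succ] at h
          exact le_of_mul_le_mul_right h h3
      exact (mul_le_of_le_one_right (norm_nonneg _) hr1.le).trans h2
  · calc _ ≤ 1 * Real.sqrt ‖c‖ ^ (i + 1 + 1) := mul_le_mul_of_nonneg_right (ha1 _) (by positivity)
      _ ≤ Real.sqrt ‖c‖ ^ 2 := by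
        rw [one_mul]; exact pow_le_pow_of_le_one hr0.le hr1.le (by omega)
      _ ≤ _ := hr2.le.trans h0z

section

variable {k : Type*} [Field k] [Fintype k] {D : Type*} [CommRing D] [Algebra k D] {c : D} {l l' : D⟦X⟧}

theorem coeff_zero_of_frobS_eq (h : frobS (k := k) D l = (PowerSeries.X - PowerSeries.C c) * l') :
    PowerSeries.coeff 0 l ^ Fintype.card k = -c * PowerSeries.coeff 0 l' := by
  rw [← coeff_frobS, h, sub_mul, map_sub, PowerSeries.coeff_zero_X_mul, PowerSeries.coeff_C_mul,
    zero_sub, neg_mul]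

theorem coeff_one_of_frobS_eq (h : frobS (k := k) D l = (PowerSeries.X - PowerSeries.C c) * l') :
    PowerSeries.coeff 1 l ^ Fintype.card k =
      PowerSeries.coeff 0 l' - c * PowerSeries.coeff 1 l' := by
  rw [← coeff_frobS, h, sub_mul, map_sub, PowerSeries.coeff_C_mul, show (1 : ℕ) = 0 + 1 from rfl,
    PowerSeries.coeff_succ_X_mul]

theorem norm_coeff_le_of_frobS_eq {F : Type*} [NormedField F] [IsUltrametricDist F] (v : D →+* F)
    (h : frobS (k := k) D l = (PowerSeries.X - PowerSeries.C c) * l)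
    (hc0 : v c ≠ 0) (hc : ‖v c‖ < 1) (hv : ∀ n, ‖v (PowerSeries.coeff n l)‖ ≤ 1)
    (h0 : v (PowerSeries.coeff 0 l) ≠ 0) : ∃ r, ‖v c‖ < r ∧
      ∀ i, ‖v (PowerSeries.coeff i l)‖ * r ^ i ≤ ‖v (PowerSeries.coeff 0 l)‖ := by
  obtain ⟨q, hq⟩ : ∃ q, Fintype.card k = q + 2 :=
    ⟨Fintype.card k - 2, by have := Fintype.one_lt_card (α := k); omega⟩
  have e0 := congrArg v (coeff_zero_of_frobS_eq h)
  have e1 := congrArg v (coeff_one_of_frobS_eq h)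
  rw [hq, map_pow, map_mul, map_neg] at e0
  rw [hq, map_pow, map_sub, map_mul] at e1
  exact norm_carlitz_coeff_le (a := fun n => v (PowerSeries.coeff n l)) hc0 hc hv h0 e0 e1

end

variable {k : Type*} [Field k] [Fintype k] (L : IntermediateField k⸨X⸩ (Qalg k))

theorem isUnit_osToTate {l : (OS L)⟦X⟧} {r : ℝ} (hr : ‖RtoLsep L (zeta L)‖ < r)
    (h0 : osV L (PowerSeries.coeff 0 l) ≠ 0)
    (hle : ∀ i, ‖osV L (PowerSeries.coeff i l)‖ * r ^ i ≤ ‖osV L (PowerSeries.coeff 0 l)‖) :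
    IsUnit (osToTate L l) := by
  have hc : ∀ i, PowerSeries.coeff i (PowerSeries.map (osV L) l) =
      osV L (PowerSeries.coeff i l) := fun i => PowerSeries.coeff_map _ _ _
  have hmem : (PowerSeries.map (osV L) l)⁻¹ ∈ tate (RtoLsep L (zeta L)) :=
    inv_mem_tate hr (by rw [hc]; exact h0) fun i => by rw [hc, hc]; exact hle i
  have h1 : PowerSeries.map (osV L) l * (PowerSeries.map (osV L) l)⁻¹ = 1 :=
    PowerSeries.mul_inv_cancel _ (by
      rw [← PowerSeries.coeff_zero_eq_constantCoeff_apply, hc]; exact h0)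
  exact IsUnit.of_mul_eq_one (M := tate (RtoLsep L (zeta L))) ⟨_, hmem⟩ (Subtype.ext h1)

theorem exists_carlitz_series {c : OS L} (hc : c ≠ 0) : ∃ l : (OS L)⟦X⟧,
    frobS (k := k) (OS L) l = (PowerSeries.X - PowerSeries.C c) * l ∧ PowerSeries.coeff 0 l ≠ 0 := by
  obtain ⟨x, hx, hx0⟩ := exists_OS_frobS_eq (L := L) (Equiv.refl Unit)
    (fun _ => PowerSeries.X - PowerSeries.C c) (fun _ => by
      rw [map_sub, PowerSeries.coeff_zero_X, PowerSeries.coeff_zero_C, zero_sub, neg_ne_zero]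
      exact hc)
  exact ⟨x (), hx (), hx0 ()⟩

theorem isUnit_osToTate_of_frobS_eq {c : OS L} {l : (OS L)⟦X⟧} (hc : osV L c = RtoLsep L (zeta L))
    (hl : frobS (k := k) (OS L) l = (PowerSeries.X - PowerSeries.C c) * l)
    (h0 : PowerSeries.coeff 0 l ≠ 0) : IsUnit (osToTate L l) := by
  have hz : RtoLsep L (zeta L) ≠ 0 := fun h => zeta_ne_zero L (by
    rw [← norm_eq_zero, ← norm_RtoLsep, h, norm_zero])
  have hlt : ‖RtoLsep L (zeta L)‖ < 1 := (norm_RtoLsep L _).trans_lt (norm_zeta_lt_one L)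
  have h00 : osV L (PowerSeries.coeff 0 l) ≠ 0 := fun h => h0 (osV_injective (h.trans (map_zero _).symm))
  obtain ⟨r, hr, hle⟩ := norm_coeff_le_of_frobS_eq (osV L) hl (by rw [← hc] at hz; exact hz)
    (by rw [← hc] at hlt; exact hlt) (fun n => norm_osV_le_one _) h00
  have hr' : ‖RtoLsep L (zeta L)‖ < r := by rw [← hc]; exact hr
  exact isUnit_osToTate L hr' h00 hle

/-- The solution of `σ(ℓ) = (z - ζ) ℓ`, the local analogue of the period of the Carlitz module: it
has integral coefficients and is invertible in `L^sep⟨z/ζ⟩`. -/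
theorem exists_carlitz : ∃ l : OSZ L, sigmaOS L l = algebraMap (RZ L) (OSZ L) (zMinusZeta L) * l ∧
    IsUnit (osToTate L l) := by
  obtain ⟨c, hc⟩ : ∃ c : OS L, c = algebraMap (VR L) (OS L) (zeta L) := ⟨_, rfl⟩
  have hTz : algebraMap (RZ L) (OSZ L) (zMinusZeta L) =
      (PowerSeries.X - PowerSeries.C c : (OS L)⟦X⟧) := by
    change PowerSeries.map (algebraMap (VR L) (OS L)) (PowerSeries.X - PowerSeries.C (zeta L)) = _
    rw [map_sub, PowerSeries.map_X, PowerSeries.map_C, hc]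
  have hz : osV L c = RtoLsep L (zeta L) := by rw [hc]; rfl
  have hz0 : c ≠ 0 := by
    rintro rfl
    rw [map_zero] at hz
    exact zeta_ne_zero L (by rw [← norm_eq_zero, ← norm_RtoLsep, ← hz, norm_zero])
  obtain ⟨l, hl, h0⟩ := exists_carlitz_series L hz0
  exact ⟨l, hl.trans (congrArg (· * l) hTz.symm), isUnit_osToTate_of_frobS_eq L hz hl h0⟩

end Carlitz

section Primes

variable {k : Type*} [Field k] [Fintype k] {L : IntermediateField k⸨X⸩ (Qalg k)}
  [FiniteDimensional k⸨X⸩ L] [Algebra.IsSeparable k⸨X⸩ L]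
variable {E : Type*} [CommRing E] [Algebra k⸨X⸩ E] [Algebra k⟦X⟧ E] [IsScalarTower k⟦X⟧ k⸨X⸩ E]
  [Module.Finite k⸨X⸩ E] [IsSemisimpleRing E] [Algebra.IsSeparable k⸨X⸩ E]
variable {y : OE k E} (hy : IsUniformizing y) (hL : ∀ (φ : E →ₐ[k⸨X⸩] Qalg k) (e : E), φ e ∈ L)

instance : Fintype (E →ₐ[k⸨X⸩] Qalg k) := Fintype.ofFinite _

/-- The prime element of `R[[z]] ⊗ O_E` that belongs to an embedding `φ`: it is `Y - φ(y)` on the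
branch of `φ` and `1` on the other branches. -/
def phiPrime (φ : E →ₐ[k⸨X⸩] Qalg k) : RZ L ⊗[k⟦X⟧] OE k E :=
  (omega hy hL (presRZ L)).symm
    (Pi.mulSingle (branchOf hy hL φ) (PowerSeries.X - PowerSeries.C (embR hL φ y)))

variable {hy hL}

theorem omegaAt_phiPrime (χ : Branch hy hL) (φ : E →ₐ[k⸨X⸩] Qalg k) :
    omegaAt χ (presRZ L) (phiPrime hy hL φ) = if branchOf hy hL φ = χ then
      PowerSeries.X - PowerSeries.C (embR hL φ y) else 1 := by
  rw [← omega_apply, phiPrime, RingEquiv.apply_symm_apply, Pi.mulSingle_apply]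
  simp only [eq_comm]

theorem omegaAt_prod_phiPrime_pow (χ : Branch hy hL) (a : (E →ₐ[k⸨X⸩] Qalg k) → ℕ) :
    omegaAt χ (presRZ L) (∏ φ, phiPrime hy hL φ ^ a φ) =
      ∏ φ ∈ χ.embeddings, (PowerSeries.X - PowerSeries.C (embR hL φ y)) ^ a φ := by
  rw [map_prod, ← Finset.prod_subset (Finset.subset_univ χ.embeddings)]
  · refine Finset.prod_congr rfl fun φ hφ => ?_
    rw [map_pow, omegaAt_phiPrime, if_pos (Branch.mem_embeddings.1 hφ)]
  · intro φ _ hφ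
    rw [map_pow, omegaAt_phiPrime, if_neg (fun h => hφ (Branch.mem_embeddings.2 h)), one_pow]

theorem omegaAt_zMinusZeta (χ : Branch hy hL) :
    omegaAt χ (presRZ L) (zMinusZeta L ⊗ₜ[k⟦X⟧] (1 : OE k E)) = χ.z - PowerSeries.C (zeta L) := by
  have h : (presRZ L).equiv (zMinusZeta L) = PowerSeries.X - PowerSeries.C (zeta L) := rfl
  rw [omegaAt_tmul, h, map_sub, χ.sub_X, χ.sub_C, map_one, map_one, mul_one]
  congr 1

variable (hy hL)

/-- In `R[[z]] ⊗ O_E` the element `z - ζ` is the product of the primes of the embeddings, up to a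
unit. -/
theorem exists_zMinusZeta_eq : ∃ w : (RZ L ⊗[k⟦X⟧] OE k E)ˣ,
    zMinusZeta L ⊗ₜ[k⟦X⟧] (1 : OE k E) = w * ∏ φ, phiPrime hy hL φ := by
  choose w hw hz using fun χ : Branch hy hL => χ.exists_z_sub_eq
  have hu : IsUnit ((omega hy hL (presRZ L)).symm w) :=
    (Pi.isUnit_iff.2 hw).map (omega hy hL (presRZ L)).symm
  refine ⟨hu.unit, (omega hy hL (presRZ L)).injective (funext fun χ => ?_)⟩
  have h1 := omegaAt_prod_phiPrime_pow χ (fun _ => 1)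
  simp only [pow_one] at h1
  rw [map_mul, Pi.mul_apply, IsUnit.unit_spec, RingEquiv.apply_symm_apply, omega_apply, omega_apply,
    h1, omegaAt_zMinusZeta, hz, mul_comm]

/-- A divisor of a power of `z - ζ` in `R[[z]] ⊗ O_E` is a product of primes of embeddings, up to a
unit. -/
theorem exists_eq_unit_mul_prod {t t' : RZ L ⊗[k⟦X⟧] OE k E} {m : ℕ}
    (h : t * t' = (zMinusZeta L ^ m) ⊗ₜ 1) :
    ∃ (a : (E →ₐ[k⸨X⸩] Qalg k) → ℕ) (u : (RZ L ⊗[k⟦X⟧] OE k E)ˣ),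
      t = u * ∏ φ, phiPrime hy hL φ ^ a φ := by
  classical
  have key : ∀ χ : Branch hy hL, ∃ (a : (E →ₐ[k⸨X⸩] Qalg k) → ℕ) (b : (VR L)⟦X⟧), IsUnit b ∧
      omegaAt χ (presRZ L) t =
        b * ∏ φ ∈ χ.embeddings, (PowerSeries.X - PowerSeries.C (embR hL φ y)) ^ a φ := fun χ => by
    obtain ⟨w, hw, hz⟩ := χ.exists_z_sub_eq
    have h1 : omegaAt χ (presRZ L) t * omegaAt χ (presRZ L) t' = w ^ m *
        ∏ p ∈ χ.embeddings ×ˢ Finset.range m, (PowerSeries.X - PowerSeries.C (embR hL p.1 y)) := by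
      have e : (zMinusZeta L ^ m) ⊗ₜ[k⟦X⟧] (1 : OE k E) = (zMinusZeta L ⊗ₜ 1) ^ m := by
        rw [Algebra.TensorProduct.tmul_pow, one_pow]
      rw [← map_mul, h, e, map_pow, omegaAt_zMinusZeta, hz, mul_pow, mul_comm,
        Finset.prod_product]
      simp [Finset.prod_pow]
    obtain ⟨s, s', b, c, hs, -, hbc, hb, -⟩ := mul_eq_mul_prime_prod
      (fun p _ => prime_X_sub_C_embR (hL := hL) p.1 hy) h1
    refine ⟨fun φ => (s.filter fun p => p.1 = φ).card, b,
      isUnit_of_mul_isUnit_left (hbc ▸ hw.pow m), ?_⟩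
    have hsub : ∀ p ∈ s, p.1 ∈ χ.embeddings := fun p hp =>
      (Finset.mem_product.1 (hs ▸ Finset.mem_union_left s' hp)).1
    rw [hb, ← Finset.prod_fiberwise_of_maps_to hsub]
    congr 1
    refine Finset.prod_congr rfl fun φ _ => ?_
    rw [Finset.prod_congr rfl (g := fun _ => PowerSeries.X - PowerSeries.C (embR hL φ y)),
      Finset.prod_const]
    intro p hp
    rw [(Finset.mem_filter.1 hp).2]
  choose a b hb hab using key
  have hu : IsUnit ((omega hy hL (presRZ L)).symm b) :=
    (Pi.isUnit_iff.2 hb).map (omega hy hL (presRZ L)).symm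
  refine ⟨fun φ => a (branchOf hy hL φ) φ, hu.unit,
    (omega hy hL (presRZ L)).injective (funext fun χ => ?_)⟩
  rw [map_mul, Pi.mul_apply, IsUnit.unit_spec, RingEquiv.apply_symm_apply, omega_apply, omega_apply,
    omegaAt_prod_phiPrime_pow, hab]
  congr 1
  refine Finset.prod_congr rfl fun φ hφ => ?_
  rw [Branch.mem_embeddings.1 hφ]

end Primes

/-! ### Frobenius eigenvectors in `R[[z]] ⊗ O_E` and its extensions -/

section Eigen

variable {k : Type*} [Field k] [Fintype k] {L : IntermediateField k⸨X⸩ (Qalg k)}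
  [FiniteDimensional k⸨X⸩ L] [Algebra.IsSeparable k⸨X⸩ L]
variable {E : Type*} [CommRing E] [Algebra k⸨X⸩ E] [Algebra k⟦X⟧ E] [IsScalarTower k⟦X⟧ k⸨X⸩ E]
  [Module.Finite k⸨X⸩ E] [IsSemisimpleRing E] [Algebra.IsSeparable k⸨X⸩ E]
variable {y : OE k E} {hy : IsUniformizing y} {hL : ∀ (φ : E →ₐ[k⸨X⸩] Qalg k) (e : E), φ e ∈ L}

variable (E) in
/-- The extension `B ⊗ O_E → B' ⊗ O_E` of a homomorphism `B → B'`. -/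
abbrev tensorO {B B' : Type*} [CommRing B] [CommRing B'] [Algebra k⟦X⟧ B] [Algebra k⟦X⟧ B']
    (f : B →ₐ[k⟦X⟧] B') : B ⊗[k⟦X⟧] OE k E →ₐ[k⟦X⟧] B' ⊗[k⟦X⟧] OE k E :=
  Algebra.TensorProduct.map f (AlgHom.id k⟦X⟧ (OE k E))

theorem tensorO_tensorO {B B' B'' : Type*} [CommRing B] [CommRing B'] [CommRing B'']
    [Algebra k⟦X⟧ B] [Algebra k⟦X⟧ B'] [Algebra k⟦X⟧ B''] (f : B →ₐ[k⟦X⟧] B')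
    (g : B' →ₐ[k⟦X⟧] B'') (x : B ⊗[k⟦X⟧] OE k E) :
    tensorO E g (tensorO E f x) = tensorO E (g.comp f) x := by
  induction x with
  | zero => simp
  | add x x' hx hx' => simp only [map_add, hx, hx']
  | tmul b a => rfl

theorem tensorO_baseMap {B B' : Type*} [CommRing B] [CommRing B'] [Algebra k⟦X⟧ B]
    [Algebra k⟦X⟧ B'] [Algebra (RZ L) B] [Algebra (RZ L) B'] [IsScalarTower k⟦X⟧ (RZ L) B]
    [IsScalarTower k⟦X⟧ (RZ L) B'] (f : B →ₐ[RZ L] B') (x : RZ L ⊗[k⟦X⟧] OE k E) :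
    tensorO E (f.restrictScalars k⟦X⟧) (baseMap k L E B x) = baseMap k L E B' x := by
  induction x with
  | zero => simp
  | add x x' hx hx' => simp only [map_add, hx, hx']
  | tmul b a =>
    rw [baseMap_tmul, baseMap_tmul, Algebra.TensorProduct.map_tmul]
    congr 1
    exact f.commutes b

include hL in
theorem tensorO_injective {B B' : Type*} [CommRing B] [CommRing B'] [Algebra k⟦X⟧ B]
    [Algebra k⟦X⟧ B'] {f : B →ₐ[k⟦X⟧] B'} (hf : Function.Injective f) :
    Function.Injective (tensorO E f) := by
  have := free_OE (k := k) hL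
  exact Module.Flat.rTensor_preserves_injective_linearMap (M := OE k E) f.toLinearMap hf

theorem omegaAt_ext {B D : Type*} [CommRing B] [CommRing D] [Algebra k⟦X⟧ B] [Algebra k D]
    [Algebra (VR L) D] [IsScalarTower k (VR L) D] [Nontrivial B] (p : SeriesPres k B D)
    {x x' : B ⊗[k⟦X⟧] OE k E} (h : ∀ χ : Branch hy hL, omegaAt χ p x = omegaAt χ p x') : x = x' :=
  (omega hy hL p).injective (funext h)

theorem omegaAt_baseMap_OSZ (χ : Branch hy hL) (x : RZ L ⊗[k⟦X⟧] OE k E) :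
    omegaAt χ (presOS L) (baseMap k L E (OSZ L) x) =
      PowerSeries.map (algebraMap (VR L) (OS L)) (omegaAt χ (presRZ L) x) :=
  omegaAt_map χ (presRZ L) (presOS L) (IsScalarTower.toAlgHom k⟦X⟧ (RZ L) (OSZ L))
    (Algebra.ofId (VR L) (OS L)) (fun _ => rfl) x

theorem omegaAt_osToSep (χ : Branch hy hL) (x : OSZ L ⊗[k⟦X⟧] OE k E) :
    omegaAt χ (presSep L) (tensorO E ((osToSep L).restrictScalars k⟦X⟧) x) =
      PowerSeries.map (osV L) (omegaAt χ (presOS L) x) :=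
  omegaAt_map χ (presOS L) (presSep L) ((osToSep L).restrictScalars k⟦X⟧) (osVal L)
    (presSep_osToSep L) x

variable (hy hL) in
/-- The equation `σ(x) = T x` has a solution in `O_{L^sep}[[z]] ⊗ O_E`. -/
theorem exists_eigenvector (T : RZ L ⊗[k⟦X⟧] OE k E)
    (hT : ∀ χ : Branch hy hL, PowerSeries.coeff 0 (omegaAt χ (presRZ L) T) ≠ 0) :
    ∃ x : OSZ L ⊗[k⟦X⟧] OE k E, tensorO E (sigmaOS L) x = baseMap k L E (OSZ L) T * x ∧
      ∀ χ : Branch hy hL, PowerSeries.coeff 0 (omegaAt χ (presOS L) x) ≠ 0 := by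
  obtain ⟨T', hT'⟩ : ∃ T' : Branch hy hL → (OS L)⟦X⟧,
      ∀ χ : Branch hy hL, omegaAt χ (presOS L) (baseMap k L E (OSZ L) T) = T' χ := ⟨_, fun _ => rfl⟩
  have hT0 : ∀ χ, PowerSeries.coeff 0 (T' χ) ≠ 0 := fun χ => by
    rw [← hT', omegaAt_baseMap_OSZ, PowerSeries.coeff_map]
    exact algebraMap_OS_ne_zero (hT χ)
  obtain ⟨x, hx, hx0⟩ := exists_OS_frobS_eq (L := L) frobPerm T' hT0
  have hox : ∀ χ : Branch hy hL, omegaAt χ (presOS L) ((omega hy hL (presOS L)).symm x) = x χ := fun χ =>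
    congrFun ((omega hy hL (presOS L)).apply_symm_apply x) χ
  refine ⟨(omega hy hL (presOS L)).symm x, omegaAt_ext (hy := hy) (hL := hL) (presOS L) fun χ => ?_,
    fun χ => by rw [hox]; exact hx0 χ⟩
  obtain ⟨χ, rfl⟩ := frobPerm.surjective χ
  rw [omegaAt_frob χ (presOS L) (sigmaOS L) (sigmaOS_apply L), hox, hx, map_mul, hox, hT']

theorem series_coeff_zero_mul {D : Type*} [CommRing D] (f g : D⟦X⟧) :
    PowerSeries.coeff 0 (f * g) = PowerSeries.coeff 0 f * PowerSeries.coeff 0 g := by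
  simp

/-- The relation between the absolute values of the constant terms of an eigenvector. -/
theorem norm_coeff_eigenvector {T : RZ L ⊗[k⟦X⟧] OE k E} {x : OSZ L ⊗[k⟦X⟧] OE k E}
    (hx : tensorO E (sigmaOS L) x = baseMap k L E (OSZ L) T * x) (χ : Branch hy hL) :
    ‖osV L (PowerSeries.coeff 0 (omegaAt χ (presOS L) x))‖ ^ Fintype.card k =
      ‖((PowerSeries.coeff 0 (omegaAt (frobPerm χ) (presRZ L) T) : VR L) : L)‖ *
        ‖osV L (PowerSeries.coeff 0 (omegaAt (frobPerm χ) (presOS L) x))‖ := by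
  have h := omegaAt_frob χ (presOS L) (sigmaOS L) (sigmaOS_apply L) x
  rw [hx, map_mul, omegaAt_baseMap_OSZ] at h
  have h1 := congrArg (PowerSeries.coeff 0) h
  rw [coeff_frobS, series_coeff_zero_mul, PowerSeries.coeff_map] at h1
  rw [← norm_pow, ← map_pow, ← h1, map_mul, norm_mul, osV_algebraMap, norm_RtoLsep]

include hy hL in
/-- An eigenvector for a unit is a unit. -/
theorem isUnit_eigenvector {T : RZ L ⊗[k⟦X⟧] OE k E} (hT : IsUnit T)
    {x : OSZ L ⊗[k⟦X⟧] OE k E} (hx : tensorO E (sigmaOS L) x = baseMap k L E (OSZ L) T * x)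
    (hx0 : ∀ χ : Branch hy hL, PowerSeries.coeff 0 (omegaAt χ (presOS L) x) ≠ 0) : IsUnit x := by
  set m : Branch hy hL → ℝ := fun χ => ‖osV L (PowerSeries.coeff 0 (omegaAt χ (presOS L) x))‖
    with hm
  have hm1 : ∀ χ, m χ ≤ 1 := fun χ => norm_osV_le_one _
  have hm0 : ∀ χ, 0 < m χ := fun χ => norm_pos_iff.2 fun h => hx0 χ (osV_injective (h.trans (map_zero _).symm))
  have hrec : ∀ χ, m χ ^ Fintype.card k = m (frobPerm χ) := fun χ => by
    have h1 := norm_coeff_eigenvector hx χ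
    have h2 : IsUnit (PowerSeries.coeff 0 (omegaAt (frobPerm χ) (presRZ L) T)) := by
      rw [PowerSeries.coeff_zero_eq_constantCoeff_apply]
      exact (hT.map (omegaAt (frobPerm χ) (presRZ L))).map PowerSeries.constantCoeff
    rwa [(isUnit_VR_iff _).1 h2, one_mul] at h1
  have h1 : ∀ χ, m χ = 1 := fun χ => by
    have : Nonempty (Branch hy hL) := ⟨χ⟩
    obtain ⟨χ0, h0⟩ := Finite.exists_min m
    have h2 : m χ0 ≤ m χ0 ^ Fintype.card k := (h0 (frobPerm χ0)).trans_eq (hrec χ0).symm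
    have h3 : m χ0 = 1 := by
      by_contra hne
      have hlt := lt_of_le_of_ne (hm1 χ0) hne
      have := pow_lt_pow_right_of_lt_one₀ (hm0 χ0) hlt (Fintype.one_lt_card (α := k))
      rw [pow_one] at this
      exact absurd h2 (not_le.2 this)
    exact le_antisymm (hm1 χ) (h3 ▸ h0 χ)
  have h2 : IsUnit (omega hy hL (presOS L) x) := Pi.isUnit_iff.2 fun χ => by
    rw [omega_apply, PowerSeries.isUnit_iff_constantCoeff,
      ← PowerSeries.coeff_zero_eq_constantCoeff_apply, isUnit_OS_iff]
    exact h1 χ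
  simpa using h2.map (omega hy hL (presOS L)).symm

variable (E L) in
/-- The map `O_{L^sep}[[z]] ⊗ O_E → L^sep⟨z/ζ⟩ ⊗ O_E`. -/
abbrev toTateO : OSZ L ⊗[k⟦X⟧] OE k E →ₐ[k⟦X⟧] TateSep L ⊗[k⟦X⟧] OE k E :=
  tensorO E ((osToTate L).restrictScalars k⟦X⟧)

variable (E L) in
/-- The map `L^sep⟨z/ζ⟩ ⊗ O_E → L^sep[[z]] ⊗ O_E`. -/
abbrev tateToSepO : TateSep L ⊗[k⟦X⟧] OE k E →ₐ[k⟦X⟧] LsepZ L ⊗[k⟦X⟧] OE k E :=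
  tensorO E ((tateIncl L).restrictScalars k⟦X⟧)

theorem tateIncl_injective : Function.Injective (tateIncl L) := Subtype.val_injective

theorem tateToSepO_toTateO (x : OSZ L ⊗[k⟦X⟧] OE k E) : tateToSepO L E (toTateO L E x) =
    tensorO E ((osToSep L).restrictScalars k⟦X⟧) x := tensorO_tensorO _ _ x

theorem sigma_tateToSepO_toTateO (x : OSZ L ⊗[k⟦X⟧] OE k E) :
    tensorO E (sigmaSepAlg L) (tateToSepO L E (toTateO L E x)) =
      tateToSepO L E (toTateO L E (tensorO E (sigmaOS L) x)) := by
  rw [tateToSepO_toTateO, tateToSepO_toTateO, tensorO_tensorO, tensorO_tensorO]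
  congr 1

include hL in
theorem one_tmul_injective {B : Type*} [CommRing B] [Algebra k⟦X⟧ B]
    (hB : Function.Injective (algebraMap k⟦X⟧ B)) {a a' : OE k E}
    (h : (1 : B) ⊗ₜ[k⟦X⟧] a = 1 ⊗ₜ a') : a = a' := by
  have := free_OE (k := k) hL
  exact Algebra.TensorProduct.includeRight_injective (A := B) hB h

theorem algebraMap_LsepZ_injective : Function.Injective (algebraMap k⟦X⟧ (LsepZ L)) := fun _ _ h =>
  PowerSeries.ext fun n => (algebraMap k (Lsep L)).injective
    (congrArg (PowerSeries.coeff (R := Lsep L) n) h)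

include hy hL in
/-- An eigenvector for `z - ζ` becomes a unit over `L^sep⟨z/ζ⟩`: up to an element of `O_E` it is
the solution `ℓ` of `σ(ℓ) = (z - ζ) ℓ`. -/
theorem isUnit_toTateO_of_eigenvector {x : OSZ L ⊗[k⟦X⟧] OE k E}
    (hx : tensorO E (sigmaOS L) x = baseMap k L E (OSZ L) (zMinusZeta L ⊗ₜ 1) * x)
    (hx0 : ∀ χ : Branch hy hL, PowerSeries.coeff 0 (omegaAt χ (presOS L) x) ≠ 0) :
    IsUnit (toTateO L E x) := by
  obtain ⟨l, hl, hlu⟩ := exists_carlitz L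
  set l' : OSZ L ⊗[k⟦X⟧] OE k E := l ⊗ₜ 1 with hl'
  have hlT : IsUnit (toTateO L E l') := by
    have := hlu.map (Algebra.TensorProduct.includeLeft :
      TateSep L →ₐ[k⟦X⟧] TateSep L ⊗[k⟦X⟧] OE k E)
    simpa [hl'] using this
  have hls : tensorO E (sigmaOS L) l' = baseMap k L E (OSZ L) (zMinusZeta L ⊗ₜ 1) * l' := by
    rw [hl', Algebra.TensorProduct.map_tmul, hl, baseMap_tmul,
      Algebra.TensorProduct.tmul_mul_tmul, mul_one]
    rfl
  set ls := tateToSepO L E (toTateO L E l') with hlsep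
  set xs := tateToSepO L E (toTateO L E x) with hxsep
  have hlsu : IsUnit ls := hlT.map (tateToSepO L E)
  have hxsu : IsUnit xs := by
    have h2 : IsUnit (omega hy hL (presSep L) xs) := Pi.isUnit_iff.2 fun χ => by
      rw [omega_apply, PowerSeries.isUnit_iff_constantCoeff,
        ← PowerSeries.coeff_zero_eq_constantCoeff_apply, hxsep, tateToSepO_toTateO, omegaAt_osToSep,
        PowerSeries.coeff_map, isUnit_iff_ne_zero]
      exact fun h => hx0 χ (osV_injective (h.trans (map_zero _).symm))
    simpa using h2.map (omega hy hL (presSep L)).symm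
  set zs : LsepZ L ⊗[k⟦X⟧] OE k E := tateToSepO L E (toTateO L E (baseMap k L E (OSZ L)
    (zMinusZeta L ⊗ₜ 1))) with hzs
  have hsl : tensorO E (sigmaSepAlg L) ls = zs * ls := by
    rw [hlsep, sigma_tateToSepO_toTateO, hls, map_mul, map_mul]
  have hsx : tensorO E (sigmaSepAlg L) xs = zs * xs := by
    rw [hxsep, sigma_tateToSepO_toTateO, hx, map_mul, map_mul]
  have hzsu : IsUnit zs := by
    have h1 := hlsu.map (tensorO E (sigmaSepAlg L))
    rw [hsl] at h1
    exact isUnit_of_mul_isUnit_left h1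
  -- The quotient of two eigenvectors is invariant under Frobenius.
  have hquot : ∀ f g : LsepZ L ⊗[k⟦X⟧] OE k E, IsUnit f → IsUnit g →
      tensorO E (sigmaSepAlg L) f = zs * f → tensorO E (sigmaSepAlg L) g = zs * g →
      ∃ a : OE k E, f * (1 ⊗ₜ a) = g := fun f g hf hg hf' hg' => by
    obtain ⟨f, rfl⟩ := hf
    obtain ⟨a, ha⟩ := exists_one_tmul_eq_of_frob_eq (hL := hL) (presSep L) (sigmaSepAlg L)
      (sigmaSepAlg_apply L) (↑f⁻¹ * g) (by
        apply (hzsu.mul f.isUnit).mul_left_cancel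
        rw [← hf', ← map_mul, Units.mul_inv_cancel_left, hg', hf', mul_assoc,
          Units.mul_inv_cancel_left])
    exact ⟨a, by rw [← ha, Units.mul_inv_cancel_left]⟩
  obtain ⟨a, ha⟩ := hquot ls xs hlsu hxsu hsl hsx
  obtain ⟨b, hb⟩ := hquot xs ls hxsu hlsu hsx hsl
  have hab : a * b = 1 := by
    apply one_tmul_injective (k := k) (hL := hL) (algebraMap_LsepZ_injective (L := L))
    apply hlsu.mul_left_cancel
    have e : (1 : LsepZ L) ⊗ₜ[k⟦X⟧] (a * b) = (1 ⊗ₜ a) * (1 ⊗ₜ b) := by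
      rw [Algebra.TensorProduct.tmul_mul_tmul, one_mul]
    rw [e, ← mul_assoc, ha, hb, ← Algebra.TensorProduct.one_def, mul_one]
  have hT : toTateO L E l' * (1 ⊗ₜ a) = toTateO L E x := by
    apply tensorO_injective (hL := hL) (f := (tateIncl L).restrictScalars k⟦X⟧) tateIncl_injective
    rw [map_mul, Algebra.TensorProduct.map_tmul, map_one]
    exact ha
  rw [← hT]
  exact hlT.mul ((IsUnit.of_mul_eq_one b hab).map
    (Algebra.TensorProduct.includeRight : OE k E →ₐ[k⟦X⟧] TateSep L ⊗[k⟦X⟧] OE k E))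

/-! ### The Tate module and the comparison isomorphism -/

variable (hy hL)
variable {M : Type*} [AddCommGroup M] [Module (RZ L) M] {S : LocalShtuka L M} {c : CM S E}

/-- A generator `x` of `H^1_v(M, A_v)` over `O_E`, in the coordinates of a trivialization of `M`,
with its factorization: `lam φ` is an eigenvector for the prime element of `φ`, `eta` is a unit, and
`x = (∏ lam φ)^n ∏ (lam φ)^(-a φ)` up to units, where `t` is `∏ (phiPrime φ)^(a φ)` up to a unit. -/
structure Solution (D : Triv c) where
  a : (E →ₐ[k⸨X⸩] Qalg k) → ℕ
  unit : (RZ L ⊗[k⟦X⟧] OE k E)ˣ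
  t_eq : D.t = unit * ∏ φ, phiPrime hy hL φ ^ a φ
  lam : (E →ₐ[k⸨X⸩] Qalg k) → OSZ L ⊗[k⟦X⟧] OE k E
  lam_frob : ∀ φ, tensorO E (sigmaOS L) (lam φ) =
    baseMap k L E (OSZ L) (phiPrime hy hL φ) * lam φ
  lam_ne : ∀ φ (χ : Branch hy hL), PowerSeries.coeff 0 (omegaAt χ (presOS L) (lam φ)) ≠ 0
  eta : (OSZ L ⊗[k⟦X⟧] OE k E)ˣ
  eta' : (OSZ L ⊗[k⟦X⟧] OE k E)ˣ
  x : (TateSep L ⊗[k⟦X⟧] OE k E)ˣ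
  x_eq : (x : TateSep L ⊗[k⟦X⟧] OE k E) * toTateO L E (∏ φ, lam φ ^ a φ) * toTateO L E eta' =
    toTateO L E ((∏ φ, lam φ) * eta) ^ D.n
  x_frob : baseMap k L E (LsepZ L) D.t *
    tensorO E (sigmaSepAlg L) (tateToSepO L E x) =
      algebraMap (RZ L) (LsepZ L) (zMinusZeta L) ^ D.n • tateToSepO L E x

theorem omegaAt_phiPrime_coeff_ne_zero (φ : E →ₐ[k⸨X⸩] Qalg k) (χ : Branch hy hL) :
    PowerSeries.coeff 0 (omegaAt χ (presRZ L) (phiPrime hy hL φ)) ≠ 0 := by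
  rw [omegaAt_phiPrime]
  split_ifs
  · rw [map_sub, PowerSeries.coeff_zero_X, PowerSeries.coeff_zero_C, zero_sub, neg_ne_zero]
    exact embR_ne_zero hy hL φ
  · rw [PowerSeries.coeff_zero_one]; exact one_ne_zero

theorem omegaAt_unit_coeff_ne_zero {T : RZ L ⊗[k⟦X⟧] OE k E} (hT : IsUnit T) (χ : Branch hy hL) :
    PowerSeries.coeff 0 (omegaAt χ (presRZ L) T) ≠ 0 := by
  rw [PowerSeries.coeff_zero_eq_constantCoeff_apply]
  exact ((hT.map (omegaAt χ (presRZ L))).map PowerSeries.constantCoeff).ne_zero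

theorem smul_eq_baseMap_mul {B : Type*} [CommRing B] [Algebra (RZ L) B] [Algebra k⟦X⟧ B]
    [IsScalarTower k⟦X⟧ (RZ L) B] (g : RZ L) (x : B ⊗[k⟦X⟧] OE k E) :
    algebraMap (RZ L) B g • x = baseMap k L E B (g ⊗ₜ 1) * x := by
  induction x with
  | zero => simp
  | add x x' hx hx' => rw [smul_add, mul_add, hx, hx']
  | tmul b a =>
    rw [baseMap_tmul, Algebra.TensorProduct.tmul_mul_tmul, one_mul, TensorProduct.smul_tmul',
      smul_eq_mul]

theorem exists_unit_mul_mul_eq {A : Type*} [CommMonoid A] {a b c : A} (ha : IsUnit a)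
    (hb : IsUnit b) (hc : IsUnit c) : ∃ x : Aˣ, (x : A) * a * b = c := by
  obtain ⟨a, rfl⟩ := ha
  obtain ⟨b, rfl⟩ := hb
  obtain ⟨c, rfl⟩ := hc
  exact ⟨c * b⁻¹ * a⁻¹, by rw [← Units.val_mul, ← Units.val_mul, inv_mul_cancel_right,
    inv_mul_cancel_right]⟩

theorem nonempty_solution (D : Triv c) : Nonempty (Solution hy hL D) := by
  obtain ⟨w, hw⟩ := exists_zMinusZeta_eq hy hL
  obtain ⟨a, u, hu⟩ := exists_eq_unit_mul_prod hy hL D.t_mul_t'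
  choose lam hlam hlam0 using fun φ => exists_eigenvector hy hL _
    (omegaAt_phiPrime_coeff_ne_zero hy hL φ)
  obtain ⟨e, he, he0⟩ := exists_eigenvector hy hL _ (omegaAt_unit_coeff_ne_zero hy hL w.isUnit)
  obtain ⟨e', he', he0'⟩ := exists_eigenvector hy hL _ (omegaAt_unit_coeff_ne_zero hy hL u.isUnit)
  obtain ⟨e, rfl⟩ := isUnit_eigenvector w.isUnit he he0
  obtain ⟨e', rfl⟩ := isUnit_eigenvector u.isUnit he' he0'
  have hprod : tensorO E (sigmaOS L) ((∏ φ, lam φ) * e) =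
      baseMap k L E (OSZ L) (zMinusZeta L ⊗ₜ 1) * ((∏ φ, lam φ) * e) := by
    rw [map_mul, map_prod, he, hw, map_mul, map_prod, Finset.prod_congr rfl fun φ _ => hlam φ,
      Finset.prod_mul_distrib]
    ring
  have hprod0 : ∀ χ : Branch hy hL,
      PowerSeries.coeff 0 (omegaAt χ (presOS L) ((∏ φ, lam φ) * e)) ≠ 0 := fun χ => by
    have h1 := hlam0
    simp only [PowerSeries.coeff_zero_eq_constantCoeff_apply] at h1 he0 ⊢
    rw [map_mul, map_mul, map_prod, map_prod]
    exact mul_ne_zero (Finset.prod_ne_zero_iff.2 fun φ _ => h1 φ χ) (he0 χ)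
  have hLam := isUnit_toTateO_of_eigenvector (hy := hy) (hL := hL) hprod hprod0
  have hlamu : ∀ φ, IsUnit (toTateO L E (lam φ)) := fun φ => by
    refine isUnit_of_dvd_unit (map_dvd (toTateO L E) ?_) hLam
    exact Dvd.dvd.mul_right (Finset.dvd_prod_of_mem lam (Finset.mem_univ φ)) _
  have hpu : IsUnit (toTateO L E (∏ φ, lam φ ^ a φ)) := by
    rw [map_prod]
    refine Finset.prod_induction _ IsUnit (fun _ _ => IsUnit.mul) isUnit_one fun φ _ => ?_
    rw [map_pow]
    exact (hlamu φ).pow _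
  have heu : IsUnit (toTateO L E (e' : OSZ L ⊗[k⟦X⟧] OE k E)) := e'.isUnit.map (toTateO L E)
  obtain ⟨x, hx⟩ : ∃ x : (TateSep L ⊗[k⟦X⟧] OE k E)ˣ, (x : TateSep L ⊗[k⟦X⟧] OE k E) *
      toTateO L E (∏ φ, lam φ ^ a φ) * toTateO L E e' = toTateO L E ((∏ φ, lam φ) * e) ^ D.n :=
    exists_unit_mul_mul_eq hpu heu (hLam.pow D.n)
  refine ⟨⟨a, u, hu, lam, hlam, hlam0, e, e', x, hx, ?_⟩⟩
  -- Apply Frobenius to the defining equation of `x` and cancel the units.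
  have hx1 := congrArg (tateToSepO L E) hx
  rw [map_mul, map_mul, map_pow] at hx1
  have hx2 := congrArg (tensorO E (sigmaSepAlg L)) hx1
  rw [map_mul, map_mul, map_pow, sigma_tateToSepO_toTateO, sigma_tateToSepO_toTateO,
    sigma_tateToSepO_toTateO, hprod, he', map_prod] at hx2
  simp only [map_pow, hlam, mul_pow] at hx2
  rw [Finset.prod_mul_distrib] at hx2
  have hcomp : ∀ T : RZ L ⊗[k⟦X⟧] OE k E,
      tateToSepO L E (toTateO L E (baseMap k L E (OSZ L) T)) = baseMap k L E (LsepZ L) T := fun T => by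
    rw [tateToSepO_toTateO, tensorO_baseMap]
  have ht : baseMap k L E (LsepZ L) D.t = baseMap k L E (LsepZ L) u *
      tateToSepO L E (toTateO L E (∏ φ, baseMap k L E (OSZ L) (phiPrime hy hL φ) ^ a φ)) := by
    rw [hu, map_mul, ← hcomp (∏ φ, _), map_prod (baseMap k L E (OSZ L))]
    simp only [map_pow]
  have hcancel : IsUnit (tateToSepO L E (toTateO L E (∏ φ, lam φ ^ a φ)) *
      tateToSepO L E (toTateO L E e')) :=
    (hpu.map (tateToSepO L E)).mul (heu.map (tateToSepO L E))
  apply hcancel.mul_right_cancel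
  simp only [map_mul, hcomp, mul_pow] at hx2 hx1
  rw [← map_pow, smul_eq_baseMap_mul, ht]
  have e1 : (zMinusZeta L ^ D.n) ⊗ₜ[k⟦X⟧] (1 : OE k E) = (zMinusZeta L ⊗ₜ 1) ^ D.n := by
    rw [Algebra.TensorProduct.tmul_pow, one_pow]
  rw [e1, map_pow]
  linear_combination hx2 - baseMap k L E (LsepZ L) (zMinusZeta L ⊗ₜ 1) ^ D.n * hx1

end Eigen

section

variable {k : Type*} [Field k] [Fintype k] (L : IntermediateField k⸨X⸩ (Qalg k))
  [FiniteDimensional k⸨X⸩ L]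

instance : Algebra k⟦X⟧ (BPlusL L) :=
  ((algebraMap (RZ L) (BPlusL L)).comp (algebraMap k⟦X⟧ (RZ L))).toAlgebra
instance : IsScalarTower k⟦X⟧ (RZ L) (BPlusL L) := IsScalarTower.of_algebraMap_eq fun _ => rfl
instance : Algebra k⟦X⟧ (BL L) :=
  ((algebraMap (RZ L) (BL L)).comp (algebraMap k⟦X⟧ (RZ L))).toAlgebra
instance : IsScalarTower k⟦X⟧ (RZ L) (BL L) := IsScalarTower.of_algebraMap_eq fun _ => rfl

end

section Comparison

variable {k : Type*} [Field k] [Fintype k] {L : IntermediateField k⸨X⸩ (Qalg k)}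
  [FiniteDimensional k⸨X⸩ L] [Algebra.IsSeparable k⸨X⸩ L]
variable {E : Type*} [CommRing E] [Algebra k⸨X⸩ E] [Algebra k⟦X⟧ E] [IsScalarTower k⟦X⟧ k⸨X⸩ E]
  [Module.Finite k⸨X⸩ E] [IsSemisimpleRing E] [Algebra.IsSeparable k⸨X⸩ E]
variable {y : OE k E} {hy : IsUniformizing y} {hL : ∀ (φ : E →ₐ[k⸨X⸩] Qalg k) (e : E), φ e ∈ L}
variable {M : Type*} [AddCommGroup M] [Module (RZ L) M] {S : LocalShtuka L M} {c : CM S E}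
  {D : Triv c} (s : Solution hy hL D)

/-- The solution over `L^sep[[z]]`. -/
def Solution.xSep : LsepZ L ⊗[k⟦X⟧] OE k E := tateToSepO L E s.x

theorem Solution.isUnit_xSep : IsUnit s.xSep := s.x.isUnit.map (tateToSepO L E)

theorem Solution.theta_mul_mem_H1v_iff (z : LsepZ L ⊗[k⟦X⟧] OE k E) :
    D.theta (LsepZ L) (s.xSep * z) ∈ H1v S ↔ ∃ a, z = 1 ⊗ₜ[k⟦X⟧] a := by
  have hz : IsUnit (algebraMap (RZ L) (LsepZ L) (zMinusZeta L) ^ D.n) :=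
    (isUnit_zMinusZeta_LsepZ L).pow D.n
  rw [D.mem_H1v_iff, map_mul, ← mul_assoc, xSep, s.x_frob, smul_mul_assoc,
    hz.smul_left_cancel, s.x.isUnit.map (tateToSepO L E) |>.mul_right_inj]
  constructor
  · exact exists_one_tmul_eq_of_frob_eq (hL := hL) (presSep L) (sigmaSepAlg L)
      (sigmaSepAlg_apply L) z
  · rintro ⟨a, rfl⟩
    rw [Algebra.TensorProduct.map_tmul, map_one]
    rfl

theorem tmul_smul_eq {B : Type*} [CommRing B] [Algebra k⟦X⟧ B] (x : B ⊗[k⟦X⟧] OE k E) (f : k⟦X⟧)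
    (a : OE k E) : x * (1 ⊗ₜ[k⟦X⟧] (f • a)) = algebraMap k⟦X⟧ B f • (x * (1 ⊗ₜ[k⟦X⟧] a)) := by
  rw [TensorProduct.tmul_smul, mul_smul_comm, algebraMap_smul]

/-- The isomorphism `O_E ≅ H^1_v(M, A_v)` that is defined by a solution. -/
def Solution.tateEquiv : OE k E ≃ₗ[k⟦X⟧] H1v S :=
  LinearEquiv.ofBijective
    { toFun := fun a => ⟨D.theta (LsepZ L) (s.xSep * (1 ⊗ₜ[k⟦X⟧] a)),
        (s.theta_mul_mem_H1v_iff _).2 ⟨a, rfl⟩⟩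
      map_add' := fun a b => Subtype.ext (by
        change D.theta (LsepZ L) _ = D.theta (LsepZ L) _ + D.theta (LsepZ L) _
        rw [TensorProduct.tmul_add, mul_add, map_add])
      map_smul' := fun f a => Subtype.ext (by
        change D.theta (LsepZ L) _ = f • D.theta (LsepZ L) _
        rw [tmul_smul_eq, map_smul, algebraMap_smul_LsepZ]) }
    ⟨fun a b h => by
      have h1 := (D.theta (LsepZ L)).injective (congrArg Subtype.val h)
      exact one_tmul_injective (hL := hL) algebraMap_LsepZ_injective
        (s.isUnit_xSep.mul_right_inj.1 h1),
    fun m => by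
      obtain ⟨m, hm⟩ := m
      obtain ⟨z, rfl⟩ := (D.theta (LsepZ L)).surjective m
      obtain ⟨z, rfl⟩ : s.xSep ∣ z := s.isUnit_xSep.dvd
      obtain ⟨a, rfl⟩ := (s.theta_mul_mem_H1v_iff z).1 hm
      exact ⟨a, rfl⟩⟩

theorem Solution.coe_tateEquiv (a : OE k E) :
    (s.tateEquiv a : LsepZ L ⊗[RZ L] M) = D.theta (LsepZ L) (s.xSep * (1 ⊗ₜ[k⟦X⟧] a)) := rfl

theorem Solution.actH1v_tateEquiv (a b : OE k E) :
    actH1v c a (s.tateEquiv b) = s.tateEquiv (a * b) := by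
  refine Subtype.ext ?_
  rw [s.coe_tateEquiv]
  have e : (1 : LsepZ L) ⊗ₜ[k⟦X⟧] (a * b) = (1 ⊗ₜ[k⟦X⟧] a) * (1 ⊗ₜ[k⟦X⟧] b) := by
    rw [Algebra.TensorProduct.tmul_mul_tmul, one_mul]
  rw [e, mul_left_comm]
  exact (theta_one_tmul_mul (isCompatible_act c) D.bij (LsepZ L) a _).symm

theorem Solution.tateInclM_theta (z : TateSep L ⊗[k⟦X⟧] OE k E) :
    tateInclM (D.theta (TateSep L) z) = D.theta (LsepZ L) (tateToSepO L E z) :=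
  (theta_map (isCompatible_act c) D.bij (tateIncl L) z).symm

theorem Solution.tateInclM_theta_x (a : OE k E) :
    tateInclM (D.theta (TateSep L) ((s.x : TateSep L ⊗[k⟦X⟧] OE k E) * (1 ⊗ₜ[k⟦X⟧] a))) = s.tateEquiv a := by
  rw [tateInclM_theta, map_mul, Algebra.TensorProduct.map_tmul, map_one, s.coe_tateEquiv]
  rfl

include s in
/-- The `τ`-invariants lie in `L^sep⟨z/ζ⟩ ⊗ M`. -/
theorem Solution.tateToH1v_bijective : Function.Bijective (tateToH1v S) := by
  have := S.free
  constructor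
  · intro m m' h
    have h1 : Function.Injective (LinearMap.rTensor M (tateIncl L).toLinearMap) :=
      Module.Flat.rTensor_preserves_injective_linearMap _ tateIncl_injective
    exact Subtype.ext (h1 (congrArg Subtype.val h))
  · intro m
    obtain ⟨a, rfl⟩ := s.tateEquiv.surjective m
    refine ⟨⟨D.theta (TateSep L) ((s.x : TateSep L ⊗[k⟦X⟧] OE k E) * (1 ⊗ₜ[k⟦X⟧] a)), ?_⟩, Subtype.ext (s.tateInclM_theta_x a)⟩
    change tateInclM _ ∈ H1v S
    rw [s.tateInclM_theta_x]
    exact (s.tateEquiv a).2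

/-- The solution over `C_v((z - ζ))`. -/
def Solution.xBC : BC L ⊗[k⟦X⟧] OE k E := tensorO E ((tateEvalAlg L).restrictScalars k⟦X⟧) s.x

theorem Solution.isUnit_xBC : IsUnit s.xBC :=
  s.x.isUnit.map (tensorO E ((tateEvalAlg L).restrictScalars k⟦X⟧))

theorem Solution.hZero_tateEquiv (a : OE k E) :
    hZero S (s.tateEquiv a) = D.theta (BC L) (s.xBC * (1 ⊗ₜ[k⟦X⟧] a)) := by
  have hmem : D.theta (TateSep L) ((s.x : TateSep L ⊗[k⟦X⟧] OE k E) * (1 ⊗ₜ[k⟦X⟧] a)) ∈ H1vTate S := by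
    change tateInclM _ ∈ H1v S
    rw [s.tateInclM_theta_x]
    exact (s.tateEquiv a).2
  have h1 : (LinearEquiv.ofBijective (tateToH1v S) s.tateToH1v_bijective).symm (s.tateEquiv a) =
      ⟨D.theta (TateSep L) ((s.x : TateSep L ⊗[k⟦X⟧] OE k E) * (1 ⊗ₜ[k⟦X⟧] a)), hmem⟩ := by
    rw [LinearEquiv.symm_apply_eq]
    exact Subtype.ext (s.tateInclM_theta_x a).symm
  rw [hZero, dif_pos s.tateToH1v_bijective, LinearMap.comp_apply, LinearMap.comp_apply,
    LinearEquiv.coe_coe, h1]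
  refine (theta_map (isCompatible_act c) D.bij (tateEvalAlg L) _).symm.trans ?_
  rw [map_mul, Algebra.TensorProduct.map_tmul, map_one]
  rfl

theorem Solution.hdR_tmul (b : BC L) (a : OE k E) :
    algebraMap (RZ L) (BC L) (zMinusZeta L) ^ D.n' • hdR S (b ⊗ₜ[k⟦X⟧] s.tateEquiv a) =
      D.thetaF (BC L) (baseMap k L E (BC L) D.t' * (s.xBC * (b ⊗ₜ[k⟦X⟧] a))) := by
  have e : b ⊗ₜ[k⟦X⟧] a = b • (1 ⊗ₜ[k⟦X⟧] a) := by rw [TensorProduct.smul_tmul', smul_eq_mul, mul_one]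
  rw [hdR, LinearMap.liftBaseChange_tmul, LinearMap.comp_apply, s.hZero_tateEquiv, smul_comm, e,
    mul_smul_comm, mul_smul_comm, map_smul]
  congr 1
  exact D.tauInvB_theta (BC L) (isUnit_zMinusZeta_BC L) _

/-- The isomorphism `O_E ≅ H^1_v(M, A_v)` after extension of scalars. -/
def Solution.tateEquivBC : BC L ⊗[k⟦X⟧] OE k E ≃ₗ[BC L] BC L ⊗[k⟦X⟧] H1v S :=
  s.tateEquiv.baseChange k⟦X⟧ (BC L) _ _

theorem Solution.hdR_tateEquivBC (w : BC L ⊗[k⟦X⟧] OE k E) :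
    algebraMap (RZ L) (BC L) (zMinusZeta L) ^ D.n' • hdR S (s.tateEquivBC w) =
      D.thetaF (BC L) (baseMap k L E (BC L) D.t' * (s.xBC * w)) := by
  induction w with
  | zero => simp
  | add w w' hw hw' => rw [map_add, map_add, smul_add, hw, hw', mul_add, mul_add, map_add]
  | tmul b a => exact s.hdR_tmul b a

theorem Triv.baseMap_t_mul_t' (D : Triv c) (B : Type*) [CommRing B] [Algebra (RZ L) B]
    [Algebra k⟦X⟧ B] [IsScalarTower k⟦X⟧ (RZ L) B] (x : B ⊗[k⟦X⟧] OE k E) :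
    baseMap k L E B D.t * (baseMap k L E B D.t' * x) =
      algebraMap (RZ L) B (zMinusZeta L) ^ (D.n + D.n') • x := by
  rw [← mul_assoc, ← map_mul, D.t_mul_t', ← map_pow, smul_eq_baseMap_mul]

theorem Triv.isUnit_baseMap_t' (D : Triv c) (B : Type*) [CommRing B] [Algebra (RZ L) B]
    [Algebra k⟦X⟧ B] [IsScalarTower k⟦X⟧ (RZ L) B]
    (hB : IsUnit (algebraMap (RZ L) B (zMinusZeta L))) : IsUnit (baseMap k L E B D.t') := by
  have h1 : baseMap k L E B D.t * baseMap k L E B D.t' =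
      algebraMap (RZ L) B (zMinusZeta L) ^ (D.n + D.n') • (1 : B ⊗[k⟦X⟧] OE k E) := by
    rw [← D.baseMap_t_mul_t' B 1, mul_one]
  refine isUnit_of_mul_isUnit_right (x := baseMap k L E B D.t) ?_
  rw [h1, ← Algebra.algebraMap_eq_smul_one]
  exact (hB.pow _).map (algebraMap B (B ⊗[k⟦X⟧] OE k E))

include s in
/-- The comparison homomorphism is an isomorphism. -/
theorem Solution.hdR_bijective : Function.Bijective (hdR S) := by
  have hz : IsUnit (algebraMap (RZ L) (BC L) (zMinusZeta L) ^ D.n') :=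
    (isUnit_zMinusZeta_BC L).pow D.n'
  have hu : IsUnit (baseMap k L E (BC L) D.t' * s.xBC) :=
    (D.isUnit_baseMap_t' (BC L) (isUnit_zMinusZeta_BC L)).mul s.isUnit_xBC
  constructor
  · intro w w' h
    obtain ⟨w, rfl⟩ := s.tateEquivBC.surjective w
    obtain ⟨w', rfl⟩ := s.tateEquivBC.surjective w'
    have h1 := s.hdR_tateEquivBC w
    rw [h, s.hdR_tateEquivBC w', ← mul_assoc, ← mul_assoc] at h1
    rw [hu.mul_right_inj.1 ((D.thetaF (BC L)).injective h1)]
  · intro v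
    obtain ⟨v', hv'⟩ := (D.thetaF (BC L)).surjective
      (algebraMap (RZ L) (BC L) (zMinusZeta L) ^ D.n' • v)
    obtain ⟨w, rfl⟩ : baseMap k L E (BC L) D.t' * s.xBC ∣ v' := hu.dvd
    refine ⟨s.tateEquivBC w, hz.smul_left_cancel.1 ?_⟩
    rw [s.hdR_tateEquivBC, ← mul_assoc, hv']

variable (u : H1v S →ₗ[k⟦X⟧] k⸨X⸩)

/-- The functional on `O_E` that corresponds to a functional on `H^1_v(M, A_v)`. -/
def Solution.functional : OE k E →ₗ[k⟦X⟧] k⸨X⸩ := u ∘ₗ s.tateEquiv.toLinearMap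

variable (L) in
/-- The extension of a functional on `O_E` to `C_v((z - ζ)) ⊗ O_E`. -/
def functionalBC (f : OE k E →ₗ[k⟦X⟧] k⸨X⸩) : BC L ⊗[k⟦X⟧] OE k E →ₗ[BC L] BC L :=
  LinearMap.liftBaseChange (BC L) (QvToBCLin L ∘ₗ f)

theorem functionalBC_tmul (f : OE k E →ₗ[k⟦X⟧] k⸨X⸩) (b : BC L) (a : OE k E) :
    functionalBC L f (b ⊗ₜ[k⟦X⟧] a) = b * QvToBC L (f a) :=
  LinearMap.liftBaseChange_tmul ..

theorem Solution.functionalBC_eq (w : BC L ⊗[k⟦X⟧] OE k E) :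
    LinearMap.liftBaseChange (BC L) (QvToBCLin L ∘ₗ u) (s.tateEquivBC w) =
      functionalBC L (s.functional u) w := by
  induction w with
  | zero => simp
  | add w w' hw hw' => rw [map_add, map_add, map_add, hw, hw']
  | tmul b a =>
    rw [functionalBC_tmul]
    exact LinearMap.liftBaseChange_tmul ..

variable (L E) in
/-- The map `L[[z - ζ]] ⊗ O_E → C_v((z - ζ)) ⊗ O_E`. -/
def plusToBC : BPlusL L ⊗[k⟦X⟧] OE k E →+* BC L ⊗[k⟦X⟧] OE k E :=
  (tensorO E ((IsScalarTower.toAlgHom (RZ L) (BPlusL L) (BC L)).restrictScalars k⟦X⟧)).toRingHom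

/-- The period in the coordinates of a trivialization. -/
theorem Solution.period_thetaF (v : BPlusL L ⊗[k⟦X⟧] OE k E) (w : BC L ⊗[k⟦X⟧] OE k E)
    (h : algebraMap (RZ L) (BC L) (zMinusZeta L) ^ D.n • (s.xBC * w) =
      baseMap k L E (BC L) D.t * plusToBC L E v) :
    period S u (D.thetaF (BPlusL L) v) = functionalBC L (s.functional u) w := by
  have h1 : dRToBC (D.thetaF (BPlusL L) v) = D.thetaF (BC L) (plusToBC L E v) :=
    (theta_map (isCompatible_frobAct c) D.bijF
      (IsScalarTower.toAlgHom (RZ L) (BPlusL L) (BC L)) v).symm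
  have hz : IsUnit (algebraMap (RZ L) (BC L) (zMinusZeta L)) := isUnit_zMinusZeta_BC L
  have h2 : hdR S (s.tateEquivBC w) = dRToBC (D.thetaF (BPlusL L) v) := by
    apply (hz.pow D.n').smul_left_cancel.1
    rw [s.hdR_tateEquivBC, h1, ← map_smul]
    congr 1
    apply (hz.pow D.n).smul_left_cancel.1
    rw [← mul_smul_comm, h, smul_smul, ← pow_add, ← D.baseMap_t_mul_t', mul_left_comm]
  rw [period, hdRInv, dif_pos s.hdR_bijective, ← h2, LinearEquiv.coe_coe,
    LinearEquiv.ofBijective_symm_apply_apply, s.functionalBC_eq]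

end Comparison

/-! ### The components of `L[[z - ζ]] ⊗ O_E` and their reductions -/

section Lift

/-- Hensel's lemma for separable extensions: a homomorphism `K → F[[X]]` whose reduction is the
inclusion of `K` into a finite separable extension `F` extends to a section `F → F[[X]]`. -/
theorem exists_ringHom_section {K F : Type*} [Field K] [Field F] [Algebra K F]
    [Algebra.IsSeparable K F] (ρ : K →+* F⟦X⟧)
    (hρ : ∀ x, PowerSeries.constantCoeff (ρ x) = algebraMap K F x) :
    ∃ j : F →+* F⟦X⟧, (∀ x, PowerSeries.constantCoeff (j x) = x) ∧
      ∀ x, j (algebraMap K F x) = ρ x := by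
  let _ : Algebra K F⟦X⟧ := ρ.toAlgebra
  let I : Ideal F⟦X⟧ := Ideal.span {PowerSeries.X}
  have hI : I = RingHom.ker (PowerSeries.constantCoeff (R := F)) := by
    ext f
    rw [Ideal.mem_span_singleton, RingHom.mem_ker, PowerSeries.X_dvd_iff]
  let r : F →ₐ[K] F⟦X⟧ ⧸ I :=
    { (Ideal.Quotient.mk I).comp (PowerSeries.C (R := F)) with
      commutes' := fun x => by
        change Ideal.Quotient.mk I (PowerSeries.C (algebraMap K F x)) = Ideal.Quotient.mk I (ρ x)
        rw [Ideal.Quotient.mk_eq_mk_iff_sub_mem, hI, RingHom.mem_ker, map_sub, hρ]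
        simp }
  have : Algebra.FormallyEtale K F := Algebra.FormallyEtale.of_isSeparable K F
  obtain ⟨g, hg⟩ := Algebra.FormallySmooth.exists_mkₐ_comp_eq_of_isAdicComplete r
  refine ⟨g.toRingHom, fun x => ?_, fun x => g.commutes x⟩
  have h1 : Ideal.Quotient.mk I (g x) = Ideal.Quotient.mk I (PowerSeries.C x) := AlgHom.congr_fun hg x
  rw [Ideal.Quotient.mk_eq_mk_iff_sub_mem, hI, RingHom.mem_ker, map_sub, sub_eq_zero] at h1
  change PowerSeries.constantCoeff (g x) = x
  rw [h1, PowerSeries.constantCoeff_C]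

end Lift

section Residue

variable {k : Type*} [Field k] [Fintype k] (L : IntermediateField k⸨X⸩ (Qalg k))
  [FiniteDimensional k⸨X⸩ L]

/-- The reduction `L[[z - ζ]] → L` modulo `z - ζ`. -/
def resPlus : BPlusL L →+* L := (PowerSeries.constantCoeff : L⟦X⟧ →+* L)

theorem resPlus_wPlus : resPlus L (wPlus L) = 0 := PowerSeries.constantCoeff_X

theorem wPlus_dvd_iff {b : BPlusL L} : wPlus L ∣ b ↔ resPlus L b = 0 :=
  PowerSeries.X_dvd_iff (R := L)

theorem isUnit_BPlusL_iff {b : BPlusL L} : IsUnit b ↔ resPlus L b ≠ 0 :=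
  (PowerSeries.isUnit_iff_constantCoeff (R := L)).trans isUnit_iff_ne_zero

instance : IsDomain (BPlusL L) := inferInstanceAs (IsDomain L⟦X⟧)

theorem wPlus_ne_zero : wPlus L ≠ 0 := PowerSeries.X_ne_zero (R := L)

theorem eq_zero_of_forall_wPlus_pow_dvd {b : BPlusL L} (h : ∀ n, wPlus L ^ n ∣ b) : b = 0 := by
  refine PowerSeries.ext (R := L) fun n => ?_
  exact (PowerSeries.X_pow_dvd_iff (R := L)).1 (h (n + 1)) n (Nat.lt_succ_self n)

/-- Evaluation of a power series at `ζ`. -/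
def evZeta : RZ L →+* VR L := evR (zeta L) (norm_zeta_lt_one L)

theorem evZeta_constRZ (a : VR L) : evZeta L (constRZ a) = a := evR_C _ a

theorem evZeta_zMinusZeta : evZeta L (zMinusZeta L) = 0 := by
  refine (map_sub (evZeta L) (zRZ L) (constRZ (zeta L))).trans ?_
  rw [evZeta_constRZ]
  exact sub_eq_zero.2 (evR_X _)

theorem zMinusZeta_dvd_of_evZeta_eq_zero {g : RZ L} (h : evZeta L g = 0) : zMinusZeta L ∣ g :=
  X_sub_C_dvd_of_eval_eq_zero (D := VR L) (evZeta L) (evR_C _) (evR_X _) h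

theorem resPlus_constRZ (a : VR L) : resPlus L (algebraMap (RZ L) (BPlusL L) (constRZ a)) = a := by
  change PowerSeries.constantCoeff (taylor (RtoL L (zeta L))
    ⟨PowerSeries.map (RtoL L) (PowerSeries.C a), RZ_mem_tateL L _⟩) = _
  simp only [PowerSeries.map_C, taylor_C, PowerSeries.constantCoeff_C]
  rfl

theorem resPlus_algebraMap (g : RZ L) :
    resPlus L (algebraMap (RZ L) (BPlusL L) g) = evZeta L g := by
  obtain ⟨h, hh⟩ := zMinusZeta_dvd_of_evZeta_eq_zero L (g := g - constRZ (evZeta L g))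
    (by rw [map_sub, evZeta_constRZ, sub_self])
  rw [sub_eq_iff_eq_add] at hh
  conv_lhs => rw [hh]
  rw [map_add, map_mul, map_add, map_mul, algebraMap_zMinusZeta, resPlus_wPlus, zero_mul, zero_add,
    resPlus_constRZ]

theorem evZeta_algebraMap (f : k⟦X⟧) : evZeta L (algebraMap k⟦X⟧ (RZ L) f) = algebraMap k⟦X⟧ (VR L) f := by
  refine evR_eq_of_forall _ _ _ fun n => ⟨algebraMap k⟦X⟧ (VR L)
    (PowerSeries.mk fun i => PowerSeries.coeff (i + n) f), ?_⟩
  conv_lhs => rw [sum_coeff_add_X_pow_mul f n]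
  rw [map_add, map_sum, map_mul, map_pow]
  congr 1
  refine Finset.sum_congr rfl fun i _ => ?_
  rw [map_mul, map_pow]
  rfl

theorem isUnit_X_BPlusL : IsUnit (algebraMap k⟦X⟧ (BPlusL L) PowerSeries.X) := by
  rw [isUnit_BPlusL_iff]
  change resPlus L (algebraMap (RZ L) (BPlusL L) (algebraMap k⟦X⟧ (RZ L) PowerSeries.X)) ≠ 0
  rw [resPlus_algebraMap, evZeta_algebraMap]
  exact zeta_ne_zero L

/-- The homomorphism `Q_v → L[[z - ζ]]`, `z ↦ ζ + (z - ζ)`. -/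
def QvToPlus : k⸨X⸩ →+* BPlusL L :=
  IsLocalization.Away.lift (S := k⸨X⸩) (PowerSeries.X : k⟦X⟧) (g := algebraMap k⟦X⟧ (BPlusL L))
    (isUnit_X_BPlusL L)

theorem QvToPlus_algebraMap (f : k⟦X⟧) :
    QvToPlus L (algebraMap k⟦X⟧ k⸨X⸩ f) = algebraMap k⟦X⟧ (BPlusL L) f :=
  IsLocalization.Away.lift_eq _ _ _

theorem resPlus_algebraMap_base (f : k⟦X⟧) : resPlus L (algebraMap k⟦X⟧ (BPlusL L) f) =
    algebraMap k⸨X⸩ L (algebraMap k⟦X⟧ k⸨X⸩ f) := by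
  change resPlus L (algebraMap (RZ L) (BPlusL L) (algebraMap k⟦X⟧ (RZ L) f)) = _
  rw [resPlus_algebraMap, evZeta_algebraMap]
  rfl

theorem resPlus_QvToPlus (x : k⸨X⸩) : resPlus L (QvToPlus L x) = algebraMap k⸨X⸩ L x := by
  have h : (resPlus L).comp (QvToPlus L) = algebraMap k⸨X⸩ L := by
    refine IsLocalization.ringHom_ext (Submonoid.powers (PowerSeries.X : k⟦X⟧)) ?_
    refine RingHom.ext fun f => ?_
    rw [RingHom.comp_apply, RingHom.comp_apply, QvToPlus_algebraMap, resPlus_algebraMap_base]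
    rfl
  exact RingHom.congr_fun h x

theorem plus_QvToPlus (x : k⸨X⸩) : algebraMap (BPlusL L) (BC L) (QvToPlus L x) = QvToBC L x := by
  have h : (algebraMap (BPlusL L) (BC L)).comp (QvToPlus L) = QvToBC L := by
    refine IsLocalization.ringHom_ext (Submonoid.powers (PowerSeries.X : k⟦X⟧)) ?_
    refine RingHom.ext fun f => ?_
    rw [RingHom.comp_apply, RingHom.comp_apply, QvToPlus_algebraMap, RingHom.comp_apply,
      QvToBC_algebraMap]
    rfl
  exact RingHom.congr_fun h x

theorem exists_section [Algebra.IsSeparable k⸨X⸩ L] : ∃ j : L →+* BPlusL L,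
    (∀ x, resPlus L (j x) = x) ∧ ∀ x, j (algebraMap k⸨X⸩ L x) = QvToPlus L x :=
  exists_ringHom_section (QvToPlus L) (resPlus_QvToPlus L)

/-- The section of the reduction `L[[z - ζ]] → L` that is compatible with `Q_v → L[[z - ζ]]`. -/
def liftL [Algebra.IsSeparable k⸨X⸩ L] : L →+* BPlusL L := (exists_section L).choose

theorem resPlus_liftL [Algebra.IsSeparable k⸨X⸩ L] (x : L) : resPlus L (liftL L x) = x :=
  (exists_section L).choose_spec.1 x

theorem liftL_algebraMap [Algebra.IsSeparable k⸨X⸩ L] (x : k⸨X⸩) :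
    liftL L (algebraMap k⸨X⸩ L x) = QvToPlus L x := (exists_section L).choose_spec.2 x

end Residue

section Components

variable {k : Type*} [Field k] [Fintype k] {L : IntermediateField k⸨X⸩ (Qalg k)}
  [FiniteDimensional k⸨X⸩ L] [Algebra.IsSeparable k⸨X⸩ L]
variable {E : Type*} [CommRing E] [Algebra k⸨X⸩ E] [Algebra k⟦X⟧ E] [IsScalarTower k⟦X⟧ k⸨X⸩ E]

instance : IsScalarTower k⟦X⟧ (BPlusL L) (BL L) := IsScalarTower.of_algebraMap_eq fun _ => rfl
instance : IsScalarTower k⟦X⟧ (BPlusL L) (BC L) := IsScalarTower.of_algebraMap_eq fun _ => rfl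

section Lift

variable (hL : ∀ (φ : E →ₐ[k⸨X⸩] Qalg k) (e : E), φ e ∈ L)

/-- The lift `O_E → L[[z - ζ]]` of an embedding `φ`, over `A_v`. -/
def liftEmb (φ : E →ₐ[k⸨X⸩] Qalg k) : OE k E →ₐ[k⟦X⟧] BPlusL L :=
  { (liftL L).comp ((algebraMap (VR L) L).comp (embR hL φ)) with
    commutes' := fun f => by
      change liftL L ((embR hL φ (algebraMap k⟦X⟧ (OE k E) f) : VR L) : L) = _
      rw [embR_algebraMap]
      exact (liftL_algebraMap L _).trans (QvToPlus_algebraMap L f) }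

theorem resPlus_liftEmb (φ : E →ₐ[k⸨X⸩] Qalg k) (a : OE k E) :
    resPlus L (liftEmb hL φ a) = (embR hL φ a : VR L) := resPlus_liftL L _

variable (B : Type*) [CommRing B] [Algebra (BPlusL L) B] [Algebra k⟦X⟧ B]
  [IsScalarTower k⟦X⟧ (BPlusL L) B]

/-- The `φ`-component `B ⊗ O_E → B` of `B ⊗ O_E`, for an `L[[z - ζ]]`-algebra `B`. -/
def evAt (φ : E →ₐ[k⸨X⸩] Qalg k) : B ⊗[k⟦X⟧] OE k E →ₐ[B] B :=
  Algebra.TensorProduct.lift (AlgHom.id B B)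
    ((IsScalarTower.toAlgHom k⟦X⟧ (BPlusL L) B).comp (liftEmb hL φ)) fun _ _ => mul_comm _ _

theorem evAt_tmul (φ : E →ₐ[k⸨X⸩] Qalg k) (b : B) (a : OE k E) :
    evAt hL B φ (b ⊗ₜ a) = b * algebraMap (BPlusL L) B (liftEmb hL φ a) :=
  Algebra.TensorProduct.lift_tmul ..

/-- The components are compatible with homomorphisms of `L[[z - ζ]]`-algebras. -/
theorem evAt_tensorO {B' : Type*} [CommRing B'] [Algebra (BPlusL L) B'] [Algebra k⟦X⟧ B']
    [IsScalarTower k⟦X⟧ (BPlusL L) B'] (f : B →ₐ[k⟦X⟧] B')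
    (hf : ∀ b : BPlusL L, f (algebraMap _ B b) = algebraMap _ B' b) (φ : E →ₐ[k⸨X⸩] Qalg k)
    (x : B ⊗[k⟦X⟧] OE k E) : evAt hL B' φ (tensorO E f x) = f (evAt hL B φ x) := by
  induction x with
  | zero => simp
  | add x y hx hy => simp only [map_add, hx, hy]
  | tmul b a =>
    rw [Algebra.TensorProduct.map_tmul, evAt_tmul, evAt_tmul, map_mul, hf]
    rfl

end Lift

variable [Module.Finite k⸨X⸩ E] [IsSemisimpleRing E] [Algebra.IsSeparable k⸨X⸩ E]
variable (hL : ∀ (φ : E →ₐ[k⸨X⸩] Qalg k) (e : E), φ e ∈ L)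

/-- Dedekind's independence of characters, for the lifted embeddings. -/
theorem isUnit_det_liftEmb (b : Module.Basis (Fin (Module.finrank k⸨X⸩ E)) k⟦X⟧ (OE k E))
    (b' : Module.Basis (Fin (Module.finrank k⸨X⸩ E)) k⸨X⸩ E) (hb : ∀ i, b' i = b i)
    (e : (E →ₐ[k⸨X⸩] Qalg k) ≃ Fin (Module.finrank k⸨X⸩ E)) :
    IsUnit (Matrix.of fun i j => liftEmb hL (e.symm i) (b j)).det := by
  rw [isUnit_BPlusL_iff, RingHom.map_det]
  intro h
  have h1 : (Matrix.of fun i j => e.symm i (b' j)).det = 0 := by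
    have h2 := congrArg (algebraMap L (Qalg k)) h
    rw [RingHom.map_det, map_zero] at h2
    rw [← h2]
    congr 1
    ext i j
    simp only [RingHom.mapMatrix_apply, Matrix.map_apply, Matrix.of_apply, resPlus_liftEmb, hb]
    rfl
  obtain ⟨v, hv, h3⟩ := Matrix.exists_vecMul_eq_zero_iff.2 h1
  have hli := linearIndependent_algHom_toLinearMap k⸨X⸩ E (Qalg k)
  rw [Fintype.linearIndependent_iff] at hli
  have h4 := hli (fun φ => v (e φ)) (b'.ext fun j => by
    have h5 := congrFun h3 j
    rw [Matrix.vecMul, dotProduct] at h5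
    rw [LinearMap.zero_apply, LinearMap.sum_apply, ← e.symm.sum_comp]
    refine Eq.trans ?_ h5
    refine Finset.sum_congr rfl fun i _ => ?_
    simp)
  exact hv (funext fun i => by simpa using h4 (e.symm i))

variable (B : Type*) [CommRing B] [Algebra (BPlusL L) B] [Algebra k⟦X⟧ B]
  [IsScalarTower k⟦X⟧ (BPlusL L) B]

/-- `B ⊗ O_E` is the product of its components. -/
theorem evAt_bijective : Function.Bijective fun (x : B ⊗[k⟦X⟧] OE k E) φ => evAt hL B φ x := by
  obtain ⟨b, b', hb⟩ := exists_basis_OE hL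
  have hc : Fintype.card (E →ₐ[k⸨X⸩] Qalg k) = Module.finrank k⸨X⸩ E := by
    rw [← Nat.card_eq_fintype_card, card_algHom_eq_finrank]
  let e := Fintype.equivFinOfCardEq hc
  let Q : Matrix (Fin (Module.finrank k⸨X⸩ E)) (Fin (Module.finrank k⸨X⸩ E)) B :=
    (algebraMap (BPlusL L) B).mapMatrix (Matrix.of fun i j => liftEmb hL (e.symm i) (b j))
  have hQ : IsUnit Q.det := by
    rw [← RingHom.map_det]; exact (isUnit_det_liftEmb hL b b' hb e).map _
  let β := Algebra.TensorProduct.basis B b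
  have hev : ∀ x φ, evAt hL B φ x = (Q.mulVec (β.repr x)) (e φ) := fun x φ => by
    conv_lhs => rw [← β.sum_repr x]
    rw [map_sum, Matrix.mulVec, dotProduct]
    refine Finset.sum_congr rfl fun j _ => ?_
    rw [map_smul, Algebra.TensorProduct.basis_apply, evAt_tmul, one_mul, smul_eq_mul, mul_comm]
    simp [Q]
  constructor
  · intro x x' h
    have h1 : Q.mulVec (β.repr x) = Q.mulVec (β.repr x') := funext fun i => by
      have h2 := congrFun h (e.symm i)
      simp only [hev, Equiv.apply_symm_apply] at h2
      exact h2
    have h2 := congrArg (Q⁻¹).mulVec h1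
    rw [Matrix.mulVec_mulVec, Matrix.mulVec_mulVec, Matrix.nonsing_inv_mul _ hQ, Matrix.one_mulVec,
      Matrix.one_mulVec] at h2
    exact β.repr.injective (DFunLike.coe_injective h2)
  · intro f
    refine ⟨β.equivFun.symm ((Q⁻¹).mulVec fun i => f (e.symm i)), funext fun φ => ?_⟩
    have h1 : ⇑(β.repr (β.equivFun.symm ((Q⁻¹).mulVec fun i => f (e.symm i)))) =
      (Q⁻¹).mulVec fun i => f (e.symm i) := β.equivFun.apply_symm_apply _
    change evAt hL B φ _ = _
    rw [hev, h1, Matrix.mulVec_mulVec, Matrix.mul_nonsing_inv _ hQ, Matrix.one_mulVec,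
      Equiv.symm_apply_apply]

theorem evAt_ext {x x' : B ⊗[k⟦X⟧] OE k E} (h : ∀ φ, evAt hL B φ x = evAt hL B φ x') : x = x' :=
  (evAt_bijective hL B).1 (funext h)

theorem exists_evAt_eq (f : (E →ₐ[k⸨X⸩] Qalg k) → B) : ∃ x, ∀ φ, evAt hL B φ x = f φ := by
  obtain ⟨x, hx⟩ := (evAt_bijective hL B).2 f
  exact ⟨x, congrFun hx⟩

theorem exists_eq_smul_of_dvd {r : B} {x : B ⊗[k⟦X⟧] OE k E} (h : ∀ φ, r ∣ evAt hL B φ x) :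
    ∃ x', x = r • x' := by
  choose f hf using h
  obtain ⟨x', hx'⟩ := exists_evAt_eq hL B f
  refine ⟨x', evAt_ext hL B fun φ => ?_⟩
  rw [map_smul, hx', hf, smul_eq_mul]

section Residue

variable {y : OE k E} (hy : IsUniformizing y)

/-- Evaluation of an element of `R[[z]] ⊗ O_E` at `z = ζ` and at the embedding `φ`. -/
def rho (φ : E →ₐ[k⸨X⸩] Qalg k) : RZ L ⊗[k⟦X⟧] OE k E →+* VR L :=
  (evPhi hy hL φ).comp (omegaAt (branchOf hy hL φ) (presRZ L))

theorem rho_tmul (φ : E →ₐ[k⸨X⸩] Qalg k) (g : RZ L) (a : OE k E) :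
    rho hL hy φ (g ⊗ₜ a) = evZeta L g * embR hL φ a := by
  rw [rho, RingHom.comp_apply, omegaAt_tmul, map_mul]
  congr 1
  · obtain ⟨h, hh⟩ := zMinusZeta_dvd_of_evZeta_eq_zero L (g := g - constRZ (evZeta L g))
      (by rw [map_sub, evZeta_constRZ, sub_self])
    have h1 : evPhi hy hL φ (omegaAt (branchOf hy hL φ) (presRZ L) (zMinusZeta L ⊗ₜ 1)) = 0 := by
      rw [omegaAt_zMinusZeta, map_sub, evPhi_z, evPhi_C, sub_self]
    rw [omegaAt_tmul, map_one, map_one, mul_one] at h1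
    rw [sub_eq_iff_eq_add] at hh
    conv_lhs => rw [hh]
    rw [map_add, map_mul, map_add, map_mul, map_add, map_mul, h1, zero_mul, zero_add]
    exact (congrArg (evPhi hy hL φ) (Branch.sub_C ..)).trans (evPhi_C hy hL φ _)
  · have h1 : PowerSeries.map (algebraMap (VR L) (VR L)) ((branchOf hy hL φ).hom a) =
        iota hy hL φ a := by
      rw [branchOf_hom]
      exact PowerSeries.ext fun n => PowerSeries.coeff_map _ n _
    rw [h1, evPhi_iota]

theorem resPlus_evAt_baseMap (φ : E →ₐ[k⸨X⸩] Qalg k) (x : RZ L ⊗[k⟦X⟧] OE k E) :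
    resPlus L (evAt hL (BPlusL L) φ (baseMap k L E (BPlusL L) x)) = (rho hL hy φ x : VR L) := by
  induction x with
  | zero => simp
  | add x y hx hy => simp only [map_add, hx, hy, Subalgebra.coe_add]
  | tmul g a =>
    rw [baseMap_tmul, evAt_tmul, rho_tmul, map_mul, resPlus_algebraMap]
    exact congrArg _ (resPlus_liftEmb hL φ a)

/-- The elements of `R[[z]] ⊗ O_E` that vanish at `z = ζ` in all embeddings are divisible by
`z - ζ`. -/
theorem exists_eq_zMinusZeta_smul {x : RZ L ⊗[k⟦X⟧] OE k E} (h : ∀ φ, rho hL hy φ x = 0) :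
    ∃ x', x = zMinusZeta L • x' := by
  obtain ⟨b, b', hb⟩ := exists_basis_OE hL
  obtain ⟨v, hv⟩ := exists_eq_smul_of_dvd hL (BPlusL L) (r := wPlus L)
    (x := baseMap k L E (BPlusL L) x) fun φ => by
      rw [wPlus_dvd_iff, resPlus_evAt_baseMap hL hy, h]; rfl
  let β := Algebra.TensorProduct.basis (RZ L) b
  let β' := Algebra.TensorProduct.basis (BPlusL L) b
  have h1 : ∀ x i, β'.repr (baseMap k L E (BPlusL L) x) i =
      algebraMap (RZ L) (BPlusL L) (β.repr x i) := fun x i => by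
    induction x with
    | zero => simp
    | add x y hx hy => simp only [map_add, Finsupp.add_apply, hx, hy]
    | tmul g a =>
      rw [baseMap_tmul, Algebra.TensorProduct.basis_repr_tmul,
        Algebra.TensorProduct.basis_repr_tmul]
      simp [Algebra.smul_def, IsScalarTower.algebraMap_apply k⟦X⟧ (RZ L) (BPlusL L)]
  have h2 : ∀ i, zMinusZeta L ∣ β.repr x i := fun i => by
    have h3 : resPlus L (β'.repr (baseMap k L E (BPlusL L) x) i) = 0 := by
      rw [hv, map_smul, Finsupp.smul_apply, smul_eq_mul, map_mul, resPlus_wPlus, zero_mul]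
    rw [h1, resPlus_algebraMap] at h3
    exact zMinusZeta_dvd_of_evZeta_eq_zero L (Subtype.ext h3)
  choose f hf using h2
  refine ⟨∑ i, f i • β i, ?_⟩
  conv_lhs => rw [← β.sum_repr x]
  rw [Finset.smul_sum]
  refine Finset.sum_congr rfl fun i _ => ?_
  rw [hf, mul_smul]

theorem rho_phiPrime (φ φ' : E →ₐ[k⸨X⸩] Qalg k) : rho hL hy φ (phiPrime hy hL φ') =
    if branchOf hy hL φ' = branchOf hy hL φ then embR hL φ y - embR hL φ' y else 1 := by
  rw [rho, RingHom.comp_apply, omegaAt_phiPrime]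
  split_ifs
  · rw [map_sub, evPhi_X, evPhi_C]
  · rw [map_one]

theorem rho_phiPrime_self (φ : E →ₐ[k⸨X⸩] Qalg k) : rho hL hy φ (phiPrime hy hL φ) = 0 := by
  rw [rho_phiPrime, if_pos rfl, sub_self]

theorem rho_phiPrime_ne_zero {φ φ' : E →ₐ[k⸨X⸩] Qalg k} (h : φ ≠ φ') :
    rho hL hy φ (phiPrime hy hL φ') ≠ 0 := by
  rw [rho_phiPrime]
  split_ifs with h1
  · intro h2
    exact h (embR_y_injOn h1.symm (sub_eq_zero.1 h2))
  · exact one_ne_zero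

theorem norm_rho_of_isUnit (φ : E →ₐ[k⸨X⸩] Qalg k) {x : RZ L ⊗[k⟦X⟧] OE k E} (hx : IsUnit x) :
    ‖(rho hL hy φ x : L)‖ = 1 := (isUnit_VR_iff _).1 (hx.map (rho hL hy φ))

end Residue

end Components

/-! ### The Hodge-Pink lattice and the CM-type -/

theorem mem_ideal_span_singleton_smul_top {A N : Type*} [CommRing A] [AddCommGroup N] [Module A N]
    {r : A} {x : N} : x ∈ Ideal.span {r} • (⊤ : Submodule A N) ↔ ∃ x', x = r • x' := by
  rw [Submodule.ideal_span_singleton_smul, Submodule.mem_smul_pointwise_iff_exists]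
  exact ⟨fun ⟨x', _, h⟩ => ⟨x', h.symm⟩, fun ⟨x', h⟩ => ⟨x', trivial, h.symm⟩⟩

section DeRham

variable {k : Type*} [Field k] [Fintype k] {L : IntermediateField k⸨X⸩ (Qalg k)}
  [FiniteDimensional k⸨X⸩ L] [Algebra.IsSeparable k⸨X⸩ L]
variable {E : Type*} [CommRing E] [Algebra k⸨X⸩ E] [Algebra k⟦X⟧ E] [IsScalarTower k⟦X⟧ k⸨X⸩ E]
  [Module.Finite k⸨X⸩ E] [IsSemisimpleRing E] [Algebra.IsSeparable k⸨X⸩ E]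
variable {y : OE k E} {hy : IsUniformizing y} {hL : ∀ (φ : E →ₐ[k⸨X⸩] Qalg k) (e : E), φ e ∈ L}
variable {M : Type*} [AddCommGroup M] [Module (RZ L) M] {S : LocalShtuka L M} {c : CM S E}
  (D : Triv c)

theorem exists_OE_ne (hL : ∀ (φ : E →ₐ[k⸨X⸩] Qalg k) (e : E), φ e ∈ L)
    {φ φ' : E →ₐ[k⸨X⸩] Qalg k} (h : φ ≠ φ') : ∃ a : OE k E, embR hL φ a ≠ embR hL φ' a := by
  by_contra! h1
  refine h (AlgHom.ext fun e => ?_)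
  obtain ⟨b, hb⟩ := exists_smul_mem_OE (k := k) e
  have h2 : φ ((b : k⟦X⟧) • e) = φ' ((b : k⟦X⟧) • e) :=
    congrArg (fun x : VR L => ((x : L) : Qalg k)) (h1 ⟨_, hb⟩)
  rw [← algebraMap_smul k⸨X⸩, map_smul, map_smul] at h2
  refine smul_right_injective _ ?_ h2
  intro h3
  exact nonZeroDivisors.ne_zero b.2
    ((FaithfulSMul.algebraMap_injective k⟦X⟧ k⸨X⸩) (h3.trans (map_zero _).symm))

section HPsi

/-- The constants in `L[[z - ζ]]`. -/
def cPlus (x : L) : BPlusL L := (PowerSeries.C x : L⟦X⟧)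

theorem resPlus_cPlus (x : L) : resPlus L (cPlus x) = x := PowerSeries.constantCoeff_C x

variable (L) in
theorem mem_span_wPlus_iff {N : Type*} [AddCommGroup N] [Module (BPlusL L) N]
    (e : (BPlusL L ⊗[k⟦X⟧] OE k E) ≃ₗ[BPlusL L] N) (hL : ∀ (φ : E →ₐ[k⸨X⸩] Qalg k) (e : E), φ e ∈ L)
    (n : ℕ) (v : BPlusL L ⊗[k⟦X⟧] OE k E) :
    e v ∈ Ideal.span {wPlus L ^ n} • (⊤ : Submodule (BPlusL L) N) ↔
      ∀ φ, wPlus L ^ n ∣ evAt hL (BPlusL L) φ v := by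
  rw [mem_ideal_span_singleton_smul_top]
  constructor
  · rintro ⟨x', hx'⟩ φ
    obtain ⟨v', rfl⟩ := e.surjective x'
    rw [← map_smul] at hx'
    rw [e.injective hx', map_smul, smul_eq_mul]
    exact dvd_mul_right _ _
  · intro h
    obtain ⟨v', rfl⟩ := exists_eq_smul_of_dvd hL (BPlusL L) h
    exact ⟨e v', map_smul _ _ _⟩

theorem dRShift_thetaF (ψ : E →ₐ[k⸨X⸩] Qalg k) (a : OE k E) (v : BPlusL L ⊗[k⟦X⟧] OE k E) :
    dRShift c (hL ψ) a (D.thetaF (BPlusL L) v) = D.thetaF (BPlusL L)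
      ((1 ⊗ₜ[k⟦X⟧] a - algebraMap (BPlusL L) _ (cPlus (embR hL ψ a : VR L))) * v) := by
  have h1 := theta_one_tmul_mul (isCompatible_frobAct c) D.bijF (BPlusL L) a v
  rw [sub_mul, map_sub, ← Algebra.smul_def, map_smul]
  refine Eq.trans ?_ (congrArg (· - _) h1.symm)
  rfl

theorem dRShift_pow_thetaF (ψ : E →ₐ[k⸨X⸩] Qalg k) (a : OE k E) (m : ℕ)
    (v : BPlusL L ⊗[k⟦X⟧] OE k E) :
    (dRShift c (hL ψ) a ^ m) (D.thetaF (BPlusL L) v) = D.thetaF (BPlusL L)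
      ((1 ⊗ₜ[k⟦X⟧] a - algebraMap (BPlusL L) _ (cPlus (embR hL ψ a : VR L))) ^ m * v) := by
  induction m with
  | zero => rw [pow_zero, pow_zero, one_mul]; rfl
  | succ m ih =>
    rw [pow_succ' (dRShift c (hL ψ) a), Module.End.mul_apply, ih, dRShift_thetaF, ← mul_assoc,
      ← pow_succ']

theorem evAt_shift (φ ψ : E →ₐ[k⸨X⸩] Qalg k) (a : OE k E) :
    resPlus L (evAt hL (BPlusL L) φ
      (1 ⊗ₜ[k⟦X⟧] a - algebraMap (BPlusL L) _ (cPlus (embR hL ψ a : VR L)))) =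
      (embR hL φ a : VR L) - (embR hL ψ a : VR L) := by
  rw [map_sub, AlgHom.commutes, evAt_tmul, one_mul, map_sub]
  exact congrArg₂ _ (resPlus_liftEmb hL φ a) (resPlus_cPlus _)

/-- The `ψ`-component of the de Rham realization, in terms of the components of
`L[[z - ζ]] ⊗ O_E`. -/
theorem thetaF_mem_HPsi_iff (ψ : E →ₐ[k⸨X⸩] Qalg k) (v : BPlusL L ⊗[k⟦X⟧] OE k E) :
    D.thetaF (BPlusL L) v ∈ HPsi c (hL ψ) ↔ ∀ φ, φ ≠ ψ → evAt hL (BPlusL L) φ v = 0 := by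
  have hmem : D.thetaF (BPlusL L) v ∈ HPsi c (hL ψ) ↔ ∀ (a : OE k E) (n : ℕ), ∀ᶠ m in atTop,
      ∀ φ, wPlus L ^ n ∣ evAt hL (BPlusL L) φ
        ((1 ⊗ₜ[k⟦X⟧] a - algebraMap (BPlusL L) _ (cPlus (embR hL ψ a : VR L))) ^ m * v) := by
    refine forall_congr' fun a => forall_congr' fun n => eventually_congr (.of_forall fun m => ?_)
    rw [dRShift_pow_thetaF, mem_span_wPlus_iff L _ hL]
  rw [hmem]
  constructor
  · intro h φ hφ
    obtain ⟨a, ha⟩ := exists_OE_ne hL hφ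
    refine eq_zero_of_forall_wPlus_pow_dvd L fun n => ?_
    obtain ⟨m, hm⟩ := (h a n).exists
    have h1 := hm φ
    rw [map_mul, map_pow] at h1
    refine (IsUnit.dvd_mul_left (IsUnit.pow m ((isUnit_BPlusL_iff L).2 ?_))).1 h1
    rw [evAt_shift, sub_ne_zero]
    exact fun h2 => ha (Subtype.ext h2)
  · intro h a n
    filter_upwards [eventually_ge_atTop n] with m hm φ
    rw [map_mul, map_pow]
    by_cases hφ : φ = ψ
    · subst hφ
      refine Dvd.dvd.mul_right ((pow_dvd_pow _ hm).trans (pow_dvd_pow_of_dvd ?_ m)) _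
      rw [wPlus_dvd_iff, evAt_shift, sub_self]
    · rw [h φ hφ, mul_zero]
      exact dvd_zero _

end HPsi

section HodgePink

/-- `z - ζ` in `L((z - ζ))`. -/
abbrev wBL (L : IntermediateField k⸨X⸩ (Qalg k)) [FiniteDimensional k⸨X⸩ L] : BL L :=
  algebraMap (BPlusL L) (BL L) (wPlus L)

theorem wBL_eq : algebraMap (RZ L) (BL L) (zMinusZeta L) = wBL L := by
  rw [IsScalarTower.algebraMap_apply (RZ L) (BPlusL L) (BL L), algebraMap_zMinusZeta]

theorem wBL_ne_zero : wBL L ≠ 0 := wBL_eq (L := L) ▸ (isUnit_zMinusZeta_BL L).ne_zero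

theorem algebraMap_BL_injective : Function.Injective (algebraMap (BPlusL L) (BL L)) :=
  HahnSeries.ofPowerSeries_injective (Γ := ℤ) (R := L)

theorem zpow_wBL_mem_range_iff {n : ℤ} (u : (BPlusL L)ˣ) :
    wBL L ^ n * algebraMap (BPlusL L) (BL L) u ∈ (algebraMap (BPlusL L) (BL L)).range ↔ 0 ≤ n := by
  constructor
  · rintro ⟨b, hb⟩
    by_contra! hn
    obtain ⟨m, rfl⟩ : ∃ m : ℕ, n = -((m : ℤ) + 1) := ⟨(-n - 1).toNat, by omega⟩
    have h1 : algebraMap (BPlusL L) (BL L) (b * wPlus L ^ (m + 1)) =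
        algebraMap (BPlusL L) (BL L) u := by
      rw [map_mul, map_pow, hb, mul_right_comm, ← zpow_natCast, ← zpow_add₀ wBL_ne_zero]
      simp
    have h2 := congrArg (resPlus L) (algebraMap_BL_injective h1)
    rw [map_mul, map_pow, resPlus_wPlus, zero_pow (Nat.succ_ne_zero m), mul_zero] at h2
    exact (isUnit_BPlusL_iff L).1 u.isUnit h2.symm
  · intro h
    obtain ⟨m, rfl⟩ := Int.eq_ofNat_of_zero_le h
    exact ⟨wPlus L ^ m * u, by rw [map_mul, map_pow, zpow_natCast]⟩

/-- The map `L[[z - ζ]] ⊗ O_E → L((z - ζ)) ⊗ O_E`. -/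
abbrev plusToBL (L : IntermediateField k⸨X⸩ (Qalg k)) [FiniteDimensional k⸨X⸩ L]
    (E : Type*) [CommRing E] [Algebra k⟦X⟧ E] :
    BPlusL L ⊗[k⟦X⟧] OE k E →ₐ[k⟦X⟧] BL L ⊗[k⟦X⟧] OE k E :=
  tensorO E ((IsScalarTower.toAlgHom (RZ L) (BPlusL L) (BL L)).restrictScalars k⟦X⟧)

theorem evAt_plusToBL (φ : E →ₐ[k⸨X⸩] Qalg k) (v : BPlusL L ⊗[k⟦X⟧] OE k E) :
    evAt hL (BL L) φ (plusToBL L E v) = algebraMap (BPlusL L) (BL L) (evAt hL (BPlusL L) φ v) :=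
  evAt_tensorO hL (BPlusL L) _ (fun _ => rfl) φ v

theorem mem_range_plusToBL_iff (hL : ∀ (φ : E →ₐ[k⸨X⸩] Qalg k) (e : E), φ e ∈ L)
    (x : BL L ⊗[k⟦X⟧] OE k E) :
    x ∈ (plusToBL L E).range ↔ ∀ φ, evAt hL (BL L) φ x ∈ (algebraMap (BPlusL L) (BL L)).range := by
  constructor
  · rintro ⟨v, rfl⟩ φ
    exact ⟨_, (evAt_plusToBL φ v).symm⟩
  · intro h
    choose f hf using h
    obtain ⟨v, hv⟩ := exists_evAt_eq hL (BPlusL L) f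
    refine ⟨v, evAt_ext hL (BL L) fun φ => ?_⟩
    rw [← hf, ← hv]
    exact evAt_plusToBL φ v

theorem latIncl_theta {N : Type*} [AddCommGroup N] [Module (RZ L) N]
    {ρ : OE k E →+* Module.End (RZ L) N} (hρ : IsCompatible ρ) {n : N}
    (hn : Function.Bijective (orbitMap hρ n)) (v : BPlusL L ⊗[k⟦X⟧] OE k E) :
    latIncl L N (theta hρ hn (BPlusL L) v) = theta hρ hn (BL L) (plusToBL L E v) :=
  (theta_map hρ hn (IsScalarTower.toAlgHom (RZ L) (BPlusL L) (BL L)) v).symm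

theorem theta_mem_range_latIncl_iff {N : Type*} [AddCommGroup N] [Module (RZ L) N]
    {ρ : OE k E →+* Module.End (RZ L) N} (hρ : IsCompatible ρ) {n : N}
    (hn : Function.Bijective (orbitMap hρ n)) (x : BL L ⊗[k⟦X⟧] OE k E) :
    theta hρ hn (BL L) x ∈ LinearMap.range (latIncl L N) ↔ x ∈ (plusToBL L E).range := by
  constructor
  · rintro ⟨m, hm⟩
    obtain ⟨v, rfl⟩ := (theta hρ hn (BPlusL L)).surjective m
    rw [latIncl_theta] at hm
    exact ⟨v, (theta hρ hn (BL L)).injective hm⟩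
  · rintro ⟨v, rfl⟩
    exact ⟨theta hρ hn (BPlusL L) v, latIncl_theta hρ hn v⟩

/-- The Hodge-Pink lattice in terms of the components of `L((z - ζ)) ⊗ O_E`. -/
theorem thetaF_mem_hodgePink_iff (hL : ∀ (φ : E →ₐ[k⸨X⸩] Qalg k) (e : E), φ e ∈ L)
    (x : BL L ⊗[k⟦X⟧] OE k E) : D.thetaF (BL L) x ∈ hodgePink S ↔
      ∀ φ, wBL L ^ (-(D.n : ℤ)) * (evAt hL (BL L) φ (baseMap k L E (BL L) D.t) *
        evAt hL (BL L) φ x) ∈ (algebraMap (BPlusL L) (BL L)).range := by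
  have h1 : tauB (BL L) S (isUnit_zMinusZeta_BL L) (D.thetaF (BL L) x) =
      D.theta (BL L) (wBL L ^ (-(D.n : ℤ)) • (baseMap k L E (BL L) D.t * x)) := by
    apply ((isUnit_zMinusZeta_BL L).pow D.n).smul_left_cancel.1
    rw [D.tauB_thetaF, map_smul, smul_smul, wBL_eq, zpow_neg, zpow_natCast,
      mul_inv_cancel₀ (pow_ne_zero _ wBL_ne_zero), one_smul]
  change tauB (BL L) S (isUnit_zMinusZeta_BL L) (D.thetaF (BL L) x) ∈ LinearMap.range _ ↔ _
  rw [h1]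
  refine (theta_mem_range_latIncl_iff (isCompatible_act c) D.bij _).trans ?_
  rw [mem_range_plusToBL_iff hL]
  simp only [map_smul, map_mul, smul_eq_mul]

theorem wPow_thetaF (n : ℤ) (x : BL L ⊗[k⟦X⟧] OE k E) :
    wPow L M n (D.thetaF (BL L) x) = D.thetaF (BL L) (wBL L ^ n • x)  := by
  rw [map_smul]
  rfl

/-- The CM-type is given by the orders of the components of `t`. -/
theorem eq_of_hasCMType (Φ : (E →ₐ[k⸨X⸩] Qalg k) → ℤ) (hΦ : HasCMType c hL Φ)
    {φ : E →ₐ[k⸨X⸩] Qalg k} {n : ℕ} {u : (BPlusL L)ˣ}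
    (ht : evAt hL (BPlusL L) φ (baseMap k L E (BPlusL L) D.t) = wPlus L ^ n * u) :
    Φ φ = n - D.n := by
  classical
  have ht' : evAt hL (BL L) φ (baseMap k L E (BL L) D.t) =
      wBL L ^ (n : ℤ) * algebraMap (BPlusL L) (BL L) u := by
    rw [← tensorO_baseMap (IsScalarTower.toAlgHom (RZ L) (BPlusL L) (BL L))]
    refine (evAt_plusToBL φ _).trans ?_
    rw [ht, map_mul, map_pow, zpow_natCast]
  -- Both descriptions of the lattice are tested on the multiples `(z - ζ)^m e` of the idempotent of `φ`.
  obtain ⟨e, he⟩ := exists_evAt_eq hL (BPlusL L) (Pi.single φ 1)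
  have he' : ∀ φ', evAt hL (BL L) φ' (plusToBL L E e) = if φ' = φ then 1 else 0 := fun φ' => by
    rw [evAt_plusToBL, he, Pi.single_apply]
    split_ifs <;> simp
  have hw : ∀ m m' : ℤ, wBL L ^ m * (wBL L ^ m' * algebraMap (BPlusL L) (BL L) u) =
      wBL L ^ (m + m') * algebraMap (BPlusL L) (BL L) u := fun m m' => by
    rw [← mul_assoc, ← zpow_add₀ wBL_ne_zero]
  have h1 : ∀ m : ℤ, D.thetaF (BL L) (wBL L ^ m • plusToBL L E e) ∈ hodgePink S ↔
      0 ≤ n - D.n + m := fun m => by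
    rw [thetaF_mem_hodgePink_iff D hL, ← zpow_wBL_mem_range_iff u]
    have h2 : n - (D.n : ℤ) + m = m + (-(D.n : ℤ) + n) := by ring
    constructor
    · intro h
      have h3 := h φ
      rw [map_smul, he', if_pos rfl, smul_eq_mul, mul_one, ht', mul_comm (wBL L ^ (n : ℤ) * _),
        mul_left_comm, hw, hw, ← h2] at h3
      exact h3
    · intro h φ'
      rw [map_smul, he']
      split_ifs with h3
      · subst h3
        rw [smul_eq_mul, mul_one, ht', mul_comm (wBL L ^ (n : ℤ) * _), mul_left_comm, hw, hw, ← h2]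
        exact h
      · rw [smul_zero, mul_zero, mul_zero]
        exact zero_mem _
  have h3 : ∀ m : ℤ, D.thetaF (BL L) (wBL L ^ m • plusToBL L E e) ∈ hodgePink S ↔
      0 ≤ Φ φ + m := fun m => by
    rw [show hodgePink S = _ from hΦ]
    constructor
    · intro h
      let G : BL L ⊗[RZ L] FrobPull L M →ₗ[BPlusL L] BL L :=
        ((evAt hL (BL L) φ).toLinearMap ∘ₗ (D.thetaF (BL L)).symm.toLinearMap).restrictScalars _
      have hG : ∀ x, G (D.thetaF (BL L) x) = evAt hL (BL L) φ x := fun x => by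
        change evAt hL (BL L) φ ((D.thetaF (BL L)).symm (D.thetaF (BL L) x)) = _
        rw [LinearEquiv.symm_apply_apply]
      let P : Submodule (BPlusL L) (BL L) :=
        LinearMap.range (LinearMap.toSpanSingleton (BPlusL L) (BL L) (wBL L ^ (-Φ φ)))
      have h4 : (⨆ φ' : E →ₐ[k⸨X⸩] Qalg k, ((HPsi c (hL φ')).map (latIncl L (FrobPull L M))).map
          (wPow L M (-Φ φ'))) ≤ P.comap G := by
        refine iSup_le fun φ' => ?_
        rintro _ ⟨_, ⟨m', hm', rfl⟩, rfl⟩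
        obtain ⟨v, rfl⟩ := (D.thetaF (BPlusL L)).surjective m'
        have hv := (thetaF_mem_HPsi_iff D φ' v).1 hm'
        have h5 : latIncl L (FrobPull L M) (D.thetaF (BPlusL L) v) =
            D.thetaF (BL L) (plusToBL L E v) := latIncl_theta (isCompatible_frobAct c) D.bijF v
        rw [h5, wPow_thetaF, Submodule.mem_comap, hG, map_smul, evAt_plusToBL]
        by_cases h6 : φ = φ'
        · subst h6
          refine ⟨evAt hL (BPlusL L) φ v, ?_⟩
          rw [LinearMap.toSpanSingleton_apply, Algebra.smul_def, smul_eq_mul, mul_comm]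
        · rw [hv φ h6, map_zero, smul_zero]
          exact zero_mem _
      obtain ⟨b, hb⟩ := h4 h
      rw [hG, map_smul, he', if_pos rfl, smul_eq_mul, mul_one, LinearMap.toSpanSingleton_apply,
        Algebra.smul_def] at hb
      refine (zpow_wBL_mem_range_iff 1).1 ⟨b, ?_⟩
      rw [Units.val_one, map_one, mul_one, zpow_add₀ wBL_ne_zero, ← hb, mul_left_comm,
        ← zpow_add₀ wBL_ne_zero, add_neg_cancel, zpow_zero, mul_one]
    · intro h
      obtain ⟨i, hi⟩ := Int.eq_ofNat_of_zero_le h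
      obtain rfl : m = -Φ φ + i := by omega
      have h4 : D.thetaF (BPlusL L) (wPlus L ^ i • e) ∈ HPsi c (hL φ) := by
        rw [thetaF_mem_HPsi_iff]
        intro φ' hφ'
        rw [map_smul, he, Pi.single_eq_of_ne hφ', smul_zero]
      refine Submodule.mem_iSup_of_mem φ ⟨_, ⟨_, h4, rfl⟩, ?_⟩
      have h5 : latIncl L (FrobPull L M) (D.thetaF (BPlusL L) (wPlus L ^ i • e)) =
          D.thetaF (BL L) (plusToBL L E (wPlus L ^ i • e)) :=
        latIncl_theta (isCompatible_frobAct c) D.bijF _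
      rw [h5, wPow_thetaF]
      congr 1
      refine evAt_ext hL (BL L) fun φ' => ?_
      have h6 : evAt hL (BPlusL L) φ' (wPlus L ^ i • e) = wPlus L ^ i * evAt hL (BPlusL L) φ' e :=
        map_smul _ _ _
      rw [map_smul, evAt_plusToBL, h6, map_mul, map_smul, evAt_plusToBL, smul_eq_mul, smul_eq_mul,
        map_pow, zpow_add₀ wBL_ne_zero, zpow_natCast, mul_assoc]
  have h5 := (h1 (-Φ φ)).symm.trans (h3 (-Φ φ))
  have h6 := (h1 (D.n - n)).symm.trans (h3 (D.n - n))
  rw [add_neg_cancel] at h5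
  have h7 := h5.2 le_rfl
  have h8 := h6.1 (by omega)
  omega

end HodgePink

variable (hy hL)

theorem rho_smul (φ : E →ₐ[k⸨X⸩] Qalg k) (g : RZ L) (x : RZ L ⊗[k⟦X⟧] OE k E) :
    rho hL hy φ (g • x) = evZeta L g * rho hL hy φ x := by
  induction x with
  | zero => simp
  | add x y hx hy => simp only [smul_add, map_add, hx, hy, mul_add]
  | tmul g' a => rw [TensorProduct.smul_tmul', rho_tmul, rho_tmul, smul_eq_mul, map_mul, mul_assoc]

open Classical in
/-- The product of the prime elements of all embeddings but `ψ`. Modulo `z - ζ` it generates the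
`ψ`-component of `R[[z]] ⊗ O_E`. -/
def primeProd (ψ : E →ₐ[k⸨X⸩] Qalg k) : RZ L ⊗[k⟦X⟧] OE k E :=
  ∏ φ ∈ Finset.univ.erase ψ, phiPrime hy hL φ

theorem rho_primeProd_of_ne {φ ψ : E →ₐ[k⸨X⸩] Qalg k} (h : φ ≠ ψ) :
    rho hL hy φ (primeProd hy hL ψ) = 0 := by
  classical
  rw [primeProd, map_prod]
  exact Finset.prod_eq_zero (Finset.mem_erase.2 ⟨h, Finset.mem_univ φ⟩) (rho_phiPrime_self hL hy φ)

theorem rho_primeProd_ne_zero (ψ : E →ₐ[k⸨X⸩] Qalg k) : rho hL hy ψ (primeProd hy hL ψ) ≠ 0 := by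
  classical
  rw [primeProd, map_prod, Finset.prod_ne_zero_iff]
  intro φ hφ
  exact rho_phiPrime_ne_zero hL hy (Finset.ne_of_mem_erase hφ).symm

theorem omegaAt_primeProd (ψ : E →ₐ[k⸨X⸩] Qalg k) [DecidableEq (E →ₐ[k⸨X⸩] Qalg k)] :
    omegaAt (branchOf hy hL ψ) (presRZ L) (primeProd hy hL ψ) =
    ∏ φ ∈ (branchOf hy hL ψ).embeddings.erase ψ,
      (PowerSeries.X - PowerSeries.C (embR hL φ y) : (VR L)⟦X⟧) := by
  rw [primeProd, map_prod]
  simp only [omegaAt_phiPrime]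
  rw [Finset.prod_ite, Finset.prod_const_one, mul_one]
  refine Finset.prod_congr ?_ fun _ _ => rfl
  ext φ
  simp only [Finset.mem_filter, Finset.mem_erase, Branch.mem_embeddings, Finset.mem_univ, and_true]

/-- The elements that vanish at all embeddings but `ψ` are, at `ψ`, divisible by `primeProd ψ`. -/
theorem rho_primeProd_dvd {ψ : E →ₐ[k⸨X⸩] Qalg k} {x : RZ L ⊗[k⟦X⟧] OE k E}
    (h : ∀ φ, φ ≠ ψ → rho hL hy φ x = 0) :
    rho hL hy ψ (primeProd hy hL ψ) ∣ rho hL hy ψ x := by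
  classical
  have h1 : ∏ φ ∈ (branchOf hy hL ψ).embeddings.erase ψ,
      (PowerSeries.X - PowerSeries.C (embR hL φ y) : (VR L)⟦X⟧) ∣
      omegaAt (branchOf hy hL ψ) (presRZ L) x := by
    refine prod_X_sub_C_dvd _ (fun φ => embR hL φ y) (fun φ => norm_embR_y_lt_one φ hy) ?_ ?_
    · intro φ hφ φ' hφ' e
      refine embR_y_injOn (hy := hy) ?_ e
      rw [Branch.mem_embeddings.1 (Finset.mem_of_mem_erase hφ), Branch.mem_embeddings.1 (Finset.mem_of_mem_erase hφ')]
    · intro φ hφ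
      have h2 := h φ (Finset.ne_of_mem_erase hφ)
      rw [rho, RingHom.comp_apply, Branch.mem_embeddings.1 (Finset.mem_of_mem_erase hφ)] at h2
      exact h2
  rw [← omegaAt_primeProd] at h1
  exact map_dvd (evPhi hy hL ψ) h1

section Functional

/-- The extension of a functional on `O_E` to `R[[z]] ⊗ O_E`. -/
def functionalRZ (L : IntermediateField k⸨X⸩ (Qalg k)) (g : OE k E →ₗ[k⟦X⟧] k⟦X⟧) :
    RZ L ⊗[k⟦X⟧] OE k E →ₗ[RZ L] RZ L :=
  LinearMap.liftBaseChange (RZ L) (Algebra.linearMap k⟦X⟧ (RZ L) ∘ₗ g)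

theorem functionalRZ_tmul (g : OE k E →ₗ[k⟦X⟧] k⟦X⟧) (b : RZ L) (a : OE k E) :
    functionalRZ L g (b ⊗ₜ a) = b * algebraMap k⟦X⟧ (RZ L) (g a) :=
  LinearMap.liftBaseChange_tmul ..

theorem functionalRZ_comp_mul (g : OE k E →ₗ[k⟦X⟧] k⟦X⟧) (b : OE k E) (x : RZ L ⊗[k⟦X⟧] OE k E) :
    functionalRZ L (g ∘ₗ LinearMap.mulLeft k⟦X⟧ b) x =
      functionalRZ L g (1 ⊗ₜ[k⟦X⟧] b * x) := by
  induction x with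
  | zero => simp
  | add x y hx hy => simp only [map_add, mul_add, hx, hy]
  | tmul r a =>
    rw [Algebra.TensorProduct.tmul_mul_tmul, functionalRZ_tmul, functionalRZ_tmul, one_mul]
    rfl

theorem evZeta_functionalRZ_congr (g : OE k E →ₗ[k⟦X⟧] k⟦X⟧) {x x' : RZ L ⊗[k⟦X⟧] OE k E}
    (h : ∀ φ, rho hL hy φ x = rho hL hy φ x') :
    evZeta L (functionalRZ L g x) = evZeta L (functionalRZ L g x') := by
  obtain ⟨x'', hx''⟩ := exists_eq_zMinusZeta_smul hL hy (x := x - x')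
    fun φ => by rw [map_sub, h, sub_self]
  rw [← sub_eq_zero, ← map_sub, ← map_sub, hx'', map_smul, smul_eq_mul, map_mul,
    evZeta_zMinusZeta, zero_mul]

/-- The pairing of a generator of the dual of `O_E` with `primeProd ψ` is a unit: modulo `z - ζ`,
the latter is not divisible by the uniformizer of `R`. -/
theorem isUnit_evZeta_functionalRZ (ψ : E →ₐ[k⸨X⸩] Qalg k) {g : OE k E →ₗ[k⟦X⟧] k⟦X⟧}
    (hg : ∀ h : OE k E →ₗ[k⟦X⟧] k⟦X⟧, ∃ b, h = g ∘ₗ LinearMap.mulLeft k⟦X⟧ b) :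
    IsUnit (evZeta L (functionalRZ L g (primeProd hy hL ψ))) := by
  obtain ⟨b, -, -⟩ := exists_basis_OE hL
  obtain ⟨π, hπ1, hπ0, hπ⟩ := exists_uniformizer_VR (L := L)
  let β := Algebra.TensorProduct.basis (RZ L) b
  set P := primeProd hy hL ψ with hP
  -- Some coordinate of `P` is a unit modulo `z - ζ`; otherwise `P` would be `π γ` modulo `z - ζ`, with
  -- `γ` a multiple of `P` at `ψ`.
  have h1 : ∃ i, IsUnit (evZeta L (β.repr P i)) := by
    by_contra! h
    choose r hr using fun i => hπ _ ((not_isUnit_VR_iff _).1 (h i))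
    let γ := ∑ i, constRZ (r i) • β i
    have h2 : ∀ φ, rho hL hy φ P = π * rho hL hy φ γ := fun φ => by
      conv_lhs => rw [← β.sum_repr P]
      rw [map_sum, map_sum, Finset.mul_sum]
      refine Finset.sum_congr rfl fun i _ => ?_
      rw [rho_smul, rho_smul, hr, evZeta_constRZ, mul_assoc]
    have h3 : rho hL hy ψ P ∣ rho hL hy ψ γ := rho_primeProd_dvd hy hL fun φ hφ => by
      have h4 := h2 φ
      rw [hP, rho_primeProd_of_ne hy hL hφ] at h4
      exact (mul_eq_zero.1 h4.symm).resolve_left hπ0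
    obtain ⟨d, hd⟩ := h3
    have h5 := h2 ψ
    rw [hd, mul_left_comm] at h5
    have h6 : π * d = 1 := mul_left_cancel₀ (rho_primeProd_ne_zero hy hL ψ) (by
      rw [mul_one, ← hP, ← h5])
    exact (not_isUnit_VR_iff _).2 hπ1 (IsUnit.of_mul_eq_one d h6)
  obtain ⟨i, hi⟩ := h1
  obtain ⟨a, ha⟩ := hg (b.coord i)
  have h2 : functionalRZ L (b.coord i) P = β.repr P i := by
    induction P with
    | zero => simp
    | add x y hx hy => simp only [map_add, hx, hy, Finsupp.add_apply]
    | tmul r x =>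
      rw [functionalRZ_tmul, Algebra.TensorProduct.basis_repr_tmul]
      simp
  rw [← h2, ha, functionalRZ_comp_mul, evZeta_functionalRZ_congr hy hL
    (x' := constRZ (embR hL ψ a) • P) g fun φ => ?_, map_smul, smul_eq_mul, map_mul] at hi
  · exact isUnit_of_mul_isUnit_right hi
  · rw [map_mul, rho_smul, rho_tmul, map_one, one_mul, evZeta_constRZ]
    by_cases hφ : φ = ψ
    · rw [hφ]
    · rw [hP, rho_primeProd_of_ne hy hL hφ, mul_zero, mul_zero]

end Functional

/-- The isomorphism `R[[z]] ⊗ O_E ≅ σ^*M`. -/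
def Triv.pullF : RZ L ⊗[k⟦X⟧] OE k E ≃ₗ[RZ L] FrobPull L M :=
  LinearEquiv.ofBijective (orbitMap (isCompatible_frobAct c) (frobIncl L D.gen)) D.bijF

theorem Triv.one_tmul_pullF (x : RZ L ⊗[k⟦X⟧] OE k E) :
    (1 : BPlusL L) ⊗ₜ[RZ L] D.pullF x = D.thetaF (BPlusL L) (baseMap k L E (BPlusL L) x) :=
  (theta_baseMap (isCompatible_frobAct c) D.bijF (BPlusL L) x).symm

theorem Triv.frobMap_pullF (a : OE k E) (x : RZ L ⊗[k⟦X⟧] OE k E) :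
    frobMap L (c.act a) (D.pullF x) = D.pullF (1 ⊗ₜ[k⟦X⟧] a * x) := by
  have h1 : D.pullF (1 ⊗ₜ[k⟦X⟧] a * x) = extAct (isCompatible_frobAct c) (1 ⊗ₜ[k⟦X⟧] a)
      (extAct (isCompatible_frobAct c) x (frobIncl L D.gen)) := by
    rw [← Module.End.mul_apply, ← map_mul]
    rfl
  rw [h1, extAct_tmul, one_smul]
  rfl

theorem Triv.mk_pullF_eq_zero_iff (x : RZ L ⊗[k⟦X⟧] OE k E) :
    (Submodule.Quotient.mk (D.pullF x) : HdRInt L M) = 0 ↔ ∀ φ, rho hL hy φ x = 0 := by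
  rw [Submodule.Quotient.mk_eq_zero, mem_ideal_span_singleton_smul_top]
  constructor
  · rintro ⟨m, hm⟩ φ
    obtain ⟨x', rfl⟩ := D.pullF.surjective m
    rw [← map_smul] at hm
    rw [D.pullF.injective hm, rho_smul, evZeta_zMinusZeta, zero_mul]
  · intro h
    obtain ⟨x', rfl⟩ := exists_eq_zMinusZeta_smul hL hy h
    exact ⟨D.pullF x', map_smul _ _ _⟩

theorem Triv.actInt_pow_pullF (ψ : E →ₐ[k⸨X⸩] Qalg k) (a : OE k E) (n : ℕ)
    (x : RZ L ⊗[k⟦X⟧] OE k E) :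
    ((actInt c a - constRZ (embR hL ψ a) • (1 : Module.End (RZ L) (HdRInt L M))) ^ n)
      (Submodule.Quotient.mk (D.pullF x) : HdRInt L M) =
    Submodule.Quotient.mk (D.pullF
      ((1 ⊗ₜ[k⟦X⟧] a - constRZ (embR hL ψ a) • (1 : RZ L ⊗[k⟦X⟧] OE k E)) ^ n * x)) := by
  induction n with
  | zero => rw [pow_zero, pow_zero, one_mul]; rfl
  | succ n ih =>
    rw [pow_succ', Module.End.mul_apply, ih, pow_succ' (_ - _), mul_assoc]
    generalize (1 ⊗ₜ[k⟦X⟧] a - constRZ (embR hL ψ a) • (1 : RZ L ⊗[k⟦X⟧] OE k E)) ^ n * x = x'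
    rw [sub_mul, smul_mul_assoc, one_mul, map_sub, map_smul, ← D.frobMap_pullF]
    rfl

/-- The `ψ`-component of `H^1_dR(M, R)`. -/
theorem Triv.mk_pullF_mem_HPsiInt_iff (ψ : E →ₐ[k⸨X⸩] Qalg k) (x : RZ L ⊗[k⟦X⟧] OE k E) :
    (Submodule.Quotient.mk (D.pullF x) : HdRInt L M) ∈ HPsiInt c (hL ψ) ↔
      ∀ φ, φ ≠ ψ → rho hL hy φ x = 0 := by
  have hr : ∀ φ a (n : ℕ), rho hL hy φ
      ((1 ⊗ₜ[k⟦X⟧] a - constRZ (embR hL ψ a) • (1 : RZ L ⊗[k⟦X⟧] OE k E)) ^ n * x) =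
      (embR hL φ a - embR hL ψ a) ^ n * rho hL hy φ x := fun φ a n => by
    rw [map_mul, map_pow, map_sub, rho_smul, rho_tmul, evZeta_constRZ, map_one, map_one, one_mul,
      mul_one]
  have h1 : (Submodule.Quotient.mk (D.pullF x) : HdRInt L M) ∈ HPsiInt c (hL ψ) ↔
      ∀ a : OE k E, ∃ n : ℕ, ∀ φ, (embR hL φ a - embR hL ψ a) ^ n * rho hL hy φ x = 0 := by
    rw [HPsiInt, Submodule.mem_iInf]
    refine forall_congr' fun a => ?_
    change _ ∈ (actInt c a).maxGenEigenspace (constRZ (embR hL ψ a)) ↔ _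
    rw [Module.End.mem_maxGenEigenspace]
    refine exists_congr fun n => ?_
    have h2 := D.actInt_pow_pullF hL ψ a n x
    refine (Eq.congr_left h2).trans ?_
    rw [D.mk_pullF_eq_zero_iff hy hL]
    exact forall_congr' fun φ => by rw [hr]
  rw [h1]
  constructor
  · intro h φ hφ
    obtain ⟨a, ha⟩ := exists_OE_ne hL hφ
    obtain ⟨n, hn⟩ := h a
    exact (mul_eq_zero.1 (hn φ)).resolve_left (pow_ne_zero n (sub_ne_zero.2 ha))
  · intro h a
    refine ⟨1, fun φ => ?_⟩
    by_cases hφ : φ = ψ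
    · rw [hφ, sub_self, pow_one, zero_mul]
    · rw [h φ hφ, mul_zero]

theorem Triv.span_primeProd (ψ : E →ₐ[k⸨X⸩] Qalg k) :
    Submodule.span (RZ L) {(Submodule.Quotient.mk (D.pullF (primeProd hy hL ψ)) : HdRInt L M)} =
      HPsiInt c (hL ψ) := by
  apply le_antisymm
  · rw [Submodule.span_singleton_le_iff_mem, D.mk_pullF_mem_HPsiInt_iff hy]
    exact fun φ hφ => rho_primeProd_of_ne hy hL hφ
  · intro m hm
    obtain ⟨m, rfl⟩ := Submodule.Quotient.mk_surjective _ m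
    obtain ⟨x, rfl⟩ := D.pullF.surjective m
    rw [D.mk_pullF_mem_HPsiInt_iff hy] at hm
    obtain ⟨r, hr⟩ := rho_primeProd_dvd hy hL hm
    rw [Submodule.mem_span_singleton]
    refine ⟨constRZ r, ?_⟩
    rw [← Submodule.Quotient.mk_smul, ← sub_eq_zero, ← Submodule.Quotient.mk_sub, ← map_smul,
      ← map_sub, D.mk_pullF_eq_zero_iff hy hL]
    intro φ
    rw [map_sub, rho_smul, evZeta_constRZ]
    by_cases hφ : φ = ψ
    · rw [hφ, hr, mul_comm, sub_self]
    · rw [hm φ hφ, rho_primeProd_of_ne hy hL hφ, mul_zero, sub_self]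

theorem Triv.span_thetaF_eq_HPsi_iff (ψ : E →ₐ[k⸨X⸩] Qalg k) (v : BPlusL L ⊗[k⟦X⟧] OE k E) :
    Submodule.span (BPlusL L) {D.thetaF (BPlusL L) v} = HPsi c (hL ψ) ↔
      (∀ φ, φ ≠ ψ → evAt hL (BPlusL L) φ v = 0) ∧ resPlus L (evAt hL (BPlusL L) ψ v) ≠ 0 := by
  classical
  constructor
  · intro h
    have hv : ∀ φ, φ ≠ ψ → evAt hL (BPlusL L) φ v = 0 := (thetaF_mem_HPsi_iff D ψ v).1
      (h ▸ Submodule.mem_span_singleton_self _)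
    refine ⟨hv, (isUnit_BPlusL_iff L).1 ?_⟩
    obtain ⟨e, he⟩ := exists_evAt_eq hL (BPlusL L) (Pi.single ψ 1)
    have h1 : D.thetaF (BPlusL L) e ∈ Submodule.span (BPlusL L) {D.thetaF (BPlusL L) v} := by
      rw [h, thetaF_mem_HPsi_iff]
      intro φ hφ
      rw [he, Pi.single_eq_of_ne hφ]
    obtain ⟨b, hb⟩ := Submodule.mem_span_singleton.1 h1
    rw [← map_smul] at hb
    have h2 := congrArg (evAt hL (BPlusL L) ψ) ((D.thetaF (BPlusL L)).injective hb)
    rw [map_smul, he, Pi.single_eq_same, smul_eq_mul, mul_comm] at h2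
    exact IsUnit.of_mul_eq_one b h2
  · rintro ⟨hv, hu⟩
    obtain ⟨u, hu⟩ := (isUnit_BPlusL_iff L).2 hu
    apply le_antisymm
    · rw [Submodule.span_singleton_le_iff_mem, thetaF_mem_HPsi_iff]
      exact hv
    · intro m hm
      obtain ⟨v', rfl⟩ := (D.thetaF (BPlusL L)).surjective m
      rw [thetaF_mem_HPsi_iff] at hm
      refine Submodule.mem_span_singleton.2 ⟨evAt hL (BPlusL L) ψ v' * ↑u⁻¹, ?_⟩
      rw [← map_smul]
      congr 1
      refine evAt_ext hL (BPlusL L) fun φ => ?_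
      rw [map_smul, smul_eq_mul]
      by_cases hφ : φ = ψ
      · rw [hφ, ← hu, mul_assoc, Units.inv_mul, mul_one]
      · rw [hv φ hφ, hm φ hφ, mul_zero]

theorem Triv.exists_of_isNormalized {ψ : E →ₐ[k⸨X⸩] Qalg k} {v : BPlusL L ⊗[k⟦X⟧] OE k E}
    (h : IsNormalized c (hL ψ) (D.thetaF (BPlusL L) v)) :
    ‖resPlus L (evAt hL (BPlusL L) ψ v)‖ = ‖(rho hL hy ψ (primeProd hy hL ψ) : L)‖ := by
  obtain ⟨-, g, hg, h2⟩ := h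
  obtain ⟨x, rfl⟩ := D.pullF.surjective g
  rw [D.one_tmul_pullF, ← map_sub, ← pow_one (wPlus L), mem_span_wPlus_iff L _ hL] at h2
  have h3 := h2 ψ
  rw [pow_one, wPlus_dvd_iff, map_sub, map_sub, sub_eq_zero, resPlus_evAt_baseMap hL hy] at h3
  rw [h3]
  have hx : ∀ φ, φ ≠ ψ → rho hL hy φ x = 0 := (D.mk_pullF_mem_HPsiInt_iff hy hL ψ x).1
    (hg ▸ Submodule.mem_span_singleton_self _)
  have h4 : (Submodule.Quotient.mk (D.pullF (primeProd hy hL ψ)) : HdRInt L M) ∈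
      Submodule.span (RZ L) {(Submodule.Quotient.mk (D.pullF x) : HdRInt L M)} := by
    rw [hg, ← D.span_primeProd hy hL ψ]
    exact Submodule.mem_span_singleton_self _
  obtain ⟨g, hg⟩ := Submodule.mem_span_singleton.1 h4
  rw [← Submodule.Quotient.mk_smul, ← sub_eq_zero, ← Submodule.Quotient.mk_sub, ← map_smul,
      ← map_sub, D.mk_pullF_eq_zero_iff hy hL] at hg
  have h5 := hg ψ
  rw [map_sub, sub_eq_zero, rho_smul] at h5
  have h6 : ∀ a b : VR L, ‖((a * b : VR L) : L)‖ ≤ ‖(b : L)‖ := fun a b => by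
    rw [Subalgebra.coe_mul, norm_mul]
    exact mul_le_of_le_one_left (norm_nonneg _) (norm_le_one L a)
  apply le_antisymm
  · obtain ⟨r, hr⟩ := rho_primeProd_dvd hy hL hx
    rw [hr, mul_comm]
    exact h6 _ _
  · rw [← h5]
    exact h6 _ _

theorem Triv.exists_isNormalized (ψ : E →ₐ[k⸨X⸩] Qalg k) (hy : IsUniformizing y) :
    ∃ v, IsNormalized c (hL ψ) (D.thetaF (BPlusL L) v) ∧
      ∀ φ, wPlus L ∣ evAt hL (BPlusL L) φ (v - baseMap k L E (BPlusL L) (primeProd hy hL ψ)) := by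
  classical
  obtain ⟨v, hv⟩ := exists_evAt_eq hL (BPlusL L) (Pi.single ψ (evAt hL (BPlusL L) ψ
    (baseMap k L E (BPlusL L) (primeProd hy hL ψ))))
  have h1 : ∀ φ, wPlus L ∣ evAt hL (BPlusL L) φ
      (v - baseMap k L E (BPlusL L) (primeProd hy hL ψ)) := fun φ => by
    rw [wPlus_dvd_iff, map_sub, hv, map_sub, resPlus_evAt_baseMap hL hy]
    by_cases hφ : φ = ψ
    · rw [hφ, Pi.single_eq_same, resPlus_evAt_baseMap hL hy, sub_self]
    · rw [Pi.single_eq_of_ne hφ, rho_primeProd_of_ne hy hL hφ, map_zero]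
      exact sub_self _
  refine ⟨v, ⟨(D.span_thetaF_eq_HPsi_iff hL ψ v).2 ⟨fun φ hφ => ?_, ?_⟩,
    D.pullF (primeProd hy hL ψ), D.span_primeProd hy hL ψ, ?_⟩, h1⟩
  · rw [hv, Pi.single_eq_of_ne hφ]
  · rw [hv, Pi.single_eq_same, resPlus_evAt_baseMap hL hy]
    exact fun h => rho_primeProd_ne_zero hy hL ψ (Subtype.ext h)
  · rw [D.one_tmul_pullF, ← map_sub, ← pow_one (wPlus L), mem_span_wPlus_iff L _ hL, pow_one]
    exact h1

end DeRham

/-! ### Absolute values of leading coefficients, and functionals on the Tate module -/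

section LeadingNorm

variable {k : Type*} [Field k] [Fintype k] (L : IntermediateField k⸨X⸩ (Qalg k))
  [FiniteDimensional k⸨X⸩ L]

/-- The absolute value of the leading coefficient of an element of `C_v((z - ζ))`. -/
def leadNorm : BC L →*₀ ℝ where
  toFun x := ‖HahnSeries.leadingCoeff (R := Cv k) (Γ := ℤ) x‖
  map_zero' := by
    change ‖HahnSeries.leadingCoeff (0 : HahnSeries ℤ (Cv k))‖ = 0
    simp
  map_one' := by
    change ‖HahnSeries.leadingCoeff (1 : HahnSeries ℤ (Cv k))‖ = 1
    simp
  map_mul' x x' := by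
    refine (congrArg _ (HahnSeries.leadingCoeff_mul (R := Cv k) (Γ := ℤ) x x')).trans ?_
    exact norm_mul _ _

theorem leadNorm_powerToBC {f : (Cv k)⟦X⟧} (hf : PowerSeries.constantCoeff f ≠ 0) :
    leadNorm L (powerToBC L f) = ‖PowerSeries.constantCoeff f‖ := by
  have h0 : (HahnSeries.ofPowerSeries ℤ (Cv k) f).coeff 0 = PowerSeries.constantCoeff f := by
    have := HahnSeries.ofPowerSeries_apply_coeff (Γ := ℤ) f 0
    simpa using this
  have hne : HahnSeries.ofPowerSeries ℤ (Cv k) f ≠ 0 := fun h => hf (by rw [← h0, h]; rfl)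
  have h1 : (HahnSeries.ofPowerSeries ℤ (Cv k) f).order = 0 := by
    apply le_antisymm
    · exact HahnSeries.order_le_of_coeff_ne_zero (h0 ▸ hf)
    · by_contra! h
      refine HahnSeries.coeff_order_eq_zero.not.2 hne ?_
      rw [HahnSeries.ofPowerSeries_apply]
      refine HahnSeries.embDomain_of_notMem_range ?_
      rintro ⟨n, hn⟩
      have : (n : ℤ) = (HahnSeries.ofPowerSeries ℤ (Cv k) f).order := hn
      omega
  change ‖HahnSeries.leadingCoeff (HahnSeries.ofPowerSeries ℤ (Cv k) f)‖ = _
  rw [HahnSeries.leadingCoeff_eq, h1, h0]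

theorem leadNorm_plus {b : BPlusL L} (hb : resPlus L b ≠ 0) :
    leadNorm L (algebraMap (BPlusL L) (BC L) b) = ‖resPlus L b‖ := by
  have h0 : ∀ f : L⟦X⟧, PowerSeries.constantCoeff (PowerSeries.map (LtoC L) f) =
      LtoC L (PowerSeries.constantCoeff f) := fun f => by
    rw [← PowerSeries.coeff_zero_eq_constantCoeff_apply, PowerSeries.coeff_map,
      PowerSeries.coeff_zero_eq_constantCoeff_apply]
  have h1 : LtoC L (resPlus L b) ≠ 0 := (map_ne_zero _).2 hb
  exact (leadNorm_powerToBC L ((h0 b).trans_ne h1)).trans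
    ((congrArg norm (h0 b)).trans (norm_LtoC L _))

theorem leadNorm_wPlus : leadNorm L (algebraMap (BPlusL L) (BC L) (wPlus L)) = 1 := by
  have h1 : algebraMap (BPlusL L) (BC L) (wPlus L) = HahnSeries.single (1 : ℤ) (1 : Cv k) := by
    change HahnSeries.ofPowerSeries ℤ (Cv k) (PowerSeries.map (LtoC L) PowerSeries.X) = _
    rw [PowerSeries.map_X, HahnSeries.ofPowerSeries_X]
  change ‖HahnSeries.leadingCoeff (R := Cv k) (Γ := ℤ) (algebraMap (BPlusL L) (BC L) (wPlus L))‖ = 1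
  rw [h1, HahnSeries.leadingCoeff_of_single, norm_one]

theorem leadNorm_zMinusZeta : leadNorm L (algebraMap (RZ L) (BC L) (zMinusZeta L)) = 1 := by
  rw [IsScalarTower.algebraMap_apply (RZ L) (BPlusL L) (BC L), algebraMap_zMinusZeta, leadNorm_wPlus]

end LeadingNorm

section Functional

variable {k : Type*} [Field k] [Fintype k] {L : IntermediateField k⸨X⸩ (Qalg k)}
  [FiniteDimensional k⸨X⸩ L] [Algebra.IsSeparable k⸨X⸩ L]
variable {E : Type*} [CommRing E] [Algebra k⸨X⸩ E] [Algebra k⟦X⟧ E] [IsScalarTower k⟦X⟧ k⸨X⸩ E]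
variable [Module.Finite k⸨X⸩ E] [IsSemisimpleRing E] [Algebra.IsSeparable k⸨X⸩ E]

theorem plusToBC_tmul (b : BPlusL L) (a : OE k E) :
    plusToBC L E (b ⊗ₜ[k⟦X⟧] a) = algebraMap (BPlusL L) (BC L) b ⊗ₜ[k⟦X⟧] a := rfl

theorem plusToBC_smul (b : BPlusL L) (v : BPlusL L ⊗[k⟦X⟧] OE k E) :
    plusToBC L E (b • v) = algebraMap (BPlusL L) (BC L) b • plusToBC L E v := by
  induction v with
  | zero => simp
  | add x y hx hy => simp only [smul_add, map_add, hx, hy]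
  | tmul b' a =>
    rw [TensorProduct.smul_tmul', plusToBC_tmul, plusToBC_tmul, TensorProduct.smul_tmul',
      smul_eq_mul, smul_eq_mul, map_mul]

theorem functionalBC_comp_mul (f : OE k E →ₗ[k⟦X⟧] k⸨X⸩) (a : OE k E)
    (v : BPlusL L ⊗[k⟦X⟧] OE k E) :
    functionalBC L (f ∘ₗ LinearMap.mulLeft k⟦X⟧ a) (plusToBC L E v) =
      functionalBC L f (plusToBC L E (1 ⊗ₜ[k⟦X⟧] a * v)) := by
  induction v with
  | zero => simp
  | add x y hx hy => simp only [map_add, mul_add, hx, hy]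
  | tmul b x =>
    rw [Algebra.TensorProduct.tmul_mul_tmul, plusToBC_tmul, plusToBC_tmul, functionalBC_tmul,
      functionalBC_tmul, one_mul]
    rfl

theorem functionalBC_smul (f : OE k E →ₗ[k⟦X⟧] k⸨X⸩) (d : k⟦X⟧) (v : BC L ⊗[k⟦X⟧] OE k E) :
    functionalBC L (d • f) v = algebraMap k⟦X⟧ (BC L) d * functionalBC L f v := by
  induction v with
  | zero => simp
  | add x y hx hy => simp only [map_add, mul_add, hx, hy]
  | tmul b x =>
    rw [functionalBC_tmul, functionalBC_tmul, LinearMap.smul_apply, Algebra.smul_def, map_mul,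
      QvToBC_algebraMap, mul_left_comm]

/-- The extension of an integral functional on `O_E` to `L[[z - ζ]] ⊗ O_E`. -/
def functionalPlus (L : IntermediateField k⸨X⸩ (Qalg k)) [FiniteDimensional k⸨X⸩ L]
    (g : OE k E →ₗ[k⟦X⟧] k⟦X⟧) : BPlusL L ⊗[k⟦X⟧] OE k E →ₗ[BPlusL L] BPlusL L :=
  LinearMap.liftBaseChange (BPlusL L) (Algebra.linearMap k⟦X⟧ (BPlusL L) ∘ₗ g)

theorem functionalPlus_tmul (g : OE k E →ₗ[k⟦X⟧] k⟦X⟧) (b : BPlusL L) (a : OE k E) :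
    functionalPlus L g (b ⊗ₜ a) = b * algebraMap k⟦X⟧ (BPlusL L) (g a) :=
  LinearMap.liftBaseChange_tmul ..

theorem functionalBC_plusToBC (g : OE k E →ₗ[k⟦X⟧] k⟦X⟧) (v : BPlusL L ⊗[k⟦X⟧] OE k E) :
    functionalBC L (Algebra.linearMap k⟦X⟧ k⸨X⸩ ∘ₗ g) (plusToBC L E v) =
      algebraMap (BPlusL L) (BC L) (functionalPlus L g v) := by
  induction v with
  | zero => simp
  | add x y hx hy => simp only [map_add, hx, hy]
  | tmul b a =>
    rw [plusToBC_tmul, functionalBC_tmul, functionalPlus_tmul, map_mul, LinearMap.comp_apply,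
      Algebra.linearMap_apply, QvToBC_algebraMap]
    rfl

theorem functionalPlus_baseMap (g : OE k E →ₗ[k⟦X⟧] k⟦X⟧) (x : RZ L ⊗[k⟦X⟧] OE k E) :
    functionalPlus L g (baseMap k L E (BPlusL L) x) =
      algebraMap (RZ L) (BPlusL L) (functionalRZ L g x) := by
  induction x with
  | zero => simp
  | add x y hx hy => simp only [map_add, hx, hy]
  | tmul b a =>
    rw [baseMap_tmul, functionalPlus_tmul, functionalRZ_tmul, map_mul]
    rfl

variable {y : OE k E} (hy : IsUniformizing y) (hL : ∀ (φ : E →ₐ[k⸨X⸩] Qalg k) (e : E), φ e ∈ L)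

open Classical in
/-- The idempotent of `L[[z - ζ]] ⊗ O_E` that belongs to the embedding `ψ`. -/
def idem (ψ : E →ₐ[k⸨X⸩] Qalg k) : BPlusL L ⊗[k⟦X⟧] OE k E :=
  (exists_evAt_eq hL (BPlusL L) (Pi.single ψ 1)).choose

open Classical in
theorem evAt_idem (ψ φ : E →ₐ[k⸨X⸩] Qalg k) :
    evAt hL (BPlusL L) φ (idem hL ψ) = if φ = ψ then 1 else 0 := by
  rw [idem, (exists_evAt_eq hL (BPlusL L) (Pi.single ψ 1)).choose_spec, Pi.single_apply]

theorem eq_smul_idem {ψ : E →ₐ[k⸨X⸩] Qalg k} {v : BPlusL L ⊗[k⟦X⟧] OE k E}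
    (h : ∀ φ, φ ≠ ψ → evAt hL (BPlusL L) φ v = 0) : v = evAt hL (BPlusL L) ψ v • idem hL ψ := by
  classical
  refine evAt_ext hL (BPlusL L) fun φ => ?_
  rw [map_smul, evAt_idem, smul_eq_mul]
  split_ifs with hφ
  · rw [hφ, mul_one]
  · rw [h φ hφ, mul_zero]

theorem mul_idem (x : BPlusL L ⊗[k⟦X⟧] OE k E) (ψ : E →ₐ[k⸨X⸩] Qalg k) :
    x * idem hL ψ = evAt hL (BPlusL L) ψ x • idem hL ψ := by
  classical
  refine evAt_ext hL (BPlusL L) fun φ => ?_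
  rw [map_smul, map_mul, evAt_idem, smul_eq_mul]
  split_ifs with hφ
  · rw [hφ]
  · rw [mul_zero, mul_zero]

/-- The `ψ`-component of a functional on `O_E`. -/
def compAt (ψ : E →ₐ[k⸨X⸩] Qalg k) (f : OE k E →ₗ[k⟦X⟧] k⸨X⸩) : BC L :=
  functionalBC L f (plusToBC L E (idem hL ψ))

theorem functionalBC_eq_compAt {ψ : E →ₐ[k⸨X⸩] Qalg k} {v : BPlusL L ⊗[k⟦X⟧] OE k E}
    (h : ∀ φ, φ ≠ ψ → evAt hL (BPlusL L) φ v = 0) (f : OE k E →ₗ[k⟦X⟧] k⸨X⸩) :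
    functionalBC L f (plusToBC L E v) =
      algebraMap (BPlusL L) (BC L) (evAt hL (BPlusL L) ψ v) * compAt hL ψ f := by
  conv_lhs => rw [eq_smul_idem hL h]
  rw [plusToBC_smul, map_smul, smul_eq_mul, compAt]

theorem compAt_comp_mul (ψ : E →ₐ[k⸨X⸩] Qalg k) (f : OE k E →ₗ[k⟦X⟧] k⸨X⸩) (a : OE k E) :
    compAt hL ψ (f ∘ₗ LinearMap.mulLeft k⟦X⟧ a) =
      algebraMap (BPlusL L) (BC L) (liftEmb hL ψ a) * compAt hL ψ f := by
  rw [compAt, functionalBC_comp_mul, mul_idem, plusToBC_smul, map_smul, smul_eq_mul, evAt_tmul,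
    one_mul]
  rfl

theorem leadNorm_algebraMap_base {d : k⟦X⟧} (hd : d ≠ 0) :
    leadNorm L (algebraMap k⟦X⟧ (BC L) d) = ‖algebraMap k⟦X⟧ k⸨X⸩ d‖ := by
  have h1 : resPlus L (algebraMap k⟦X⟧ (BPlusL L) d) ≠ 0 := by
    rw [resPlus_algebraMap_base]
    exact (map_ne_zero _).2 ((map_ne_zero_iff _ (FaithfulSMul.algebraMap_injective _ _)).2 hd)
  refine (leadNorm_plus L h1).trans ?_
  rw [resPlus_algebraMap_base, norm_algebraMap_L]

theorem leadNorm_liftEmb {ψ : E →ₐ[k⸨X⸩] Qalg k} {a : OE k E} (ha : ψ a ≠ 0) :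
    leadNorm L (algebraMap (BPlusL L) (BC L) (liftEmb hL ψ a)) = ‖ψ a‖ := by
  have h1 : resPlus L (liftEmb hL ψ a) ≠ 0 := by
    rw [resPlus_liftEmb]
    exact fun h => ha (congrArg (algebraMap L (Qalg k)) h)
  rw [leadNorm_plus L h1, resPlus_liftEmb]
  rfl

/-- The `ψ`-component of a generator of the dual of `O_E`. -/
theorem leadNorm_compAt (ψ : E →ₐ[k⸨X⸩] Qalg k) {g : OE k E →ₗ[k⟦X⟧] k⟦X⟧}
    (hg : ∀ h : OE k E →ₗ[k⟦X⟧] k⟦X⟧, ∃ b, h = g ∘ₗ LinearMap.mulLeft k⟦X⟧ b) :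
    leadNorm L (compAt hL ψ (Algebra.linearMap k⟦X⟧ k⸨X⸩ ∘ₗ g)) *
      ‖(rho hL hy ψ (primeProd hy hL ψ) : L)‖ = 1 := by
  classical
  set P := primeProd hy hL ψ with hP
  set b := evAt hL (BPlusL L) ψ (baseMap k L E (BPlusL L) P) with hb
  have hb1 : resPlus L b = (rho hL hy ψ P : L) := resPlus_evAt_baseMap hL hy ψ P
  have hb0 : resPlus L b ≠ 0 := by
    rw [hb1]
    exact fun h => rho_primeProd_ne_zero hy hL ψ (Subtype.ext h)
  have hu := isUnit_evZeta_functionalRZ hy hL ψ hg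
  obtain ⟨v', hv'⟩ := exists_eq_smul_of_dvd hL (BPlusL L) (r := wPlus L)
    (x := b • idem hL ψ - baseMap k L E (BPlusL L) P) fun φ => by
      rw [wPlus_dvd_iff, map_sub, map_smul, evAt_idem, map_sub, smul_eq_mul, map_mul]
      split_ifs with hφ
      · rw [hφ, map_one, mul_one, sub_self]
      · rw [map_zero, mul_zero, resPlus_evAt_baseMap hL hy, hP, rho_primeProd_of_ne hy hL hφ]
        exact sub_self _
  have h1 : resPlus L (functionalPlus L g (b • idem hL ψ)) =
      (evZeta L (functionalRZ L g P) : VR L) := by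
    rw [sub_eq_iff_eq_add.1 hv', map_add, map_add, map_smul, smul_eq_mul, map_mul, resPlus_wPlus,
      zero_mul, zero_add, functionalPlus_baseMap, resPlus_algebraMap]
  have h2 : resPlus L (functionalPlus L g (b • idem hL ψ)) ≠ 0 := by
    rw [h1]
    exact fun h => hu.ne_zero (Subtype.ext h)
  have h3 := leadNorm_plus L h2
  rw [h1, (isUnit_VR_iff _).1 hu, ← functionalBC_plusToBC, plusToBC_smul, map_smul, smul_eq_mul,
    map_mul, leadNorm_plus L hb0, hb1, mul_comm] at h3
  exact h3

end Functional

section Bezout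

variable {k : Type*} [Field k] [Fintype k]
variable {E : Type*} [CommRing E] [Algebra k⸨X⸩ E] [Algebra k⟦X⟧ E] [IsScalarTower k⟦X⟧ k⸨X⸩ E]
  [Module.Finite k⸨X⸩ E] [IsSemisimpleRing E]

/-- Two elements of `E` generate a principal fractional ideal: in every factor of `E`, one of them
divides the other. -/
theorem exists_bezout (e₁ e₂ : E) : ∃ s₁ s₂ q₁ q₂ : OE k E,
    e₁ = q₁ * (s₁ * e₁ + s₂ * e₂) ∧ e₂ = q₂ * (s₁ * e₁ + s₂ * e₂) := by
  classical
  obtain ⟨F, Ψ, -, hφ⟩ := exists_prod_fields (k := k) E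
  have hint : ∀ f : (∀ m, F m), (∀ m, ‖f m‖ ≤ 1) → Ψ.symm f ∈ OE k E := fun f hf => by
    refine (isIntegral_iff_forall_norm_le_one (k := k) _).2 fun φ => ?_
    obtain ⟨m, g, hg⟩ := hφ φ
    rw [hg, AlgEquiv.apply_symm_apply, norm_map_algHom]
    exact hf m
  let P : MaximalSpectrum E → Prop := fun m => ‖Ψ e₂ m‖ ≤ ‖Ψ e₁ m‖
  have h1 : ∀ m, ‖(if P m then 1 else 0 : F m)‖ ≤ 1 := fun m => by split_ifs <;> simp
  have h2 : ∀ m, ‖(if P m then 0 else 1 : F m)‖ ≤ 1 := fun m => by split_ifs <;> simp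
  have hd : ∀ m (a b : F m), ‖a‖ ≤ ‖b‖ → ‖a / b‖ ≤ 1 := fun m a b h => by
    rw [norm_div]; exact div_le_one_of_le₀ h (norm_nonneg _)
  have h3 : ∀ m, ‖(if P m then 1 else Ψ e₁ m / Ψ e₂ m : F m)‖ ≤ 1 := fun m => by
    split_ifs with h
    · simp
    · exact hd m _ _ (not_le.1 h).le
  have h4 : ∀ m, ‖(if P m then Ψ e₂ m / Ψ e₁ m else 1 : F m)‖ ≤ 1 := fun m => by
    split_ifs with h
    · exact hd m _ _ h
    · simp
  have hz : ∀ m (a b : F m), ‖a‖ ≤ ‖b‖ → a = a / b * b := fun m a b h => by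
    rw [div_mul_cancel_of_imp]
    rintro rfl
    simpa using h
  refine ⟨⟨_, hint _ h1⟩, ⟨_, hint _ h2⟩, ⟨_, hint _ h3⟩, ⟨_, hint _ h4⟩, ?_, ?_⟩
  · apply Ψ.injective
    rw [map_mul, map_add, map_mul, map_mul]
    simp only [AlgEquiv.apply_symm_apply]
    funext m
    simp only [Pi.mul_apply, Pi.add_apply]
    split_ifs with h
    · simp
    · simpa using hz m _ _ (not_le.1 h).le
  · apply Ψ.injective
    rw [map_mul, map_add, map_mul, map_mul]
    simp only [AlgEquiv.apply_symm_apply]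
    funext m
    simp only [Pi.mul_apply, Pi.add_apply]
    split_ifs with h
    · simpa using hz m _ _ h
    · simp

theorem exists_common_divisor {ι : Type*} (s : Finset ι) (e : ι → E) (N : AddSubgroup E)
    (hN : ∀ (a : OE k E) x, x ∈ N → (a : E) * x ∈ N) (he : ∀ i ∈ s, e i ∈ N) :
    ∃ e₀ ∈ N, ∀ i ∈ s, ∃ q : OE k E, e i = q * e₀ := by
  classical
  induction s using Finset.induction_on with
  | empty => exact ⟨0, zero_mem _, by simp⟩
  | insert j s hj ih =>
    obtain ⟨e₀, h0, h1⟩ := ih fun i hi => he i (Finset.mem_insert_of_mem hi)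
    obtain ⟨s₁, s₂, q₁, q₂, h2, h3⟩ := exists_bezout (k := k) e₀ (e j)
    refine ⟨_, add_mem (hN s₁ _ h0) (hN s₂ _ (he j (Finset.mem_insert_self _ _))), fun i hi => ?_⟩
    rcases Finset.mem_insert.1 hi with rfl | hi
    · exact ⟨q₂, h3⟩
    · obtain ⟨q, hq⟩ := h1 i hi
      exact ⟨q * q₁, by rw [Subalgebra.coe_mul, mul_assoc, ← h2, hq]⟩

end Bezout

section Homology

variable {k : Type*} [Field k] [Fintype k] {L : IntermediateField k⸨X⸩ (Qalg k)}
  [FiniteDimensional k⸨X⸩ L] [Algebra.IsSeparable k⸨X⸩ L]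
variable {E : Type*} [CommRing E] [Algebra k⸨X⸩ E] [Algebra k⟦X⟧ E] [IsScalarTower k⟦X⟧ k⸨X⸩ E]
  [Module.Finite k⸨X⸩ E] [IsSemisimpleRing E] [Algebra.IsSeparable k⸨X⸩ E]
variable {M : Type*} [AddCommGroup M] [Module (RZ L) M] {S : LocalShtuka L M} {c : CM S E}

variable {e : OE k E ≃ₗ[k⟦X⟧] H1v S} (he : ∀ a b, actH1v c a (e b) = e (a * b))
include he

/-- A single denominator suffices in order to recognize `u' = x • u`. -/
theorem isESmul_iff {x : E} {d₀ : k⟦X⟧} {b₀ : OE k E} (hd : d₀ ≠ 0)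
    (hb : (b₀ : E) = algebraMap k⟦X⟧ E d₀ * x) (u u' : H1v S →ₗ[k⟦X⟧] k⸨X⸩) :
    IsESmul c x u u' ↔ ∀ z, d₀ • u' (e z) = u (e (b₀ * z)) := by
  constructor
  · intro h z
    have h1 := LinearMap.congr_fun (h b₀ d₀ hb) (e z)
    rwa [LinearMap.smul_apply, LinearMap.comp_apply, he] at h1
  · intro h b d hbd
    refine LinearMap.ext fun m => ?_
    obtain ⟨z, rfl⟩ := e.surjective m
    rw [LinearMap.smul_apply, LinearMap.comp_apply, he]
    have h1 : d • b₀ = d₀ • b := Subtype.ext (by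
      rw [Subalgebra.coe_smul, Subalgebra.coe_smul, Algebra.smul_def, Algebra.smul_def, hb, hbd,
        mul_left_comm])
    refine smul_right_injective _ hd ?_
    change d₀ • d • u' (e z) = d₀ • u (e (b * z))
    rw [smul_comm, h, ← map_smul, ← map_smul, ← map_smul, ← map_smul, ← smul_mul_assoc, h1,
      smul_mul_assoc]

theorem isESmul_comp {x : E} {u u' : H1v S →ₗ[k⟦X⟧] k⸨X⸩} (h : IsESmul c x u u') (a : OE k E) :
    IsESmul c ((a : E) * x) u (u' ∘ₗ actH1v c a) := by
  obtain ⟨d, hd⟩ := exists_smul_mem_OE (k := k) x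
  have hd0 := nonZeroDivisors.ne_zero d.2
  have hb : ((⟨_, hd⟩ : OE k E) : E) = algebraMap k⟦X⟧ E d * x := Algebra.smul_def _ _
  rw [isESmul_iff he hd0 hb] at h
  refine (isESmul_iff he hd0 (b₀ := a * ⟨_, hd⟩) ?_ _ _).2 fun z => ?_
  · rw [Subalgebra.coe_mul, hb, mul_left_comm]
  · rw [LinearMap.comp_apply, he, h, mul_assoc, mul_left_comm]

theorem isESmul_unique {x : E} {u u' u'' : H1v S →ₗ[k⟦X⟧] k⸨X⸩} (h : IsESmul c x u u')
    (h' : IsESmul c x u u'') : u' = u'' := by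
  obtain ⟨d, hd⟩ := exists_smul_mem_OE (k := k) x
  have hd0 := nonZeroDivisors.ne_zero d.2
  have hb : ((⟨_, hd⟩ : OE k E) : E) = algebraMap k⟦X⟧ E d * x := Algebra.smul_def _ _
  rw [isESmul_iff he hd0 hb] at h h'
  refine LinearMap.ext fun m => ?_
  obtain ⟨z, rfl⟩ := e.surjective m
  exact smul_right_injective _ hd0 ((h z).trans (h' z).symm)

theorem isESmul_add {x x' : E} {u u₁ u₂ : H1v S →ₗ[k⟦X⟧] k⸨X⸩} (h : IsESmul c x u u₁)
    (h' : IsESmul c x' u u₂) : IsESmul c (x + x') u (u₁ + u₂) := by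
  obtain ⟨d, hd⟩ := exists_smul_mem_OE (k := k) x
  obtain ⟨d', hd'⟩ := exists_smul_mem_OE (k := k) x'
  have hd0 := mul_ne_zero (nonZeroDivisors.ne_zero d.2) (nonZeroDivisors.ne_zero d'.2)
  have hb : ((d'.1 • ⟨_, hd⟩ : OE k E) : E) = algebraMap k⟦X⟧ E (d * d') * x := by
    rw [Subalgebra.coe_smul, smul_smul, Algebra.smul_def, mul_comm d'.1]
  have hb' : ((d.1 • ⟨_, hd'⟩ : OE k E) : E) = algebraMap k⟦X⟧ E (d * d') * x' := by
    rw [Subalgebra.coe_smul, smul_smul, Algebra.smul_def]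
  rw [isESmul_iff he hd0 hb] at h
  rw [isESmul_iff he hd0 hb'] at h'
  refine (isESmul_iff he hd0 (b₀ := d'.1 • ⟨_, hd⟩ + d.1 • ⟨_, hd'⟩) ?_ _ _).2 fun z => ?_
  · rw [Subalgebra.coe_add, hb, hb', mul_add]
  · rw [LinearMap.add_apply, smul_add, h, h', add_mul, map_add, map_add]

/-- An `E`-generator of the rational dual of the `v`-adic realization has a valuation: the lattice
of integral functionals is principal. -/
theorem exists_isValU (hL : ∀ (φ : E →ₐ[k⸨X⸩] Qalg k) (e : E), φ e ∈ L)
    (u : H1v S →ₗ[k⟦X⟧] k⸨X⸩) (hu : IsEGenerator c u) (ψ : E →ₐ[k⸨X⸩] Qalg k) :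
    ∃ s, IsValU c ψ u s := by
  obtain ⟨b, -, -⟩ := exists_basis_OE hL
  have hact : ∀ (u : H1v S →ₗ[k⟦X⟧] k⸨X⸩) a z, (u ∘ₗ actH1v c a) (e z) = u (e (a * z)) :=
    fun u a z => by rw [LinearMap.comp_apply, he]
  have hz0 : IsESmul c 0 u 0 := by
    refine (isESmul_iff he one_ne_zero (b₀ := 0) (by simp) _ _).2 fun z => ?_
    rw [zero_mul, map_zero, map_zero, LinearMap.zero_apply, smul_zero]
  -- The elements `x` for which the functional `x u` is integral; its coordinate functionals `ui`
  -- generate all integral functionals, and a common divisor of the `ui` is a generator.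
  let N : AddSubgroup E :=
    { carrier := {x | ∃ u', IsIntegralFunctional u' ∧ IsESmul c x u u'}
      zero_mem' := ⟨0, fun x => zero_mem _, hz0⟩
      add_mem' := by
        rintro x x' ⟨u₁, h1, h2⟩ ⟨u₂, h3, h4⟩
        exact ⟨u₁ + u₂, fun m => add_mem (h1 m) (h3 m), isESmul_add he h2 h4⟩
      neg_mem' := by
        rintro x ⟨u₁, h1, h2⟩
        exact ⟨u₁ ∘ₗ actH1v c (-1), fun m => h1 _, by simpa using isESmul_comp he h2 (-1)⟩ }
  let ui : Fin (Module.finrank k⸨X⸩ E) → (H1v S →ₗ[k⟦X⟧] k⸨X⸩) := fun i =>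
    Algebra.linearMap k⟦X⟧ k⸨X⸩ ∘ₗ b.coord i ∘ₗ e.symm.toLinearMap
  have hui : ∀ i z, ui i (e z) = algebraMap k⟦X⟧ k⸨X⸩ (b.repr z i) := fun i z => by
    simp [ui]
  choose x hx using fun i => hu (ui i)
  obtain ⟨x₀, ⟨u₀, h0, h1⟩, h2⟩ := exists_common_divisor (k := k) Finset.univ x N
    (fun a x ⟨u', h1, h2⟩ => ⟨u' ∘ₗ actH1v c a, fun m => h1 _, isESmul_comp he h2 a⟩)
    fun i _ => ⟨ui i, fun m => ⟨_, rfl⟩, hx i⟩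
  choose q hq using fun i => h2 i (Finset.mem_univ i)
  have h3 : ∀ i, ui i = u₀ ∘ₗ actH1v c (q i) := fun i =>
    isESmul_unique he (hx i) ((hq i).symm ▸ isESmul_comp he h1 (q i))
  have h4 : IsOEGenerator c u₀ := by
    refine ⟨h0, fun u' hu' => ?_⟩
    choose r hr using fun i => hu' (e (b i))
    refine ⟨∑ i, r i • q i, LinearMap.ext fun m => ?_⟩
    obtain ⟨z, rfl⟩ := e.surjective m
    rw [hact, Finset.sum_mul, map_sum, map_sum]
    conv_lhs => rw [← b.sum_repr z]
    rw [map_sum, map_sum]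
    refine Finset.sum_congr rfl fun i _ => ?_
    rw [map_smul, map_smul, ← hr, smul_mul_assoc, map_smul, map_smul, ← hact, ← h3, hui,
      Algebra.smul_def, Algebra.smul_def, mul_comm]
  have h5 : IsUnit x₀ := by
    have hart : IsArtinianRing E := IsArtinianRing.of_finite k⸨X⸩ E
    refine IsArtinianRing.isUnit_of_mem_nonZeroDivisors
      (mem_nonZeroDivisors_iff_right.2 fun g hg => ?_)
    obtain ⟨d, hd⟩ := exists_smul_mem_OE (k := k) x₀
    obtain ⟨d', hd'⟩ := exists_smul_mem_OE (k := k) g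
    have hd0 := nonZeroDivisors.ne_zero d.2
    have hb : ((⟨_, hd⟩ : OE k E) : E) = algebraMap k⟦X⟧ E d * x₀ := Algebra.smul_def _ _
    have h6 : (⟨_, hd⟩ * ⟨_, hd'⟩ : OE k E) = 0 := Subtype.ext (by
      change (d : k⟦X⟧) • x₀ * ((d' : k⟦X⟧) • g) = 0
      rw [smul_mul_smul_comm, mul_comm x₀, hg, smul_zero])
    have h7 : ∀ z, u₀ (e (z * ⟨_, hd'⟩)) = 0 := fun z => by
      have h8 := (isESmul_iff he hd0 hb _ _).1 h1 (z * ⟨_, hd'⟩)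
      rw [mul_left_comm, h6, mul_zero, map_zero, map_zero] at h8
      exact (smul_eq_zero_iff_right hd0).1 h8
    have h9 : (⟨_, hd'⟩ : OE k E) = 0 := by
      refine b.repr.injective (Finsupp.ext fun i => ?_)
      have h10 := hui i ⟨_, hd'⟩
      rw [h3, hact, h7] at h10
      rw [map_zero]
      exact (FaithfulSMul.algebraMap_injective k⟦X⟧ k⸨X⸩) (h10.symm.trans (map_zero _).symm)
    have h11 : (d' : k⟦X⟧) • g = 0 := congrArg Subtype.val h9
    rw [← algebraMap_smul k⸨X⸩] at h11
    refine (smul_eq_zero_iff_right ?_).1 h11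
    exact (map_ne_zero_iff _ (FaithfulSMul.algebraMap_injective k⟦X⟧ k⸨X⸩)).2
      (nonZeroDivisors.ne_zero d'.2)
  obtain ⟨x₀, rfl⟩ := h5
  exact ⟨_, x₀⁻¹, u₀, by rwa [inv_inv], h4, rfl⟩

omit he in
theorem IsIntegralFunctional.exists_eq {u : H1v S →ₗ[k⟦X⟧] k⸨X⸩} (hu : IsIntegralFunctional u) :
    ∃ g : H1v S →ₗ[k⟦X⟧] k⟦X⟧, u = Algebra.linearMap k⟦X⟧ k⸨X⸩ ∘ₗ g := by
  choose g hg using hu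
  have hinj := FaithfulSMul.algebraMap_injective k⟦X⟧ k⸨X⸩
  refine ⟨{ toFun := g, map_add' := fun x y => hinj ?_, map_smul' := fun r x => hinj ?_ },
    LinearMap.ext fun x => (hg x).symm⟩
  · change algebraMap k⟦X⟧ k⸨X⸩ _ = _
    rw [map_add, hg, hg, hg, map_add]
  · change algebraMap k⟦X⟧ k⸨X⸩ _ = algebraMap k⟦X⟧ k⸨X⸩ (r * g x)
    rw [map_mul, hg, hg, map_smul, Algebra.smul_def]

/-- The `ψ`-component of an `E`-generator. -/
theorem leadNorm_compAt_of_isESmul {y : OE k E} (hy : IsUniformizing y)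
    (hL : ∀ (φ : E →ₐ[k⸨X⸩] Qalg k) (e : E), φ e ∈ L) {u u' : H1v S →ₗ[k⟦X⟧] k⸨X⸩}
    {ψ : E →ₐ[k⸨X⸩] Qalg k} {a : Eˣ} (h : IsESmul c (a⁻¹ : Eˣ) u u') (h' : IsOEGenerator c u') :
    leadNorm L (compAt hL ψ (u ∘ₗ e.toLinearMap)) *
      ‖(rho hL hy ψ (primeProd hy hL ψ) : L)‖ = ‖ψ a‖ := by
  have hinj := FaithfulSMul.algebraMap_injective k⟦X⟧ k⸨X⸩
  obtain ⟨g, hg⟩ := IsIntegralFunctional.exists_eq h'.1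
  have h1 := leadNorm_compAt hy hL ψ (g := g ∘ₗ e.toLinearMap) fun f => by
    obtain ⟨b, hb⟩ := h'.2 (Algebra.linearMap k⟦X⟧ k⸨X⸩ ∘ₗ f ∘ₗ e.symm.toLinearMap)
      fun m => ⟨_, rfl⟩
    refine ⟨b, LinearMap.ext fun z => hinj ?_⟩
    have h2 := LinearMap.congr_fun hb (e z)
    rw [LinearMap.comp_apply u', he, hg] at h2
    simpa using h2
  obtain ⟨d, hd⟩ := exists_smul_mem_OE (k := k) ((a⁻¹ : Eˣ) : E)
  have hd0 := nonZeroDivisors.ne_zero d.2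
  have hb : ((⟨_, hd⟩ : OE k E) : E) = algebraMap k⟦X⟧ E d * (a⁻¹ : Eˣ) := Algebra.smul_def _ _
  have h2 : (d : k⟦X⟧) • (Algebra.linearMap k⟦X⟧ k⸨X⸩ ∘ₗ (g ∘ₗ e.toLinearMap)) =
      (u ∘ₗ e.toLinearMap) ∘ₗ LinearMap.mulLeft k⟦X⟧ ⟨_, hd⟩ := by
    refine LinearMap.ext fun z => ?_
    have h3 := (isESmul_iff he hd0 hb u u').1 h z
    rw [hg] at h3
    exact h3
  have hψa : ψ a ≠ 0 := (a.isUnit.map ψ).ne_zero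
  have hψb : ψ ((⟨_, hd⟩ : OE k E) : E) = algebraMap k⸨X⸩ (Qalg k) (algebraMap k⟦X⟧ k⸨X⸩ d) *
      (ψ a)⁻¹ := by
    rw [hb, map_mul, IsScalarTower.algebraMap_apply k⟦X⟧ k⸨X⸩ E, AlgHom.commutes]
    congr 1
    refine eq_inv_of_mul_eq_one_left ?_
    rw [← map_mul, Units.inv_mul, map_one]
  have hd1 : algebraMap k⟦X⟧ k⸨X⸩ d ≠ 0 := (map_ne_zero_iff _ hinj).2 hd0
  have h3 : leadNorm L (compAt hL ψ ((d : k⟦X⟧) •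
      (Algebra.linearMap k⟦X⟧ k⸨X⸩ ∘ₗ (g ∘ₗ e.toLinearMap)))) =
      leadNorm L (compAt hL ψ ((u ∘ₗ e.toLinearMap) ∘ₗ LinearMap.mulLeft k⟦X⟧ ⟨_, hd⟩)) := by
    rw [h2]
  rw [compAt_comp_mul, map_mul, leadNorm_liftEmb hL (by
    rw [hψb]; exact mul_ne_zero ((map_ne_zero _).2 hd1) (inv_ne_zero hψa)), hψb, compAt,
    functionalBC_smul, map_mul, leadNorm_algebraMap_base hd0, norm_mul, norm_inv,
    norm_algebraMap', mul_assoc] at h3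
  have h4 := mul_left_cancel₀ (norm_ne_zero_iff.2 hd1) h3
  change leadNorm L (compAt hL ψ (Algebra.linearMap k⟦X⟧ k⸨X⸩ ∘ₗ (g ∘ₗ e.toLinearMap))) = _ at h4
  rw [h4, mul_assoc] at h1
  rw [inv_mul_eq_iff_eq_mul₀ (norm_ne_zero_iff.2 hψa), mul_one] at h1
  exact h1

end Homology

/-! ### The absolute value of a period -/

section PeriodNorm

variable {k : Type*} [Field k] [Fintype k] {L : IntermediateField k⸨X⸩ (Qalg k)}
  [FiniteDimensional k⸨X⸩ L] [Algebra.IsSeparable k⸨X⸩ L]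
variable {E : Type*} [CommRing E] [Algebra k⸨X⸩ E] [Algebra k⟦X⟧ E] [IsScalarTower k⟦X⟧ k⸨X⸩ E]
  [Module.Finite k⸨X⸩ E] [IsSemisimpleRing E] [Algebra.IsSeparable k⸨X⸩ E]
variable {y : OE k E} (hy : IsUniformizing y) (hL : ∀ (φ : E →ₐ[k⸨X⸩] Qalg k) (e : E), φ e ∈ L)

/-- The absolute value of the leading coefficient of the `ψ`-component in `L[[z - ζ]]` of an
element of `R[[z]] ⊗ O_E`. -/
def normAt (ψ : E →ₐ[k⸨X⸩] Qalg k) : RZ L ⊗[k⟦X⟧] OE k E →* ℝ :=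
  (leadNorm L).toMonoidHom.comp ((algebraMap (BPlusL L) (BC L)).toMonoidHom.comp
    ((evAt hL (BPlusL L) ψ).toRingHom.toMonoidHom.comp
      (baseMap k L E (BPlusL L)).toRingHom.toMonoidHom))

theorem normAt_apply (ψ : E →ₐ[k⸨X⸩] Qalg k) (x : RZ L ⊗[k⟦X⟧] OE k E) : normAt hL ψ x =
    leadNorm L (algebraMap (BPlusL L) (BC L) (evAt hL (BPlusL L) ψ (baseMap k L E _ x))) := rfl

theorem normAt_eq_norm_rho {ψ : E →ₐ[k⸨X⸩] Qalg k} {x : RZ L ⊗[k⟦X⟧] OE k E}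
    (hx : rho hL hy ψ x ≠ 0) : normAt hL ψ x = ‖(rho hL hy ψ x : L)‖ := by
  have h := resPlus_evAt_baseMap hL hy ψ x
  rw [normAt_apply, leadNorm_plus L, h]
  rw [h]
  exact fun h => hx (Subtype.ext h)

theorem evAt_zMinusZeta (ψ : E →ₐ[k⸨X⸩] Qalg k) :
    evAt hL (BPlusL L) ψ (baseMap k L E (BPlusL L) (zMinusZeta L ⊗ₜ 1)) = wPlus L := by
  rw [baseMap_tmul, evAt_tmul, map_one, map_one, mul_one, algebraMap_zMinusZeta]

theorem zMinusZeta_eq_primeProd (ψ : E →ₐ[k⸨X⸩] Qalg k) : ∃ w : (RZ L ⊗[k⟦X⟧] OE k E)ˣ,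
    zMinusZeta L ⊗ₜ 1 = (w : RZ L ⊗[k⟦X⟧] OE k E) * (phiPrime hy hL ψ * primeProd hy hL ψ) := by
  classical
  obtain ⟨w, hw⟩ := exists_zMinusZeta_eq hy hL
  refine ⟨w, hw.trans ?_⟩
  rw [primeProd, Finset.mul_prod_erase _ _ (Finset.mem_univ ψ)]

theorem normAt_isUnit {ψ : E →ₐ[k⸨X⸩] Qalg k} {x : RZ L ⊗[k⟦X⟧] OE k E} (hx : IsUnit x) :
    normAt hL ψ x = 1 := by
  obtain ⟨y, hy⟩ := exists_isUniformizing (k := k) (E := E)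
  rw [normAt_eq_norm_rho hy hL (hx.map (rho hL hy ψ)).ne_zero, norm_rho_of_isUnit hL hy ψ hx]

theorem normAt_prod (ψ : E →ₐ[k⸨X⸩] Qalg k) : ∏ φ, normAt hL ψ (phiPrime hy hL φ) = 1 := by
  obtain ⟨w, hw⟩ := exists_zMinusZeta_eq hy hL
  have h := congrArg (normAt hL ψ) hw
  rw [map_mul, normAt_isUnit hL w.isUnit, one_mul, map_prod, normAt_apply, evAt_zMinusZeta,
    leadNorm_wPlus] at h
  exact h.symm

theorem normAt_ne_zero (ψ φ : E →ₐ[k⸨X⸩] Qalg k) : normAt hL ψ (phiPrime hy hL φ) ≠ 0 := by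
  intro h
  refine zero_ne_one (α := ℝ) ?_
  rw [← normAt_prod hy hL ψ, Finset.prod_eq_zero (Finset.mem_univ φ) h]

/-- The prime element of `ψ` is a uniformizer at `z = ζ` in the component `ψ`. -/
theorem exists_evAt_phiPrime_eq (ψ : E →ₐ[k⸨X⸩] Qalg k) : ∃ u : (BPlusL L)ˣ,
    evAt hL (BPlusL L) ψ (baseMap k L E (BPlusL L) (phiPrime hy hL ψ)) = wPlus L * u := by
  obtain ⟨q, hq⟩ := (wPlus_dvd_iff (L := L)).2 (show resPlus L (evAt hL (BPlusL L) ψ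
    (baseMap k L E (BPlusL L) (phiPrime hy hL ψ))) = 0 by
      rw [resPlus_evAt_baseMap hL hy, rho_phiPrime_self]; rfl)
  obtain ⟨w, hw⟩ := zMinusZeta_eq_primeProd hy hL ψ
  have h := congrArg (fun x => evAt hL (BPlusL L) ψ (baseMap k L E (BPlusL L) x)) hw
  simp only [map_mul, evAt_zMinusZeta, hq] at h
  have hu : IsUnit q := by
    refine IsUnit.of_mul_eq_one (evAt hL (BPlusL L) ψ (baseMap k L E (BPlusL L) w) *
      evAt hL (BPlusL L) ψ (baseMap k L E (BPlusL L) (primeProd hy hL ψ))) ?_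
    refine mul_left_cancel₀ (wPlus_ne_zero (L := L)) ?_
    linear_combination -h
  exact ⟨hu.unit, hq⟩

variable {hy hL} {M : Type*} [AddCommGroup M] [Module (RZ L) M] {S : LocalShtuka L M} {c : CM S E}
  {D : Triv c} (s : Solution hy hL D)

/-- The CM-type is read off from the prime factorization of `t`. -/
theorem Solution.cmType_eq {Φ : (E →ₐ[k⸨X⸩] Qalg k) → ℤ} (hΦ : HasCMType c hL Φ)
    (φ : E →ₐ[k⸨X⸩] Qalg k) : Φ φ = s.a φ - D.n := by
  classical
  obtain ⟨u, hu⟩ := exists_evAt_phiPrime_eq hy hL φ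
  have h1 : IsUnit (evAt hL (BPlusL L) φ (baseMap k L E (BPlusL L)
      (s.unit * ∏ φ' ∈ Finset.univ.erase φ, phiPrime hy hL φ' ^ s.a φ'))) := by
    rw [isUnit_BPlusL_iff, resPlus_evAt_baseMap hL hy, map_mul, map_prod]
    refine fun h => mul_ne_zero (s.unit.isUnit.map (rho hL hy φ)).ne_zero ?_ (Subtype.ext h)
    refine Finset.prod_ne_zero_iff.2 fun φ' hφ' => ?_
    rw [map_pow]
    exact pow_ne_zero _ (rho_phiPrime_ne_zero hL hy (Finset.ne_of_mem_erase hφ').symm)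
  refine eq_of_hasCMType D Φ hΦ (n := s.a φ) (u := u ^ s.a φ * h1.unit) ?_
  rw [s.t_eq, ← Finset.mul_prod_erase _ _ (Finset.mem_univ φ), mul_left_comm, map_mul, map_mul,
    map_pow, map_pow, hu, mul_pow, Units.val_mul, Units.val_pow_eq_pow_val, mul_assoc]
  rfl

include s in
theorem Solution.normAt_t {Φ : (E →ₐ[k⸨X⸩] Qalg k) → ℤ} (hΦ : HasCMType c hL Φ)
    (ψ : E →ₐ[k⸨X⸩] Qalg k) : normAt hL ψ D.t = ∏ φ, normAt hL ψ (phiPrime hy hL φ) ^ Φ φ := by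
  have h1 : ∏ φ, normAt hL ψ (phiPrime hy hL φ) ^ (-(D.n : ℤ)) = 1 := by
    rw [Finset.prod_zpow, normAt_prod, one_zpow]
  rw [s.t_eq, map_mul, normAt_isUnit hL s.unit.isUnit, one_mul, map_prod,
    ← mul_one (∏ φ, (normAt hL ψ) _), ← h1, ← Finset.prod_mul_distrib]
  refine Finset.prod_congr rfl fun φ _ => ?_
  rw [map_pow, s.cmType_eq hΦ, sub_eq_add_neg, zpow_add₀ (normAt_ne_zero hy hL ψ φ), zpow_natCast]

theorem Solution.leadNorm_evAt_xBC_ne_zero (ψ : E →ₐ[k⸨X⸩] Qalg k) :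
    leadNorm L (evAt hL (BC L) ψ s.xBC) ≠ 0 :=
  (map_ne_zero _).2 (s.isUnit_xBC.map (evAt hL (BC L) ψ)).ne_zero

/-- The absolute value of a period, up to the contribution of the `ψ`-component of the solution. -/
theorem Solution.leadNorm_period (u : H1v S →ₗ[k⟦X⟧] k⸨X⸩) {ψ : E →ₐ[k⸨X⸩] Qalg k}
    {v : BPlusL L ⊗[k⟦X⟧] OE k E} (h : ∀ φ, φ ≠ ψ → evAt hL (BPlusL L) φ v = 0)
    (hv : resPlus L (evAt hL (BPlusL L) ψ v) ≠ 0) :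
    leadNorm L (period S u (D.thetaF (BPlusL L) v)) * leadNorm L (evAt hL (BC L) ψ s.xBC) =
      normAt hL ψ D.t * (‖resPlus L (evAt hL (BPlusL L) ψ v)‖ *
        leadNorm L (compAt hL ψ (s.functional u))) := by
  have e1 : ∀ φ, evAt hL (BC L) φ (plusToBC L E v) =
      algebraMap (BPlusL L) (BC L) (evAt hL (BPlusL L) φ v) := fun φ =>
    evAt_tensorO hL (BPlusL L) _ (fun _ => rfl) φ v
  have e2 : evAt hL (BC L) ψ (baseMap k L E (BC L) D.t) =
      algebraMap (BPlusL L) (BC L) (evAt hL (BPlusL L) ψ (baseMap k L E (BPlusL L) D.t)) := by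
    rw [← tensorO_baseMap (IsScalarTower.toAlgHom (RZ L) (BPlusL L) (BC L)) D.t]
    exact evAt_tensorO hL (BPlusL L) _ (fun _ => rfl) ψ _
  have hz : algebraMap (RZ L) (BC L) (zMinusZeta L) ^ D.n ≠ 0 :=
    ((isUnit_zMinusZeta_BC L).pow D.n).ne_zero
  have hx : evAt hL (BC L) ψ s.xBC ≠ 0 := (s.isUnit_xBC.map (evAt hL (BC L) ψ)).ne_zero
  set z := algebraMap (RZ L) (BC L) (zMinusZeta L) ^ D.n with hz'
  let β := z⁻¹ * evAt hL (BC L) ψ (baseMap k L E (BC L) D.t) * (evAt hL (BC L) ψ s.xBC)⁻¹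
  rw [s.period_thetaF u v (β • plusToBC L E v) ?_,
    map_smul, functionalBC_eq_compAt hL h, smul_eq_mul,
    map_mul, map_mul, map_mul, map_mul, map_inv₀, map_inv₀, e2, leadNorm_plus L hv, normAt_apply,
    hz', map_pow, leadNorm_zMinusZeta, one_pow, inv_one, one_mul]
  · field_simp [s.leadNorm_evAt_xBC_ne_zero ψ]
  · refine evAt_ext hL (BC L) fun φ => ?_
    rw [map_smul, map_mul, map_smul, map_mul, e1, smul_eq_mul, smul_eq_mul]
    by_cases hφ : φ = ψ
    · rw [hφ, ← hz']
      simp only [β]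
      field_simp
    · rw [h φ hφ, map_zero, mul_zero, mul_zero, mul_zero, mul_zero]

end PeriodNorm

/-! ### The absolute value of the solution at `z = ζ` -/

section Dynamics

variable {B : Type*} [Finite B] {s : Equiv.Perm B}

theorem perm_pow_apply_succ (s : Equiv.Perm B) (n : ℕ) (χ : B) :
    (s ^ (n + 1)) χ = (s ^ n) (s χ) := by
  rw [pow_succ, Equiv.Perm.mul_apply]

section

variable {b : B} {n0 n1 : B → ℝ} {q : ℕ} {ρ : ℝ} (hq : 2 ≤ q) (hρ0 : 0 < ρ) (hρ : ρ < 1)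
  (h00 : ∀ χ, 0 < n0 χ) (h01 : ∀ χ, n0 χ ≤ 1)
  (hA : ∀ χ, s χ ≠ b → n0 χ ^ q = n0 (s χ)) (hB : ∀ χ, s χ = b → n0 χ ^ q = ρ * n0 (s χ))

include hq hρ0 h00 h01 hA hB hρ

/-- The constant terms of a Frobenius eigenvector for the prime element of an embedding are at least
as large as the prime element. -/
theorem le_norm_constant (χ : B) : ρ ≤ n0 χ := by
  have : Nonempty B := ⟨χ⟩
  obtain ⟨χ0, h0⟩ := Finite.exists_min n0
  refine le_trans ?_ (h0 χ)
  have h1 : ρ * n0 χ0 ≤ n0 χ0 ^ q := by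
    by_cases h : s χ0 = b
    · rw [hB _ h]
      exact mul_le_mul_of_nonneg_left (h0 _) hρ0.le
    · rw [hA _ h]
      exact (mul_le_of_le_one_left (h00 _).le hρ.le).trans (h0 _)
  obtain ⟨m, rfl⟩ : ∃ m, q = m + 1 + 1 := ⟨q - 2, by omega⟩
  rw [pow_succ] at h1
  refine (le_of_mul_le_mul_right h1 (h00 _)).trans ?_
  rw [pow_succ]
  exact mul_le_of_le_one_left (h00 _).le (pow_le_one₀ (h00 _).le (h01 _))

theorem norm_constant_lt_one (n : ℕ) (χ : B) (h : (s ^ (n + 1)) χ = b) : n0 χ < 1 := by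
  have hlt : ∀ χ, n0 χ ^ q < 1 → n0 χ < 1 := fun χ h => by
    by_contra! h1
    exact absurd (one_le_pow₀ h1) (not_le.2 h)
  induction n generalizing χ with
  | zero =>
    refine hlt χ ?_
    rw [hB χ (by simpa using h)]
    exact (mul_le_of_le_one_right hρ0.le (h01 _)).trans_lt hρ
  | succ n ih =>
    refine hlt χ ?_
    by_cases h1 : s χ = b
    · rw [hB χ h1]
      exact (mul_le_of_le_one_right hρ0.le (h01 _)).trans_lt hρ
    · rw [hA χ h1]
      exact ih (s χ) (by rw [← h, ← perm_pow_apply_succ])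

theorem norm_linear_lt_one (hA' : ∀ χ, s χ ≠ b → n1 χ ^ q = n1 (s χ))
    (hB' : ∀ χ, s χ = b → n1 χ ^ q ≤ max ρ (n0 b)) (n : ℕ) (χ : B) (h : (s ^ (n + 1)) χ = b) :
    n1 χ < 1 := by
  have hlt : ∀ χ, n1 χ ^ q < 1 → n1 χ < 1 := fun χ h => by
    by_contra! h1
    exact absurd (one_le_pow₀ h1) (not_le.2 h)
  have hb : n0 b < 1 := by
    refine norm_constant_lt_one hq hρ0 hρ h00 h01 hA hB (orderOf s - 1) b ?_
    rw [Nat.sub_add_cancel (orderOf_pos s), pow_orderOf_eq_one, Equiv.Perm.one_apply]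
  induction n generalizing χ with
  | zero => exact hlt χ ((hB' χ (by simpa using h)).trans_lt (max_lt hρ hb))
  | succ n ih =>
    refine hlt χ ?_
    by_cases h1 : s χ = b
    · exact (hB' χ h1).trans_lt (max_lt hρ hb)
    · rw [hA' χ h1]
      exact ih (s χ) (by rw [← h, ← perm_pow_apply_succ])

/-- A constant term can be a non-unit only on the Frobenius orbit of the embedding. -/
theorem exists_pow_apply_eq {χ : B} (h : n0 χ < 1) : ∃ n, (s ^ (n + 1)) χ = b := by
  by_contra! hne
  have h1 : ∀ n, n0 ((s ^ n) χ) = n0 χ ^ q ^ n := fun n => by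
    induction n with
    | zero => simp
    | succ n ih =>
      have h2 := hne n
      rw [pow_succ' s, Equiv.Perm.mul_apply] at h2 ⊢
      rw [← hA _ h2, ih, ← pow_mul, pow_succ]
  obtain ⟨n, hn⟩ := exists_pow_lt_of_lt_one hρ0 h
  have h2 : n0 χ ^ q ^ n ≤ n0 χ ^ n :=
    pow_le_pow_of_le_one (h00 χ).le (h01 χ) (Nat.lt_pow_self (by omega)).le
  have h3 := le_norm_constant hq hρ0 hρ h00 h01 hA hB ((s ^ n) χ)
  rw [h1] at h3
  exact absurd (h3.trans h2) (not_le.2 hn)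

end

/-- The solution of a linear recursion along the orbits of a permutation. -/
theorem hasSum_of_recursion {f g : B → ℝ} {q : ℝ} (hq : 1 < q)
    (h : ∀ χ, q * f χ = f (s χ) + g (s χ)) (χ : B) :
    HasSum (fun n : ℕ => g ((s ^ (n + 1)) χ) / q ^ (n + 1)) (f χ) := by
  have hq0 : 0 < q := one_pos.trans hq
  have hbdd : ∀ f : B → ℝ, ∃ C, ∀ χ, ‖f χ‖ ≤ C := fun f => by
    obtain ⟨C, hC⟩ := (Set.finite_range fun χ => ‖f χ‖).bddAbove
    exact ⟨C, fun χ => hC ⟨χ, rfl⟩⟩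
  have hgeo : Summable fun n : ℕ => (q⁻¹) ^ n :=
    summable_geometric_of_lt_one (by positivity) (inv_lt_one_of_one_lt₀ hq)
  have hs : Summable fun n : ℕ => g ((s ^ (n + 1)) χ) / q ^ (n + 1) := by
    obtain ⟨C, hC⟩ := hbdd g
    refine Summable.of_norm_bounded (((summable_nat_add_iff 1).2 hgeo).mul_left C) fun n => ?_
    rw [norm_div, norm_pow, Real.norm_of_nonneg hq0.le, div_eq_mul_inv, ← inv_pow]
    exact mul_le_mul_of_nonneg_right (hC _) (by positivity)
  have hpart : ∀ n : ℕ, f χ = (∑ i ∈ Finset.range n, g ((s ^ (i + 1)) χ) / q ^ (i + 1)) +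
      f ((s ^ n) χ) / q ^ n := fun n => by
    induction n with
    | zero => simp
    | succ n ih =>
      rw [Finset.sum_range_succ, pow_succ' s n, Equiv.Perm.mul_apply, ih, add_assoc, ← add_div,
        add_comm (g _), ← h, pow_succ' q]
      congr 1
      field_simp
  rw [hs.hasSum_iff_tendsto_nat]
  obtain ⟨C, hC⟩ := hbdd f
  have hz : Tendsto (fun n : ℕ => f ((s ^ n) χ) / q ^ n) atTop (𝓝 0) := by
    refine squeeze_zero_norm (a := fun n => C * (q⁻¹) ^ n) (fun n => ?_) ?_
    · rw [norm_div, norm_pow, Real.norm_of_nonneg hq0.le, div_eq_mul_inv, ← inv_pow]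
      exact mul_le_mul_of_nonneg_right (hC _) (by positivity)
    · have := (tendsto_pow_atTop_nhds_zero_of_lt_one (r := q⁻¹) (by positivity)
        (inv_lt_one_of_one_lt₀ hq)).const_mul C
      rwa [mul_zero] at this
  have := hz.const_sub (f χ)
  rw [sub_zero] at this
  refine this.congr fun n => ?_
  conv_lhs => rw [hpart n]
  rw [add_sub_cancel_right]

end Dynamics

section Evaluation

variable {k : Type*} [Field k] [Fintype k] {L : IntermediateField k⸨X⸩ (Qalg k)}
  [FiniteDimensional k⸨X⸩ L]

theorem series_ringHom_eq {A F : Type*} [CommRing A] [NormedField F] [IsUltrametricDist F]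
    {θ θ' : A⟦X⟧ →+* F} (h : ∀ f, ‖θ f‖ ≤ 1) (h' : ∀ f, ‖θ' f‖ ≤ 1)
    (hC : ∀ a, θ (PowerSeries.C a) = θ' (PowerSeries.C a)) (hX : θ PowerSeries.X = θ' PowerSeries.X)
    (hlt : ‖θ PowerSeries.X‖ < 1) : θ = θ' := by
  refine RingHom.ext fun f => eq_of_forall_norm_sub_le hlt fun n => ?_
  rw [sum_coeff_add_X_pow_mul f n]
  simp only [map_add, map_sum, map_mul, map_pow, hC, ← hX, add_sub_add_left_eq_sub, ← mul_sub]
  rw [norm_mul, norm_pow]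
  refine mul_le_of_le_one_right (by positivity) ((norm_sub_le_max _ _).trans ?_)
  exact max_le (h _) (h' _)

theorem norm_LtoC_VR_lt_one {c : VR L} (hc : ‖(c : L)‖ < 1) : ‖LtoC L c‖ < 1 := by
  rwa [norm_LtoC]

/-- Evaluation of power series with coefficients in `O_{L^sep}` at an element of the maximal ideal
of `R`. -/
def evOS (c : VR L) (hc : ‖(c : L)‖ < 1) : (OS L)⟦X⟧ →+* Cv k :=
  (PowerSeries.constantCoeff (R := Cv k)).comp ((taylor (LtoC L c)).comp
    ((PowerSeries.map ((LsepToC L).comp (osV L))).codRestrict (tate (LtoC L c)) fun f =>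
      mem_tate_of_norm_le_one _ (norm_LtoC_VR_lt_one hc) _ fun n => by
        rw [PowerSeries.coeff_map, RingHom.comp_apply, norm_LsepToC]; exact norm_osV_le_one _))

variable {c : VR L} (hc : ‖(c : L)‖ < 1)

theorem evOS_C (a : OS L) : evOS c hc (PowerSeries.C a) = LsepToC L (osV L a) := by
  change PowerSeries.constantCoeff (taylor (LtoC L c) ⟨PowerSeries.map _ _, _⟩) = _
  simp only [PowerSeries.map_C, taylor_C, PowerSeries.constantCoeff_C]
  rfl

theorem evOS_X : evOS c hc PowerSeries.X = LtoC L c := by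
  change PowerSeries.constantCoeff (taylor (LtoC L c) ⟨PowerSeries.map _ _, _⟩) = _
  simp only [PowerSeries.map_X, taylor_X, PowerSeries.constantCoeff_C, map_add,
    PowerSeries.constantCoeff_X, zero_add]

theorem norm_evOS_le_one (f : (OS L)⟦X⟧) : ‖evOS c hc f‖ ≤ 1 := by
  refine norm_constantCoeff_taylor_le _ _ fun n => ?_
  have h1 : ‖PowerSeries.coeff n (PowerSeries.map ((LsepToC L).comp (osV L)) f)‖ ≤ 1 := by
    rw [PowerSeries.coeff_map, RingHom.comp_apply, norm_LsepToC]; exact norm_osV_le_one _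
  exact mul_le_one₀ h1 (by positivity) (pow_le_one₀ (norm_nonneg _) (norm_LtoC_VR_lt_one hc).le)

theorem constantCoeff_taylor_osToTate (f : OSZ L) : PowerSeries.constantCoeff
    (taylor (LsepToC L (RtoLsep L (zeta L))) (tateSepToTateC L (osToTate L f))) =
      evOS (zeta L) (norm_zeta_lt_one L) f :=
  congrArg (fun f => PowerSeries.constantCoeff (taylor (LtoC L (zeta L)) f))
    (Subtype.ext (PowerSeries.ext fun _ => rfl))

attribute [irreducible] evOS

theorem norm_evOS_of_isUnit {f : (OS L)⟦X⟧} (hf : IsUnit f) : ‖evOS c hc f‖ = 1 := by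
  obtain ⟨g, hg⟩ := isUnit_iff_exists_inv.1 hf
  refine le_antisymm (norm_evOS_le_one hc f) ?_
  have h := congrArg norm (congrArg (evOS c hc) hg)
  rw [map_mul, map_one, norm_mul, norm_one] at h
  rw [← h]
  exact mul_le_of_le_one_right (norm_nonneg _) (norm_evOS_le_one hc g)

/-- The evaluation has the absolute value of the constant term as soon as the latter dominates. -/
theorem norm_evOS_eq {f : (OS L)⟦X⟧} (h : ‖(c : L)‖ < ‖osV L (PowerSeries.coeff 0 f)‖ ∨
    (c ≠ 0 ∧ ‖(c : L)‖ ≤ ‖osV L (PowerSeries.coeff 0 f)‖ ∧ ‖osV L (PowerSeries.coeff 1 f)‖ < 1)) :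
    ‖evOS c hc f‖ = ‖osV L (PowerSeries.coeff 0 f)‖ := by
  have e : ∃ g, evOS c hc f = LsepToC L (osV L (PowerSeries.coeff 0 f)) +
      LtoC L c * (LsepToC L (osV L (PowerSeries.coeff 1 f)) + LtoC L c * evOS c hc g) := by
    refine ⟨PowerSeries.mk fun m => PowerSeries.coeff (m + 2) f, ?_⟩
    conv_lhs => rw [sum_coeff_add_X_pow_mul f 2]
    simp only [map_add, map_zero, map_mul, map_pow, evOS_C, evOS_X, Finset.sum_range_succ,
      Finset.sum_range_zero]
    ring
  obtain ⟨g, e⟩ := e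
  have hc' := norm_LtoC_VR_lt_one hc
  have h2 : ‖LtoC L c * evOS c hc g‖ < 1 := by
    rw [norm_mul]
    exact (mul_le_of_le_one_right (norm_nonneg _) (norm_evOS_le_one hc g)).trans_lt hc'
  have h1 : ‖LtoC L c * (LsepToC L (osV L (PowerSeries.coeff 1 f)) + LtoC L c * evOS c hc g)‖ <
      ‖LsepToC L (osV L (PowerSeries.coeff 0 f))‖ := by
    rw [norm_mul, norm_LsepToC, norm_LtoC]
    have h3 := IsUltrametricDist.norm_add_le_max (LsepToC L (osV L (PowerSeries.coeff 1 f)))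
      (LtoC L c * evOS c hc g)
    rw [norm_LsepToC] at h3
    rcases h with h | ⟨hc0, h, h4⟩
    · refine (mul_le_of_le_one_right (norm_nonneg _) (h3.trans ?_)).trans_lt h
      exact max_le (norm_osV_le_one _) h2.le
    · refine (mul_lt_of_lt_one_right (norm_pos_iff.2 fun h0 => hc0 (Subtype.ext h0))
        (h3.trans_lt (max_lt h4 h2))).trans_le h
  rw [e, IsUltrametricDist.norm_add_eq_max_of_norm_ne_norm h1.ne', max_eq_left h1.le, norm_LsepToC]

end Evaluation

section SolutionValue

variable {k : Type*} [Field k] [Fintype k] {L : IntermediateField k⸨X⸩ (Qalg k)}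
  [FiniteDimensional k⸨X⸩ L] [Algebra.IsSeparable k⸨X⸩ L]
variable {E : Type*} [CommRing E] [Algebra k⸨X⸩ E] [Algebra k⟦X⟧ E] [IsScalarTower k⟦X⟧ k⸨X⸩ E]
  [Module.Finite k⸨X⸩ E] [IsSemisimpleRing E] [Algebra.IsSeparable k⸨X⸩ E]
variable {y : OE k E} (hy : IsUniformizing y) (hL : ∀ (φ : E →ₐ[k⸨X⸩] Qalg k) (e : E), φ e ∈ L)

/-- Evaluation of an element of `O_{L^sep}[[z]] ⊗ O_E` at `z = ζ` and at the embedding `φ`. -/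
def evSep (φ : E →ₐ[k⸨X⸩] Qalg k) : OSZ L ⊗[k⟦X⟧] OE k E →+* Cv k :=
  (evOS (embR hL φ y) (norm_embR_y_lt_one φ hy)).comp (omegaAt (branchOf hy hL φ) (presOS L))

theorem evOS_map (φ : E →ₐ[k⸨X⸩] Qalg k) (f : (VR L)⟦X⟧) :
    evOS (embR hL φ y) (norm_embR_y_lt_one φ hy) (PowerSeries.map (algebraMap (VR L) (OS L)) f) =
      LtoC L (evPhi hy hL φ f) := by
  have h : (evOS (embR hL φ y) (norm_embR_y_lt_one φ hy)).comp
      (PowerSeries.map (algebraMap (VR L) (OS L))) = ((LtoC L).comp (RtoL L)).comp (evPhi hy hL φ) := by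
    refine series_ringHom_eq
      (fun f => norm_evOS_le_one (norm_embR_y_lt_one φ hy) (PowerSeries.map _ f))
      (fun f => ?_) (fun a => ?_) ?_ ?_
    · exact (norm_LtoC L _).trans_le (norm_le_one L _)
    · rw [RingHom.comp_apply, PowerSeries.map_C, evOS_C, RingHom.comp_apply, evPhi_C, osV_algebraMap]
      rfl
    · rw [RingHom.comp_apply, PowerSeries.map_X, evOS_X, RingHom.comp_apply, evPhi_X]
      rfl
    · rw [RingHom.comp_apply, PowerSeries.map_X, evOS_X]
      exact norm_LtoC_VR_lt_one (norm_embR_y_lt_one φ hy)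
  exact RingHom.congr_fun h f

theorem evOS_sub (φ : E →ₐ[k⸨X⸩] Qalg k) (g : (OS L)⟦X⟧) :
    evOS (embR hL φ y) (norm_embR_y_lt_one φ hy) ((branchOf hy hL φ).sub (OS L) g) =
      evOS (zeta L) (norm_zeta_lt_one L) g := by
  have hX : evOS (embR hL φ y) (norm_embR_y_lt_one φ hy)
      ((branchOf hy hL φ).sub (OS L) PowerSeries.X) = LtoC L (zeta L) := by
    rw [Branch.sub_X, evOS_map hy hL, evPhi_z]
  have h : (evOS (embR hL φ y) (norm_embR_y_lt_one φ hy)).comp ((branchOf hy hL φ).sub (OS L)) =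
      evOS (zeta L) (norm_zeta_lt_one L) := by
    refine series_ringHom_eq
      (fun f => norm_evOS_le_one (norm_embR_y_lt_one φ hy) ((branchOf hy hL φ).sub (OS L) f))
      (norm_evOS_le_one (norm_zeta_lt_one L)) (fun a => ?_) ?_ ?_
    · rw [RingHom.comp_apply, Branch.sub_C, evOS_C, evOS_C]
    · rw [RingHom.comp_apply, hX, evOS_X]
    · rw [RingHom.comp_apply, hX]
      exact norm_LtoC_VR_lt_one (norm_zeta_lt_one L)
  exact RingHom.congr_fun h g

theorem evSep_tmul (φ : E →ₐ[k⸨X⸩] Qalg k) (g : OSZ L) (a : OE k E) :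
    evSep hy hL φ (g ⊗ₜ a) = evOS (zeta L) (norm_zeta_lt_one L) g * LtoC L (embR hL φ a) := by
  rw [evSep, RingHom.comp_apply, omegaAt_tmul, map_mul, evOS_map hy hL, branchOf_hom, evPhi_iota]
  congr 1
  exact evOS_sub hy hL φ g

/-- The image of an element of `L^sep⟨z/ζ⟩ ⊗ O_E` in `C_v((z - ζ)) ⊗ O_E`. -/
abbrev tateToBCO (L : IntermediateField k⸨X⸩ (Qalg k)) [FiniteDimensional k⸨X⸩ L]
    (E : Type*) [CommRing E] [Algebra k⟦X⟧ E] :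
    TateSep L ⊗[k⟦X⟧] OE k E →ₐ[k⟦X⟧] BC L ⊗[k⟦X⟧] OE k E :=
  tensorO E ((tateEvalAlg L).restrictScalars k⟦X⟧)

theorem exists_powerToBC_eq (φ : E →ₐ[k⸨X⸩] Qalg k) (x : OSZ L ⊗[k⟦X⟧] OE k E) :
    ∃ F : (Cv k)⟦X⟧, evAt hL (BC L) φ (tateToBCO L E (toTateO L E x)) = powerToBC L F ∧
      PowerSeries.constantCoeff F = evSep hy hL φ x := by
  induction x with
  | zero => exact ⟨0, by simp⟩
  | add x x' hx hx' =>
    obtain ⟨F, h1, h2⟩ := hx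
    obtain ⟨F', h1', h2'⟩ := hx'
    exact ⟨F + F', by rw [map_add, map_add, map_add, map_add, h1, h1'], by
      rw [map_add, map_add, h2, h2']⟩
  | tmul g a =>
    refine ⟨taylor (LsepToC L (RtoLsep L (zeta L))) (tateSepToTateC L (osToTate L g)) *
      PowerSeries.map (LtoC L) (liftEmb hL φ a), ?_, ?_⟩
    · rw [Algebra.TensorProduct.map_tmul, Algebra.TensorProduct.map_tmul, evAt_tmul, map_mul]
      rfl
    · have h1 : PowerSeries.constantCoeff (PowerSeries.map (LtoC L) (liftEmb hL φ a)) =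
          LtoC L (embR hL φ a) := by
        rw [← PowerSeries.coeff_zero_eq_constantCoeff_apply]
        refine (PowerSeries.coeff_map _ _ _).trans (congrArg (LtoC L) ?_)
        refine Eq.trans ?_ (resPlus_liftEmb hL φ a)
        exact PowerSeries.coeff_zero_eq_constantCoeff_apply _
      exact (map_mul _ _ _).trans ((congrArg₂ _ (constantCoeff_taylor_osToTate g) h1).trans
        (evSep_tmul hy hL φ g a).symm)

theorem leadNorm_evAt_eq {φ : E →ₐ[k⸨X⸩] Qalg k} {x : OSZ L ⊗[k⟦X⟧] OE k E}
    (hx : evSep hy hL φ x ≠ 0) :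
    leadNorm L (evAt hL (BC L) φ (tateToBCO L E (toTateO L E x))) = ‖evSep hy hL φ x‖ := by
  obtain ⟨F, h1, h2⟩ := exists_powerToBC_eq hy hL φ x
  rw [h1, leadNorm_powerToBC L (by rwa [h2]), h2]

theorem leadNorm_evAt_of_isUnit {φ : E →ₐ[k⸨X⸩] Qalg k} {x : OSZ L ⊗[k⟦X⟧] OE k E}
    (hx : IsUnit x) : leadNorm L (evAt hL (BC L) φ (tateToBCO L E (toTateO L E x))) = 1 := by
  obtain ⟨y, hy⟩ := exists_isUniformizing (k := k) (E := E)
  rw [leadNorm_evAt_eq hy hL (hx.map (evSep hy hL φ)).ne_zero]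
  exact norm_evOS_of_isUnit (norm_embR_y_lt_one φ hy)
    (hx.map (omegaAt (branchOf hy hL φ) (presOS L)))

section Eigen

variable {hy hL}

theorem Branch.e_frobPerm (χ : Branch hy hL) : (frobPerm χ).e = χ.e := by
  obtain ⟨φ, hφ⟩ := (frobPerm χ).exists_eq
  have hu := χ.isUnit_unit.map (frobS (k := k) (VR L))
  have hz : (frobPerm χ).z = PowerSeries.X ^ χ.e * frobS (k := k) (VR L) χ.unit := by
    rw [Branch.z, frobPerm_hom, ← Branch.z, χ.z_eq, map_mul, map_pow, frobS_X]
  have h1 := evPhi_z (hy := hy) (hL := hL) φ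
  rw [hφ, hz, map_mul, map_pow, evPhi_X] at h1
  have h2 := congrArg (fun x : VR L => ‖(x : L)‖) h1
  simp only [Subalgebra.coe_mul, norm_mul, Subalgebra.coe_pow, norm_pow,
    (isUnit_VR_iff _).1 (hu.map (evPhi hy hL φ)), mul_one] at h2
  rw [norm_zeta_eq (hy := hy) (hL := hL) φ, hφ] at h2
  exact (pow_right_injective₀ (norm_pos_iff.2 fun h => embR_ne_zero hy hL φ (Subtype.ext h))
    (norm_embR_y_lt_one φ hy).ne h2).symm

theorem Branch.e_frobPerm_pow (χ : Branch hy hL) (n : ℕ) : ((frobPerm ^ n) χ).e = χ.e := by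
  induction n with
  | zero => rfl
  | succ n ih => rw [pow_succ', Equiv.Perm.mul_apply, e_frobPerm, ih]

theorem norm_embR_y_eq {φ ψ : E →ₐ[k⸨X⸩] Qalg k}
    (h : (branchOf hy hL φ).e = (branchOf hy hL ψ).e) :
    ‖((embR hL φ y : VR L) : L)‖ = ‖((embR hL ψ y : VR L) : L)‖ := by
  have h1 := norm_zeta_eq (hy := hy) (hL := hL) φ
  rw [norm_zeta_eq (hy := hy) (hL := hL) ψ, h] at h1
  exact ((pow_left_inj₀ (norm_nonneg _) (norm_nonneg _) (Branch.e_pos _).ne').1 h1).symm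

variable {M : Type*} [AddCommGroup M] [Module (RZ L) M] {S : LocalShtuka L M} {c : CM S E}
  {D : Triv c} (s : Solution hy hL D)

/-- The absolute values of the constant terms of the eigenvector for the prime element of `φ`. -/
def Solution.norm0 (φ : E →ₐ[k⸨X⸩] Qalg k) (χ : Branch hy hL) : ℝ :=
  ‖osV L (PowerSeries.coeff 0 (omegaAt χ (presOS L) (s.lam φ)))‖

theorem Solution.norm0_pos (φ : E →ₐ[k⸨X⸩] Qalg k) (χ : Branch hy hL) : 0 < s.norm0 φ χ :=
  norm_pos_iff.2 fun h => s.lam_ne φ χ (osV_injective (h.trans (map_zero _).symm))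

theorem Solution.frobS_lam (φ : E →ₐ[k⸨X⸩] Qalg k) (χ : Branch hy hL) :
    frobS (k := k) (OS L) (omegaAt χ (presOS L) (s.lam φ)) =
      (if frobPerm χ = branchOf hy hL φ then
        PowerSeries.X - PowerSeries.C (algebraMap (VR L) (OS L) (embR hL φ y)) else 1) *
        omegaAt (frobPerm χ) (presOS L) (s.lam φ) := by
  have h := omegaAt_frob χ (presOS L) (sigmaOS L) (sigmaOS_apply L) (s.lam φ)
  rw [s.lam_frob, map_mul, omegaAt_baseMap_OSZ, omegaAt_phiPrime] at h
  rw [← h]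
  congr 1
  by_cases h1 : frobPerm χ = branchOf hy hL φ
  · rw [if_pos h1, if_pos h1.symm, map_sub, PowerSeries.map_X, PowerSeries.map_C]
  · rw [if_neg h1, if_neg (Ne.symm h1), map_one]

theorem Solution.norm0_pow (φ : E →ₐ[k⸨X⸩] Qalg k) (χ : Branch hy hL) :
    s.norm0 φ χ ^ Fintype.card k =
      (if frobPerm χ = branchOf hy hL φ then ‖((embR hL φ y : VR L) : L)‖ else 1) *
        s.norm0 φ (frobPerm χ) := by
  have h := s.frobS_lam φ χ
  rw [norm0, ← norm_pow, ← map_pow]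
  split_ifs at h ⊢ with h1
  · rw [coeff_zero_of_frobS_eq h, map_mul, norm_mul, map_neg, norm_neg, osV_algebraMap, norm_RtoLsep]
    rfl
  · rw [one_mul] at h ⊢
    rw [← coeff_frobS, h]
    rfl

/-- At the embedding `ψ` the eigenvector for `φ` has the absolute value of its constant term on the
branch of `ψ`. -/
theorem Solution.leadNorm_evAt_lam (φ ψ : E →ₐ[k⸨X⸩] Qalg k) :
    leadNorm L (evAt hL (BC L) ψ (tateToBCO L E (toTateO L E (s.lam φ)))) =
      s.norm0 φ (branchOf hy hL ψ) := by
  have hq : 2 ≤ Fintype.card k := Fintype.one_lt_card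
  set ρ := ‖((embR hL φ y : VR L) : L)‖ with hρ
  have hρ0 : 0 < ρ := norm_pos_iff.2 fun h => embR_ne_zero hy hL φ (Subtype.ext h)
  have hρ1 : ρ < 1 := norm_embR_y_lt_one φ hy
  set b := branchOf hy hL φ with hb
  have h01 : ∀ χ, s.norm0 φ χ ≤ 1 := fun χ => norm_osV_le_one _
  have hA : ∀ χ, frobPerm χ ≠ b → s.norm0 φ χ ^ Fintype.card k = s.norm0 φ (frobPerm χ) :=
    fun χ h => by rw [s.norm0_pow, if_neg h, one_mul]
  have hB : ∀ χ, frobPerm χ = b → s.norm0 φ χ ^ Fintype.card k = ρ * s.norm0 φ (frobPerm χ) :=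
    fun χ h => by rw [s.norm0_pow, if_pos h]
  let n1 : Branch hy hL → ℝ := fun χ =>
    ‖osV L (PowerSeries.coeff 1 (omegaAt χ (presOS L) (s.lam φ)))‖
  have hA' : ∀ χ, frobPerm χ ≠ b → n1 χ ^ Fintype.card k = n1 (frobPerm χ) := fun χ h => by
    have h1 := s.frobS_lam φ χ
    rw [if_neg h, one_mul] at h1
    simp only [n1]
    rw [← norm_pow, ← map_pow, ← coeff_frobS, h1]
  have hB' : ∀ χ, frobPerm χ = b → n1 χ ^ Fintype.card k ≤ max ρ (s.norm0 φ b) := fun χ h => by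
    have h1 := s.frobS_lam φ χ
    rw [if_pos h] at h1
    simp only [n1]
    rw [← norm_pow, ← map_pow, coeff_one_of_frobS_eq h1, map_sub, map_mul, h, max_comm]
    refine (norm_sub_le_max _ _).trans (max_le_max le_rfl ?_)
    rw [norm_mul, osV_algebraMap, norm_RtoLsep]
    exact mul_le_of_le_one_right hρ0.le (norm_osV_le_one _)
  have hev : ‖evSep hy hL ψ (s.lam φ)‖ = s.norm0 φ (branchOf hy hL ψ) := by
    refine norm_evOS_eq (norm_embR_y_lt_one ψ hy) ?_
    rcases (h01 (branchOf hy hL ψ)).eq_or_lt with h | h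
    · left
      exact (norm_embR_y_lt_one ψ hy).trans_eq h.symm
    · right
      -- A constant term that is not a unit occurs only on the orbit of the branch of `φ`; there it
      -- dominates all other terms at `Y = ψ(y)`.
      obtain ⟨n, hn⟩ := exists_pow_apply_eq hq hρ0 hρ1 (s.norm0_pos φ) h01 hA hB h
      refine ⟨embR_ne_zero hy hL ψ, ?_,
        norm_linear_lt_one hq hρ0 hρ1 (s.norm0_pos φ) h01 hA hB hA' hB' n _ hn⟩
      rw [norm_embR_y_eq (φ := ψ) (ψ := φ)]
      · exact le_norm_constant hq hρ0 hρ1 (s.norm0_pos φ) h01 hA hB _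
      · rw [← hb, ← hn, Branch.e_frobPerm_pow]
  rw [leadNorm_evAt_eq hy hL, hev]
  rw [← norm_ne_zero_iff, hev]
  exact (s.norm0_pos φ _).ne'

/-- The absolute value of the `ψ`-component of the solution. -/
theorem Solution.leadNorm_evAt_xBC {Φ : (E →ₐ[k⸨X⸩] Qalg k) → ℤ} (hΦ : HasCMType c hL Φ)
    (ψ : E →ₐ[k⸨X⸩] Qalg k) : leadNorm L (evAt hL (BC L) ψ s.xBC) *
      ∏ φ, s.norm0 φ (branchOf hy hL ψ) ^ Φ φ = 1 := by
  have h := congrArg (fun x => leadNorm L (evAt hL (BC L) ψ (tateToBCO L E x))) s.x_eq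
  simp only [map_mul, map_prod, map_pow, s.leadNorm_evAt_lam, leadNorm_evAt_of_isUnit hL s.eta.isUnit,
    leadNorm_evAt_of_isUnit hL s.eta'.isUnit, mul_one] at h
  have h0 : ∀ φ, s.norm0 φ (branchOf hy hL ψ) ≠ 0 := fun φ => (s.norm0_pos φ _).ne'
  simp only [s.cmType_eq hΦ, zpow_sub₀ (h0 _), zpow_natCast, Finset.prod_div_distrib,
    Finset.prod_pow]
  rw [mul_div_assoc', div_eq_one_iff_eq (pow_ne_zero _ (Finset.prod_ne_zero_iff.2 fun φ _ => h0 φ))]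
  exact h

end Eigen

/-! ### Congruences between embeddings -/

variable {hy hL}

/-- `φ ≡ Frob^n ∘ ψ` on `O_E`, modulo the maximal ideal of the valuation ring of `Q_v^alg`. -/
def FrobCong (φ ψ : E →ₐ[k⸨X⸩] Qalg k) (n : ℕ) : Prop :=
  ∀ a : OE k E, ‖φ a - ψ a ^ Fintype.card k ^ n‖ < 1

theorem norm_evPhi_sub_lt_one (φ : E →ₐ[k⸨X⸩] Qalg k) (g : (VR L)⟦X⟧) :
    ‖((evPhi hy hL φ g - PowerSeries.coeff 0 g : VR L) : L)‖ < 1 := by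
  have h := congrArg (evPhi hy hL φ) (PowerSeries.eq_X_mul_shift_add_const g)
  rw [map_add, map_mul, evPhi_X, evPhi_C, ← PowerSeries.coeff_zero_eq_constantCoeff_apply] at h
  rw [h, add_sub_cancel_right, Subalgebra.coe_mul, norm_mul]
  exact mul_lt_one_of_nonneg_of_lt_one_left (norm_nonneg _) (norm_embR_y_lt_one φ hy)
    (norm_le_one L _)

theorem residue_eq_iff {a b : VR L} : IsLocalRing.residue (VR L) a = IsLocalRing.residue (VR L) b ↔
    ‖((a - b : VR L) : L)‖ < 1 := by
  rw [← sub_eq_zero, ← map_sub, IsLocalRing.residue_eq_zero_iff, mem_maximalIdeal_VR_iff]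

theorem residue_embR (φ : E →ₐ[k⸨X⸩] Qalg k) (a : OE k E) :
    IsLocalRing.residue (VR L) (embR hL φ a) =
      IsLocalRing.residue (VR L) (PowerSeries.coeff 0 ((branchOf hy hL φ).hom a)) := by
  rw [residue_eq_iff, branchOf_hom, ← evPhi_iota hy hL φ a]
  exact norm_evPhi_sub_lt_one φ _

theorem frobCong_iff (hL : ∀ (φ : E →ₐ[k⸨X⸩] Qalg k) (e : E), φ e ∈ L)
    {φ ψ : E →ₐ[k⸨X⸩] Qalg k} {n : ℕ} : FrobCong φ ψ n ↔ ∀ a : OE k E,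
      IsLocalRing.residue (VR L) (embR hL φ a) =
        IsLocalRing.residue (VR L) (embR hL ψ a) ^ Fintype.card k ^ n :=
  forall_congr' fun a => by rw [← map_pow (IsLocalRing.residue (VR L)), residue_eq_iff]; rfl

theorem frobPerm_pow_hom (χ : Branch hy hL) (n : ℕ) (a : OE k E) :
    PowerSeries.coeff 0 (((frobPerm ^ n) χ).hom a) =
      PowerSeries.coeff 0 (χ.hom a) ^ Fintype.card k ^ n := by
  induction n with
  | zero => simp
  | succ n ih =>
    rw [pow_succ', Equiv.Perm.mul_apply, frobPerm_hom, coeff_frobS, ih, ← pow_mul, pow_succ]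

theorem eq_of_mem_teich {a b : VR L} (ha : a ∈ teich L) (hb : b ∈ teich L)
    (h : IsLocalRing.residue (VR L) a = IsLocalRing.residue (VR L) b) : a = b := by
  by_contra h0
  have h1 := (isUnit_VR_iff _).1 (isUnit_of_mem_teich (sub_mem ha hb) (sub_ne_zero.2 h0))
  exact (residue_eq_iff.1 h).ne h1

/-- The congruences between the embeddings are described by the Frobenius on the branches. -/
theorem branchOf_eq_frobPerm_pow_iff {φ ψ : E →ₐ[k⸨X⸩] Qalg k} {n : ℕ} :
    branchOf hy hL φ = (frobPerm ^ n) (branchOf hy hL ψ) ↔ FrobCong φ ψ n := by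
  rw [frobCong_iff hL]
  constructor
  · intro h a
    rw [residue_embR (hy := hy), residue_embR (hy := hy), h, frobPerm_pow_hom, map_pow]
  · intro h
    refine Branch.ext (ringHom_ext_of_teich hy (Branch.hom_y _) (Branch.hom_y _) fun l m hm hl => ?_)
    obtain ⟨a, ha, ha'⟩ := (branchOf hy hL φ).hom_teich hm hl
    obtain ⟨b, hb, hb'⟩ := ((frobPerm ^ n) (branchOf hy hL ψ)).hom_teich hm hl
    rw [ha', hb', eq_of_mem_teich ha hb]
    have h1 := h l
    rw [residue_embR (hy := hy), residue_embR (hy := hy), ← map_pow, ← frobPerm_pow_hom, ha', hb']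
      at h1
    simpa using h1

theorem branchOf_eq_iff {φ ψ : E →ₐ[k⸨X⸩] Qalg k} :
    branchOf hy hL φ = branchOf hy hL ψ ↔ FrobCong φ ψ 0 := by
  rw [← branchOf_eq_frobPerm_pow_iff (hy := hy) (hL := hL), pow_zero]
  rfl

end SolutionValue

/-! ### The valuation of the period -/

section Valuation

variable (k : Type*) [Field k] [Fintype k]

/-- The valuation with `v(ζ) = 1` that belongs to an absolute value. -/
def lv (x : ℝ) : ℝ := Real.logb ‖algebraMap k⸨X⸩ (Cv k) (algebraMap k⟦X⟧ k⸨X⸩ PowerSeries.X)‖ x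

variable {k}

@[simp] theorem lv_one : lv k 1 = 0 := Real.logb_one

theorem lv_mul {x y : ℝ} (hx : x ≠ 0) (hy : y ≠ 0) : lv k (x * y) = lv k x + lv k y :=
  Real.logb_mul hx hy

theorem lv_pow (x : ℝ) (n : ℕ) : lv k (x ^ n) = n * lv k x := Real.logb_pow _ _ _

theorem lv_zpow (x : ℝ) (n : ℤ) : lv k (x ^ n) = n * lv k x := by
  rw [lv, Real.logb, Real.log_zpow, mul_div_assoc]
  rfl

theorem lv_prod {ι : Type*} (s : Finset ι) (f : ι → ℝ) (h : ∀ i ∈ s, f i ≠ 0) :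
    lv k (∏ i ∈ s, f i) = ∑ i ∈ s, lv k (f i) := Real.logb_prod s f h

end Valuation

section Sums

variable {k : Type*} [Field k] [Fintype k]
variable {E : Type*} [CommRing E] [Algebra k⸨X⸩ E] [Algebra k⟦X⟧ E] [IsScalarTower k⟦X⟧ k⸨X⸩ E]
  [Module.Finite k⸨X⸩ E] [IsSemisimpleRing E] [Algebra.IsSeparable k⸨X⸩ E]

open Classical in
/-- The sum over the embeddings `φ ≡ ψ` that corresponds to `-μ_Art`. -/
def conjSum (y : OE k E) (ψ : E →ₐ[k⸨X⸩] Qalg k) (a : (E →ₐ[k⸨X⸩] Qalg k) → ℝ) : ℝ :=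
  ∑ φ with FrobCong φ ψ 0, (a φ - a ψ) * lv k ‖ψ y - φ y‖

open Classical in
/-- The sum over the embeddings `φ ≡ Frob^n ∘ ψ` that gives the coefficient of `q^{-ns}` in
`Z(a, s)`. -/
def frobSum (y : OE k E) (ψ : E →ₐ[k⸨X⸩] Qalg k) (a : (E →ₐ[k⸨X⸩] Qalg k) → ℝ) (n : ℕ) : ℝ :=
  lv k ‖ψ y‖ * ∑ φ with FrobCong φ ψ n, a φ

variable {L : IntermediateField k⸨X⸩ (Qalg k)} [FiniteDimensional k⸨X⸩ L]
  [Algebra.IsSeparable k⸨X⸩ L]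
variable {y : OE k E} (hy : IsUniformizing y) (hL : ∀ (φ : E →ₐ[k⸨X⸩] Qalg k) (e : E), φ e ∈ L)

theorem sum_lv_normAt (ψ : E →ₐ[k⸨X⸩] Qalg k) (a : (E →ₐ[k⸨X⸩] Qalg k) → ℝ) :
    ∑ φ, a φ * lv k (normAt hL ψ (phiPrime hy hL φ)) = conjSum y ψ a := by
  classical
  have h0 := normAt_ne_zero hy hL ψ
  have h1 : ∑ φ, lv k (normAt hL ψ (phiPrime hy hL φ)) = 0 := by
    rw [← lv_prod _ _ fun φ _ => h0 φ, normAt_prod, lv_one]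
  have h2 : ∑ φ, a φ * lv k (normAt hL ψ (phiPrime hy hL φ)) =
      ∑ φ, (a φ - a ψ) * lv k (normAt hL ψ (phiPrime hy hL φ)) := by
    simp only [sub_mul, Finset.sum_sub_distrib, ← Finset.mul_sum, h1, mul_zero, sub_zero]
  rw [h2, conjSum, Finset.sum_filter]
  refine Finset.sum_congr rfl fun φ _ => ?_
  rcases eq_or_ne φ ψ with rfl | hφ
  · simp
  have h3 := rho_phiPrime hL hy ψ φ
  rw [← branchOf_eq_iff (hy := hy) (hL := hL)]
  split_ifs at h3 ⊢ with h
  · rw [normAt_eq_norm_rho hy hL, h3]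
    · rfl
    · rw [h3, sub_ne_zero]
      exact fun h4 => hφ (embR_y_injOn h h4.symm)
  · rw [normAt_eq_norm_rho hy hL, h3, OneMemClass.coe_one, norm_one, lv_one, mul_zero]
    rw [h3]
    exact one_ne_zero

variable {hy hL}

theorem Solution.hasSum_frobSum {M : Type*} [AddCommGroup M] [Module (RZ L) M]
    {S : LocalShtuka L M} {c : CM S E} {D : Triv c} (s : Solution hy hL D)
    (ψ : E →ₐ[k⸨X⸩] Qalg k) (a : (E →ₐ[k⸨X⸩] Qalg k) → ℝ) :
    HasSum (fun n => frobSum y ψ a (n + 1) / (Fintype.card k : ℝ) ^ (n + 1))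
      (∑ φ, a φ * lv k (s.norm0 φ (branchOf hy hL ψ))) := by
  classical
  have hne : ∀ φ, ‖((embR hL φ y : VR L) : L)‖ ≠ 0 := fun φ =>
    norm_ne_zero_iff.2 fun h => embR_ne_zero hy hL φ (Subtype.ext h)
  have h := hasSum_of_recursion (s := frobPerm (hy := hy) (hL := hL)) (q := (Fintype.card k : ℝ))
    (f := fun χ => ∑ φ, a φ * lv k (s.norm0 φ χ))
    (g := fun χ => ∑ φ, if branchOf hy hL φ = χ then a φ * lv k ‖((embR hL φ y : VR L) : L)‖ else 0)
    (by exact_mod_cast Fintype.one_lt_card) (fun χ => ?_) (branchOf hy hL ψ)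
  · refine h.congr_fun fun n => ?_
    congr 1
    rw [frobSum, Finset.mul_sum, Finset.sum_filter]
    refine Finset.sum_congr rfl fun φ _ => ?_
    rw [← branchOf_eq_frobPerm_pow_iff (hy := hy) (hL := hL)]
    split_ifs with h1
    · have h2 : ‖((embR hL φ y : VR L) : L)‖ = ‖((embR hL ψ y : VR L) : L)‖ :=
        norm_embR_y_eq (hy := hy) (by rw [h1, Branch.e_frobPerm_pow])
      rw [h2, mul_comm]
      rfl
    · rfl
  · rw [Finset.mul_sum, ← Finset.sum_add_distrib]
    refine Finset.sum_congr rfl fun φ _ => ?_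
    have h1 := congrArg (lv k) (s.norm0_pow φ χ)
    rw [lv_pow] at h1
    rw [mul_left_comm, h1]
    by_cases h2 : frobPerm χ = branchOf hy hL φ
    · rw [if_pos h2, if_pos h2.symm, lv_mul (hne φ) (s.norm0_pos φ _).ne']
      ring
    · rw [if_neg h2, if_neg (Ne.symm h2), one_mul, add_zero]

variable {M : Type*} [AddCommGroup M] [Module (RZ L) M]
    {S : LocalShtuka L M} {c : CM S E}

theorem Triv.exists_isValOmega (hy : IsUniformizing y) (D : Triv c) {ψ : E →ₐ[k⸨X⸩] Qalg k}
    {ω : HdRPlus L M} (hω : Submodule.span (BPlusL L) {ω} = HPsi c (hL ψ)) :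
    ∃ r, IsValOmega c (hL ψ) ω r := by
  obtain ⟨v', hn, -⟩ := D.exists_isNormalized hL ψ hy
  obtain ⟨v, rfl⟩ := (D.thetaF (BPlusL L)).surjective ω
  obtain ⟨x, hx⟩ := Submodule.mem_span_singleton.1
    ((hω.trans hn.1.symm).le (Submodule.mem_span_singleton_self _))
  have hx' : x • v' = v := (D.thetaF (BPlusL L)).injective ((map_smul _ _ _).trans hx)
  have h0 := ((D.span_thetaF_eq_HPsi_iff hL ψ v).1 hω).2
  rw [← hx', map_smul, smul_eq_mul, map_mul] at h0
  exact ⟨_, _, ((isUnit_BPlusL_iff L).2 (left_ne_zero_of_mul h0)).unit, hn, hx.symm, rfl⟩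

theorem Triv.norm_resPlus_of_isValOmega (hy : IsUniformizing y) (D : Triv c)
    {ψ : E →ₐ[k⸨X⸩] Qalg k} {v : BPlusL L ⊗[k⟦X⟧] OE k E} {r : ℝ}
    (h : IsValOmega c (hL ψ) (D.thetaF (BPlusL L) v) r) : ∃ t : ℝ, t ≠ 0 ∧ r = lv k t ∧
      ‖resPlus L (evAt hL (BPlusL L) ψ v)‖ = t * ‖(rho hL hy ψ (primeProd hy hL ψ) : L)‖ := by
  obtain ⟨ω', x, hn, hx, rfl⟩ := h
  obtain ⟨v', rfl⟩ := (D.thetaF (BPlusL L)).surjective ω'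
  have hx' : v = (x : BPlusL L) • v' :=
    (D.thetaF (BPlusL L)).injective (hx.trans (map_smul _ _ _).symm)
  refine ⟨‖resPlus L x‖, norm_ne_zero_iff.2 ((isUnit_BPlusL_iff L).1 x.isUnit), ?_, ?_⟩
  · rw [← norm_LtoC]
    rfl
  · rw [hx', map_smul, smul_eq_mul, map_mul, norm_mul, D.exists_of_isNormalized hy hL hn]

/-- The period does not vanish, and its valuation is given by sums over the embeddings of `E`. -/
theorem Solution.vBC_period {D : Triv c} (s : Solution hy hL D)
    {Φ : (E →ₐ[k⸨X⸩] Qalg k) → ℤ} (hΦ : HasCMType c hL Φ) {ψ : E →ₐ[k⸨X⸩] Qalg k}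
    {u : H1v S →ₗ[k⟦X⟧] k⸨X⸩} {ω : HdRPlus L M} {r t : ℝ}
    (hω : Submodule.span (BPlusL L) {ω} = HPsi c (hL ψ))
    (hr : IsValOmega c (hL ψ) ω r) (ht : IsValU c ψ u t) : period S u ω ≠ 0 ∧
      vBC (period S u ω) = conjSum y ψ (fun φ => Φ φ) +
        ∑' n, frobSum y ψ (fun φ => Φ φ) (n + 1) / (Fintype.card k : ℝ) ^ (n + 1) + r + t := by
  obtain ⟨v, rfl⟩ := (D.thetaF (BPlusL L)).surjective ω
  obtain ⟨hv, hv0⟩ := (D.span_thetaF_eq_HPsi_iff hL ψ v).1 hω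
  obtain ⟨r', hr0, rfl, hr'⟩ := D.norm_resPlus_of_isValOmega hy hr
  obtain ⟨a, u', h1, h2, rfl⟩ := ht
  have hP : ‖(rho hL hy ψ (primeProd hy hL ψ) : L)‖ ≠ 0 := norm_ne_zero_iff.2 fun h =>
    rho_primeProd_ne_zero hy hL ψ (Subtype.ext h)
  have hu := leadNorm_compAt_of_isESmul s.actH1v_tateEquiv hy hL (ψ := ψ) h1 h2
  have ha : ‖ψ a‖ ≠ 0 := norm_ne_zero_iff.2 (a.isUnit.map ψ).ne_zero
  have hp := s.leadNorm_period u hv hv0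
  have hx := s.leadNorm_evAt_xBC hΦ ψ
  change _ = _ * (_ * leadNorm L (compAt hL ψ (u ∘ₗ s.tateEquiv.toLinearMap))) at hp
  rw [s.normAt_t hΦ, hr', mul_assoc r', mul_comm ‖_‖, hu] at hp
  have h0 := normAt_ne_zero hy hL ψ
  have h0' : ∀ φ, s.norm0 φ (branchOf hy hL ψ) ≠ 0 := fun φ => (s.norm0_pos φ _).ne'
  have key : leadNorm L (period S u (D.thetaF (BPlusL L) v)) =
      (∏ φ, normAt hL ψ (phiPrime hy hL φ) ^ Φ φ) * (r' * ‖ψ a‖) *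
        ∏ φ, s.norm0 φ (branchOf hy hL ψ) ^ Φ φ := by
    rw [← hp, mul_assoc, hx, mul_one]
  have hA : ∀ φ ∈ Finset.univ, normAt hL ψ (phiPrime hy hL φ) ^ Φ φ ≠ 0 := fun φ _ =>
    zpow_ne_zero _ (h0 φ)
  have hB : ∀ φ ∈ Finset.univ, s.norm0 φ (branchOf hy hL ψ) ^ Φ φ ≠ 0 := fun φ _ =>
    zpow_ne_zero _ (h0' φ)
  have hA' := Finset.prod_ne_zero_iff.2 hA
  have hB' := Finset.prod_ne_zero_iff.2 hB
  refine ⟨fun h => ?_, ?_⟩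
  · rw [h, map_zero] at key
    exact mul_ne_zero (mul_ne_zero hA' (mul_ne_zero hr0 ha)) hB' key.symm
  · change lv k (leadNorm L (period S u (D.thetaF (BPlusL L) v))) = _
    have hva : vC ((ψ a : Qalg k) : Cv k) = lv k ‖ψ a‖ := by
      rw [← UniformSpace.Completion.norm_coe]
      rfl
    rw [key, lv_mul (mul_ne_zero hA' (mul_ne_zero hr0 ha)) hB', lv_mul hA' (mul_ne_zero hr0 ha),
      lv_mul hr0 ha, lv_prod _ _ hA, lv_prod _ _ hB, hva, (s.hasSum_frobSum ψ _).tsum_eq,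
      ← sum_lv_normAt hy hL]
    simp only [lv_zpow]
    ring

end Sums

/-! ### Invariance of the sums over embeddings under extension of the algebra -/

section Inflation

variable {k : Type*} [Field k] [Fintype k]
variable {E : Type*} [CommRing E] [Algebra k⸨X⸩ E] [Algebra k⟦X⟧ E] [IsScalarTower k⟦X⟧ k⸨X⸩ E]
  [Module.Finite k⸨X⸩ E] [IsSemisimpleRing E] [Algebra.IsSeparable k⸨X⸩ E]
variable {E' : Type*} [CommRing E'] [Algebra k⸨X⸩ E'] [Algebra k⟦X⟧ E']
  [IsScalarTower k⟦X⟧ k⸨X⸩ E'] [Module.Finite k⸨X⸩ E'] [IsSemisimpleRing E']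
  [Algebra.IsSeparable k⸨X⸩ E']
variable {L : IntermediateField k⸨X⸩ (Qalg k)} [FiniteDimensional k⸨X⸩ L]
  [Algebra.IsSeparable k⸨X⸩ L]
variable {y : OE k E} {y' : OE k E'}

/-- The map of rings of integers induced by a homomorphism of algebras. -/
def mapOE (j : E →ₐ[k⸨X⸩] E') : OE k E →+* OE k E' :=
  ((j.restrictScalars k⟦X⟧).mapIntegralClosure).toRingHom

theorem FrobCong.comp {σ σ' : E' →ₐ[k⸨X⸩] Qalg k} {n : ℕ} (h : FrobCong σ σ' n)
    (j : E →ₐ[k⸨X⸩] E') : FrobCong (σ.comp j) (σ'.comp j) n := fun a => h (mapOE j a)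

theorem exists_frobCong (hy : IsUniformizing y) (hL : ∀ (φ : E →ₐ[k⸨X⸩] Qalg k) (e : E), φ e ∈ L)
    (ψ : E →ₐ[k⸨X⸩] Qalg k) (n : ℕ) : ∃ φ, FrobCong φ ψ n := by
  obtain ⟨φ, hφ⟩ := ((frobPerm ^ n) (branchOf hy hL ψ)).exists_eq
  exact ⟨φ, branchOf_eq_frobPerm_pow_iff.1 hφ⟩

theorem FrobCong.iff_zero (hy : IsUniformizing y)
    (hL : ∀ (φ : E →ₐ[k⸨X⸩] Qalg k) (e : E), φ e ∈ L) {φ ψ : E →ₐ[k⸨X⸩] Qalg k} {n : ℕ}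
    (h : FrobCong φ ψ n) (φ' : E →ₐ[k⸨X⸩] Qalg k) : FrobCong φ' ψ n ↔ FrobCong φ' φ 0 := by
  rw [← branchOf_eq_iff (hy := hy) (hL := hL),
    ← branchOf_eq_frobPerm_pow_iff (hy := hy) (hL := hL),
    ← branchOf_eq_frobPerm_pow_iff.2 h]

theorem frobSum_eq_of_frobCong (hy : IsUniformizing y)
    (hL : ∀ (φ : E →ₐ[k⸨X⸩] Qalg k) (e : E), φ e ∈ L) {φ ψ : E →ₐ[k⸨X⸩] Qalg k} {n : ℕ}
    (h : FrobCong φ ψ n) (a : (E →ₐ[k⸨X⸩] Qalg k) → ℝ) : frobSum y ψ a n = frobSum y φ a 0 := by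
  classical
  have h1 : ‖φ y‖ = ‖ψ y‖ := norm_embR_y_eq (hy := hy) (hL := hL) (by
    rw [branchOf_eq_frobPerm_pow_iff.2 h, Branch.e_frobPerm_pow])
  rw [frobSum, frobSum, h1, Finset.filter_congr fun φ' _ => h.iff_zero hy hL φ']

variable (hy : IsUniformizing y) (hL : ∀ (φ : E →ₐ[k⸨X⸩] Qalg k) (e : E), φ e ∈ L)
  (hy' : IsUniformizing y') (hL' : ∀ (φ : E' →ₐ[k⸨X⸩] Qalg k) (e : E'), φ e ∈ L)
  (j : E →ₐ[k⸨X⸩] E')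

include hy hL hy' hL' in
open Classical in
/-- The embeddings in a class of congruent embeddings of `E'` are distributed evenly over the
restrictions to `E`: if `Y' ^ e' · unit` is the image of `y` in the branch of `σ₀`, then the
series `Y' ^ e' · unit - φ(y)` is a unit times the product of the factors `Y' - σ(y')` over
the `e'` embeddings `σ` that extend `φ`. -/
theorem exists_card_fiber (σ₀ : E' →ₐ[k⸨X⸩] Qalg k) : ∃ e' : ℕ, ‖σ₀ (j y)‖ = ‖σ₀ y'‖ ^ e' ∧
    ∀ φ, FrobCong φ (σ₀.comp j) 0 →
      (Finset.univ.filter fun σ => FrobCong σ σ₀ 0 ∧ σ.comp j = φ).card = e' ∧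
      ‖σ₀ (j y) - φ y‖ = ∏ σ with FrobCong σ σ₀ 0 ∧ σ.comp j = φ, ‖σ₀ y' - σ y'‖ := by
  set χ' := branchOf hy' hL' σ₀
  set χ := branchOf hy hL (σ₀.comp j)
  set g := χ'.hom (mapOE j y)
  have hχ' : ∀ σ, σ ∈ χ'.embeddings ↔ FrobCong σ σ₀ 0 := fun σ =>
    Branch.mem_embeddings.trans branchOf_eq_iff
  have hχ : ∀ φ, φ ∈ χ.embeddings ↔ FrobCong φ (σ₀.comp j) 0 := fun φ =>
    Branch.mem_embeddings.trans branchOf_eq_iff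
  have hev : ∀ σ ∈ χ'.embeddings, evPhi hy' hL' σ g = embR hL (σ.comp j) y := fun σ hσ => by
    rw [Branch.mem_embeddings] at hσ
    exact (congrArg (fun χ : Branch hy' hL' => evPhi hy' hL' σ (χ.hom (mapOE j y))) hσ.symm).trans
      (evPhi_iota hy' hL' σ _)
  have h0 : σ₀ ∈ χ'.embeddings := Branch.mem_embeddings.2 rfl
  have hg0 : g ≠ 0 := fun h => embR_ne_zero hy hL (σ₀.comp j) (by rw [← hev _ h0, h, map_zero])
  obtain ⟨e', u, hu, hg⟩ := (χ'.isTeichSeries (mapOE j y)).eq_X_pow_mul hg0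
  change g = _ at hg
  have hpos : 0 < ‖σ₀ y'‖ := norm_pos_iff.2 (hy'.1 σ₀).1
  have hnorm : ‖σ₀ (j y)‖ = ‖σ₀ y'‖ ^ e' := by
    have h1 := congrArg (fun x : VR L => ‖(x : L)‖) (hev _ h0)
    simp only [hg, map_mul, map_pow, evPhi_X, Subalgebra.coe_mul, Subalgebra.coe_pow, norm_mul,
      norm_pow, (isUnit_VR_iff _).1 (hu.map (evPhi hy' hL' σ₀)), mul_one] at h1
    exact h1.symm
  have hfib : ∀ φ, (Finset.univ.filter fun σ => FrobCong σ σ₀ 0 ∧ σ.comp j = φ) =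
      χ'.embeddings.filter fun σ => σ.comp j = φ := fun φ => by
    ext σ
    simp [hχ']
  have he : χ'.e = e' * χ.e := by
    have h1 : ‖(zeta L : L)‖ = ‖σ₀ y'‖ ^ χ'.e := norm_zeta_eq (hy := hy') (hL := hL') σ₀
    have h2 : ‖(zeta L : L)‖ = ‖σ₀ (j y)‖ ^ χ.e := norm_zeta_eq (hy := hy) (hL := hL) (σ₀.comp j)
    rw [hnorm, ← pow_mul, h1] at h2
    exact pow_right_injective₀ hpos (hy'.1 σ₀).2.ne h2
  have hdvd : ∀ φ ∈ χ.embeddings, ∃ h,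
      PowerSeries.X ^ e' * u - PowerSeries.C (embR hL φ y) =
        (∏ σ ∈ χ'.embeddings.filter fun σ => σ.comp j = φ,
          (PowerSeries.X - PowerSeries.C (embR hL' σ y'))) * h := fun φ hφ => by
    refine prod_X_sub_C_dvd _ _ (fun σ => norm_embR_y_lt_one σ hy') ?_ ?_
    · intro σ hσ σ' hσ' h
      have h1 := Branch.mem_embeddings.1 (Finset.mem_filter.1 hσ).1
      have h2 := Branch.mem_embeddings.1 (Finset.mem_filter.1 hσ').1
      exact embR_y_injOn (h1.trans h2.symm) h
    · intro σ hσ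
      obtain ⟨h1, rfl⟩ := Finset.mem_filter.1 hσ
      have h2 := hev σ h1
      rw [hg] at h2
      change evPhi hy' hL' σ _ = 0
      rw [map_sub, h2, evPhi_C, sub_self]
  -- Each fiber has at most `e'` elements, and the sum over the fibers is `e' e`: equality holds.
  have hle : ∀ φ ∈ χ.embeddings, (χ'.embeddings.filter fun σ => σ.comp j = φ).card ≤ e' :=
    fun φ hφ => by
      obtain ⟨h, hh⟩ := hdvd φ hφ
      exact (card_le_of_prod_X_sub_C_dvd _ _ (fun σ => norm_embR_y_lt_one σ hy') hu
        (norm_embR_y_lt_one φ hy) hh).1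
  have hsum : ∑ φ ∈ χ.embeddings, (χ'.embeddings.filter fun σ => σ.comp j = φ).card =
      ∑ φ ∈ χ.embeddings, e' := by
    refine (Finset.card_eq_sum_card_fiberwise (f := fun σ : E' →ₐ[k⸨X⸩] Qalg k => σ.comp j)
      fun σ hσ => (hχ _).2 (((hχ' σ).1 hσ).comp j)).symm.trans ?_
    rw [Branch.card_embeddings, Finset.sum_const, Branch.card_embeddings, he, smul_eq_mul, mul_comm]
  have hcard := (Finset.sum_eq_sum_iff_of_le hle).1 hsum
  refine ⟨e', hnorm, fun φ hφ => ?_⟩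
  rw [hfib]
  have hφ' := (hχ φ).2 hφ
  refine ⟨hcard φ hφ', ?_⟩
  obtain ⟨h, hh⟩ := hdvd φ hφ'
  have hu' := (card_le_of_prod_X_sub_C_dvd _ _ (fun σ => norm_embR_y_lt_one σ hy') hu
    (norm_embR_y_lt_one φ hy) hh).2 (hcard φ hφ')
  have h1 := congrArg (evPhi hy' hL' σ₀) hh
  rw [map_sub, ← hg, hev _ h0, evPhi_C, map_mul, map_prod] at h1
  have h2 := congrArg (fun x : VR L => ‖(x : L)‖) h1
  simp only [Subalgebra.coe_mul, norm_mul, (isUnit_VR_iff _).1 (hu'.map (evPhi hy' hL' σ₀)),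
    mul_one, map_sub, evPhi_X, evPhi_C] at h2
  refine h2.trans ?_
  change ‖RtoL L _‖ = _
  rw [map_prod, norm_prod]
  rfl

include hy hL hy' hL' in
theorem frobSum_comp (σ₀ : E' →ₐ[k⸨X⸩] Qalg k) (a : (E →ₐ[k⸨X⸩] Qalg k) → ℝ) (n : ℕ) :
    frobSum y (σ₀.comp j) a n = frobSum y' σ₀ (fun σ => a (σ.comp j)) n := by
  classical
  obtain ⟨σ₁, h1⟩ := exists_frobCong hy' hL' σ₀ n
  rw [frobSum_eq_of_frobCong hy' hL' h1, frobSum_eq_of_frobCong hy hL (h1.comp j)]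
  obtain ⟨e', hn, hf⟩ := exists_card_fiber hy hL hy' hL' j σ₁
  rw [frobSum, frobSum, AlgHom.comp_apply, hn, lv_pow, mul_comm (e' : ℝ), mul_assoc]
  congr 1
  rw [Finset.mul_sum, ← Finset.sum_fiberwise_of_maps_to (g := fun σ : E' →ₐ[k⸨X⸩] Qalg k => σ.comp j)
    (t := Finset.univ.filter fun φ => FrobCong φ (σ₁.comp j) 0)]
  · refine Finset.sum_congr rfl fun φ hφ => ?_
    rw [Finset.filter_filter, ← (hf φ (Finset.mem_filter.1 hφ).2).1, ← nsmul_eq_mul,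
      ← Finset.sum_const]
    exact Finset.sum_congr rfl fun σ hσ => by rw [(Finset.mem_filter.1 hσ).2.2]
  · intro σ hσ
    exact Finset.mem_filter.2 ⟨Finset.mem_univ _, (Finset.mem_filter.1 hσ).2.comp j⟩

include hy hL hy' hL' in
theorem conjSum_comp (σ₀ : E' →ₐ[k⸨X⸩] Qalg k) (a : (E →ₐ[k⸨X⸩] Qalg k) → ℝ) :
    conjSum y (σ₀.comp j) a = conjSum y' σ₀ fun σ => a (σ.comp j) := by
  classical
  obtain ⟨e', hn, hf⟩ := exists_card_fiber hy hL hy' hL' j σ₀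
  rw [conjSum, conjSum,
    ← Finset.sum_fiberwise_of_maps_to (g := fun σ : E' →ₐ[k⸨X⸩] Qalg k => σ.comp j)
    (t := Finset.univ.filter fun φ => FrobCong φ (σ₀.comp j) 0)]
  · refine Finset.sum_congr rfl fun φ hφ => ?_
    rw [Finset.filter_filter]
    rcases eq_or_ne φ (σ₀.comp j) with rfl | h0
    · rw [sub_self, zero_mul, Finset.sum_eq_zero]
      intro σ hσ
      rw [(Finset.mem_filter.1 hσ).2.2, sub_self, zero_mul]
    · rw [AlgHom.comp_apply, (hf φ (Finset.mem_filter.1 hφ).2).2, lv_prod, Finset.mul_sum]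
      · exact Finset.sum_congr rfl fun σ hσ => by rw [(Finset.mem_filter.1 hσ).2.2]
      · intro σ hσ
        obtain ⟨-, h1, rfl⟩ := Finset.mem_filter.1 hσ
        rw [norm_ne_zero_iff, sub_ne_zero]
        intro h2
        refine h0 (congrArg (fun σ => AlgHom.comp σ j) ?_)
        exact embR_y_injOn (hy := hy') (hL := hL') (branchOf_eq_iff.2 h1)
          (Subtype.ext (Subtype.ext h2.symm))
  · intro σ hσ
    exact Finset.mem_filter.2 ⟨Finset.mem_univ _, (Finset.mem_filter.1 hσ).2.comp j⟩

end Inflation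

/-! ### The different of a Galois extension -/

section Different

variable {k : Type*} [Field k] [Fintype k] {L : IntermediateField k⸨X⸩ (Qalg k)}
  [FiniteDimensional k⸨X⸩ L] [Algebra.IsSeparable k⸨X⸩ L]

/-- The functional `a ↦ Tr(t a)` on the ring of integers. -/
def traceMul (t : L) : OE k L →ₗ[k⟦X⟧] k⸨X⸩ :=
  (Algebra.traceForm k⸨X⸩ L t).restrictScalars k⟦X⟧ ∘ₗ (OE k L).val.toLinearMap

theorem traceMul_apply (t : L) (a : OE k L) :
    traceMul t a = Algebra.trace k⸨X⸩ L (t * a) := rfl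

theorem sum_algHom_eq_trace (x : L) :
    ∑ σ : L →ₐ[k⸨X⸩] Qalg k, σ x = algebraMap k⸨X⸩ (Qalg k) (Algebra.trace k⸨X⸩ L x) := by
  rw [trace_eq_sum_embeddings (Qalg k)]
  exact Finset.sum_equiv (Equiv.refl _) (by simp) (by simp)

variable (hL : ∀ (φ : L →ₐ[k⸨X⸩] Qalg k) (e : L), φ e ∈ L)

theorem functionalBC_trace (v : BPlusL L ⊗[k⟦X⟧] OE k L) :
    functionalBC L (traceMul 1) (plusToBC L L v) =
      algebraMap (BPlusL L) (BC L) (∑ φ, evAt hL (BPlusL L) φ v) := by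
  induction v with
  | zero => simp
  | add x y hx hy => simp only [map_add, hx, hy, Finset.sum_add_distrib]
  | tmul b a =>
    have h : ∑ φ, liftEmb hL φ a = QvToPlus L (Algebra.trace k⸨X⸩ L (a : L)) := by
      rw [← liftL_algebraMap]
      change ∑ φ, liftL L (embR hL φ a : VR L) = _
      rw [← map_sum]
      refine congrArg (liftL L) (Subtype.ext ?_)
      refine Eq.trans ?_ (sum_algHom_eq_trace (a : L))
      exact map_sum L.val _ _
    have h2 : ∀ φ, evAt hL (BPlusL L) φ (b ⊗ₜ a) = b * liftEmb hL φ a := fun φ => evAt_tmul ..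
    simp only [h2]
    rw [plusToBC_tmul, functionalBC_tmul, ← Finset.mul_sum, map_mul, h, plus_QvToPlus,
      traceMul_apply, one_mul]

theorem compAt_trace (ψ : L →ₐ[k⸨X⸩] Qalg k) : compAt hL ψ (traceMul 1) = 1 := by
  classical
  rw [compAt, functionalBC_trace hL]
  simp [evAt_idem]

include hL in
/-- Every functional on the ring of integers is given by the trace form. -/
theorem exists_eq_traceMul (h : OE k L →ₗ[k⟦X⟧] k⟦X⟧) :
    ∃ t : L, Algebra.linearMap k⟦X⟧ k⸨X⸩ ∘ₗ h = traceMul t := by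
  obtain ⟨b, b', hb⟩ := exists_basis_OE hL
  let f : Module.Dual k⸨X⸩ L := b'.constr k⸨X⸩ fun i => algebraMap k⟦X⟧ k⸨X⸩ (h (b i))
  refine ⟨(LinearMap.BilinForm.toDual _ (traceForm_nondegenerate k⸨X⸩ L)).symm f,
    b.ext fun i => ?_⟩
  refine Eq.trans ?_ (LinearMap.BilinForm.apply_toDual_symm_apply
    (hB := traceForm_nondegenerate k⸨X⸩ L) f (b i : L)).symm
  rw [← hb]
  exact (Module.Basis.constr_basis b' k⸨X⸩ (fun i => algebraMap k⟦X⟧ k⸨X⸩ (h (b i))) i).symm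

instance : IsFractionRing (VR L) L :=
  integralClosure.isFractionRing_of_finite_extension k⸨X⸩ L

instance : IsDedekindDomain (VR L) := integralClosure.isDedekindDomain k⟦X⟧ k⸨X⸩ L

instance : Module.IsTorsionFree k⟦X⟧ (VR L) := isTorsionFree_OE (E := L)

theorem exists_differentIdeal_eq : ∃ d : VR L, d ≠ 0 ∧
    differentIdeal k⟦X⟧ (VR L) = Ideal.span {d} ∧
    ∀ t : L, (∀ a : VR L, Algebra.trace k⸨X⸩ L (t * a) ∈ (algebraMap k⟦X⟧ k⸨X⸩).range) ↔
      ∃ b : VR L, (b : L) = d * t := by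
  have hpir : IsPrincipalIdealRing (VR L) := inferInstance
  obtain ⟨d, hd⟩ := (IsPrincipalIdealRing.principal (differentIdeal k⟦X⟧ (VR L))).principal
  have h1 := coeIdeal_differentIdeal k⟦X⟧ k⸨X⸩ L (VR L)
  have h2 : ((differentIdeal k⟦X⟧ (VR L) : Ideal (VR L)) : FractionalIdeal (VR L)⁰ L) =
      FractionalIdeal.spanSingleton (VR L)⁰ (d : L) := by
    rw [hd]
    exact FractionalIdeal.coeIdeal_span_singleton d
  rw [h2] at h1
  have h3 : FractionalIdeal.dual k⟦X⟧ k⸨X⸩ (1 : FractionalIdeal (VR L)⁰ L) =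
      FractionalIdeal.spanSingleton (VR L)⁰ (d : L)⁻¹ := by
    rw [← FractionalIdeal.spanSingleton_inv, h1, inv_inv]
  have hd0 : d ≠ 0 := by
    rintro rfl
    rw [ZeroMemClass.coe_zero, inv_zero, FractionalIdeal.spanSingleton_zero,
      FractionalIdeal.dual_eq_zero_iff] at h3
    exact one_ne_zero h3
  have hd0' : (d : L) ≠ 0 := fun h => hd0 (Subtype.ext h)
  refine ⟨d, hd0, hd, fun t => ?_⟩
  have h4 := FractionalIdeal.mem_dual (A := k⟦X⟧) (K := k⸨X⸩) (x := t)
    (one_ne_zero (α := FractionalIdeal (VR L)⁰ L))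
  rw [h3, FractionalIdeal.mem_spanSingleton] at h4
  constructor
  · intro h
    obtain ⟨b, rfl⟩ := h4.2 fun a ha => by
      obtain ⟨a, rfl⟩ := (FractionalIdeal.mem_one_iff _).1 ha
      exact h a
    refine ⟨b, ?_⟩
    rw [Algebra.smul_def, mul_comm, mul_assoc, inv_mul_cancel₀ hd0', mul_one]
    rfl
  · rintro ⟨b, hb⟩ a
    refine h4.1 ⟨b, ?_⟩ a ((FractionalIdeal.mem_one_iff _).2 ⟨a, rfl⟩)
    rw [Algebra.smul_def]
    change (b : L) * _ = _
    rw [hb, mul_comm, inv_mul_cancel_left₀ hd0']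

/-- A generator of the different and the product of the differences of the conjugates of a
uniformizer have the same absolute value. -/
theorem norm_differentIdeal {y : OE k L} (hy : IsUniformizing y) {d : VR L} (hd0 : d ≠ 0)
    (hd : ∀ t : L, (∀ a : VR L, Algebra.trace k⸨X⸩ L (t * a) ∈ (algebraMap k⟦X⟧ k⸨X⸩).range) ↔
      ∃ b : VR L, (b : L) = d * t) (ψ : L →ₐ[k⸨X⸩] Qalg k) :
    ‖(d : L)‖ = ‖(rho hL hy ψ (primeProd hy hL ψ) : L)‖ := by
  have hd0' : (d : L) ≠ 0 := fun h => hd0 (Subtype.ext h)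
  have hinj := FaithfulSMul.algebraMap_injective k⟦X⟧ k⸨X⸩
  have h1 := (hd (d : L)⁻¹).2 ⟨1, (mul_inv_cancel₀ hd0').symm⟩
  choose g hg using h1
  let g' : OE k L →ₗ[k⟦X⟧] k⟦X⟧ :=
    { toFun := g
      map_add' := fun a b => hinj (by
        rw [map_add, hg, hg, hg, ← map_add, ← mul_add]; rfl)
      map_smul' := fun c a => hinj (by
        rw [RingHom.id_apply, smul_eq_mul, map_mul, hg, hg]
        exact (map_smul (traceMul (d : L)⁻¹) c a).trans (Algebra.smul_def _ _)) }
  have hg' : Algebra.linearMap k⟦X⟧ k⸨X⸩ ∘ₗ g' = traceMul (d : L)⁻¹ := LinearMap.ext hg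
  have h2 := leadNorm_compAt hy hL ψ (g := g') fun h => by
    obtain ⟨t, ht⟩ := exists_eq_traceMul hL h
    obtain ⟨b, hb⟩ := (hd t).1 fun a => ⟨h a, LinearMap.congr_fun ht a⟩
    refine ⟨b, LinearMap.ext fun a => hinj ?_⟩
    refine (LinearMap.congr_fun ht a).trans (Eq.trans ?_ (LinearMap.congr_fun hg' (b * a)).symm)
    rw [traceMul_apply, traceMul_apply, Subalgebra.coe_mul, hb, ← mul_assoc, ← mul_assoc,
      inv_mul_cancel₀ hd0', one_mul]
  have h3 : traceMul (1 : L) = traceMul (d : L)⁻¹ ∘ₗ LinearMap.mulLeft k⟦X⟧ (d : OE k L) :=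
    LinearMap.ext fun a => by
      rw [LinearMap.comp_apply, LinearMap.mulLeft_apply, traceMul_apply, traceMul_apply,
        Subalgebra.coe_mul, ← mul_assoc, inv_mul_cancel₀ hd0']
  have h4 := compAt_trace hL ψ
  rw [h3, compAt_comp_mul, ← hg'] at h4
  have h5 := congrArg (leadNorm L) h4
  have hψ : ψ (d : L) ≠ 0 := (map_ne_zero ψ).2 hd0'
  rw [map_mul, leadNorm_liftEmb hL hψ, map_one] at h5
  rw [← norm_map_algHom ψ]
  have h6 := h5.trans h2.symm
  rw [mul_comm] at h6
  refine mul_left_cancel₀ (fun h => ?_) h6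
  rw [h, mul_zero] at h5
  exact zero_ne_one h5

end Different

/-! ### The sums over the Galois group -/

section GaloisSums

variable {k : Type*} [Field k] [Fintype k]

theorem lv_norm_X : lv k ‖algebraMap k⸨X⸩ (Qalg k) (algebraMap k⟦X⟧ k⸨X⸩ PowerSeries.X)‖ = 1 := by
  have h1 : ‖algebraMap k⸨X⸩ (Cv k) (algebraMap k⟦X⟧ k⸨X⸩ PowerSeries.X)‖ =
      ‖algebraMap k⟦X⟧ k⸨X⸩ PowerSeries.X‖ := norm_algebraMap' _ _
  have h0 : 0 < ‖algebraMap k⟦X⟧ k⸨X⸩ PowerSeries.X‖ := norm_pos_iff.2 (by simp)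
  rw [lv, h1, norm_algebraMap']
  exact Real.logb_self_eq_one_iff.2 ⟨h0.ne', norm_X_lt_one.ne, by linarith⟩

variable (N : FiniteGaloisIntermediateField k⸨X⸩ (Qalg k))

theorem vN_eq (x : N.toIntermediateField) : vN N x = lv k ‖x‖ := by
  change lv k ‖((x : Qalg k) : Cv k)‖ = _
  rw [UniformSpace.Completion.norm_coe]
  rfl

theorem vN_nonneg {x : ON N} (hx : x ≠ 0) : 0 ≤ vN N (x : N.toIntermediateField) := by
  have h1 : ‖algebraMap k⸨X⸩ (Cv k) (algebraMap k⟦X⟧ k⸨X⸩ PowerSeries.X)‖ =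
      ‖algebraMap k⟦X⟧ k⸨X⸩ PowerSeries.X‖ := norm_algebraMap' _ _
  rw [vN_eq, lv, h1]
  exact Real.logb_nonneg_of_base_lt_one (norm_pos_iff.2 (by simp)) norm_X_lt_one
    (norm_pos_iff.2 fun h => hx (Subtype.ext h)) (norm_le_one _ x)

theorem irreducible_unif : Irreducible (unif N) := by
  refine Classical.epsilon_spec (p := fun x : ON N => Irreducible x) ?_
  obtain ⟨π, h1, h0, h⟩ := exists_uniformizer_VR N.toIntermediateField
  refine ⟨π, (not_isUnit_VR_iff π).2 h1, fun a b hab => ?_⟩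
  by_contra! h2
  obtain ⟨c, rfl⟩ := h a ((not_isUnit_VR_iff a).1 h2.1)
  rw [mul_assoc] at hab
  exact h2.2 (IsUnit.of_mul_eq_one_right c (mul_left_cancel₀ h0 (hab.symm.trans (mul_one π).symm)))

theorem unif_dvd {x : ON N} (hx : ‖(x : N.toIntermediateField)‖ < 1) : unif N ∣ x := by
  obtain ⟨π, h1, h0, h⟩ := exists_uniformizer_VR N.toIntermediateField
  obtain ⟨c, hc⟩ := h (unif N) ((not_isUnit_VR_iff _).1 (irreducible_unif N).not_isUnit)
  have hu := ((irreducible_unif N).isUnit_or_isUnit hc).resolve_left ((not_isUnit_VR_iff π).2 h1)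
  rw [hc]
  exact (hu.mul_right_dvd).2 (h x hx)

theorem isUniformizing_unif : IsUniformizing (E := N.toIntermediateField) (unif N) := by
  refine ⟨fun φ => ⟨(map_ne_zero φ).2 fun h => (irreducible_unif N).ne_zero (Subtype.ext h), ?_⟩,
    fun a => ?_⟩
  · rw [norm_map_algHom]
    exact (not_isUnit_VR_iff _).1 (irreducible_unif N).not_isUnit
  · obtain ⟨y, hy⟩ := exists_isUniformizing (k := k) (E := N.toIntermediateField)
    obtain ⟨l, a', hl, rfl⟩ := hy.2 a
    have h1 : ‖(y : N.toIntermediateField)‖ < 1 := by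
      rw [← norm_map_algHom N.toIntermediateField.val]
      exact (hy.1 _).2
    obtain ⟨c, rfl⟩ := unif_dvd N h1
    exact ⟨l, c * a', hl, by rw [mul_assoc]⟩

theorem lv_norm_unif : lv k ‖(unif N : N.toIntermediateField)‖ = (ramIdx N : ℝ)⁻¹ := by
  have h0 : (algebraMap k⟦X⟧ (ON N) PowerSeries.X) ≠ 0 := fun h =>
    zeta_ne_zero N.toIntermediateField (congrArg Subtype.val h)
  obtain ⟨c, hc, hc'⟩ := (FiniteMultiplicity.of_not_isUnit (irreducible_unif N).not_isUnit
    h0).exists_eq_pow_mul_and_not_dvd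
  have hu : IsUnit c := by
    by_contra h
    exact hc' (unif_dvd N ((not_isUnit_VR_iff c).1 h))
  have h1 := congrArg (fun x : ON N => lv k ‖(x : N.toIntermediateField)‖) hc
  simp only [Subalgebra.coe_mul, Subalgebra.coe_pow, norm_mul, norm_pow, (isUnit_VR_iff c).1 hu,
    mul_one, lv_pow] at h1
  have h2 : (ramIdx N : ℝ) * lv k ‖(unif N : N.toIntermediateField)‖ = 1 :=
    h1.symm.trans lv_norm_X
  exact eq_inv_of_mul_eq_one_right h2

theorem algHom_mem (φ : N.toIntermediateField →ₐ[k⸨X⸩] Qalg k) (x : N.toIntermediateField) :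
    φ x ∈ N.toIntermediateField :=
  IntermediateField.normal_iff_forall_fieldRange_le.1 inferInstance φ ⟨x, rfl⟩

/-- The embeddings of `N` correspond to the elements of its Galois group. -/
def galEquiv : (N.toIntermediateField →ₐ[k⸨X⸩] Qalg k) ≃ GN N :=
  Normal.algHomEquivAut k⸨X⸩ (Qalg k) N.toIntermediateField

theorem galEquiv_symm_apply (g : GN N) (x : N.toIntermediateField) :
    (galEquiv N).symm g x = (g x : Qalg k) := by
  rw [galEquiv, Normal.algHomEquivAut_symm_apply]
  rfl

theorem galEquiv_symm_one : (galEquiv N).symm 1 = N.toIntermediateField.val :=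
  AlgHom.ext fun x => galEquiv_symm_apply N 1 x

theorem coe_galEquiv (φ : N.toIntermediateField →ₐ[k⸨X⸩] Qalg k) (x : N.toIntermediateField) :
    ((galEquiv N φ x : N.toIntermediateField) : Qalg k) = φ x := by
  rw [← galEquiv_symm_apply, Equiv.symm_apply_apply]

theorem frobCong_galEquiv_symm {g : GN N} {n : ℕ} :
    FrobCong ((galEquiv N).symm g) N.toIntermediateField.val n ↔ g ∈ WN N n :=
  forall_congr' fun a => by rw [galEquiv_symm_apply]; rfl

theorem frobSum_unif (a : GN N → ℝ) (n : ℕ) [DecidablePred (· ∈ WN N n)] :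
    frobSum (unif N : OE k N.toIntermediateField) N.toIntermediateField.val
      (fun φ => a (galEquiv N φ)) n = (ramIdx N : ℝ)⁻¹ * ∑ g, if g ∈ WN N n then a g else 0 := by
  classical
  rw [frobSum, Finset.sum_filter, ← Equiv.sum_comp (galEquiv N).symm]
  congr 1
  · exact lv_norm_unif N
  · refine Finset.sum_congr rfl fun g _ => ?_
    rw [Equiv.apply_symm_apply]
    exact if_congr (frobCong_galEquiv_symm N) rfl rfl

theorem conjSum_unif (a : GN N → ℝ) [DecidablePred (· ∈ WN N 0)] :
    conjSum (unif N : OE k N.toIntermediateField) N.toIntermediateField.val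
      (fun φ => a (galEquiv N φ)) = ∑ g, if g ∈ WN N 0 then
        (a g - a 1) * vN N (g (unif N : N.toIntermediateField) - unif N) else 0 := by
  classical
  rw [conjSum, Finset.sum_filter, ← Equiv.sum_comp (galEquiv N).symm]
  refine Finset.sum_congr rfl fun g _ => ?_
  rw [Equiv.apply_symm_apply, ← galEquiv_symm_one N, Equiv.apply_symm_apply, galEquiv_symm_one,
    vN_eq, norm_sub_rev, galEquiv_symm_apply]
  exact if_congr (frobCong_galEquiv_symm N) rfl rfl

theorem Zv_eq (a : GQ k → ℚ) : Zv N a 1 =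
    ∑' n, frobSum (unif N : OE k N.toIntermediateField) N.toIntermediateField.val
      (fun φ => onGN N a (galEquiv N φ)) (n + 1) / (Fintype.card k : ℝ) ^ (n + 1) := by
  classical
  rw [Zv, ← tsum_mul_left]
  refine tsum_congr fun n => ?_
  rw [frobSum_unif N (fun g => (onGN N a g : ℝ)), mul_div_assoc, Finset.sum_div]
  congr 1
  refine Finset.sum_congr rfl fun g _ => ?_
  rw [mul_one, Real.rpow_natCast, ite_div, zero_div]

theorem eq_one_of_unif {g : GN N} (hg : g ∈ WN N 0)
    (h : g (unif N : N.toIntermediateField) = unif N) : g = 1 := by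
  have h1 := embR_y_injOn (hy := isUniformizing_unif N) (hL := algHom_mem N)
    (branchOf_eq_iff.2 ((frobCong_galEquiv_symm N).2 hg))
    (Subtype.ext (Subtype.ext ((galEquiv_symm_apply N g _).trans (congrArg Subtype.val h))))
  rw [← galEquiv_symm_one] at h1
  exact (galEquiv N).symm.injective h1

theorem one_mem_WN : (1 : GN N) ∈ WN N 0 := fun x => by simp

theorem vDifferent_eq [DecidablePred (· ∈ WN N 0)] : vDifferent N =
    ∑ g, if g ∈ WN N 0 then vN N (g (unif N : N.toIntermediateField) - unif N) else 0 := by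
  classical
  have hy := isUniformizing_unif N
  obtain ⟨d, hd0, hd, ht⟩ := exists_differentIdeal_eq (L := N.toIntermediateField)
  have h1 : vDifferent N = vN N (d : N.toIntermediateField) := by
    refine IsLeast.csInf_eq ⟨⟨d, ?_, hd0, rfl⟩, ?_⟩
    · change d ∈ differentIdeal k⟦X⟧ (VR N.toIntermediateField)
      rw [hd]
      exact Ideal.mem_span_singleton_self d
    · rintro _ ⟨x, hx, hx0, rfl⟩
      change x ∈ differentIdeal k⟦X⟧ (VR N.toIntermediateField) at hx
      rw [hd] at hx
      obtain ⟨c, rfl⟩ := Ideal.mem_span_singleton.1 hx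
      have hc0 := right_ne_zero_of_mul hx0
      have h2 := vN_nonneg N hc0
      rw [vN_eq] at h2 ⊢
      rw [vN_eq, Subalgebra.coe_mul, norm_mul, lv_mul (norm_ne_zero_iff.2 fun h => hd0 (Subtype.ext h))
        (norm_ne_zero_iff.2 fun h => hc0 (Subtype.ext h))]
      linarith
  rw [h1, vN_eq, norm_differentIdeal (algHom_mem N) hy hd0 ht N.toIntermediateField.val, primeProd,
    map_prod]
  have h3 : ∀ (s : Finset (N.toIntermediateField →ₐ[k⸨X⸩] Qalg k))
      (f : (N.toIntermediateField →ₐ[k⸨X⸩] Qalg k) → ON N),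
      ‖((∏ i ∈ s, f i : ON N) : N.toIntermediateField)‖ = ∏ i ∈ s, ‖(f i : N.toIntermediateField)‖ :=
    fun s f => by
      change ‖RtoL N.toIntermediateField _‖ = _
      rw [map_prod, norm_prod]
      rfl
  have h4 : ∀ φ ∈ Finset.univ.erase N.toIntermediateField.val,
      rho (algHom_mem N) hy N.toIntermediateField.val (phiPrime hy (algHom_mem N) φ) ≠ 0 := by
    intro φ hφ h
    rw [rho_phiPrime] at h
    split_ifs at h with hb
    · exact Finset.ne_of_mem_erase hφ (embR_y_injOn hb (sub_eq_zero.1 h).symm)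
    · exact one_ne_zero h
  rw [h3, lv_prod _ _ fun φ hφ => norm_ne_zero_iff.2 fun h => h4 φ hφ (Subtype.ext h),
    ← Finset.add_sum_erase _ _ (Finset.mem_univ (1 : GN N))]
  -- The term of `g = 1` is the junk value `v(0) = 0`.
  have h5 : lv k (0 : ℝ) = 0 := Real.logb_zero
  rw [if_pos (one_mem_WN N), AlgEquiv.one_apply, sub_self, vN_eq, norm_zero, h5, zero_add]
  refine Finset.sum_equiv (galEquiv N) (fun φ => ?_) fun φ hφ => ?_
  · rw [Finset.mem_erase, Finset.mem_erase, ← galEquiv_symm_one, ne_eq, ne_eq, Equiv.eq_symm_apply]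
    simp
  · rw [rho_phiPrime]
    have h6 : branchOf hy (algHom_mem N) φ = branchOf hy (algHom_mem N) N.toIntermediateField.val ↔
        galEquiv N φ ∈ WN N 0 := by
      rw [branchOf_eq_iff, ← frobCong_galEquiv_symm, Equiv.symm_apply_apply]
    split_ifs with h7 h8 h8
    · rw [vN_eq, norm_sub_rev]
      refine congrArg (lv k) ?_
      change _ = ‖((unif N : N.toIntermediateField) : Qalg k) -
        ((galEquiv N φ (unif N : N.toIntermediateField) : N.toIntermediateField) : Qalg k)‖
      rw [coe_galEquiv]
      rfl
    · exact absurd (h6.1 h7) h8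
    · exact absurd (h6.2 h8) h7
    · rw [OneMemClass.coe_one, norm_one, lv_one]

theorem muArt_eq (a : GQ k → ℚ) : muArt N a =
    -conjSum (unif N : OE k N.toIntermediateField) N.toIntermediateField.val
      (fun φ => onGN N a (galEquiv N φ)) := by
  classical
  have h5 : lv k (0 : ℝ) = 0 := Real.logb_zero
  rw [conjSum_unif N (fun g => (onGN N a g : ℝ)), muArt]
  have h1 : ∀ g : GN N, (onGN N a g : ℝ) * muN N g =
      -(if g ∈ WN N 0 then (onGN N a g : ℝ) * vN N (g (unif N : N.toIntermediateField) - unif N)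
        else 0) + if g = 1 then (onGN N a 1 : ℝ) * vDifferent N else 0 := fun g => by
    rw [muN]
    by_cases hg : g ∈ WN N 0
    · by_cases h : g (unif N : N.toIntermediateField) = unif N
      · have h1 := eq_one_of_unif N hg h
        rw [if_neg (not_not.2 hg), if_neg (not_not.2 h), if_pos hg, if_pos h1, h, sub_self, vN_eq,
          norm_zero, h5, h1]
        ring
      · have h1 : g ≠ 1 := by rintro rfl; exact h rfl
        rw [if_neg (not_not.2 hg), if_pos h, if_pos hg, if_neg h1]
        ring
    · have h1 : g ≠ 1 := by rintro rfl; exact hg (one_mem_WN N)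
      rw [if_pos hg, if_neg hg, if_neg h1]
      ring
  simp only [h1]
  rw [Finset.sum_add_distrib, Finset.sum_neg_distrib, Finset.sum_ite_eq' Finset.univ (1 : GN N),
    if_pos (Finset.mem_univ _), vDifferent_eq, Finset.mul_sum, ← Finset.sum_neg_distrib,
    ← Finset.sum_neg_distrib, ← Finset.sum_add_distrib]
  refine Finset.sum_congr rfl fun g _ => ?_
  split_ifs
  · ring
  · ring

end GaloisSums

/-! ### Comparison of the embeddings of `E` with the Galois group of `N` -/

section Comparison

variable {k : Type*} [Field k] [Fintype k]

theorem exists_extension {F : IntermediateField k⸨X⸩ (Qalg k)} (σ : F →ₐ[k⸨X⸩] Qalg k) :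
    ∃ g : GQ k, ∀ x : F, g x = σ x :=
  ⟨AlgEquiv.ofBijective (σ.liftNormal (Qalg k)) (AlgHom.normal_bijective _ _ _ _),
    fun x => σ.liftNormal_commutes (Qalg k) x⟩

variable {E : Type*} [CommRing E] [Algebra k⸨X⸩ E] [Algebra k⟦X⟧ E] [IsScalarTower k⟦X⟧ k⸨X⸩ E]
  [Module.Finite k⸨X⸩ E] [IsSemisimpleRing E] [Algebra.IsSeparable k⸨X⸩ E]
variable (L : IntermediateField k⸨X⸩ (Qalg k)) [FiniteDimensional k⸨X⸩ L]
  [Algebra.IsSeparable k⸨X⸩ L]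
variable {y : OE k E} (hy : IsUniformizing y) (hL : ∀ (φ : E →ₐ[k⸨X⸩] Qalg k) (e : E), φ e ∈ L)
  (N : FiniteGaloisIntermediateField k⸨X⸩ (Qalg k))

instance isSeparable_normalClosure :
    Algebra.IsSeparable k⸨X⸩ (IntermediateField.normalClosure k⸨X⸩ L (Qalg k)) := by
  have h : ∀ f : L →ₐ[k⸨X⸩] Qalg k, Algebra.IsSeparable k⸨X⸩ f.fieldRange := fun f =>
    AlgEquiv.Algebra.isSeparable (AlgEquiv.ofInjectiveField f)
  exact IntermediateField.isSeparable_iSup _ _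

include hy hL in
/-- The sums over the embeddings of `E` agree with the sums over the Galois group of `N`: both
are equal to a sum over the embeddings of the compositum of `L` and `N`. -/
theorem sums_eq {Φ : (E →ₐ[k⸨X⸩] Qalg k) → ℤ} {ψ : E →ₐ[k⸨X⸩] Qalg k}
    (hN : ConstMod N (aPsiPhi ψ Φ)) :
    conjSum y ψ (fun φ => Φ φ) = -muArt N (aPsiPhi ψ Φ) ∧
    ∑' n, frobSum y ψ (fun φ => Φ φ) (n + 1) / (Fintype.card k : ℝ) ^ (n + 1) =
      Zv N (aPsiPhi ψ Φ) 1 := by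
  have hNsep : Algebra.IsSeparable k⸨X⸩ N.toIntermediateField := inferInstance
  let F := L ⊔ N.toIntermediateField
  have hF : FiniteDimensional k⸨X⸩ F := IntermediateField.finiteDimensional_sup _ _
  have hFsep : Algebra.IsSeparable k⸨X⸩ F := IntermediateField.isSeparable_sup _ _ _ _
  let L' := IntermediateField.normalClosure k⸨X⸩ F (Qalg k)
  have hL'fin : FiniteDimensional k⸨X⸩ L' := normalClosure.is_finiteDimensional _ _ _
  have hFL : F ≤ L' := IntermediateField.le_normalClosure F
  have hF' : ∀ (σ : F →ₐ[k⸨X⸩] Qalg k) (e : F), σ e ∈ L' := fun σ e =>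
    AlgHom.fieldRange_le_normalClosure σ ⟨e, rfl⟩
  have hE' : ∀ (φ : E →ₐ[k⸨X⸩] Qalg k) (e : E), φ e ∈ L' := fun φ e =>
    hFL (le_sup_left (a := L) (hL φ e))
  have hN' : ∀ (φ : N.toIntermediateField →ₐ[k⸨X⸩] Qalg k) e, φ e ∈ L' := fun φ e =>
    hFL (le_sup_right (a := L) (algHom_mem N φ e))
  obtain ⟨y', hy'⟩ := exists_isUniformizing (k := k) (E := F)
  let j : E →ₐ[k⸨X⸩] F := ψ.codRestrict F.toSubalgebra fun e => le_sup_left (a := L) (hL ψ e)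
  let i : N.toIntermediateField →ₐ[k⸨X⸩] F := IntermediateField.inclusion le_sup_right
  have hj : F.val.comp j = ψ := rfl
  have hi : F.val.comp i = N.toIntermediateField.val := rfl
  have key : ∀ σ : F →ₐ[k⸨X⸩] Qalg k, (Φ (σ.comp j) : ℝ) =
      onGN N (aPsiPhi ψ Φ) (galEquiv N (σ.comp i)) := fun σ => by
    obtain ⟨g, hg⟩ := exists_extension σ
    have h1 : aPsiPhi ψ Φ g = Φ (σ.comp j) :=
      congrArg (fun φ => ((Φ φ : ℤ) : ℚ)) (AlgHom.ext fun e => hg (j e))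
    have h2 : onGN N (aPsiPhi ψ Φ) (galEquiv N (σ.comp i)) = aPsiPhi ψ Φ g := by
      refine hN _ _ fun x hx => ?_
      refine ((galEquiv N (σ.comp i)).liftNormal_commutes (Qalg k) ⟨x, hx⟩).trans ?_
      exact (coe_galEquiv N _ _).trans (hg (i ⟨x, hx⟩)).symm
    rw [h2, h1, Rat.cast_intCast]
  have hu := isUniformizing_unif N
  constructor
  · rw [muArt_eq, neg_neg, ← hj, ← hi, conjSum_comp hy hE' hy' hF' j F.val,
      conjSum_comp hu hN' hy' hF' i F.val]
    simp only [key, hj]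
  · rw [Zv_eq, ← hj, ← hi]
    simp only [frobSum_comp hy hE' hy' hF' j F.val, frobSum_comp hu hN' hy' hF' i F.val]
    simp only [key, hj]

end Comparison

end

end LocSht

theorem theorem4p16 {k : Type*} [Field k] [Fintype k]
    (L : IntermediateField k⸨X⸩ (Qalg k)) [FiniteDimensional k⸨X⸩ L] [Algebra.IsSeparable k⸨X⸩ L]
    {M : Type*} [AddCommGroup M] [Module (RZ L) M] (S : LocalShtuka L M)
    {E : Type*} [CommRing E] [Algebra k⸨X⸩ E] [Algebra k⟦X⟧ E] [IsScalarTower k⟦X⟧ k⸨X⸩ E]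
    [Module.Finite k⸨X⸩ E] [IsSemisimpleRing E] [Algebra.IsSeparable k⸨X⸩ E]
    (c : CM S E) (hL : ∀ (φ : E →ₐ[k⸨X⸩] Qalg k) (e : E), φ e ∈ L)
    (Φ : (E →ₐ[k⸨X⸩] Qalg k) → ℤ) (hΦ : HasCMType c hL Φ)
    (u : H1v S →ₗ[k⟦X⟧] k⸨X⸩) (hu : IsEGenerator c u)
    (ψ : E →ₐ[k⸨X⸩] Qalg k) (ω : HdRPlus L M)
    (hω : Submodule.span (BPlusL L) {ω} = HPsi c (hL ψ))
    (N : FiniteGaloisIntermediateField k⸨X⸩ (Qalg k)) (hN : ConstMod N (aPsiPhi ψ Φ)) :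
    Function.Bijective (tateToH1v S) ∧
    Function.Bijective (hdR S) ∧
    (∃ r, IsValOmega c (hL ψ) ω r) ∧
    (∃ s, IsValU c ψ u s) ∧
    period S u ω ≠ 0 ∧
    ∀ r s : ℝ, IsValOmega c (hL ψ) ω r → IsValU c ψ u s →
      vBC (period S u ω) =
        Zv N (aPsiPhi ψ Φ) 1 - muArt N (aPsiPhi ψ Φ) + r + s := by
  obtain ⟨y, hy⟩ := exists_isUniformizing (k := k) (E := E)
  obtain ⟨m, hm⟩ := exists_cyclic hy hL c
  obtain ⟨D⟩ := nonempty_triv c hm (orbitMap_frobIncl_bijective hL c hm)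
  obtain ⟨sol⟩ := nonempty_solution hy hL D
  obtain ⟨r, hr⟩ := D.exists_isValOmega hy hω
  obtain ⟨t, ht⟩ := exists_isValU sol.actH1v_tateEquiv hL u hu ψ
  refine ⟨sol.tateToH1v_bijective, sol.hdR_bijective, ⟨r, hr⟩, ⟨t, ht⟩,
    (sol.vBC_period hΦ hω hr ht).1, fun r' s hr' hs => ?_⟩
  obtain ⟨h1, h2⟩ := sums_eq L hy hL N hN
  rw [(sol.vBC_period hΦ hω hr' hs).2, h1, h2]
  ring
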